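/- Let $\nu>0$, $w_d\ge 0$, $c_0,c_1>0$, $\lambda>0$. For $\mu>0$ consider on $(0,1)\times(0,\infty)$ the Benjamin–Bona–Mahony–Burgers equation $$w_t-\mu w_{xxt}-\nu w_{xx}+(1+w_d)w_x+ww_x=0,\qquad w(\cdot,0)=w_0,$$ with the feedback laws $$w_x(0,t)=\tfrac1\nu\Big((c_0+1+w_d)w(0,t)+\tfrac{2}{9c_0}w^3(0,t)\Big),\qquad w_x(1,t)=-\tfrac1\nu\Big((c_1+1+w_d)w(1,t)+\tfrac{2}{9c_1}w^3(1,t)\Big).\qquad(\ast)$$ Write $(\cdot,\cdot)$, $\|\cdot\|$ for the inner product and norm of $L^2(0,1)$, $\|\cdot\|_2$ for the norm of $H^2(0,1)$, and, for $u,u_t,\chi\in H^1(0,1)$, $$\begin{aligned}B(u,u_t;\chi)={}&(u_t,\chi)+\mu(u_{xt},\chi_x)+\nu(u_x,\chi_x)+(1+w_d)(u_x,\chi)+(uu_x,\chi)\\&+\frac\mu\nu\sum_{i=0}^1\Big((c_i+1+w_d)u_t(i)+\frac{2}{3c_i}u^2(i)u_t(i)\Big)\chi(i)+\sum_{i=0}^1\Big((c_i+1+w_d)u(i)+\frac{2}{9c_i}u^3(i)\Big)\chi(i).\end{aligned}$$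 A weak solution is a $w$ with $w(t)\in H^1(0,1)$, $w_t\in L^2(0,T;H^1(0,1))$ for all $T>0$, $w(0)=w_0$, and $B(w(t),w_t(t);\chi)=0$ for almost every $t>0$ and all $\chi\in H^1(0,1)$. Let $V_h$ be the space of continuous functions on $[0,1]$ that are affine on each subinterval of a partition $0=x_0<\dots<x_N=1$, $h=\max_j(x_j-x_{j-1})$. Let $\tilde w_h(t)\in V_h$ be the elliptic projection of $w(t)$, $$(w_x-\tilde w_{hx},\chi_x)+\lambda(w-\tilde w_h,\chi)=0\quad\forall\chi\in V_h,$$ let $w_h(t)\in V_h$ be the semidiscrete solution, $B(w_h(t),w_{ht}(t);\chi)=0$ for all $\chi\in V_h$, $t>0$, with $w_h(0)=\tilde w_h(0)$, and put $\theta=w_h-\tilde w_h$. Further let $$E_2(\theta)(t)=\sum_{i=0}^1\Big((c_i+1+w_d)+\frac1{9c_i}\theta^2(i,t)\Big)\theta^2(i,t),\qquad |||\theta(t)|||^2=\theta^2(0,t)+\theta^2(1,t)+\|\theta_x(t)\|^2,$$ $$0\le\alpha\le\frac12\min\Big\{\frac{\nu}{\mu+1},\frac{\nu}{2\mu+\nu},\frac{\nu(1+c_i+w_d)}{\nu+(1+c_i+w_d)\mu}\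 (i=0,1)\Big\}.$$ Then for every $R$ and every $\mu>0$ there is a constant $C>0$, depending only on $\nu,w_d,c_0,c_1,\lambda,R$ and $\mu$ (in particular not on $h$, the partition, $t$ or $\alpha$), such that for every $w_0\in H^2(0,1)$ with $\|w_0\|_2\le R$, the corresponding weak solution $w$ (and $w_h$, $\tilde w_h$), and all $t\ge0$: $\theta(x,\cdot)$ is differentiable almost everywhere in time for each $x\in[0,1]$, the integrals below are finite, and $$\begin{aligned}\nu\|\theta_x(t)\|^2+\frac13E_2(\theta)(t)&+2e^{-2\alpha t}\int_0^te^{2\alpha s}\big(\|\theta_t(s)\|^2+\mu\|\theta_{xt}(s)\|^2\big)ds\\&+\frac\mu\nu e^{-2\alpha t}\int_0^te^{2\alpha s}\sum_{i=0}^1(1+c_i+w_d)\theta_t^2(i,s)\,ds\\&\le C\,\frac1\mu\,\|w_0\|_2\,(1+\mu)\,h^4e^{-2\alpha t}\exp(C\|w_0\|_2),\end{aligned}$$ and consequently also $$|||\theta(t)|||^2\le C\,\frac1\mu\,\|w_0\|_2\,(1+\mu)\,h^4e^{-2\alpha t}\exp(C\|w_0\|_2).$$ Moreover, for weak solutions $w$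 that satisfy the feedback laws $(\ast)$ pointwise for all $t>0$, the constant $C$ can be chosen independently of $\mu>0$ as well, depending only on $\nu,w_d,c_0,c_1,\lambda,R$. -/

import Mathlib

open MeasureTheory Set

noncomputable section

namespace BBMB

/-- The space `H¹(0,1)`, each class being represented by its absolutely continuous representative on
`[0,1]`; the weak derivative is the (almost everywhere defined) derivative `deriv f` on `(0,1)`. -/
def InH1 (f : ℝ → ℝ) : Prop :=
  AbsolutelyContinuousOnInterval f 0 1 ∧ MemLp (deriv f) 2 (volume.restrict (Ioo (0 : ℝ) 1))

/-- The space `H²(0,1)`: functions of `H¹(0,1)` whose derivative on `(0,1)` is (the restriction of)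
a function of `H¹(0,1)`. -/
def InH2 (f : ℝ → ℝ) : Prop :=
  InH1 f ∧ ∃ g : ℝ → ℝ, InH1 g ∧ EqOn (deriv f) g (Ioo (0 : ℝ) 1)

/-- The square `‖f‖²` of the norm of `L²(0,1)`. -/
def sqNorm (f : ℝ → ℝ) : ℝ := ∫ x in (0 : ℝ)..1, f x ^ 2

/-- The norm `‖f‖₂` of `H²(0,1)`. -/
def h2Norm (f : ℝ → ℝ) : ℝ :=
  √(sqNorm f + sqNorm (deriv f) + sqNorm (deriv (deriv f)))

/-- The two end points `0` and `1` of the interval. -/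
def endpt : Fin 2 → ℝ := ![0, 1]

/-- `|||f||| = (f(0)² + f(1)² + ‖f_x‖²)^{1/2}`. -/
def tnorm (f : ℝ → ℝ) : ℝ := √(f 0 ^ 2 + f 1 ^ 2 + sqNorm (deriv f))

/-- Derivative with respect to time of a function of `(t, x)`, taken at each fixed `x`. -/
def dt (u : ℝ → ℝ → ℝ) (t x : ℝ) : ℝ := deriv (fun s => u s x) t

/-- The admissible decay rates `α`. -/
def AdmissibleRate (ν μ wd : ℝ) (c : Fin 2 → ℝ) (α : ℝ) : Prop :=
  0 ≤ α ∧ α ≤ 1 / 2 * (ν / (μ + 1)) ∧ α ≤ 1 / 2 * (ν / (2 * μ + ν)) ∧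
    ∀ i, α ≤ 1 / 2 * (ν * (1 + c i + wd) / (ν + (1 + c i + wd) * μ))

/-- The left-hand side of the weak formulation of the closed-loop problem, for the state `u`, its time
derivative `ut` (both at a fixed time) and the test function `χ`. -/
def weakForm (ν μ wd : ℝ) (c : Fin 2 → ℝ) (u ut χ : ℝ → ℝ) : ℝ :=
  (∫ x in (0 : ℝ)..1, ut x * χ x)
    + μ * (∫ x in (0 : ℝ)..1, deriv ut x * deriv χ x)
    + ν * (∫ x in (0 : ℝ)..1, deriv u x * deriv χ x)
    + (1 + wd) * (∫ x in (0 : ℝ)..1, deriv u x * χ x)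
    + (∫ x in (0 : ℝ)..1, u x * deriv u x * χ x)
    + μ / ν * ∑ i, ((c i + 1 + wd) * ut (endpt i)
        + 2 / (3 * c i) * u (endpt i) ^ 2 * ut (endpt i)) * χ (endpt i)
    + ∑ i, ((c i + 1 + wd) * u (endpt i) + 2 / (9 * c i) * u (endpt i) ^ 3) * χ (endpt i)

/-- `w` is a weak solution on `(0,∞)` of the closed-loop problem with initial value `w₀`: it lies in
`H¹(0,T; H¹(0,1))` for every `T`, with time derivative `wt`, and satisfies the weak formulation for
almost every `t > 0`. -/
def IsWeakSolution (ν μ wd : ℝ) (c : Fin 2 → ℝ) (w₀ : ℝ → ℝ) (w : ℝ → ℝ → ℝ) : Prop :=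
  ∃ wt : ℝ → ℝ → ℝ,
    (∀ t, 0 ≤ t → InH1 (w t)) ∧
    (∀ᵐ t ∂(volume.restrict (Ioi (0 : ℝ))), InH1 (wt t)) ∧
    (∀ T : ℝ, 0 < T →
      MemLp (fun p : ℝ × ℝ => wt p.1 p.2) 2
        ((volume.restrict (Ioo 0 T)).prod (volume.restrict (Ioo 0 1))) ∧
      MemLp (fun p : ℝ × ℝ => deriv (wt p.1) p.2) 2
        ((volume.restrict (Ioo 0 T)).prod (volume.restrict (Ioo 0 1)))) ∧
    (∀ t, 0 ≤ t → ∀ x ∈ Icc (0 : ℝ) 1, w t x = w₀ x + ∫ s in (0 : ℝ)..t, wt s x) ∧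
    (∀ᵐ t ∂(volume.restrict (Ioi (0 : ℝ))), ∀ χ : ℝ → ℝ, InH1 χ →
      weakForm ν μ wd c (w t) (wt t) χ = 0)

/-- The Neumann feedback laws `w_x(0,t) = K₀(w(0,t))` and `w_x(1,t) = K₁(w(1,t))` for all `t > 0`, with
one-sided derivatives at the end points. -/
def SatisfiesFeedback (ν wd : ℝ) (c : Fin 2 → ℝ) (w : ℝ → ℝ → ℝ) : Prop :=
  ∀ t, 0 < t →
    HasDerivWithinAt (w t)
      (1 / ν * ((c 0 + 1 + wd) * w t 0 + 2 / (9 * c 0) * w t 0 ^ 3)) (Icc 0 1) 0 ∧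
    HasDerivWithinAt (w t)
      (-(1 / ν * ((c 1 + 1 + wd) * w t 1 + 2 / (9 * c 1) * w t 1 ^ 3))) (Icc 0 1) 1

/-- A partition `0 = x_0 < x_1 < ⋯ < x_N = 1` of `[0,1]`. -/
structure Mesh where
  N : ℕ
  node : Fin (N + 1) → ℝ
  strictMono : StrictMono node
  first : node 0 = 0
  last : node (Fin.last N) = 1

/-- The mesh parameter, the largest length of a subinterval. -/
def Mesh.h (P : Mesh) : ℝ := ⨆ j : Fin P.N, (P.node j.succ - P.node j.castSucc)

/-- The space `V_h` of continuous functions on `[0,1]` that are affine on each subinterval. -/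
def Mesh.space (P : Mesh) : Set (ℝ → ℝ) :=
  {v | ContinuousOn v (Icc 0 1) ∧
    ∀ j : Fin P.N, ∃ a b : ℝ, ∀ x ∈ Ioo (P.node j.castSucc) (P.node j.succ), v x = a + b * x}

/-- `v ∈ V_h` is the elliptic projection of `f`:
`(f_x - v_x, χ_x) + lam (f - v, χ) = 0` for all `χ ∈ V_h`. -/
def IsEllipticProjection (lam : ℝ) (P : Mesh) (f v : ℝ → ℝ) : Prop :=
  v ∈ P.space ∧ ∀ χ ∈ P.space,
    (∫ x in (0 : ℝ)..1, (deriv f x - deriv v x) * deriv χ x)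
      + lam * (∫ x in (0 : ℝ)..1, (f x - v x) * χ x) = 0

/-- `wh` is a solution on `(0,∞)` of the semidiscrete Galerkin problem in `V_h`, continuous up to
`t = 0`. -/
def IsSemidiscreteSolution (ν μ wd : ℝ) (c : Fin 2 → ℝ) (P : Mesh) (wh : ℝ → ℝ → ℝ) : Prop :=
  (∀ t, 0 ≤ t → wh t ∈ P.space) ∧
  (∀ x ∈ Icc (0 : ℝ) 1, ContinuousOn (fun t => wh t x) (Ici 0)) ∧
  (∀ t, 0 < t → ∀ x ∈ Icc (0 : ℝ) 1, DifferentiableAt ℝ (fun s => wh s x) t) ∧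
  (∀ t, 0 < t → ∀ χ ∈ P.space, weakForm ν μ wd c (wh t) (dt wh t) χ = 0)

/-- The data of the error analysis: `w` is the weak solution with initial value `w₀ ∈ H²(0,1)`, `wp t` is
the elliptic projection of `w t`, and `wh` is the semidiscrete solution with initial value `wp 0`. -/
structure Setting (ν μ wd lam : ℝ) (c : Fin 2 → ℝ) (w₀ : ℝ → ℝ) (w : ℝ → ℝ → ℝ) (P : Mesh)
    (wp wh : ℝ → ℝ → ℝ) : Prop where
  initial : InH2 w₀
  weak : IsWeakSolution ν μ wd c w₀ w
  projection : ∀ t, 0 ≤ t → IsEllipticProjection lam P (w t) (wp t)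
  semidiscrete : IsSemidiscreteSolution ν μ wd c P wh
  discreteInitial : ∀ x ∈ Icc (0 : ℝ) 1, wh 0 x = wp 0 x

/-- `E₂(f) = ∑_{i=0,1} ((c_i + 1 + w_d) + f(i)² / (9 c_i)) f(i)²`. -/
def E₂ (wd : ℝ) (c : Fin 2 → ℝ) (f : ℝ → ℝ) : ℝ :=
  ∑ i, ((c i + 1 + wd) + 1 / (9 * c i) * f (endpt i) ^ 2) * f (endpt i) ^ 2

/-- The first weighted integrand, `e^{2αs} (‖θ_t(s)‖² + μ ‖θ_{xt}(s)‖²)`. -/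
def interiorRate (μ α : ℝ) (θ : ℝ → ℝ → ℝ) (s : ℝ) : ℝ :=
  Real.exp (2 * α * s) * (sqNorm (dt θ s) + μ * sqNorm (deriv (dt θ s)))

/-- The second weighted integrand, `e^{2αs} ∑_{i=0,1} (1 + c_i + w_d) θ_t(i,s)²`. -/
def boundaryRate (wd α : ℝ) (c : Fin 2 → ℝ) (θ : ℝ → ℝ → ℝ) (s : ℝ) : ℝ :=
  Real.exp (2 * α * s) * ∑ i, (1 + c i + wd) * dt θ s (endpt i) ^ 2

/-- The bound `C μ⁻¹ ‖w₀‖₂ (1 + μ) h⁴ e^{-2αt} exp(C ‖w₀‖₂)`. -/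
def bound (μ α C : ℝ) (w₀ : ℝ → ℝ) (h t : ℝ) : ℝ :=
  C * (1 / μ) * h2Norm w₀ * (1 + μ) * h ^ 4 * Real.exp (-(2 * α * t)) * Real.exp (C * h2Norm w₀)

/-- The superconvergence estimate for `θ` with constant `C`. The time derivative `θ_t` exists at each
`x ∈ [0,1]` for almost all times, the time integrals are finite, and the estimate holds for all
times; so does the resulting estimate of `|||θ|||`. -/
def Superconvergence (ν μ wd α C : ℝ) (c : Fin 2 → ℝ) (w₀ : ℝ → ℝ) (h : ℝ) (θ : ℝ → ℝ → ℝ) : Prop :=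
  (∀ x ∈ Icc (0 : ℝ) 1, ∀ᵐ s ∂(volume.restrict (Ioi (0 : ℝ))),
    DifferentiableAt ℝ (fun r => θ r x) s) ∧
  ∀ t, 0 ≤ t →
    IntervalIntegrable (interiorRate μ α θ) volume 0 t ∧
    IntervalIntegrable (boundaryRate wd α c θ) volume 0 t ∧
    ν * sqNorm (deriv (θ t)) + 1 / 3 * E₂ wd c (θ t)
        + 2 * Real.exp (-(2 * α * t)) * (∫ s in (0 : ℝ)..t, interiorRate μ α θ s)
        + μ / ν * Real.exp (-(2 * α * t)) * (∫ s in (0 : ℝ)..t, boundaryRate wd α c θ s)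
      ≤ bound μ α C w₀ h t ∧
    tnorm (θ t) ^ 2 ≤ bound μ α C w₀ h t

end BBMB

end

noncomputable section

namespace BBMB

/-! ### The space `L²(0,1)` -/

/-! Write η for the difference of the exact solution and its projection, so that w_h - w = θ - η.
Subtracting the two weak formulations gives an equation for θ that is driven by η. The orthogonality
of the elliptic projection replaces the pairings of η_x and η_xt with χ_x by -λ(η, χ) and -λ(η_t,
χ). The convective difference is the derivative of (w_h + w)(w_h - w)/2, and its η part is
integrated by parts. Hence η enters only through its L² norm and its end point values
(`error_identity`). Both are O(h²) on every partition (`projection_error`), although η_x is in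
general only O(h). This is the source of the superconvergence.

Testing with θ and with θ_t gives two differential inequalities, `exists_errEnergy₁'_le` and
`exists_errEnergy₂'_le`. The first bounds the weighted time integral of |||θ|||², which is a source
term of the second. The second controls θ at every time, because its boundary part is built from an
exact quartic primitive of the cubic feedback difference and dominates E₂. Both are integrated by
`gronwall` with the weight exp(2αt); the admissible α are those for which part of the dissipation
pays for this weight. Since θ(0) = 0, everything on the right comes from η.

The coefficients are a priori quantities. The exact and the discrete solution satisfy the same two
energy identities, and the cubic part of the feedback absorbs the convective boundary flux u³/3
without any smallness assumption (`abs_cube_le`, `exists_trajectory_bound`). The bounds for η and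
η_t need w_xx and w_xxt. After multiplication by exp(νt/μ) the combination μ w_xt + ν w_x is a total
time derivative, so the weak equation can be integrated in time, which shows that w(t) lies in H²
and that Z = w_xx solves μ Z_t + ν Z = lower order terms (`exists_secondDeriv`). The end point
derivatives agree with the feedback law up to a defect that decays like exp(-νt/μ).

The dependence on μ is concentrated in two integrals: μ times the weighted integral of ‖w_xxt‖², and
the integral of the squared traces of w_t. The general energy bounds control them with a factor
(1+μ)/μ, which is harmless for fixed μ and for μ ≥ 1. If the feedback laws hold pointwise, the
defect vanishes, and testing the equation with w_xxt produces a boundary dissipation of w_t that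
does not degenerate as μ tends to 0 (`exists_feedback_bound`). -/

/-- Square integrability on `(0,1)`. -/
abbrev InL2 (f : ℝ → ℝ) : Prop := MemLp f 2 (volume.restrict (Ioo (0 : ℝ) 1))

/-- The inner product of `L²(0,1)`. -/
def ip (f g : ℝ → ℝ) : ℝ := ∫ x in (0 : ℝ)..1, f x * g x

theorem unitIntegral_eq (f : ℝ → ℝ) : ∫ x in (0 : ℝ)..1, f x = ∫ x in Ioo (0 : ℝ) 1, f x := by
  rw [intervalIntegral.integral_of_le zero_le_one, integral_Ioc_eq_integral_Ioo]

theorem intervalIntegrable_iff_Ioo {f : ℝ → ℝ} {a b : ℝ} (hab : a ≤ b) :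
    IntervalIntegrable f volume a b ↔ Integrable f (volume.restrict (Ioo a b)) := by
  rw [intervalIntegrable_iff_integrableOn_Ioo_of_le hab, IntegrableOn]

theorem ip_eq (f g : ℝ → ℝ) : ip f g = ∫ x in Ioo (0 : ℝ) 1, f x * g x := unitIntegral_eq _

theorem InL2.integrable_mul {f g : ℝ → ℝ} (hf : InL2 f) (hg : InL2 g) :
    Integrable (fun x => f x * g x) (volume.restrict (Ioo (0 : ℝ) 1)) :=
  MemLp.integrable_mul hf hg

theorem InL2.intervalIntegrable_mul {f g : ℝ → ℝ} (hf : InL2 f) (hg : InL2 g) :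
    IntervalIntegrable (fun x => f x * g x) volume 0 1 :=
  (intervalIntegrable_iff_Ioo zero_le_one).2 (hf.integrable_mul hg)

theorem InL2.fun_add {f g : ℝ → ℝ} (hf : InL2 f) (hg : InL2 g) : InL2 (fun x => f x + g x) :=
  MemLp.add hf hg

theorem InL2.fun_sub {f g : ℝ → ℝ} (hf : InL2 f) (hg : InL2 g) : InL2 (fun x => f x - g x) :=
  MemLp.sub hf hg

theorem inL2_const (a : ℝ) : InL2 (fun _ => a) := memLp_const a

theorem InL2.intervalIntegrable {f : ℝ → ℝ} (hf : InL2 f) : IntervalIntegrable f volume 0 1 :=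
  (intervalIntegrable_iff_Ioo zero_le_one).2 (hf.integrable (by norm_num))

theorem InL2.bdd_mul {f g : ℝ → ℝ} (hf : ContinuousOn f (Icc 0 1)) (hg : InL2 g) :
    InL2 (fun x => f x * g x) := by
  obtain ⟨C, hC⟩ := isCompact_Icc.exists_bound_of_continuousOn hf
  have h1 : AEStronglyMeasurable f (volume.restrict (Ioo (0 : ℝ) 1)) :=
    (hf.mono Ioo_subset_Icc_self).aestronglyMeasurable measurableSet_Ioo
  refine MemLp.of_le_mul (c := C) hg (h1.mul hg.1) ?_
  filter_upwards [ae_restrict_mem measurableSet_Ioo] with x hx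
  rw [norm_mul]
  exact mul_le_mul_of_nonneg_right (hC x (Ioo_subset_Icc_self hx)) (norm_nonneg _)

theorem inL2_of_continuousOn {f : ℝ → ℝ} (hf : ContinuousOn f (Icc 0 1)) : InL2 f := by
  simpa using InL2.bdd_mul hf (inL2_const 1)

theorem ip_comm (f g : ℝ → ℝ) : ip f g = ip g f := by
  simp only [ip, mul_comm]

theorem ip_congr {f g f' g' : ℝ → ℝ} (hf : f =ᵐ[volume.restrict (Ioo (0 : ℝ) 1)] f')
    (hg : g =ᵐ[volume.restrict (Ioo (0 : ℝ) 1)] g') : ip f g = ip f' g' := by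
  rw [ip_eq, ip_eq]
  refine integral_congr_ae ?_
  filter_upwards [hf, hg] with x h1 h2
  rw [h1, h2]

theorem sqNorm_eq_ip (f : ℝ → ℝ) : sqNorm f = ip f f := by simp only [sqNorm, ip, sq]

theorem sqNorm_congr {f g : ℝ → ℝ} (hf : f =ᵐ[volume.restrict (Ioo (0 : ℝ) 1)] g) :
    sqNorm f = sqNorm g := by
  rw [sqNorm_eq_ip, sqNorm_eq_ip, ip_congr hf hf]

theorem sqNorm_nonneg (f : ℝ → ℝ) : 0 ≤ sqNorm f :=
  intervalIntegral.integral_nonneg zero_le_one fun _ _ => sq_nonneg _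

theorem ip_add_left {f g k : ℝ → ℝ} (hf : InL2 f) (hg : InL2 g) (hk : InL2 k) :
    ip (fun x => f x + g x) k = ip f k + ip g k := by
  simp only [ip, add_mul]
  exact intervalIntegral.integral_add (hf.intervalIntegrable_mul hk) (hg.intervalIntegrable_mul hk)

theorem ip_sub_left {f g k : ℝ → ℝ} (hf : InL2 f) (hg : InL2 g) (hk : InL2 k) :
    ip (fun x => f x - g x) k = ip f k - ip g k := by
  simp only [ip, sub_mul]
  exact intervalIntegral.integral_sub (hf.intervalIntegrable_mul hk) (hg.intervalIntegrable_mul hk)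

theorem ip_const_mul_left (a : ℝ) (f g : ℝ → ℝ) : ip (fun x => a * f x) g = a * ip f g := by
  simp only [ip, mul_assoc, intervalIntegral.integral_const_mul]

theorem ip_add_right {f g k : ℝ → ℝ} (hf : InL2 f) (hg : InL2 g) (hk : InL2 k) :
    ip k (fun x => f x + g x) = ip k f + ip k g := by
  rw [ip_comm, ip_add_left hf hg hk, ip_comm f, ip_comm g]

theorem ip_sub_right {f g k : ℝ → ℝ} (hf : InL2 f) (hg : InL2 g) (hk : InL2 k) :
    ip k (fun x => f x - g x) = ip k f - ip k g := by
  rw [ip_comm, ip_sub_left hf hg hk, ip_comm f, ip_comm g]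

theorem ip_const_mul_right (a : ℝ) (f g : ℝ → ℝ) : ip f (fun x => a * g x) = a * ip f g := by
  rw [ip_comm, ip_const_mul_left, ip_comm]

theorem sqNorm_const_mul (a : ℝ) (f : ℝ → ℝ) : sqNorm (fun x => a * f x) = a ^ 2 * sqNorm f := by
  simp only [sqNorm, mul_pow, intervalIntegral.integral_const_mul]

/-- The quadratic polynomial s ↦ ‖f + s g‖² is nonnegative, so its discriminant is nonpositive. -/
theorem ip_sq_le {f g : ℝ → ℝ} (hf : InL2 f) (hg : InL2 g) :
    ip f g ^ 2 ≤ sqNorm f * sqNorm g := by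
  have key : ∀ s : ℝ, 0 ≤ sqNorm g * (s * s) + (2 * ip f g) * s + sqNorm f := by
    intro s
    have h := sqNorm_nonneg (fun x => f x + s * g x)
    have hsg : InL2 (fun x => s * g x) := hg.const_mul s
    rw [sqNorm_eq_ip, ip_add_left hf hsg (hf.fun_add hsg), ip_const_mul_left,
      ip_add_right hf hsg hf, ip_add_right hf hsg hg, ip_const_mul_right, ip_const_mul_right,
      ip_comm g f, ← sqNorm_eq_ip, ← sqNorm_eq_ip] at h
    linarith
  have := discrim_le_zero key
  rw [discrim] at this
  linarith

theorem abs_ip_le {f g : ℝ → ℝ} (hf : InL2 f) (hg : InL2 g) :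
    |ip f g| ≤ √(sqNorm f) * √(sqNorm g) := by
  rw [← Real.sqrt_mul (sqNorm_nonneg f)]
  exact Real.abs_le_sqrt (ip_sq_le hf hg)

theorem sqNorm_add_le {f g : ℝ → ℝ} (hf : InL2 f) (hg : InL2 g) :
    sqNorm (fun x => f x + g x) ≤ 2 * sqNorm f + 2 * sqNorm g := by
  have h := sqNorm_nonneg (fun x => f x - g x)
  rw [sqNorm_eq_ip, ip_sub_left hf hg (hf.fun_sub hg), ip_sub_right hf hg hf, ip_sub_right hf hg hg] at h
  rw [sqNorm_eq_ip, sqNorm_eq_ip, sqNorm_eq_ip, ip_add_left hf hg (hf.fun_add hg),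
    ip_add_right hf hg hf, ip_add_right hf hg hg]
  linarith

theorem sqNorm_sub_le {f g : ℝ → ℝ} (hf : InL2 f) (hg : InL2 g) :
    sqNorm (fun x => f x - g x) ≤ 2 * sqNorm f + 2 * sqNorm g := by
  have h := sqNorm_nonneg (fun x => f x + g x)
  rw [sqNorm_eq_ip, ip_add_left hf hg (hf.fun_add hg), ip_add_right hf hg hf, ip_add_right hf hg hg] at h
  rw [sqNorm_eq_ip, sqNorm_eq_ip, sqNorm_eq_ip, ip_sub_left hf hg (hf.fun_sub hg),
    ip_sub_right hf hg hf, ip_sub_right hf hg hg]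
  linarith

theorem sqNorm_mono {f g : ℝ → ℝ} (hf : InL2 f) (hg : InL2 g)
    (h : ∀ x ∈ Icc (0 : ℝ) 1, f x ^ 2 ≤ g x ^ 2) : sqNorm f ≤ sqNorm g := by
  refine intervalIntegral.integral_mono_on zero_le_one ?_ ?_ h
  · simpa only [sq] using hf.intervalIntegrable_mul hf
  · simpa only [sq] using hg.intervalIntegrable_mul hg

theorem sqNorm_const (a : ℝ) : sqNorm (fun _ => a) = a ^ 2 := by simp [sqNorm]

/-- If `f² ≤ m` on `[0,1]`, then `‖f g‖² ≤ m ‖g‖²`. -/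
theorem sqNorm_mul_le {f g : ℝ → ℝ} {m : ℝ} (hf : ContinuousOn f (Icc 0 1)) (hg : InL2 g)
    (h : ∀ x ∈ Icc (0 : ℝ) 1, f x ^ 2 ≤ m) : sqNorm (fun x => f x * g x) ≤ m * sqNorm g := by
  have hm : 0 ≤ m := (sq_nonneg _).trans (h 0 (by simp))
  have h1 := sqNorm_mono (InL2.bdd_mul hf hg) (hg.const_mul (√m)) (fun x hx => by
    rw [mul_pow, mul_pow, Real.sq_sqrt hm]
    exact mul_le_mul_of_nonneg_right (h x hx) (sq_nonneg _))
  rwa [sqNorm_const_mul, Real.sq_sqrt hm] at h1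

/-- Values in `L²(0,1)`: `f² ≤ m` on `[0,1]` gives `‖f‖² ≤ m`. -/
theorem sqNorm_le_of_sq_le {f : ℝ → ℝ} {m : ℝ} (hf : ContinuousOn f (Icc 0 1))
    (h : ∀ x ∈ Icc (0 : ℝ) 1, f x ^ 2 ≤ m) : sqNorm f ≤ m := by
  simpa [sqNorm_const] using sqNorm_mul_le hf (inL2_const 1) h

/-! ### The space `H¹(0,1)` -/

theorem InH1.continuousOn {f : ℝ → ℝ} (hf : InH1 f) : ContinuousOn f (Icc 0 1) := by
  simpa [uIcc_of_le (zero_le_one (α := ℝ))] using hf.1.continuousOn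

theorem InH1.inL2 {f : ℝ → ℝ} (hf : InH1 f) : InL2 f := inL2_of_continuousOn hf.continuousOn

theorem InH1.deriv_inL2 {f : ℝ → ℝ} (hf : InH1 f) : InL2 (deriv f) := hf.2

theorem InH1.ae_differentiableAt {f : ℝ → ℝ} (hf : InH1 f) :
    ∀ᵐ x ∂volume.restrict (Ioo (0 : ℝ) 1), DifferentiableAt ℝ f x := by
  filter_upwards [ae_restrict_of_ae hf.1.ae_differentiableAt, ae_restrict_mem measurableSet_Ioo]
    with x hx h
  exact hx (by rw [uIcc_of_le zero_le_one]; exact Ioo_subset_Icc_self h)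

theorem InH1.eq_add_integral {f : ℝ → ℝ} (hf : InH1 f) {x : ℝ} (hx : x ∈ Icc (0 : ℝ) 1) :
    f x = f 0 + ∫ y in (0 : ℝ)..x, deriv f y := by
  have h : AbsolutelyContinuousOnInterval f 0 x := hf.1.mono (by
    rw [uIcc_of_le hx.1, uIcc_of_le zero_le_one]; exact Icc_subset_Icc_right hx.2)
  rw [h.integral_deriv_eq_sub]; ring

theorem ae_Ioo_of_ae {p : ℝ → Prop} (h : ∀ᵐ x, x ∈ uIcc (0 : ℝ) 1 → p x) :
    ∀ᵐ x ∂volume.restrict (Ioo (0 : ℝ) 1), p x := by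
  filter_upwards [ae_restrict_of_ae h, ae_restrict_mem measurableSet_Ioo] with x hx h
  exact hx (by rw [uIcc_of_le zero_le_one]; exact Ioo_subset_Icc_self h)

theorem deriv_eqOn_of_eqOn {f g : ℝ → ℝ} (h : EqOn f g (Ioo 0 1)) :
    EqOn (deriv f) (deriv g) (Ioo 0 1) := fun _ hx =>
  Filter.EventuallyEq.deriv_eq (Filter.eventuallyEq_of_mem (isOpen_Ioo.mem_nhds hx) h)

theorem EqOn.ae_eq_Ioo {f g : ℝ → ℝ} (h : EqOn f g (Ioo (0 : ℝ) 1)) :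
    f =ᵐ[volume.restrict (Ioo (0 : ℝ) 1)] g := by
  filter_upwards [ae_restrict_mem measurableSet_Ioo] with x hx using h hx

theorem absolutelyContinuousOnInterval_congr {f g : ℝ → ℝ}
    (hf : AbsolutelyContinuousOnInterval f 0 1) (h : EqOn f g (Icc 0 1)) :
    AbsolutelyContinuousOnInterval g 0 1 := by
  rw [absolutelyContinuousOnInterval_iff] at hf ⊢
  intro ε hε
  obtain ⟨δ, hδ, H⟩ := hf ε hε
  refine ⟨δ, hδ, fun E hE hs => ?_⟩
  refine lt_of_eq_of_lt (Finset.sum_congr rfl fun i hi => ?_) (H E hE hs)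
  have := hE.1 i hi
  rw [uIcc_of_le (zero_le_one (α := ℝ))] at this
  rw [h this.1, h this.2]

theorem InH1.congr {f g : ℝ → ℝ} (hf : InH1 f) (h : EqOn f g (Icc 0 1)) : InH1 g :=
  ⟨absolutelyContinuousOnInterval_congr hf.1 h,
    (memLp_congr_ae (EqOn.ae_eq_Ioo (deriv_eqOn_of_eqOn (h.mono Ioo_subset_Icc_self)))).1 hf.2⟩

theorem deriv_ae_congr {f g : ℝ → ℝ} (h : EqOn f g (Icc 0 1)) :
    deriv f =ᵐ[volume.restrict (Ioo (0 : ℝ) 1)] deriv g :=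
  EqOn.ae_eq_Ioo (deriv_eqOn_of_eqOn (h.mono Ioo_subset_Icc_self))

/-- A primitive of a square integrable function lies in `H¹(0,1)`. -/
theorem inH1_of_primitive {f g : ℝ → ℝ} (hg : InL2 g)
    (h : ∀ x ∈ Icc (0 : ℝ) 1, f x = f 0 + ∫ y in (0 : ℝ)..x, g y) :
    InH1 f ∧ deriv f =ᵐ[volume.restrict (Ioo (0 : ℝ) 1)] g := by
  have hi := hg.intervalIntegrable
  have hac : AbsolutelyContinuousOnInterval (fun x => f 0 + ∫ y in (0 : ℝ)..x, g y) 0 1 := by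
    have h1 := hi.absolutelyContinuousOnInterval_intervalIntegral (c := 0) (by simp)
    have h2 : AbsolutelyContinuousOnInterval (fun _ : ℝ => f 0) 0 1 :=
      (LipschitzWith.const (f 0)).lipschitzOnWith.absolutelyContinuousOnInterval
    exact h2.add h1
  have hd : deriv f =ᵐ[volume.restrict (Ioo (0 : ℝ) 1)] g := by
    filter_upwards [ae_Ioo_of_ae hi.ae_hasDerivAt_integral, ae_restrict_mem measurableSet_Ioo]
      with x hx hx1
    have h3 := (hx 0 (by simp)).const_add (f 0)
    have : f =ᶠ[nhds x] fun x => f 0 + ∫ y in (0 : ℝ)..x, g y :=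
      Filter.eventuallyEq_of_mem (isOpen_Ioo.mem_nhds hx1)
        fun y hy => h y (Ioo_subset_Icc_self hy)
    rw [this.deriv_eq, h3.deriv]
  refine ⟨⟨absolutelyContinuousOnInterval_congr hac fun x hx => (h x hx).symm, ?_⟩, hd⟩
  exact (memLp_congr_ae hd).2 hg

theorem InH1.deriv_add {f g : ℝ → ℝ} (hf : InH1 f) (hg : InH1 g) :
    deriv (fun x => f x + g x) =ᵐ[volume.restrict (Ioo (0 : ℝ) 1)]
      fun x => deriv f x + deriv g x := by
  filter_upwards [hf.ae_differentiableAt, hg.ae_differentiableAt] with x h1 h2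
  exact deriv_fun_add h1 h2

theorem InH1.deriv_sub {f g : ℝ → ℝ} (hf : InH1 f) (hg : InH1 g) :
    deriv (fun x => f x - g x) =ᵐ[volume.restrict (Ioo (0 : ℝ) 1)]
      fun x => deriv f x - deriv g x := by
  filter_upwards [hf.ae_differentiableAt, hg.ae_differentiableAt] with x h1 h2
  exact deriv_fun_sub h1 h2

theorem InH1.deriv_mul {f g : ℝ → ℝ} (hf : InH1 f) (hg : InH1 g) :
    deriv (fun x => f x * g x) =ᵐ[volume.restrict (Ioo (0 : ℝ) 1)]
      fun x => deriv f x * g x + f x * deriv g x := by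
  filter_upwards [hf.ae_differentiableAt, hg.ae_differentiableAt] with x h1 h2
  exact deriv_fun_mul h1 h2

theorem InH1.add {f g : ℝ → ℝ} (hf : InH1 f) (hg : InH1 g) : InH1 (fun x => f x + g x) :=
  ⟨hf.1.add hg.1, (memLp_congr_ae (hf.deriv_add hg)).2 (hf.2.add hg.2)⟩

theorem InH1.sub {f g : ℝ → ℝ} (hf : InH1 f) (hg : InH1 g) : InH1 (fun x => f x - g x) :=
  ⟨hf.1.sub hg.1, (memLp_congr_ae (hf.deriv_sub hg)).2 (hf.2.sub hg.2)⟩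

theorem InH1.mul {f g : ℝ → ℝ} (hf : InH1 f) (hg : InH1 g) : InH1 (fun x => f x * g x) := by
  refine ⟨hf.1.mul hg.1, (memLp_congr_ae (hf.deriv_mul hg)).2 (MemLp.add ?_ ?_)⟩
  · simpa only [mul_comm] using InL2.bdd_mul hg.continuousOn hf.2
  · exact InL2.bdd_mul hf.continuousOn hg.2

theorem inH1_const (a : ℝ) : InH1 (fun _ => a) :=
  ⟨(LipschitzWith.const a).lipschitzOnWith.absolutelyContinuousOnInterval, by simp⟩

theorem InH1.const_mul {f : ℝ → ℝ} (hf : InH1 f) (a : ℝ) : InH1 (fun x => a * f x) :=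
  (inH1_const a).mul hf

/-- Integration by parts. -/
theorem InH1.ip_deriv {f g : ℝ → ℝ} (hf : InH1 f) (hg : InH1 g) :
    ip (deriv f) g = f 1 * g 1 - f 0 * g 0 - ip f (deriv g) := by
  have := hf.1.integral_mul_deriv_eq_deriv_mul hg.1
  simp only [ip]; linarith

theorem InH1.ip_deriv_self {f : ℝ → ℝ} (hf : InH1 f) :
    ip (deriv f) f = (f 1 ^ 2 - f 0 ^ 2) / 2 := by
  have := hf.ip_deriv hf
  rw [ip_comm f] at this
  linarith

/-- The square of the norm `|||·|||`. -/
def xsq (f : ℝ → ℝ) : ℝ := f 0 ^ 2 + f 1 ^ 2 + sqNorm (deriv f)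

theorem xsq_nonneg (f : ℝ → ℝ) : 0 ≤ xsq f := by
  have := sqNorm_nonneg (deriv f)
  rw [xsq]; positivity

theorem tnorm_sq (f : ℝ → ℝ) : tnorm f ^ 2 = xsq f := Real.sq_sqrt (xsq_nonneg f)

theorem integral_sq_le {g : ℝ → ℝ} (hg : InL2 g) {a b : ℝ} (hab : a ≤ b) (ha : 0 ≤ a) (hb : b ≤ 1) :
    (∫ x in a..b, g x) ^ 2 ≤ (b - a) * ∫ x in a..b, g x ^ 2 := by
  have hsub : Ioo a b ⊆ Ioo (0 : ℝ) 1 := Ioo_subset_Ioo ha hb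
  have hg' : MemLp g 2 (volume.restrict (Ioo a b)) := hg.mono_measure (Measure.restrict_mono hsub le_rfl)
  have i1 : IntervalIntegrable g volume a b :=
    (intervalIntegrable_iff_Ioo hab).2 (hg'.integrable (by norm_num))
  have i2 : IntervalIntegrable (fun x => g x ^ 2) volume a b :=
    (intervalIntegrable_iff_Ioo hab).2 hg'.integrable_sq
  have key : ∀ s : ℝ, 0 ≤ (b - a) * (s * s) + (2 * ∫ x in a..b, g x) * s + ∫ x in a..b, g x ^ 2 := by
    intro s
    have h : 0 ≤ ∫ x in a..b, (g x + s) ^ 2 :=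
      intervalIntegral.integral_nonneg hab fun _ _ => sq_nonneg _
    have e : ∀ x, (g x + s) ^ 2 = (g x ^ 2 + (2 * s) * g x) + s ^ 2 := fun x => by ring
    simp only [e] at h
    rw [intervalIntegral.integral_add (i2.add (i1.const_mul _)) (by simp),
      intervalIntegral.integral_add i2 (i1.const_mul _), intervalIntegral.integral_const_mul,
      intervalIntegral.integral_const, smul_eq_mul] at h
    linarith
  have := discrim_le_zero key
  rw [discrim] at this
  linarith

theorem intervalIntegrable_sub {f : ℝ → ℝ} (hf : IntervalIntegrable f volume 0 1) {a b : ℝ}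
    (ha : 0 ≤ a) (hab : a ≤ b) (hb : b ≤ 1) : IntervalIntegrable f volume a b :=
  hf.mono_set (by
    rw [uIcc_of_le hab, uIcc_of_le zero_le_one]; exact Icc_subset_Icc ha hb)

/-- The supremum of `f²` is at most `|||f|||²`. -/
theorem InH1.sq_le_xsq {f : ℝ → ℝ} (hf : InH1 f) {x : ℝ} (hx : x ∈ Icc (0 : ℝ) 1) :
    f x ^ 2 ≤ f 0 ^ 2 + f 1 ^ 2 + sqNorm (deriv f) / 2 := by
  have hi : InL2 (deriv f) := hf.2
  have e0 := hf.eq_add_integral hx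
  have e1 := hf.eq_add_integral (x := 1) (by simp)
  have i1 := hi.intervalIntegrable
  have m1 := intervalIntegrable_sub i1 le_rfl hx.1 hx.2
  have m2 := intervalIntegrable_sub i1 hx.1 hx.2 le_rfl
  have s1 := intervalIntegral.integral_add_adjacent_intervals m1 m2
  have q1 := integral_sq_le hi hx.1 le_rfl hx.2
  have q2 := integral_sq_le hi hx.2 hx.1 le_rfl
  have j : IntervalIntegrable (fun x => deriv f x ^ 2) volume 0 1 :=
    (intervalIntegrable_iff_Ioo zero_le_one).2 hi.integrable_sq
  have s2 := intervalIntegral.integral_add_adjacent_intervals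
    (intervalIntegrable_sub j le_rfl hx.1 hx.2) (intervalIntegrable_sub j hx.1 hx.2 le_rfl)
  have n1 : 0 ≤ ∫ y in (0 : ℝ)..x, deriv f y ^ 2 :=
    intervalIntegral.integral_nonneg hx.1 fun _ _ => sq_nonneg _
  have n2 : 0 ≤ ∫ y in x..(1 : ℝ), deriv f y ^ 2 :=
    intervalIntegral.integral_nonneg hx.2 fun _ _ => sq_nonneg _
  rw [sqNorm, ← s2]
  set A := ∫ y in (0 : ℝ)..x, deriv f y
  set B := ∫ y in x..(1 : ℝ), deriv f y
  set p := ∫ y in (0 : ℝ)..x, deriv f y ^ 2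
  set q := ∫ y in x..(1 : ℝ), deriv f y ^ 2
  have hf1 : f 1 = f x + B := by linarith
  have hf0 : f 0 = f x - A := by linarith
  -- A and B are the increments of f to the left and to the right of x. Then 2 f(x) = (f(0) + f(1))
  -- + (A - B), which is why only A - B has to be estimated. Cauchy–Schwarz on the two pieces has
  -- the weights x and 1 - x, which add up to 1.
  have hAB : (A - B) ^ 2 ≤ p + q := by
    obtain ⟨hx0, hx1⟩ := hx
    rcases eq_or_lt_of_le hx0 with h0 | h0
    · have hA : A = 0 := by have := sq_nonneg A; rw [← h0] at q1; nlinarith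
      rw [hA]; nlinarith
    rcases eq_or_lt_of_le hx1 with h1 | h1
    · have hB : B = 0 := by have := sq_nonneg B; rw [h1] at q2; nlinarith
      rw [hB]; nlinarith
    have a1 : A ^ 2 / x ≤ p := by rw [div_le_iff₀ h0]; linarith
    have a2 : B ^ 2 / (1 - x) ≤ q := by rw [div_le_iff₀ (by linarith)]; linarith
    have a3 : (A - B) ^ 2 ≤ A ^ 2 / x + B ^ 2 / (1 - x) := by
      rw [div_add_div _ _ h0.ne' (by linarith), le_div_iff₀ (by nlinarith)]
      nlinarith [sq_nonneg (A * (1 - x) + B * x)]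
    linarith
  rw [hf1, hf0]
  nlinarith [sq_nonneg (f x - A + B), sq_nonneg (A + B)]

theorem InH1.sqNorm_le_xsq {f : ℝ → ℝ} (hf : InH1 f) :
    sqNorm f ≤ f 0 ^ 2 + f 1 ^ 2 + sqNorm (deriv f) / 2 :=
  sqNorm_le_of_sq_le hf.continuousOn fun _ hx => hf.sq_le_xsq hx

/-- The trace inequality `f(x)² ≤ ‖f‖² + 2 ‖f‖ ‖f_x‖`. -/
theorem InH1.sq_le_trace {f : ℝ → ℝ} (hf : InH1 f) {x : ℝ} (hx : x ∈ Icc (0 : ℝ) 1) :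
    f x ^ 2 ≤ sqNorm f + 2 * (√(sqNorm f) * √(sqNorm (deriv f))) := by
  have hfg : InL2 (fun y => deriv f y * f y) := by
    simpa only [mul_comm] using InL2.bdd_mul hf.continuousOn hf.2
  have hac : AbsolutelyContinuousOnInterval (fun y => f y * f y) 0 1 := hf.1.mul hf.1
  have hd := hf.deriv_mul hf
  have habs : IntervalIntegrable (fun y => |deriv f y * f y|) volume 0 1 :=
    (hfg.intervalIntegrable).abs
  have hJ : ∫ y in (0 : ℝ)..1, |deriv f y * f y| ≤ √(sqNorm f) * √(sqNorm (deriv f)) := by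
    have h1 : InL2 (fun y => |deriv f y|) := hf.2.norm
    have h2 : InL2 (fun y => |f y|) := hf.inL2.norm
    have := abs_ip_le h1 h2
    simp only [sqNorm, sq_abs] at this
    simp only [abs_mul]
    rw [mul_comm]
    exact (le_abs_self _).trans this
  -- The difference f(x)² - f(y)² is at most 2 ∫ |f f_x| for every y; averaging over y then produces
  -- ‖f‖².
  have key : ∀ y ∈ Icc (0 : ℝ) 1, f x ^ 2 - 2 * (√(sqNorm f) * √(sqNorm (deriv f))) ≤ f y ^ 2 := by
    intro y hy
    have hac' : AbsolutelyContinuousOnInterval (fun y => f y * f y) y x := hac.mono (by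
      rw [uIcc_of_le (zero_le_one (α := ℝ))]; exact uIcc_subset_Icc hy hx)
    have e := hac'.integral_deriv_eq_sub
    have hsub : uIoc y x ⊆ Ioc 0 1 := fun z hz => by
      rw [mem_uIoc] at hz
      rcases hz with hz | hz
      · exact ⟨hy.1.trans_lt hz.1, hz.2.trans hx.2⟩
      · exact ⟨hx.1.trans_lt hz.1, hz.2.trans hy.2⟩
    have b1 : |∫ z in y..x, deriv (fun y => f y * f y) z|
        ≤ ∫ z in (0 : ℝ)..1, 2 * |deriv f z * f z| := by
      have c1 := intervalIntegral.norm_integral_le_integral_norm_uIoc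
        (f := deriv (fun y => f y * f y)) (μ := volume) (a := y) (b := x)
      rw [Real.norm_eq_abs] at c1
      have hint : IntegrableOn (fun z => 2 * |deriv f z * f z|) (Ioc 0 1) :=
        (intervalIntegrable_iff_integrableOn_Ioc_of_le zero_le_one).1 (habs.const_mul 2)
      have hae : ∀ᵐ z ∂volume.restrict (Ioc (0 : ℝ) 1),
          deriv (fun y => f y * f y) z = deriv f z * f z + f z * deriv f z := by
        rwa [← restrict_Ioo_eq_restrict_Ioc]
      have hae' : ∀ᵐ z ∂volume.restrict (uIoc y x),
          ‖deriv (fun y => f y * f y) z‖ = 2 * |deriv f z * f z| := by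
        filter_upwards [ae_restrict_of_ae_restrict_of_subset hsub hae] with z hz
        rw [hz, Real.norm_eq_abs, mul_comm (f z), ← two_mul, abs_mul, abs_two]
      refine c1.trans ?_
      rw [integral_congr_ae hae', intervalIntegral.integral_of_le zero_le_one]
      exact setIntegral_mono_set hint (Filter.Eventually.of_forall fun z => by positivity)
        (Filter.Eventually.of_forall hsub)
    rw [e, intervalIntegral.integral_const_mul] at b1
    have := (le_abs_self _).trans b1
    nlinarith
  have hi : IntervalIntegrable (fun x => f x ^ 2) volume 0 1 :=
    (intervalIntegrable_iff_Ioo zero_le_one).2 hf.inL2.integrable_sq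
  have := intervalIntegral.integral_mono_on zero_le_one (by simp) hi key
  rw [intervalIntegral.integral_const] at this
  have h3 : ∫ u in (0 : ℝ)..1, f u ^ 2 = sqNorm f := rfl
  rw [h3, smul_eq_mul] at this
  linarith

/-! ### Primitives in time and a weighted Gronwall inequality -/

/-- `y` is a primitive of the locally integrable function `φ` on `[0,∞)`. -/
structure HasPrim (y φ : ℝ → ℝ) : Prop where
  int : ∀ T, 0 ≤ T → IntervalIntegrable φ volume 0 T
  eq : ∀ t, 0 ≤ t → y t = y 0 + ∫ s in (0 : ℝ)..t, φ s

theorem ac_congr {f g : ℝ → ℝ} {a b : ℝ}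
    (hf : AbsolutelyContinuousOnInterval f a b) (h : EqOn f g (uIcc a b)) :
    AbsolutelyContinuousOnInterval g a b := by
  rw [absolutelyContinuousOnInterval_iff] at hf ⊢
  intro ε hε
  obtain ⟨δ, hδ, H⟩ := hf ε hε
  refine ⟨δ, hδ, fun E hE hs => ?_⟩
  refine lt_of_eq_of_lt (Finset.sum_congr rfl fun i hi => ?_) (H E hE hs)
  rw [h (hE.1 i hi).1, h (hE.1 i hi).2]

/-- An absolutely continuous f has bounded range on [a,b], and a C¹ function is Lipschitz on a
compact interval that contains this range. -/
theorem ac_comp {f F : ℝ → ℝ} {a b : ℝ} (hf : AbsolutelyContinuousOnInterval f a b)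
    (hF : ContDiff ℝ 1 F) : AbsolutelyContinuousOnInterval (fun x => F (f x)) a b := by
  obtain ⟨C, hC⟩ := hf.exists_bound
  obtain ⟨K, hK⟩ := hF.contDiffOn.exists_lipschitzOnWith (s := Icc (-C) C) (by norm_num)
    (convex_Icc _ _) isCompact_Icc
  rw [absolutelyContinuousOnInterval_iff] at hf ⊢
  intro ε hε
  obtain ⟨δ, hδ, H⟩ := hf (ε / (K + 1)) (by positivity)
  refine ⟨δ, hδ, fun E hE hs => ?_⟩
  have h1 := H E hE hs
  rw [lt_div_iff₀ (by positivity)] at h1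
  refine lt_of_le_of_lt ?_ h1
  rw [Finset.sum_mul]
  refine Finset.sum_le_sum fun i hi => ?_
  have m : ∀ z ∈ uIcc a b, f z ∈ Icc (-C) C := fun z hz => abs_le.1 (hC z hz)
  have := hK.dist_le_mul _ (m _ (hE.1 i hi).1) _ (m _ (hE.1 i hi).2)
  nlinarith [dist_nonneg (x := f (E.2 i).1) (y := f (E.2 i).2)]

theorem ae_Ioi_of_forall_Ioo {p : ℝ → Prop}
    (h : ∀ T : ℝ, 0 < T → ∀ᵐ t ∂volume.restrict (Ioo 0 T), p t) :
    ∀ᵐ t ∂volume.restrict (Ioi (0 : ℝ)), p t := by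
  have e : Ioi (0 : ℝ) = ⋃ n : ℕ, Ioo (0 : ℝ) (n + 1) := by
    ext x
    simp only [mem_Ioi, mem_iUnion, mem_Ioo]
    refine ⟨fun hx => ?_, fun ⟨_, h⟩ => h.1⟩
    obtain ⟨n, hn⟩ := exists_nat_gt x
    exact ⟨n, hx, hn.trans (lt_add_one _)⟩
  rw [e, ae_restrict_iUnion_iff]
  exact fun n => h _ (by positivity)

theorem ae_Ioo_of_ae_Ioi {p : ℝ → Prop} (h : ∀ᵐ t ∂volume.restrict (Ioi (0 : ℝ)), p t) (T : ℝ) :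
    ∀ᵐ t ∂volume.restrict (Ioo 0 T), p t :=
  ae_restrict_of_ae_restrict_of_subset Ioo_subset_Ioi_self h

theorem intervalIntegral_congr_ae_Ioi {f g : ℝ → ℝ}
    (h : ∀ᵐ t ∂volume.restrict (Ioi (0 : ℝ)), f t = g t) {t : ℝ} (ht : 0 ≤ t) :
    ∫ s in (0 : ℝ)..t, f s = ∫ s in (0 : ℝ)..t, g s := by
  rw [intervalIntegral.integral_of_le ht, intervalIntegral.integral_of_le ht]
  exact integral_congr_ae (ae_restrict_of_ae_restrict_of_subset Ioc_subset_Ioi_self h)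

theorem intervalIntegrable_congr_ae_Ioi {f g : ℝ → ℝ}
    (h : ∀ᵐ t ∂volume.restrict (Ioi (0 : ℝ)), f t = g t) {t : ℝ} (ht : 0 ≤ t)
    (hf : IntervalIntegrable f volume 0 t) : IntervalIntegrable g volume 0 t := by
  rw [intervalIntegrable_iff_integrableOn_Ioc_of_le ht] at hf ⊢
  exact hf.congr (ae_restrict_of_ae_restrict_of_subset Ioc_subset_Ioi_self h)

theorem intervalIntegral_mono_ae_Ioi {f g : ℝ → ℝ}
    (h : ∀ᵐ t ∂volume.restrict (Ioi (0 : ℝ)), f t ≤ g t) {t : ℝ} (ht : 0 ≤ t)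
    (hf : IntervalIntegrable f volume 0 t) (hg : IntervalIntegrable g volume 0 t) :
    ∫ s in (0 : ℝ)..t, f s ≤ ∫ s in (0 : ℝ)..t, g s := by
  rw [intervalIntegral.integral_of_le ht, intervalIntegral.integral_of_le ht]
  exact integral_mono_ae ((intervalIntegrable_iff_integrableOn_Ioc_of_le ht).1 hf)
    ((intervalIntegrable_iff_integrableOn_Ioc_of_le ht).1 hg)
    (ae_restrict_of_ae_restrict_of_subset Ioc_subset_Ioi_self h)

/-- This is the fundamental theorem for absolutely continuous functions. It transfers product and
chain rules, which are elementary for derivatives at a point, to `HasPrim`. -/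
theorem hasPrim_of_ac {y φ : ℝ → ℝ} (h : ∀ T, 0 ≤ T → AbsolutelyContinuousOnInterval y 0 T)
    (hd : ∀ᵐ t ∂volume.restrict (Ioi (0 : ℝ)), HasDerivAt y (φ t) t) : HasPrim y φ := by
  have e : ∀ᵐ t ∂volume.restrict (Ioi (0 : ℝ)), deriv y t = φ t := by
    filter_upwards [hd] with t ht using ht.deriv
  refine ⟨fun T hT => intervalIntegrable_congr_ae_Ioi e hT (h T hT).intervalIntegrable_deriv,
    fun t ht => ?_⟩
  rw [← intervalIntegral_congr_ae_Ioi e ht, (h t ht).integral_deriv_eq_sub]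
  ring

namespace HasPrim

variable {y z φ ψ : ℝ → ℝ}

theorem ac (h : HasPrim y φ) {T : ℝ} (hT : 0 ≤ T) : AbsolutelyContinuousOnInterval y 0 T := by
  have h1 := (h.int T hT).absolutelyContinuousOnInterval_intervalIntegral (c := 0) (by simp)
  have h2 : AbsolutelyContinuousOnInterval (fun _ : ℝ => y 0) 0 T :=
    (LipschitzWith.const (y 0)).lipschitzOnWith.absolutelyContinuousOnInterval
  refine ac_congr (h2.add h1) fun x hx => ?_
  rw [uIcc_of_le hT] at hx
  exact (h.eq x hx.1).symm

theorem ae_hasDerivAt (h : HasPrim y φ) :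
    ∀ᵐ t ∂volume.restrict (Ioi (0 : ℝ)), HasDerivAt y (φ t) t := by
  refine ae_Ioi_of_forall_Ioo fun T hT => ?_
  filter_upwards [ae_restrict_of_ae (h.int T hT.le).ae_hasDerivAt_integral,
    ae_restrict_mem measurableSet_Ioo] with t ht h1
  rw [uIcc_of_le hT.le] at ht
  have h3 := (ht (Ioo_subset_Icc_self h1) 0 (by simp [hT.le])).const_add (y 0)
  exact h3.congr_of_eventuallyEq (Filter.eventuallyEq_of_mem (Ioi_mem_nhds h1.1)
    fun x hx => h.eq x (le_of_lt hx))

theorem continuousOn (h : HasPrim y φ) {T : ℝ} (hT : 0 ≤ T) : ContinuousOn y (Icc 0 T) := by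
  simpa [uIcc_of_le hT] using (h.ac hT).continuousOn

theorem congr_right (h : HasPrim y φ) (e : ∀ᵐ t ∂volume.restrict (Ioi (0 : ℝ)), φ t = ψ t) :
    HasPrim y ψ :=
  ⟨fun T hT => intervalIntegrable_congr_ae_Ioi e hT (h.int T hT), fun t ht => by
    rw [← intervalIntegral_congr_ae_Ioi e ht, ← h.eq t ht]⟩

theorem congr_left (h : HasPrim y φ) (e : ∀ t, 0 ≤ t → y t = z t) : HasPrim z φ :=
  ⟨h.int, fun t ht => by rw [← e t ht, ← e 0 le_rfl, h.eq t ht]⟩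

theorem add (h : HasPrim y φ) (k : HasPrim z ψ) :
    HasPrim (fun t => y t + z t) (fun t => φ t + ψ t) :=
  ⟨fun T hT => (h.int T hT).add (k.int T hT), fun t ht => by
    rw [intervalIntegral.integral_add (h.int t ht) (k.int t ht), h.eq t ht, k.eq t ht]; ring⟩

theorem const_mul (h : HasPrim y φ) (a : ℝ) : HasPrim (fun t => a * y t) (fun t => a * φ t) :=
  ⟨fun T hT => (h.int T hT).const_mul a, fun t ht => by
    rw [intervalIntegral.integral_const_mul, h.eq t ht]; ring⟩

theorem const (a : ℝ) : HasPrim (fun _ => a) (fun _ => 0) :=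
  ⟨fun _ _ => by simp, fun _ _ => by simp⟩

theorem sub (h : HasPrim y φ) (k : HasPrim z ψ) :
    HasPrim (fun t => y t - z t) (fun t => φ t - ψ t) :=
  ⟨fun T hT => (h.int T hT).sub (k.int T hT), fun t ht => by
    rw [intervalIntegral.integral_sub (h.int t ht) (k.int t ht), h.eq t ht, k.eq t ht]; ring⟩

theorem mul (h : HasPrim y φ) (k : HasPrim z ψ) :
    HasPrim (fun t => y t * z t) (fun t => φ t * z t + y t * ψ t) := by
  refine hasPrim_of_ac (fun T hT => (h.ac hT).mul (k.ac hT)) ?_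
  filter_upwards [h.ae_hasDerivAt, k.ae_hasDerivAt] with t h1 h2 using h1.mul h2

theorem comp (h : HasPrim y φ) {F F' : ℝ → ℝ} (hF : ContDiff ℝ 1 F)
    (hF' : ∀ x, HasDerivAt F (F' x) x) : HasPrim (fun t => F (y t)) (fun t => F' (y t) * φ t) := by
  refine hasPrim_of_ac (fun T hT => ac_comp (h.ac hT) hF) ?_
  filter_upwards [h.ae_hasDerivAt] with t h1 using (hF' _).comp t h1

theorem pow (h : HasPrim y φ) (n : ℕ) :
    HasPrim (fun t => y t ^ n) (fun t => n * y t ^ (n - 1) * φ t) :=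
  h.comp (F := fun x => x ^ n) (F' := fun x => n * x ^ (n - 1)) (contDiff_id.pow n) fun x => hasDerivAt_pow n x

theorem finsetSum {ι : Type*} (s : Finset ι) {y φ : ι → ℝ → ℝ} (h : ∀ i, HasPrim (y i) (φ i)) :
    HasPrim (fun t => ∑ i ∈ s, y i t) (fun t => ∑ i ∈ s, φ i t) := by
  classical
  induction s using Finset.induction_on with
  | empty => simpa using const 0
  | insert a s ha ih => simpa only [Finset.sum_insert ha] using (h a).add ih

end HasPrim

theorem hasPrim_integral {φ : ℝ → ℝ} (h : ∀ T, 0 ≤ T → IntervalIntegrable φ volume 0 T) :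
    HasPrim (fun t => ∫ s in (0 : ℝ)..t, φ s) φ := ⟨h, fun t _ => by simp⟩

/-- Weighted Gronwall inequality. -/
theorem gronwall {y φ γ d f : ℝ → ℝ} {α : ℝ} (hy : HasPrim y φ)
    (hγ : ∀ T, 0 ≤ T → IntervalIntegrable γ volume 0 T)
    (hd : ∀ T, 0 ≤ T → IntervalIntegrable d volume 0 T)
    (hf : ∀ T, 0 ≤ T → IntervalIntegrable f volume 0 T)
    (γ0 : ∀ t, 0 ≤ γ t) (d0 : ∀ t, 0 ≤ d t) (f0 : ∀ t, 0 ≤ f t)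
    (h : ∀ᵐ t ∂volume.restrict (Ioi (0 : ℝ)), φ t + d t ≤ (γ t - 2 * α) * y t + f t)
    {t : ℝ} (ht : 0 ≤ t) :
    Real.exp (2 * α * t) * y t + ∫ s in (0 : ℝ)..t, Real.exp (2 * α * s) * d s
      ≤ (y 0 + ∫ s in (0 : ℝ)..t, Real.exp (2 * α * s) * f s) *
        Real.exp (∫ s in (0 : ℝ)..t, γ s) := by
  have hΓ := hasPrim_integral hγ
  set Γ : ℝ → ℝ := fun t => ∫ s in (0 : ℝ)..t, γ s with hΓdef
  have hlin : HasPrim (fun t => 2 * α * t) (fun _ => 2 * α) :=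
    ⟨fun _ _ => by simp, fun t _ => by simp; ring⟩
  -- The integrating factor is exp(2αs - Γ(s)) with Γ a primitive of γ. Multiplied by it, the
  -- inequality bounds the derivative of a single function, so no sign of y is needed.
  have hE := (hlin.sub hΓ).comp Real.contDiff_exp Real.hasDerivAt_exp
  have hz := hE.mul hy
  have ce : Continuous fun s : ℝ => Real.exp (2 * α * s) := by fun_prop
  have cE : ContinuousOn (fun s => Real.exp (2 * α * s - Γ s)) (uIcc 0 t) := by
    rw [uIcc_of_le ht]; exact hE.continuousOn ht
  have i1 : IntervalIntegrable (fun s => Real.exp (2 * α * s - Γ s) * d s) volume 0 t :=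
    (hd t ht).continuousOn_mul cE
  have i2 : IntervalIntegrable (fun s => Real.exp (2 * α * s) * f s) volume 0 t :=
    (hf t ht).continuousOn_mul ce.continuousOn
  have i3 : IntervalIntegrable (fun s => Real.exp (2 * α * s) * d s) volume 0 t :=
    (hd t ht).continuousOn_mul ce.continuousOn
  have Γmono : ∀ s ∈ Icc 0 t, Γ s ≤ Γ t := fun s hs =>
    intervalIntegral.integral_mono_interval le_rfl hs.1 hs.2
      (Filter.Eventually.of_forall γ0) (hγ t ht)
  have Γnn : ∀ s, 0 ≤ s → 0 ≤ Γ s := fun s hs =>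
    intervalIntegral.integral_nonneg hs fun u _ => γ0 u
  have key : ∫ s in (0 : ℝ)..t,
      (Real.exp (2 * α * s - Γ s) * (2 * α - γ s) * y s + Real.exp (2 * α * s - Γ s) * φ s)
      ≤ ∫ s in (0 : ℝ)..t, (Real.exp (2 * α * s) * f s - Real.exp (2 * α * s - Γ s) * d s) := by
    refine intervalIntegral_mono_ae_Ioi ?_ ht (hz.int t ht) (i2.sub i1)
    filter_upwards [h, ae_restrict_mem measurableSet_Ioi] with s hs hs0
    have p := Real.exp_pos (2 * α * s - Γ s)
    -- Since Γ ≥ 0, the factor exp(-Γ) may be dropped in front of the source f.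
    have q : Real.exp (2 * α * s - Γ s) ≤ Real.exp (2 * α * s) :=
      Real.exp_le_exp.2 (by linarith [Γnn s (le_of_lt hs0)])
    have r := mul_le_mul_of_nonneg_right q (f0 s)
    have := mul_le_mul_of_nonneg_left hs p.le
    linarith
  have e1 := hz.eq t ht
  rw [intervalIntegral.integral_sub i2 i1] at key
  simp only [hΓdef, intervalIntegral.integral_same, mul_zero, sub_zero, Real.exp_zero, one_mul]
    at e1
  have e2 : Real.exp (2 * α * t - Γ t) * y t
      ≤ y 0 + ((∫ s in (0 : ℝ)..t, Real.exp (2 * α * s) * f s)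
        - ∫ s in (0 : ℝ)..t, Real.exp (2 * α * s - Γ s) * d s) := by
    refine e1.le.trans ?_
    gcongr
  have e3 := mul_le_mul_of_nonneg_left e2 (Real.exp_pos (Γ t)).le
  -- In front of d the factor exp(-Γ(s)) must be undone instead; multiplication by exp(Γ(t))
  -- suffices because Γ is nondecreasing.
  have e4 : ∫ s in (0 : ℝ)..t, Real.exp (2 * α * s) * d s
      ≤ Real.exp (Γ t) * ∫ s in (0 : ℝ)..t, Real.exp (2 * α * s - Γ s) * d s := by
    rw [← intervalIntegral.integral_const_mul]
    refine intervalIntegral.integral_mono_on ht i3 (i1.const_mul _) fun s hs => ?_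
    rw [← mul_assoc, ← Real.exp_add]
    refine mul_le_mul_of_nonneg_right (Real.exp_le_exp.2 ?_) (d0 s)
    linarith [Γmono s hs]
  have e5 : Real.exp (Γ t) * (Real.exp (2 * α * t - Γ t) * y t) = Real.exp (2 * α * t) * y t := by
    rw [← mul_assoc, ← Real.exp_add]; congr 2; ring
  rw [e5] at e3
  have : Real.exp (∫ s in (0 : ℝ)..t, γ s) = Real.exp (Γ t) := rfl
  rw [this]
  nlinarith

/-! ### Curves in `L²(0,1)` and `H¹(0,1)` -/

/-- Square integrability on `(0,T) × (0,1)`. -/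
abbrev InL2T (T : ℝ) (V : ℝ → ℝ → ℝ) : Prop :=
  MemLp (fun p : ℝ × ℝ => V p.1 p.2) 2
    ((volume.restrict (Ioo 0 T)).prod (volume.restrict (Ioo 0 1)))

/-- `U` is an absolutely continuous curve in `L²(0,1)` with square integrable derivative `V`. -/
structure L2Curve (U V : ℝ → ℝ → ℝ) : Prop where
  init : InL2 (U 0)
  mem : ∀ T, 0 < T → InL2T T V
  eq : ∀ t, 0 ≤ t → ∀ᵐ x ∂volume.restrict (Ioo (0 : ℝ) 1), U t x = U 0 x + ∫ s in (0 : ℝ)..t, V s x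

theorem InL2T.ae_inL2 {T : ℝ} {V : ℝ → ℝ → ℝ} (h : InL2T T V) :
    ∀ᵐ s ∂volume.restrict (Ioo 0 T), InL2 (V s) := by
  filter_upwards [h.integrable_sq.prod_right_ae, h.1.prodMk_left] with s h1 h2
  exact (memLp_two_iff_integrable_sq h2).2 h1

theorem InL2T.ae_memLp {T : ℝ} {V : ℝ → ℝ → ℝ} (h : InL2T T V) :
    ∀ᵐ x ∂volume.restrict (Ioo (0 : ℝ) 1), MemLp (fun s => V s x) 2 (volume.restrict (Ioo 0 T)) := by
  filter_upwards [h.integrable_sq.prod_left_ae, h.1.prod_swap.prodMk_left] with x h1 h2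
  exact (memLp_two_iff_integrable_sq h2).2 h1

theorem intervalIntegrable_of_pos {f : ℝ → ℝ}
    (h : ∀ T, 0 < T → Integrable f (volume.restrict (Ioo 0 T))) (T : ℝ) (hT : 0 ≤ T) :
    IntervalIntegrable f volume 0 T := by
  rcases eq_or_lt_of_le hT with rfl | hT'
  · simp
  · exact (intervalIntegrable_iff_Ioo hT).2 (h T hT')

theorem ae_forall_intervalIntegrable {V : ℝ → ℝ → ℝ} (h : ∀ T, 0 < T → InL2T T V) :
    ∀ᵐ x ∂volume.restrict (Ioo (0 : ℝ) 1), ∀ T, 0 ≤ T →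
      IntervalIntegrable (fun s => V s x) volume 0 T := by
  -- Integer time horizons suffice, so the exceptional set of points x can be chosen independently
  -- of T.
  have : ∀ᵐ x ∂volume.restrict (Ioo (0 : ℝ) 1), ∀ n : ℕ,
      MemLp (fun s => V s x) 2 (volume.restrict (Ioo (0 : ℝ) (n + 1))) :=
    ae_all_iff.2 fun n => InL2T.ae_memLp (h _ (by positivity))
  filter_upwards [this] with x hx
  refine fun T hT => intervalIntegrable_of_pos (fun T hT => ?_) T hT
  obtain ⟨n, hn⟩ := exists_nat_gt T
  exact (((hx n).integrable (by norm_num)).mono_measure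
    (Measure.restrict_mono (Ioo_subset_Ioo_right (by linarith)) le_rfl))

theorem intervalIntegrable_sqNorm {V : ℝ → ℝ → ℝ} (h : ∀ T, 0 < T → InL2T T V) :
    ∀ T, 0 ≤ T → IntervalIntegrable (fun s => sqNorm (V s)) volume 0 T := by
  refine intervalIntegrable_of_pos fun T hT => ?_
  have := (h T hT).integrable_sq.integral_prod_left
  refine this.congr (Filter.Eventually.of_forall fun s => ?_)
  exact (unitIntegral_eq _).symm

theorem InL2T.integrable_mul {T : ℝ} {V V' : ℝ → ℝ → ℝ} (h : InL2T T V) (h' : InL2T T V') :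
    Integrable (fun p : ℝ × ℝ => V p.1 p.2 * V' p.1 p.2)
      ((volume.restrict (Ioo 0 T)).prod (volume.restrict (Ioo 0 1))) :=
  MemLp.integrable_mul h h'

theorem inL2T_const_left {T : ℝ} {G : ℝ → ℝ} (hG : InL2 G) : InL2T T (fun _ x => G x) := by
  have h : MemLp (fun p : ℝ × ℝ => G p.2) 2
      ((volume.restrict (Ioo 0 T)).prod (volume.restrict (Ioo 0 1))) := hG.comp_snd _
  exact h

theorem intervalIntegrable_ip {V : ℝ → ℝ → ℝ} (h : ∀ T, 0 < T → InL2T T V) {G : ℝ → ℝ}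
    (hG : InL2 G) : ∀ T, 0 ≤ T → IntervalIntegrable (fun s => ip (V s) G) volume 0 T := by
  refine intervalIntegrable_of_pos fun T hT => ?_
  have := ((h T hT).integrable_mul (inL2T_const_left hG)).integral_prod_left
  refine this.congr (Filter.Eventually.of_forall fun s => ?_)
  exact (ip_eq _ _).symm

/-- Cauchy–Schwarz in time. -/
theorem sq_integral_le {v : ℝ → ℝ} {T t : ℝ} (hv : MemLp v 2 (volume.restrict (Ioo 0 T)))
    (ht : 0 ≤ t) (htT : t ≤ T) :
    (∫ s in (0 : ℝ)..t, v s) ^ 2 ≤ T * ∫ s in Ioo 0 T, v s ^ 2 := by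
  have hT := ht.trans htT
  have i1 : Integrable v (volume.restrict (Ioo 0 t)) :=
    (hv.integrable (by norm_num)).mono_measure
      (Measure.restrict_mono (Ioo_subset_Ioo_right htT) le_rfl)
  have i2 : Integrable (fun s => v s ^ 2) (volume.restrict (Ioo 0 t)) :=
    hv.integrable_sq.mono_measure (Measure.restrict_mono (Ioo_subset_Ioo_right htT) le_rfl)
  have j1 := (intervalIntegrable_iff_Ioo ht).2 i1
  have j2 := (intervalIntegrable_iff_Ioo ht).2 i2
  have key : ∀ r : ℝ, 0 ≤ t * (r * r) + (2 * ∫ x in (0 : ℝ)..t, v x) * r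
      + ∫ x in (0 : ℝ)..t, v x ^ 2 := by
    intro r
    have h : 0 ≤ ∫ x in (0 : ℝ)..t, (v x + r) ^ 2 :=
      intervalIntegral.integral_nonneg ht fun _ _ => sq_nonneg _
    have e : ∀ x, (v x + r) ^ 2 = (v x ^ 2 + (2 * r) * v x) + r ^ 2 := fun x => by ring
    simp only [e] at h
    rw [intervalIntegral.integral_add (j2.add (j1.const_mul _)) (by simp),
      intervalIntegral.integral_add j2 (j1.const_mul _), intervalIntegral.integral_const_mul,
      intervalIntegral.integral_const, smul_eq_mul] at h
    linarith
  have h1 := discrim_le_zero key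
  rw [discrim] at h1
  have h2 : ∫ x in (0 : ℝ)..t, v x ^ 2 ≤ ∫ s in Ioo 0 T, v s ^ 2 := by
    rw [intervalIntegral.integral_of_le ht, integral_Ioc_eq_integral_Ioo]
    exact setIntegral_mono_set hv.integrable_sq (Filter.Eventually.of_forall fun z => sq_nonneg _)
      (Filter.Eventually.of_forall (Ioo_subset_Ioo_right htT))
  have h3 : 0 ≤ ∫ x in (0 : ℝ)..t, v x ^ 2 :=
    intervalIntegral.integral_nonneg ht fun _ _ => sq_nonneg _
  nlinarith

/-- The primitive in time of a square integrable function, as a jointly measurable function. -/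
theorem exists_measurable_primitive {T : ℝ} {V : ℝ → ℝ → ℝ} (h : InL2T T V) :
    ∃ W : ℝ → ℝ → ℝ, StronglyMeasurable (Function.uncurry W) ∧
      ∀ᵐ x ∂volume.restrict (Ioo (0 : ℝ) 1), ∀ t ∈ Icc 0 T, ∫ s in (0 : ℝ)..t, V s x = W t x := by
  set V' : ℝ × ℝ → ℝ := h.1.mk _
  have hV' : StronglyMeasurable V' := h.1.stronglyMeasurable_mk
  have hae : ∀ᵐ x ∂volume.restrict (Ioo (0 : ℝ) 1), ∀ᵐ s ∂volume.restrict (Ioo 0 T),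
      V s x = V' (s, x) := by
    have h1 : ∀ᵐ q ∂((volume.restrict (Ioo (0 : ℝ) 1)).prod (volume.restrict (Ioo 0 T))),
        V q.2 q.1 = V' (q.2, q.1) := by
      have h2 := h.1.ae_eq_mk
      have := (Measure.measurePreserving_swap (μ := volume.restrict (Ioo (0 : ℝ) 1))
        (ν := volume.restrict (Ioo 0 T))).quasiMeasurePreserving.ae h2
      exact this
    exact Measure.ae_ae_of_ae_prod h1
  -- The variable upper limit is moved into an indicator over the fixed interval (0,T). The
  -- integrand is then jointly measurable in (t, x, s), and so is its integral in (t, x).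
  refine ⟨fun t x => ∫ s in Ioo 0 T, (Iio t).indicator (fun s => V' (s, x)) s, ?_, ?_⟩
  · have : StronglyMeasurable (Function.uncurry fun (p : ℝ × ℝ) (s : ℝ) =>
        (Iio p.1).indicator (fun s => V' (s, p.2)) s) := by
      have e : (Function.uncurry fun (p : ℝ × ℝ) (s : ℝ) =>
          (Iio p.1).indicator (fun s => V' (s, p.2)) s)
          = {q : (ℝ × ℝ) × ℝ | q.2 < q.1.1}.indicator (fun q => V' (q.2, q.1.2)) := by
        ext ⟨p, s⟩
        simp only [Function.uncurry_apply_pair, indicator, mem_Iio, mem_ofPred_eq]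
      rw [e]
      refine StronglyMeasurable.indicator (hV'.comp_measurable (by fun_prop)) ?_
      exact measurableSet_lt measurable_snd (measurable_fst.comp measurable_fst)
    exact this.integral_prod_right
  · filter_upwards [hae] with x hx t ht
    rw [integral_indicator measurableSet_Iio, Measure.restrict_restrict measurableSet_Iio,
      intervalIntegral.integral_of_le ht.1, integral_Ioc_eq_integral_Ioo]
    have e : Iio t ∩ Ioo 0 T = Ioo 0 t := by
      ext s; simp only [mem_inter_iff, mem_Iio, mem_Ioo]
      exact ⟨fun h => ⟨h.2.1, h.1⟩, fun h => ⟨h.2, h.1, h.2.trans_le ht.2⟩⟩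
    rw [e]
    exact integral_congr_ae (ae_restrict_of_ae_restrict_of_subset (Ioo_subset_Ioo_right ht.2) hx)

/-- By Cauchy–Schwarz in time, T ∫ V(s,x)² ds dominates the square of the primitive for all t in
[0,T] at once, and it is integrable in x by Fubini. -/
theorem InL2T.primitive {T : ℝ} {V : ℝ → ℝ → ℝ} (h : InL2T T V) :
    InL2T T (fun t x => ∫ s in (0 : ℝ)..t, V s x) ∧
      ∀ t ∈ Icc 0 T, InL2 (fun x => ∫ s in (0 : ℝ)..t, V s x) := by
  obtain ⟨W, hW, hWV⟩ := exists_measurable_primitive h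
  have hJ : Integrable (fun x => ∫ s in Ioo 0 T, V s x ^ 2) (volume.restrict (Ioo (0 : ℝ) 1)) :=
    h.integrable_sq.integral_prod_right
  have hb : ∀ᵐ x ∂volume.restrict (Ioo (0 : ℝ) 1), ∀ t ∈ Icc 0 T,
      (∫ s in (0 : ℝ)..t, V s x) ^ 2 ≤ T * ∫ s in Ioo 0 T, V s x ^ 2 := by
    filter_upwards [h.ae_memLp] with x hx t ht using sq_integral_le hx ht.1 ht.2
  constructor
  · have m1 : AEStronglyMeasurable (fun p : ℝ × ℝ => ∫ s in (0 : ℝ)..p.1, V s p.2)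
        ((volume.restrict (Ioo 0 T)).prod (volume.restrict (Ioo 0 1))) := by
      refine ⟨Function.uncurry W, hW, ?_⟩
      have h2 : ∀ᵐ p ∂((volume.restrict (Ioo 0 T)).prod (volume.restrict (Ioo (0 : ℝ) 1))),
          p.1 ∈ Ioo 0 T ∧ ∀ t ∈ Icc 0 T, ∫ s in (0 : ℝ)..t, V s p.2 = W t p.2 :=
        (Measure.quasiMeasurePreserving_fst.ae (ae_restrict_mem measurableSet_Ioo)).and
          (Measure.quasiMeasurePreserving_snd.ae hWV)
      filter_upwards [h2] with p hp using hp.2 _ (Ioo_subset_Icc_self hp.1)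
    refine (memLp_two_iff_integrable_sq m1).2 ?_
    have hJ' : Integrable (fun p : ℝ × ℝ => T * ∫ s in Ioo 0 T, V s p.2 ^ 2)
        ((volume.restrict (Ioo 0 T)).prod (volume.restrict (Ioo 0 1))) :=
      (hJ.comp_snd _).const_mul T
    refine hJ'.mono' (m1.pow 2) ?_
    have h2 : ∀ᵐ p ∂((volume.restrict (Ioo 0 T)).prod (volume.restrict (Ioo (0 : ℝ) 1))),
          p.1 ∈ Ioo 0 T ∧ ∀ t ∈ Icc 0 T,
            (∫ s in (0 : ℝ)..t, V s p.2) ^ 2 ≤ T * ∫ s in Ioo 0 T, V s p.2 ^ 2 :=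
        (Measure.quasiMeasurePreserving_fst.ae (ae_restrict_mem measurableSet_Ioo)).and
          (Measure.quasiMeasurePreserving_snd.ae hb)
    filter_upwards [h2] with p hp
    rw [Real.norm_eq_abs, abs_of_nonneg (sq_nonneg _)]
    exact hp.2 _ (Ioo_subset_Icc_self hp.1)
  · intro t ht
    have m1 : AEStronglyMeasurable (fun x => ∫ s in (0 : ℝ)..t, V s x)
        (volume.restrict (Ioo (0 : ℝ) 1)) := by
      refine ⟨W t, hW.comp_measurable (measurable_const.prodMk measurable_id), ?_⟩
      filter_upwards [hWV] with x hx using hx t ht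
    refine (memLp_two_iff_integrable_sq m1).2 ((hJ.const_mul T).mono' (m1.pow 2) ?_)
    filter_upwards [hb] with x hx
    rw [Real.norm_eq_abs, abs_of_nonneg (sq_nonneg _)]
    exact hx t ht

namespace L2Curve

variable {U V : ℝ → ℝ → ℝ}

theorem inL2 (h : L2Curve U V) {t : ℝ} (ht : 0 ≤ t) : InL2 (U t) := by
  have h1 := ((h.mem (t + 1) (by positivity)).primitive).2 t ⟨ht, by linarith⟩
  exact (memLp_congr_ae (h.eq t ht)).2 (h.init.fun_add h1)

/-- The canonical jointly square integrable version of the curve. -/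
theorem inL2T (h : L2Curve U V) {T : ℝ} (hT : 0 < T) :
    InL2T T (fun t x => U 0 x + ∫ s in (0 : ℝ)..t, V s x) :=
  MemLp.add (inL2T_const_left h.init) ((h.mem T hT).primitive).1

/-- For almost every x the scalar function t ↦ U(t,x)² obeys the chain rule; Fubini exchanges the
integrals over x and over time. -/
theorem hasPrim_sqNorm (h : L2Curve U V) :
    HasPrim (fun t => sqNorm (U t)) (fun s => 2 * ip (U s) (V s)) := by
  -- For each t, U(t) agrees with this version outside a null set that may depend on t. Only the
  -- version Ũ is jointly measurable and differentiable in time along almost every fixed x.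
  set Ũ : ℝ → ℝ → ℝ := fun t x => U 0 x + ∫ s in (0 : ℝ)..t, V s x with hŨ
  have hmul : ∀ T, 0 < T → Integrable (fun p : ℝ × ℝ => 2 * (Ũ p.1 p.2 * V p.1 p.2))
      ((volume.restrict (Ioo 0 T)).prod (volume.restrict (Ioo 0 1))) := fun T hT =>
    (InL2T.integrable_mul (h.inL2T hT) (h.mem T hT)).const_mul 2
  have hip : ∀ s, 0 ≤ s → 2 * ip (U s) (V s) = ∫ x in Ioo (0 : ℝ) 1, 2 * (Ũ s x * V s x) := by
    intro s hs
    rw [integral_const_mul, ← ip_eq (Ũ s) (V s)]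
    congr 1
    exact ip_congr (h.eq s hs) (Filter.EventuallyEq.refl _ _)
  refine ⟨intervalIntegrable_of_pos fun T hT => ?_, fun t ht => ?_⟩
  · refine (hmul T hT).integral_prod_left.congr ?_
    filter_upwards [ae_restrict_mem measurableSet_Ioo] with s hs using (hip s hs.1.le).symm
  · rcases eq_or_lt_of_le ht with rfl | ht'
    · simp
    have e1 : ∫ s in (0 : ℝ)..t, 2 * ip (U s) (V s)
        = ∫ s in Ioo 0 t, ∫ x in Ioo (0 : ℝ) 1, 2 * (Ũ s x * V s x) := by
      rw [intervalIntegral.integral_of_le ht, integral_Ioc_eq_integral_Ioo]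
      exact setIntegral_congr_fun measurableSet_Ioo fun s hs => hip s hs.1.le
    have e2 := integral_integral_swap (f := fun s x => 2 * (Ũ s x * V s x)) (hmul t ht')
    have e3 : ∀ᵐ x ∂volume.restrict (Ioo (0 : ℝ) 1),
        ∫ s in Ioo 0 t, 2 * (Ũ s x * V s x) = U t x ^ 2 - U 0 x ^ 2 := by
      filter_upwards [ae_forall_intervalIntegrable h.mem, h.eq t ht] with x hx hx2
      have hp : HasPrim (fun t => Ũ t x) (fun s => V s x) :=
        ⟨hx, fun t _ => by simp [hŨ]⟩
      have := (hp.pow 2).eq t ht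
      simp only [Nat.cast_ofNat, Nat.add_one_sub_one, pow_one, mul_assoc] at this
      rw [hx2, ← integral_Ioc_eq_integral_Ioo, ← intervalIntegral.integral_of_le ht]
      simp only [hŨ, intervalIntegral.integral_same, add_zero] at this ⊢
      linarith
    rw [e1, e2, integral_congr_ae e3, integral_sub (h.inL2 ht).integrable_sq h.init.integrable_sq,
      sqNorm, sqNorm, unitIntegral_eq, unitIntegral_eq]
    ring

theorem hasPrim_ip (h : L2Curve U V) {G : ℝ → ℝ} (hG : InL2 G) :
    HasPrim (fun t => ip (U t) G) (fun s => ip (V s) G) := by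
  refine ⟨intervalIntegrable_ip h.mem hG, fun t ht => ?_⟩
  rcases eq_or_lt_of_le ht with rfl | ht'
  · simp
  have e1 : ∫ s in (0 : ℝ)..t, ip (V s) G = ∫ s in Ioo 0 t, ∫ x in Ioo (0 : ℝ) 1, V s x * G x := by
    rw [intervalIntegral.integral_of_le ht, integral_Ioc_eq_integral_Ioo]
    exact setIntegral_congr_fun measurableSet_Ioo fun s _ => ip_eq _ _
  have e2 := integral_integral_swap (f := fun s x => V s x * G x)
    (InL2T.integrable_mul (h.mem t ht') (inL2T_const_left hG))
  have e3 : ∀ᵐ x ∂volume.restrict (Ioo (0 : ℝ) 1),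
      ∫ s in Ioo 0 t, V s x * G x = U t x * G x - U 0 x * G x := by
    filter_upwards [h.eq t ht] with x hx2
    rw [hx2, ← integral_Ioc_eq_integral_Ioo, ← intervalIntegral.integral_of_le ht,
      intervalIntegral.integral_mul_const]
    ring
  rw [e1, e2, integral_congr_ae e3, integral_sub ((h.inL2 ht).integrable_mul hG)
    (h.init.integrable_mul hG), ip_eq, ip_eq]
  ring

end L2Curve

/-! ### Curves in H¹(0,1), their traces and their space derivatives. -/

/-- `u` is an absolutely continuous curve in `H¹(0,1)` with square integrable derivative `ut`. -/
structure H1Curve (u ut : ℝ → ℝ → ℝ) : Prop where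
  h1 : ∀ t, 0 ≤ t → InH1 (u t)
  h1t : ∀ᵐ t ∂volume.restrict (Ioi (0 : ℝ)), InH1 (ut t)
  mem : ∀ T, 0 < T → InL2T T ut
  -- Joint measurability and integrability are asked of p only; the derivatives of the slices need
  -- to agree with it merely for almost every time and almost every point.
  memx : ∃ p : ℝ → ℝ → ℝ, (∀ T, 0 < T → InL2T T p) ∧ ∀ᵐ t ∂volume.restrict (Ioi (0 : ℝ)),
    deriv (ut t) =ᵐ[volume.restrict (Ioo (0 : ℝ) 1)] p t
  eq : ∀ t, 0 ≤ t → ∀ x ∈ Icc (0 : ℝ) 1, u t x = u 0 x + ∫ s in (0 : ℝ)..t, ut s x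

/-- The kernel that represents point evaluation at `x` on `H¹(0,1)`. -/
def evalKernel (x y : ℝ) : ℝ := if y < x then y else y - 1

theorem evalKernel_inL2 (x : ℝ) : InL2 (evalKernel x) := by
  have hm : Measurable (evalKernel x) :=
    Measurable.ite measurableSet_Iio measurable_id (measurable_id.sub_const 1)
  refine MemLp.of_bound hm.aestronglyMeasurable 1 ?_
  filter_upwards [ae_restrict_mem measurableSet_Ioo] with y hy
  rw [Real.norm_eq_abs, abs_le, evalKernel]
  split_ifs <;> constructor <;> linarith [hy.1, hy.2]

/-- Integration by parts against y on [0,x] and against y - 1 on [x,1]. Writing a point value as a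
sum of two inner products makes traces of a curve measurable and integrable in time. -/
theorem InH1.eq_ip_evalKernel {f : ℝ → ℝ} (hf : InH1 f) {x : ℝ} (hx : x ∈ Icc (0 : ℝ) 1) :
    f x = ip f (fun _ => 1) + ip (deriv f) (evalKernel x) := by
  have hid : AbsolutelyContinuousOnInterval (fun y : ℝ => y) 0 1 :=
    LipschitzWith.id.lipschitzOnWith.absolutelyContinuousOnInterval
  have hid1 : AbsolutelyContinuousOnInterval (fun y : ℝ => y - 1) 0 1 :=
    hid.sub (inH1_const 1).1
  have s1 : uIcc 0 x ⊆ uIcc 0 1 := by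
    rw [uIcc_of_le hx.1, uIcc_of_le zero_le_one]; exact Icc_subset_Icc_right hx.2
  have s2 : uIcc x 1 ⊆ uIcc 0 1 := by
    rw [uIcc_of_le hx.2, uIcc_of_le zero_le_one]; exact Icc_subset_Icc_left hx.1
  have a1 := (hid.mono s1).integral_mul_deriv_eq_deriv_mul (hf.1.mono s1)
  have a2 := (hid1.mono s2).integral_mul_deriv_eq_deriv_mul (hf.1.mono s2)
  simp only [deriv_id'', one_mul, deriv_sub_const] at a1 a2
  have i := hf.inL2.intervalIntegrable
  have j : IntervalIntegrable (fun y => deriv f y * evalKernel x y) volume 0 1 :=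
    InL2.intervalIntegrable_mul hf.2 (evalKernel_inL2 x)
  have b1 := intervalIntegral.integral_add_adjacent_intervals
    (intervalIntegrable_sub i le_rfl hx.1 hx.2) (intervalIntegrable_sub i hx.1 hx.2 le_rfl)
  have b2 := intervalIntegral.integral_add_adjacent_intervals
    (intervalIntegrable_sub j le_rfl hx.1 hx.2) (intervalIntegrable_sub j hx.1 hx.2 le_rfl)
  have c1 : ∫ y in (0 : ℝ)..x, deriv f y * evalKernel x y = ∫ y in (0 : ℝ)..x, y * deriv f y := by
    rw [intervalIntegral.integral_of_le hx.1, intervalIntegral.integral_of_le hx.1,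
      integral_Ioc_eq_integral_Ioo, integral_Ioc_eq_integral_Ioo]
    refine setIntegral_congr_fun measurableSet_Ioo fun y hy => ?_
    simp only [evalKernel, if_pos hy.2, mul_comm]
  have c2 : ∫ y in x..(1 : ℝ), deriv f y * evalKernel x y
      = ∫ y in x..(1 : ℝ), (y - 1) * deriv f y := by
    rw [intervalIntegral.integral_of_le hx.2, intervalIntegral.integral_of_le hx.2]
    refine setIntegral_congr_fun measurableSet_Ioc fun y hy => ?_
    simp only [evalKernel, if_neg (not_lt.2 hy.1.le), mul_comm]
  have d : ip f (fun _ => 1) = ∫ y in (0 : ℝ)..1, f y := by simp [ip]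
  have e : ip (deriv f) (evalKernel x) = ∫ y in (0 : ℝ)..1, deriv f y * evalKernel x y := rfl
  rw [d, e, ← b1, ← b2, c1, c2, a1, a2]
  ring

namespace H1Curve

variable {u ut : ℝ → ℝ → ℝ}

theorem l2 (h : H1Curve u ut) : L2Curve u ut :=
  ⟨(h.h1 0 le_rfl).inL2, h.mem, fun t ht => by
    filter_upwards [ae_restrict_mem measurableSet_Ioo] with x hx
    exact h.eq t ht x (Ioo_subset_Icc_self hx)⟩

theorem trace_intervalIntegrable (h : H1Curve u ut) {x : ℝ} (hx : x ∈ Icc (0 : ℝ) 1) :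
    ∀ T, 0 ≤ T → IntervalIntegrable (fun s => ut s x) volume 0 T := by
  intro T hT
  obtain ⟨p, hp, hpe⟩ := h.memx
  have := (intervalIntegrable_ip h.mem (inL2_const 1) T hT).add
    (intervalIntegrable_ip hp (evalKernel_inL2 x) T hT)
  refine intervalIntegrable_congr_ae_Ioi ?_ hT this
  filter_upwards [h.h1t, hpe] with s hs hs'
  rw [hs.eq_ip_evalKernel hx, ip_congr hs' (Filter.EventuallyEq.refl _ _)]

theorem hasPrim (h : H1Curve u ut) {x : ℝ} (hx : x ∈ Icc (0 : ℝ) 1) :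
    HasPrim (fun t => u t x) (fun s => ut s x) :=
  ⟨h.trace_intervalIntegrable hx, fun t ht => h.eq t ht x hx⟩

/-- The increment u(t,x) - u(0,x) is integrated first in time and then in space; after exchanging
the order it is a primitive in x of the time integral of p, whose derivative is determined almost
everywhere. -/
theorem l2x_of (h : H1Curve u ut) {p : ℝ → ℝ → ℝ} (hp : ∀ T, 0 < T → InL2T T p)
    (hpe : ∀ᵐ t ∂volume.restrict (Ioi (0 : ℝ)),
      deriv (ut t) =ᵐ[volume.restrict (Ioo (0 : ℝ) 1)] p t) :
    L2Curve (fun t => deriv (u t)) p := by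
  refine ⟨(h.h1 0 le_rfl).2, hp, fun t ht => ?_⟩
  rcases eq_or_lt_of_le ht with rfl | ht'
  · simp
  have hW := ((hp t ht').primitive).2 t ⟨ht, le_rfl⟩
  have hd := (h.h1 t ht).sub (h.h1 0 le_rfl)
  have key : ∀ x ∈ Icc (0 : ℝ) 1, u t x - u 0 x
      = (u t 0 - u 0 0) + ∫ y in (0 : ℝ)..x, ∫ s in (0 : ℝ)..t, p s y := by
    intro x hx
    have e1 : ∀ᵐ s ∂volume.restrict (Ioi (0 : ℝ)),
        ut s x = ut s 0 + ∫ y in (0 : ℝ)..x, p s y := by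
      filter_upwards [h.h1t, hpe] with s hs hs'
      rw [hs.eq_add_integral hx, intervalIntegral.integral_of_le hx.1,
        intervalIntegral.integral_of_le hx.1, integral_Ioc_eq_integral_Ioo,
        integral_Ioc_eq_integral_Ioo]
      congr 1
      exact integral_congr_ae
        (ae_restrict_of_ae_restrict_of_subset (Ioo_subset_Ioo_right hx.2) hs')
    have hint : IntervalIntegrable (fun s => ∫ y in (0 : ℝ)..x, p s y) volume 0 t := by
      have := (h.trace_intervalIntegrable hx t ht).sub
        (h.trace_intervalIntegrable (x := 0) (by simp) t ht)
      refine intervalIntegrable_congr_ae_Ioi ?_ ht this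
      filter_upwards [e1] with s hs
      rw [hs]; ring
    have hsw : ∫ s in (0 : ℝ)..t, ∫ y in (0 : ℝ)..x, p s y
        = ∫ y in (0 : ℝ)..x, ∫ s in (0 : ℝ)..t, p s y := by
      simp only [intervalIntegral.integral_of_le ht, intervalIntegral.integral_of_le hx.1,
        integral_Ioc_eq_integral_Ioo]
      refine integral_integral_swap (f := fun s y => p s y) ?_
      have : Integrable (fun q : ℝ × ℝ => p q.1 q.2)
          ((volume.restrict (Ioo 0 t)).prod (volume.restrict (Ioo 0 1))) :=
        (hp t ht').integrable (by norm_num)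
      exact this.mono_measure (Measure.prod_mono le_rfl
        (Measure.restrict_mono (Ioo_subset_Ioo_right hx.2) le_rfl))
    rw [h.eq t ht x hx, h.eq t ht 0 (by simp), ← hsw, intervalIntegral_congr_ae_Ioi e1 ht,
      intervalIntegral.integral_add (h.trace_intervalIntegrable (by simp) t ht) hint]
    ring
  have h2 := (inH1_of_primitive hW (f := fun x => u t x - u 0 x) key).2
  filter_upwards [h2, (h.h1 t ht).deriv_sub (h.h1 0 le_rfl)] with x hx hx'
  rw [← hx, hx']; ring

theorem hasPrim_sqNorm_deriv (h : H1Curve u ut) :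
    HasPrim (fun t => sqNorm (deriv (u t))) (fun s => 2 * ip (deriv (u s)) (deriv (ut s))) := by
  obtain ⟨p, hp, hpe⟩ := h.memx
  refine (h.l2x_of hp hpe).hasPrim_sqNorm.congr_right ?_
  filter_upwards [hpe] with s hs
  rw [ip_congr (Filter.EventuallyEq.refl _ _) hs]

theorem hasPrim_ip_deriv (h : H1Curve u ut) {G : ℝ → ℝ} (hG : InL2 G) :
    HasPrim (fun t => ip (deriv (u t)) G) (fun s => ip (deriv (ut s)) G) := by
  obtain ⟨p, hp, hpe⟩ := h.memx
  refine ((h.l2x_of hp hpe).hasPrim_ip hG).congr_right ?_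
  filter_upwards [hpe] with s hs
  rw [ip_congr hs (Filter.EventuallyEq.refl _ _)]

theorem intervalIntegrable_sqNorm_deriv (h : H1Curve u ut) :
    ∀ T, 0 ≤ T → IntervalIntegrable (fun s => sqNorm (deriv (ut s))) volume 0 T := by
  obtain ⟨p, hp, hpe⟩ := h.memx
  refine fun T hT => intervalIntegrable_congr_ae_Ioi ?_ hT (intervalIntegrable_sqNorm hp T hT)
  filter_upwards [hpe] with s hs
  rw [sqNorm_congr hs]

theorem sub {v vt : ℝ → ℝ → ℝ} (h : H1Curve u ut) (k : H1Curve v vt) :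
    H1Curve (fun t x => u t x - v t x) (fun t x => ut t x - vt t x) := by
  refine ⟨fun t ht => (h.h1 t ht).sub (k.h1 t ht), ?_, fun T hT => (h.mem T hT).sub (k.mem T hT),
    ?_, fun t ht x hx => ?_⟩
  · filter_upwards [h.h1t, k.h1t] with t h1 h2 using h1.sub h2
  · obtain ⟨p, hp, hpe⟩ := h.memx
    obtain ⟨q, hq, hqe⟩ := k.memx
    refine ⟨fun t x => p t x - q t x, fun T hT => (hp T hT).sub (hq T hT), ?_⟩
    filter_upwards [h.h1t, k.h1t, hpe, hqe] with t h1 h2 h3 h4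
    filter_upwards [h1.deriv_sub h2, h3, h4] with x h5 h6 h7
    rw [h5, h6, h7]
  · rw [h.eq t ht x hx, k.eq t ht x hx, intervalIntegral.integral_sub
      (h.trace_intervalIntegrable hx t ht) (k.trace_intervalIntegrable hx t ht)]
    ring

theorem intervalIntegrable_trace_sq (h : H1Curve u ut) {x : ℝ} (hx : x ∈ Icc (0 : ℝ) 1) :
    ∀ T, 0 ≤ T → IntervalIntegrable (fun s => ut s x ^ 2) volume 0 T := by
  intro T hT
  have h1 := h.trace_intervalIntegrable hx T hT
  have h2 := ((intervalIntegrable_sqNorm h.mem T hT).const_mul 2).add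
    (h.intervalIntegrable_sqNorm_deriv T hT)
  rw [intervalIntegrable_iff_integrableOn_Ioc_of_le hT] at h1 h2 ⊢
  refine Integrable.mono' h2 (h1.1.pow 2) ?_
  filter_upwards [ae_restrict_of_ae_restrict_of_subset Ioc_subset_Ioi_self h.h1t] with s hs
  rw [Real.norm_eq_abs, abs_of_nonneg (sq_nonneg _)]
  have h3 := hs.sq_le_trace hx
  have := Real.sq_sqrt (sqNorm_nonneg (ut s))
  have := Real.sq_sqrt (sqNorm_nonneg (deriv (ut s)))
  nlinarith [sq_nonneg (√(sqNorm (ut s)) - √(sqNorm (deriv (ut s))))]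

theorem intervalIntegrable_xsq (h : H1Curve u ut) :
    ∀ T, 0 ≤ T → IntervalIntegrable (fun s => xsq (ut s)) volume 0 T := fun T hT =>
  ((h.intervalIntegrable_trace_sq (by simp) T hT).add
    (h.intervalIntegrable_trace_sq (by simp) T hT)).add (h.intervalIntegrable_sqNorm_deriv T hT)

theorem continuousOn_xsq (h : H1Curve u ut) {T : ℝ} (hT : 0 ≤ T) :
    ContinuousOn (fun t => xsq (u t)) (Icc 0 T) :=
  (((h.hasPrim (by simp)).continuousOn hT).pow 2 |>.add
    (((h.hasPrim (by simp)).continuousOn hT).pow 2)).add (h.hasPrim_sqNorm_deriv.continuousOn hT)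

end H1Curve

/-! ### Energy estimates for a single trajectory -/

theorem weakForm_eq (ν μ wd : ℝ) (c : Fin 2 → ℝ) (u ut χ : ℝ → ℝ) :
    weakForm ν μ wd c u ut χ = ip ut χ + μ * ip (deriv ut) (deriv χ)
      + ν * ip (deriv u) (deriv χ) + (1 + wd) * ip (deriv u) χ
      + ip (fun x => u x * deriv u x) χ
      + μ / ν * (((c 0 + 1 + wd) * ut 0 + 2 / (3 * c 0) * u 0 ^ 2 * ut 0) * χ 0
        + ((c 1 + 1 + wd) * ut 1 + 2 / (3 * c 1) * u 1 ^ 2 * ut 1) * χ 1)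
      + (((c 0 + 1 + wd) * u 0 + 2 / (9 * c 0) * u 0 ^ 3) * χ 0
        + ((c 1 + 1 + wd) * u 1 + 2 / (9 * c 1) * u 1 ^ 3) * χ 1) := by
  simp only [weakForm, ip, Fin.sum_univ_two, endpt, Matrix.cons_val_zero, Matrix.cons_val_one]

theorem InH1.ip_mul_deriv_self {u : ℝ → ℝ} (hu : InH1 u) :
    ip (fun x => u x * deriv u x) u = (u 1 ^ 3 - u 0 ^ 3) / 3 := by
  have h := hu.ip_deriv (hu.mul hu)
  have e1 : ip u (deriv fun x => u x * u x) = 2 * ip (fun x => u x * deriv u x) u := by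
    rw [ip_congr (Filter.EventuallyEq.refl _ _) (hu.deriv_mul hu)]
    simp only [ip, ← intervalIntegral.integral_const_mul]
    congr 1; ext x; ring
  have e2 : ip (deriv u) (fun x => u x * u x) = ip (fun x => u x * deriv u x) u := by
    simp only [ip]
    congr 1; ext x; ring
  rw [e1, e2] at h
  linarith

/-- Absorption of boundary values by `|||f|||²` and `‖f‖²`. -/
theorem InH1.trace_absorb {f : ℝ → ℝ} (hf : InH1 f) {a δ : ℝ} (ha : 0 ≤ a) (hδ : 0 < δ)
    {x : ℝ} (hx : x ∈ Icc (0 : ℝ) 1) :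
    a * f x ^ 2 ≤ δ * xsq f + (a + a ^ 2 / δ) * sqNorm f := by
  have h := mul_le_mul_of_nonneg_left (hf.sq_le_trace hx) ha
  have h0 := Real.sq_sqrt (sqNorm_nonneg f)
  have h1 := Real.sq_sqrt (sqNorm_nonneg (deriv f))
  set p := √(sqNorm f)
  set q := √(sqNorm (deriv f))
  have hq : q ^ 2 ≤ xsq f := by rw [h1, xsq]; nlinarith [sq_nonneg (f 0), sq_nonneg (f 1)]
  have h2 : 2 * (a * (p * q)) ≤ δ * q ^ 2 + a ^ 2 / δ * p ^ 2 := by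
    have e : δ * q ^ 2 + a ^ 2 / δ * p ^ 2 - 2 * (a * (p * q)) = (δ * q - a * p) ^ 2 / δ := by
      field_simp; ring
    have : 0 ≤ (δ * q - a * p) ^ 2 / δ := by positivity
    linarith
  have h3 := mul_le_mul_of_nonneg_left hq hδ.le
  rw [← h0]
  nlinarith

/-- The form in which the decay rate is used: after clearing denominators, the exponential weight
costs at most half of the dissipation ν‖u_x‖² and half of each linear boundary term. -/
theorem AdmissibleRate.mul_le {ν μ wd α : ℝ} {c : Fin 2 → ℝ} (hν : 0 < ν) (hμ : 0 < μ)
    (hwd : 0 ≤ wd) (hc : ∀ i, 0 < c i) (h : AdmissibleRate ν μ wd c α) :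
    α * (1 + μ) ≤ ν / 2 ∧ ∀ i, α * (1 + μ / ν * (c i + 1 + wd)) ≤ (c i + 1 + wd) / 2 := by
  obtain ⟨h0, h1, -, h3⟩ := h
  constructor
  · have := mul_le_mul_of_nonneg_right h1 (by positivity : 0 ≤ μ + 1)
    rw [mul_assoc, div_mul_cancel₀ _ (by positivity)] at this
    linarith
  · intro i
    have hci := hc i
    have := mul_le_mul_of_nonneg_right (h3 i) (by positivity : 0 ≤ (ν + (1 + c i + wd) * μ) / ν)
    have e : 1 / 2 * (ν * (1 + c i + wd) / (ν + (1 + c i + wd) * μ))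
        * ((ν + (1 + c i + wd) * μ) / ν) = (c i + 1 + wd) / 2 := by
      field_simp; ring
    rw [e] at this
    have e2 : (ν + (1 + c i + wd) * μ) / ν = 1 + μ / ν * (c i + 1 + wd) := by field_simp; ring
    rwa [e2] at this

/-- The first energy. -/
def energy₁ (ν μ wd : ℝ) (c : Fin 2 → ℝ) (u : ℝ → ℝ) : ℝ :=
  sqNorm u + μ * sqNorm (deriv u)
    + μ / ν * (((c 0 + 1 + wd) * u 0 ^ 2 + 1 / (3 * c 0) * u 0 ^ 4)
      + ((c 1 + 1 + wd) * u 1 ^ 2 + 1 / (3 * c 1) * u 1 ^ 4))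

/-- The derivative of the first energy along a trajectory. -/
def energy₁' (ν μ wd : ℝ) (c : Fin 2 → ℝ) (u ut : ℝ → ℝ) : ℝ :=
  2 * ip u ut + μ * (2 * ip (deriv u) (deriv ut))
    + μ / ν * (((c 0 + 1 + wd) * (2 * u 0 * ut 0) + 1 / (3 * c 0) * (4 * u 0 ^ 3 * ut 0))
      + ((c 1 + 1 + wd) * (2 * u 1 * ut 1) + 1 / (3 * c 1) * (4 * u 1 ^ 3 * ut 1)))

/-- The second energy. -/
def energy₂ (ν wd : ℝ) (c : Fin 2 → ℝ) (u : ℝ → ℝ) : ℝ :=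
  ν * sqNorm (deriv u)
    + (((c 0 + 1 + wd) * u 0 ^ 2 + 1 / (9 * c 0) * u 0 ^ 4)
      + ((c 1 + 1 + wd) * u 1 ^ 2 + 1 / (9 * c 1) * u 1 ^ 4))

/-- The derivative of the second energy along a trajectory. -/
def energy₂' (ν wd : ℝ) (c : Fin 2 → ℝ) (u ut : ℝ → ℝ) : ℝ :=
  ν * (2 * ip (deriv u) (deriv ut))
    + (((c 0 + 1 + wd) * (2 * u 0 * ut 0) + 1 / (9 * c 0) * (4 * u 0 ^ 3 * ut 0))
      + ((c 1 + 1 + wd) * (2 * u 1 * ut 1) + 1 / (9 * c 1) * (4 * u 1 ^ 3 * ut 1)))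

theorem H1Curve.hasPrim_energy₁ {u ut : ℝ → ℝ → ℝ} (h : H1Curve u ut) (ν μ wd : ℝ)
    (c : Fin 2 → ℝ) :
    HasPrim (fun t => energy₁ ν μ wd c (u t)) (fun t => energy₁' ν μ wd c (u t) (ut t)) := by
  have h0 := h.hasPrim (x := 0) (by simp)
  have h1 := h.hasPrim (x := 1) (by simp)
  have := (h.l2.hasPrim_sqNorm.add (h.hasPrim_sqNorm_deriv.const_mul μ)).add
    (((((h0.pow 2).const_mul (c 0 + 1 + wd)).add ((h0.pow 4).const_mul (1 / (3 * c 0)))).add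
    (((h1.pow 2).const_mul (c 1 + 1 + wd)).add ((h1.pow 4).const_mul (1 / (3 * c 1))))).const_mul
      (μ / ν))
  simpa [energy₁, energy₁'] using this

theorem H1Curve.hasPrim_energy₂ {u ut : ℝ → ℝ → ℝ} (h : H1Curve u ut) (ν wd : ℝ)
    (c : Fin 2 → ℝ) :
    HasPrim (fun t => energy₂ ν wd c (u t)) (fun t => energy₂' ν wd c (u t) (ut t)) := by
  have h0 := h.hasPrim (x := 0) (by simp)
  have h1 := h.hasPrim (x := 1) (by simp)
  have := (h.hasPrim_sqNorm_deriv.const_mul ν).add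
    ((((h0.pow 2).const_mul (c 0 + 1 + wd)).add ((h0.pow 4).const_mul (1 / (9 * c 0)))).add
    (((h1.pow 2).const_mul (c 1 + 1 + wd)).add ((h1.pow 4).const_mul (1 / (9 * c 1)))))
  simpa [energy₂, energy₂'] using this

/-- The smallest of the dissipation coefficients. -/
def dissip (ν : ℝ) (c : Fin 2 → ℝ) : ℝ := min ν (min (c 0) (c 1))

theorem dissip_pos {ν : ℝ} {c : Fin 2 → ℝ} (hν : 0 < ν) (hc : ∀ i, 0 < c i) : 0 < dissip ν c :=
  lt_min hν (lt_min (hc 0) (hc 1))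

theorem dissip_le {ν : ℝ} {c : Fin 2 → ℝ} :
    dissip ν c ≤ ν ∧ dissip ν c ≤ c 0 ∧ dissip ν c ≤ c 1 :=
  ⟨min_le_left _ _, (min_le_right _ _).trans (min_le_left _ _),
    (min_le_right _ _).trans (min_le_right _ _)⟩

theorem dissip_mul_xsq_le {ν : ℝ} {c : Fin 2 → ℝ} (f : ℝ → ℝ) :
    dissip ν c * xsq f ≤ ν * sqNorm (deriv f) + c 0 * f 0 ^ 2 + c 1 * f 1 ^ 2 := by
  obtain ⟨h1, h2, h3⟩ := dissip_le (ν := ν) (c := c)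
  have := mul_le_mul_of_nonneg_right h1 (sqNorm_nonneg (deriv f))
  have := mul_le_mul_of_nonneg_right h2 (sq_nonneg (f 0))
  have := mul_le_mul_of_nonneg_right h3 (sq_nonneg (f 1))
  rw [xsq]; linarith

/-- The weak form is tested with u. The boundary rate term 2/(3c_i) u²u_t times u is an exact
derivative, which fixes the coefficient 1/(3c_i) of the quartic part of the energy. -/
theorem energy₁'_eq {ν μ wd : ℝ} {c : Fin 2 → ℝ} {u ut : ℝ → ℝ}
    (hu : InH1 u) (h : weakForm ν μ wd c u ut u = 0) :
    energy₁' ν μ wd c u ut = -2 * (ν * sqNorm (deriv u) + (1 + wd) * ((u 1 ^ 2 - u 0 ^ 2) / 2)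
      + (u 1 ^ 3 - u 0 ^ 3) / 3 + ((c 0 + 1 + wd) * u 0 ^ 2 + 2 / (9 * c 0) * u 0 ^ 4)
      + ((c 1 + 1 + wd) * u 1 ^ 2 + 2 / (9 * c 1) * u 1 ^ 4)) := by
  rw [weakForm_eq, hu.ip_mul_deriv_self, hu.ip_deriv_self, ← sqNorm_eq_ip, ip_comm ut,
    ip_comm (deriv ut)] at h
  rw [energy₁']
  have e0 : (1 : ℝ) / (3 * c 0) = 2 / (3 * c 0) / 2 := by ring
  have e1 : (1 : ℝ) / (3 * c 1) = 2 / (3 * c 1) / 2 := by ring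
  rw [e0, e1]
  linarith

/-- The difference of the two sides is the nonnegative quantity |s|²(3m - |s|)²/(18m). With m = c_i
it lets the feedback absorb the convective boundary flux u³/3 for data of any size. -/
theorem abs_cube_le {m : ℝ} (hm : 0 < m) (s : ℝ) :
    |s| ^ 3 / 3 ≤ m / 2 * s ^ 2 + 1 / (18 * m) * s ^ 4 := by
  have e : m / 2 * s ^ 2 + 1 / (18 * m) * s ^ 4 - |s| ^ 3 / 3
      = |s| ^ 2 * (3 * m - |s|) ^ 2 / (18 * m) := by
    have h2 : s ^ 2 = |s| ^ 2 := (sq_abs s).symm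
    have h4 : s ^ 4 = |s| ^ 4 := by
      rw [show s ^ 4 = (s ^ 2) ^ 2 by ring, h2]; ring
    rw [h2, h4]
    field_simp; ring
  have : 0 ≤ |s| ^ 2 * (3 * m - |s|) ^ 2 / (18 * m) := by positivity
  linarith

/-- The cubic boundary terms are absorbed by `abs_cube_le` with m = c_i, the linear convection by
the summand 1 + w_d of the feedback. The factor 2 of the energy identity then still leaves c_i in
front of each squared end point value. -/
theorem energy₁'_le {ν μ wd : ℝ} {c : Fin 2 → ℝ} {u ut : ℝ → ℝ}
    (hν : 0 < ν) (hwd : 0 ≤ wd) (hc : ∀ i, 0 < c i) (hu : InH1 u)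
    (h : weakForm ν μ wd c u ut u = 0) :
    energy₁' ν μ wd c u ut + dissip ν c * xsq u ≤ 0 := by
  have h1 := energy₁'_eq hu h
  have h2 := dissip_mul_xsq_le (ν := ν) (c := c) u
  have a0 := abs_cube_le (hc 0) (u 0)
  have a1 := abs_cube_le (hc 1) (u 1)
  have b0 : u 0 ^ 3 ≤ |u 0| ^ 3 := by rw [← abs_pow]; exact le_abs_self _
  have b1 : -u 1 ^ 3 ≤ |u 1| ^ 3 := by rw [← abs_pow]; exact neg_le_abs _
  have hc0 := hc 0
  have hc1 := hc 1
  have n := sqNorm_nonneg (deriv u)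
  have r0 : 1 / (18 * c 0) * u 0 ^ 4 ≤ 2 / (9 * c 0) * u 0 ^ 4 := by
    refine mul_le_mul_of_nonneg_right ?_ (by positivity)
    rw [div_le_div_iff₀ (by positivity) (by positivity)]; nlinarith
  have r1 : 1 / (18 * c 1) * u 1 ^ 4 ≤ 2 / (9 * c 1) * u 1 ^ 4 := by
    refine mul_le_mul_of_nonneg_right ?_ (by positivity)
    rw [div_le_div_iff₀ (by positivity) (by positivity)]; nlinarith
  have w0 := mul_nonneg hwd (sq_nonneg (u 0))
  have w1 := mul_nonneg hwd (sq_nonneg (u 1))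
  have p0 := mul_nonneg hc0.le (sq_nonneg (u 0))
  have p1 := mul_nonneg hc1.le (sq_nonneg (u 1))
  have q0 := sq_nonneg (u 0)
  have q1 := sq_nonneg (u 1)
  have := mul_nonneg hν.le n
  rw [h1]
  nlinarith

/-- The part of the energy that carries μ bounds μ times the squared supremum of u. The resulting
gain 1/(1+μ) compensates the factor 1+μ in the time integral of |||u|||², which keeps Gronwall
exponents bounded in μ. -/
theorem energy_ge {ν μ wd : ℝ} {c : Fin 2 → ℝ} {u : ℝ → ℝ} (hν : 0 < ν) (hμ : 0 < μ)
    (hwd : 0 ≤ wd) (hc : ∀ i, 0 < c i) (hu : InH1 u) :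
    (1 + μ) * sqNorm u ≤ (1 + ν) * (sqNorm u + μ * sqNorm (deriv u)
      + μ / ν * ((c 0 + 1 + wd) * u 0 ^ 2 + (c 1 + 1 + wd) * u 1 ^ 2)) := by
  have h := mul_le_mul_of_nonneg_left hu.sqNorm_le_xsq hμ.le
  have n0 := sqNorm_nonneg u
  have n1 := sqNorm_nonneg (deriv u)
  have b : ∀ (i : Fin 2) (s : ℝ), μ * s ^ 2 ≤ ν * (μ / ν * ((c i + 1 + wd) * s ^ 2)) := by
    intro i s
    have e : ν * (μ / ν * ((c i + 1 + wd) * s ^ 2)) = μ * s ^ 2 * (c i + 1 + wd) := by field_simp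
    rw [e]
    have := hc i
    exact le_mul_of_one_le_right (by positivity) (by linarith)
  have b0 := b 0 (u 0)
  have b1 := b 1 (u 1)
  have hc0 := hc 0
  have hc1 := hc 1
  have k0 : 0 ≤ μ / ν * ((c 0 + 1 + wd) * u 0 ^ 2) := by positivity
  have k1 : 0 ≤ μ / ν * ((c 1 + 1 + wd) * u 1 ^ 2) := by positivity
  have := mul_nonneg hμ.le n1
  have := mul_nonneg hν.le n0
  have := mul_nonneg hν.le (mul_nonneg hμ.le n1)
  nlinarith

/-- The dissipation dominates the weighted quadratic energy. -/
theorem rate_mul_energy_le {ν μ wd α : ℝ} {c : Fin 2 → ℝ} {u : ℝ → ℝ} (hν : 0 < ν) (hμ : 0 < μ)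
    (hwd : 0 ≤ wd) (hc : ∀ i, 0 < c i) (hα : AdmissibleRate ν μ wd c α) (hu : InH1 u) :
    α * (sqNorm u + μ * sqNorm (deriv u)
      + μ / ν * ((c 0 + 1 + wd) * u 0 ^ 2 + (c 1 + 1 + wd) * u 1 ^ 2))
      ≤ ν / 2 * sqNorm (deriv u) + (c 0 + 1 + wd) / 2 * u 0 ^ 2 + (c 1 + 1 + wd) / 2 * u 1 ^ 2 := by
  obtain ⟨h1, h2⟩ := hα.mul_le hν hμ hwd hc
  have n1 := sqNorm_nonneg (deriv u)
  have h := mul_le_mul_of_nonneg_left hu.sqNorm_le_xsq hα.1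
  have := mul_le_mul_of_nonneg_right (h2 0) (sq_nonneg (u 0))
  have := mul_le_mul_of_nonneg_right (h2 1) (sq_nonneg (u 1))
  have := mul_le_mul_of_nonneg_right h1 n1
  have := mul_nonneg hα.1 n1
  nlinarith

/-- A variant with parameter m/4. It takes only a small share of the quadratic dissipation and moves
the rest into a s², where a will be a coefficient that is integrable in time. -/
theorem abs_cube_le_of_sq_le {m a : ℝ} (hm : 0 < m) {s : ℝ} (hs : s ^ 2 ≤ a) :
    |s| ^ 3 / 3 ≤ m / 8 * s ^ 2 + 2 / (9 * m) * (a * s ^ 2) := by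
  have h := abs_cube_le (m := m / 4) (by positivity) s
  have e : 1 / (18 * (m / 4)) * s ^ 4 = 2 / (9 * m) * (s ^ 2 * s ^ 2) := by field_simp; ring
  rw [e] at h
  have h2 : 2 / (9 * m) * (s ^ 2 * s ^ 2) ≤ 2 / (9 * m) * (a * s ^ 2) := by gcongr
  linarith

/-- With the exponential weight the quartic feedback term pays for the quartic part of the energy,
so the cubic terms cannot be absorbed by it as well. They are estimated by |||u|||² times squared
traces, and the trace inequality turns this into |||u|||²‖u‖² plus a small multiple of |||u|||².
Since |||u|||² is integrable in time, the former is admissible in Gronwall. -/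
theorem exists_energy₁'_weighted {ν wd : ℝ} {c : Fin 2 → ℝ} (hν : 0 < ν) (hwd : 0 ≤ wd)
    (hc : ∀ i, 0 < c i) (A : ℝ) (hA : 0 ≤ A) : ∃ C : ℝ, 0 < C ∧ ∀ (μ α : ℝ) (u ut : ℝ → ℝ), 0 < μ →
      AdmissibleRate ν μ wd c α → InH1 u → weakForm ν μ wd c u ut u = 0 → xsq u ≤ A →
      energy₁' ν μ wd c u ut + dissip ν c / 2 * xsq u
        ≤ (C / (1 + μ) * xsq u - 2 * α) * energy₁ ν μ wd c u := by
  obtain ⟨hmν, hm0, hm1⟩ := dissip_le (ν := ν) (c := c)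
  have m0 := dissip_pos hν hc
  have h2' := fun u => dissip_mul_xsq_le (ν := ν) (c := c) u
  generalize dissip ν c = m at *
  -- Chosen so that 2/(9m) · δ = m/16: each trace absorption then costs a sixteenth of the
  -- dissipation.
  obtain ⟨δ, hδ⟩ : ∃ δ, δ = 9 * m ^ 2 / 32 := ⟨_, rfl⟩
  have δ0 : 0 < δ := by rw [hδ]; positivity
  refine ⟨8 / (9 * m) * (1 + A / δ) * (1 + ν), by positivity, fun μ α u ut hμ hα hu h hX => ?_⟩
  have h1 := energy₁'_eq hu h
  have h2 := h2' u
  have h3 := rate_mul_energy_le hν hμ hwd hc hα hu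
  have h4 := energy_ge (μ := μ) hν hμ hwd hc hu
  have n := sqNorm_nonneg (deriv u)
  have n0 := sqNorm_nonneg u
  have x0 := xsq_nonneg u
  have s0 : u 0 ^ 2 ≤ xsq u := by rw [xsq]; nlinarith [sq_nonneg (u 1)]
  have s1 : u 1 ^ 2 ≤ xsq u := by rw [xsq]; nlinarith [sq_nonneg (u 0)]
  have a0 := abs_cube_le_of_sq_le m0 s0
  have a1 := abs_cube_le_of_sq_le m0 s1
  have t0 := hu.trace_absorb x0 δ0 (x := 0) (by simp)
  have t1 := hu.trace_absorb x0 δ0 (x := 1) (by simp)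
  have b0 : u 0 ^ 3 ≤ |u 0| ^ 3 := by rw [← abs_pow]; exact le_abs_self _
  have b1 : -u 1 ^ 3 ≤ |u 1| ^ 3 := by rw [← abs_pow]; exact neg_le_abs _
  have hc0 := hc 0
  have hc1 := hc 1
  -- quartic part of the energy
  have hαμ : α * (μ / ν) ≤ 1 / 2 := by
    have := (hα.mul_le hν hμ hwd hc).1
    rw [mul_div_assoc', div_le_iff₀ hν]
    nlinarith [hα.1]
  have q : ∀ i (s : ℝ), α * (μ / ν * (1 / (3 * c i) * s ^ 4)) ≤ 2 / (9 * c i) * s ^ 4 := by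
    intro i s
    have hci := hc i
    have e : α * (μ / ν * (1 / (3 * c i) * s ^ 4)) = α * (μ / ν) * (1 / (3 * c i) * s ^ 4) := by ring
    rw [e]
    have e2 : 2 / (9 * c i) * s ^ 4 = 2 / 3 * (1 / (3 * c i) * s ^ 4) := by field_simp; ring
    rw [e2]
    exact mul_le_mul_of_nonneg_right (by linarith) (by positivity)
  have q0 := q 0 (u 0)
  have q1 := q 1 (u 1)
  have hE : sqNorm u + μ * sqNorm (deriv u)
      + μ / ν * ((c 0 + 1 + wd) * u 0 ^ 2 + (c 1 + 1 + wd) * u 1 ^ 2) ≤ energy₁ ν μ wd c u := by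
    rw [energy₁]
    have k0 : 0 ≤ μ / ν * (1 / (3 * c 0) * u 0 ^ 4) := by positivity
    have k1 : 0 ≤ μ / ν * (1 / (3 * c 1) * u 1 ^ 4) := by positivity
    linarith
  have hn0 : sqNorm u ≤ (1 + ν) / (1 + μ) * energy₁ ν μ wd c u := by
    rw [div_mul_eq_mul_div, le_div_iff₀ (by positivity)]
    have := mul_le_mul_of_nonneg_left hE (by positivity : 0 ≤ 1 + ν)
    linarith
  have hx2 : xsq u + xsq u ^ 2 / δ ≤ (1 + A / δ) * xsq u := by
    have : xsq u ^ 2 / δ ≤ A / δ * xsq u := by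
      rw [div_mul_eq_mul_div]
      refine div_le_div_of_nonneg_right ?_ δ0.le
      rw [sq]
      exact mul_le_mul_of_nonneg_right hX x0
    linarith
  have key : 2 / (9 * m) * ((xsq u + xsq u ^ 2 / δ) * sqNorm u)
      ≤ 2 / (9 * m) * ((1 + A / δ) * xsq u * ((1 + ν) / (1 + μ) * energy₁ ν μ wd c u)) := by
    gcongr
  have ex : 2 / (9 * m) * (δ * xsq u) = m / 16 * xsq u := by rw [hδ]; field_simp; ring
  have g0 := mul_le_mul_of_nonneg_left t0 (by positivity : 0 ≤ 2 / (9 * m))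
  have g1 := mul_le_mul_of_nonneg_left t1 (by positivity : 0 ≤ 2 / (9 * m))
  rw [mul_add, ex] at g0 g1
  have hCe : 8 / (9 * m) * (1 + A / δ) * (1 + ν) / (1 + μ) * xsq u * energy₁ ν μ wd c u
      = 4 * (2 / (9 * m) * ((1 + A / δ) * xsq u * ((1 + ν) / (1 + μ) * energy₁ ν μ wd c u))) := by
    ring
  have hen : α * energy₁ ν μ wd c u = α * (sqNorm u + μ * sqNorm (deriv u)
      + μ / ν * ((c 0 + 1 + wd) * u 0 ^ 2 + (c 1 + 1 + wd) * u 1 ^ 2))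
      + α * (μ / ν * (1 / (3 * c 0) * u 0 ^ 4)) + α * (μ / ν * (1 / (3 * c 1) * u 1 ^ 4)) := by
    rw [energy₁]; ring
  rw [sub_mul, hCe, mul_assoc 2 α, hen, h1]
  have w1 := mul_nonneg hwd (sq_nonneg (u 1))
  have z0 := sq_nonneg (u 0)
  have z1 := sq_nonneg (u 1)
  have hxe : m * (u 0 ^ 2 + u 1 ^ 2) ≤ m * xsq u := by
    refine mul_le_mul_of_nonneg_left ?_ m0.le
    rw [xsq]; linarith
  linarith

/-- The dissipation in the estimate of the time derivative. -/
def rate₂ (μ : ℝ) (f : ℝ → ℝ) : ℝ := sqNorm f + μ * xsq f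

theorem rate₂_ge {μ : ℝ} (hμ : 0 < μ) {f : ℝ → ℝ} (hf : InH1 f) :
    (1 + μ) * sqNorm f ≤ rate₂ μ f := by
  have h := mul_le_mul_of_nonneg_left hf.sqNorm_le_xsq hμ.le
  have n1 := mul_nonneg hμ.le (sqNorm_nonneg (deriv f))
  rw [rate₂, xsq]; nlinarith

theorem rate₂_nonneg {μ : ℝ} (hμ : 0 < μ) (f : ℝ → ℝ) : 0 ≤ rate₂ μ f := by
  have := sqNorm_nonneg f
  have := xsq_nonneg f
  rw [rate₂]; positivity

/-- The coercivity constant of the principal part in the estimate of the time derivative. -/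
def coer (ν : ℝ) : ℝ := min 1 (1 / ν)

theorem coer_pos {ν : ℝ} (hν : 0 < ν) : 0 < coer ν := lt_min one_pos (by positivity)

theorem coer_mul_rate₂_le {ν μ wd : ℝ} {c : Fin 2 → ℝ} (hν : 0 < ν) (hμ : 0 < μ) (hwd : 0 ≤ wd)
    (hc : ∀ i, 0 < c i) (f : ℝ → ℝ) :
    coer ν * rate₂ μ f ≤ sqNorm f + μ * sqNorm (deriv f)
      + μ / ν * ((c 0 + 1 + wd) * f 0 ^ 2 + (c 1 + 1 + wd) * f 1 ^ 2) := by
  have n0 := sqNorm_nonneg f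
  have n1 := mul_nonneg hμ.le (sqNorm_nonneg (deriv f))
  have k1 : coer ν ≤ 1 := min_le_left _ _
  have k2 : coer ν ≤ 1 / ν := min_le_right _ _
  have b : ∀ i (s : ℝ), coer ν * (μ * s ^ 2) ≤ μ / ν * ((c i + 1 + wd) * s ^ 2) := by
    intro i s
    have hci := hc i
    calc coer ν * (μ * s ^ 2) ≤ 1 / ν * (μ * s ^ 2) := by gcongr
      _ = μ / ν * (1 * s ^ 2) := by ring
      _ ≤ μ / ν * ((c i + 1 + wd) * s ^ 2) := by gcongr; linarith
  have b0 := b 0 (f 0)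
  have b1 := b 1 (f 1)
  rw [rate₂, xsq]
  nlinarith

theorem abs_mul_le_young {k a b : ℝ} (hk : 0 < k) : |a * b| ≤ k / 2 * a ^ 2 + 1 / (2 * k) * b ^ 2 := by
  have e : k / 2 * a ^ 2 + 1 / (2 * k) * b ^ 2 - |a| * |b| = (k * |a| - |b|) ^ 2 / (2 * k) := by
    rw [← sq_abs a, ← sq_abs b]; field_simp; ring
  have : 0 ≤ (k * |a| - |b|) ^ 2 / (2 * k) := by positivity
  rw [abs_mul]; linarith

theorem abs_ip_le_young {f g : ℝ → ℝ} (hf : InL2 f) (hg : InL2 g) {k : ℝ} (hk : 0 < k) :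
    |ip f g| ≤ k / 2 * sqNorm f + 1 / (2 * k) * sqNorm g := by
  have h := abs_mul_le_young (a := √(sqNorm f)) (b := √(sqNorm g)) hk
  rw [Real.sq_sqrt (sqNorm_nonneg f), Real.sq_sqrt (sqNorm_nonneg g)] at h
  exact (abs_ip_le hf hg).trans ((le_abs_self _).trans h)

/-- The weak form is tested with u_t. The viscous term and the feedback terms are exact derivatives,
the quartic boundary rate terms have a good sign, and only the convection has to be estimated. Its
factor u_t is measured by ‖u_t‖², of which (1+μ) copies are available by `rate₂_ge`. -/
theorem energy₂'_le {ν μ wd : ℝ} {c : Fin 2 → ℝ} {u ut : ℝ → ℝ}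
    (hν : 0 < ν) (hμ : 0 < μ) (hwd : 0 ≤ wd) (hc : ∀ i, 0 < c i) (hu : InH1 u) (hut : InH1 ut)
    (h : weakForm ν μ wd c u ut ut = 0) :
    energy₂' ν wd c u ut + coer ν * rate₂ μ ut
      ≤ 2 * (1 + wd) ^ 2 / coer ν / (1 + μ) * ((1 + xsq u) * xsq u) := by
  have k0 := coer_pos hν
  have hk := coer_mul_rate₂_le hν hμ hwd hc ut
  have hX0 := xsq_nonneg u
  have hcont : ContinuousOn (fun x => 1 + wd + u x) (Icc 0 1) :=
    continuousOn_const.add hu.continuousOn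
  have hg : InL2 (fun x => (1 + wd + u x) * deriv u x) := InL2.bdd_mul hcont hu.2
  have hsup : ∀ x ∈ Icc (0 : ℝ) 1, (1 + wd + u x) ^ 2 ≤ 2 * (1 + wd) ^ 2 * (1 + xsq u) := by
    intro x hx
    have h1 := hu.sq_le_xsq hx
    have h2 : u x ^ 2 ≤ xsq u := h1.trans (by
      rw [xsq]; linarith [sqNorm_nonneg (deriv u)])
    have h3 : 1 ≤ (1 + wd) ^ 2 := by nlinarith
    nlinarith [sq_nonneg (1 + wd - u x)]
  have hn : sqNorm (fun x => (1 + wd + u x) * deriv u x)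
      ≤ 2 * (1 + wd) ^ 2 * (1 + xsq u) * xsq u := by
    refine (sqNorm_mul_le hcont hu.deriv_inL2 hsup).trans ?_
    have : sqNorm (deriv u) ≤ xsq u := by rw [xsq]; nlinarith [sq_nonneg (u 0), sq_nonneg (u 1)]
    gcongr
  have hconv : (1 + wd) * ip (deriv u) ut + ip (fun x => u x * deriv u x) ut
      = ip (fun x => (1 + wd + u x) * deriv u x) ut := by
    rw [← ip_const_mul_left, ← ip_add_left (hu.deriv_inL2.const_mul _)
      (InL2.bdd_mul hu.continuousOn hu.2) hut.inL2]
    simp only [ip, add_mul]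
  have hy := abs_ip_le_young hut.inL2 hg (k := coer ν * (1 + μ)) (by positivity)
  rw [ip_comm, abs_le] at hy
  have hr := rate₂_ge hμ hut
  have hkr := mul_le_mul_of_nonneg_left hr k0.le
  have hq : 1 / (2 * (coer ν * (1 + μ))) * sqNorm (fun x => (1 + wd + u x) * deriv u x)
      ≤ 1 / (2 * (coer ν * (1 + μ))) * (2 * (1 + wd) ^ 2 * (1 + xsq u) * xsq u) := by gcongr
  have he : 1 / (2 * (coer ν * (1 + μ))) * (2 * (1 + wd) ^ 2 * (1 + xsq u) * xsq u)
      = (2 * (1 + wd) ^ 2 / coer ν / (1 + μ) * ((1 + xsq u) * xsq u)) / 2 := by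
    field_simp
  rw [weakForm_eq, ← sqNorm_eq_ip, ← sqNorm_eq_ip] at h
  have hc0 := hc 0
  have hc1 := hc 1
  have z0 : 0 ≤ μ / ν * (2 / (3 * c 0) * u 0 ^ 2 * ut 0 ^ 2) := by positivity
  have z1 : 0 ≤ μ / ν * (2 / (3 * c 1) * u 1 ^ 2 * ut 1 ^ 2) := by positivity
  have e0 : (1 : ℝ) / (9 * c 0) = 2 / (9 * c 0) / 2 := by ring
  have e1 : (1 : ℝ) / (9 * c 1) = 2 / (9 * c 1) / 2 := by ring
  rw [energy₂', e0, e1]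
  nlinarith [hy.1]

/-! ### A priori bounds for trajectories, with and without exponential weight. -/

/-- An `H¹` curve that satisfies the two energy identities of the closed-loop problem. -/
structure IsTrajectory (ν μ wd : ℝ) (c : Fin 2 → ℝ) (u ut : ℝ → ℝ → ℝ) : Prop where
  curve : H1Curve u ut
  self : ∀ᵐ t ∂volume.restrict (Ioi (0 : ℝ)), weakForm ν μ wd c (u t) (ut t) (u t) = 0
  rate : ∀ᵐ t ∂volume.restrict (Ioi (0 : ℝ)), weakForm ν μ wd c (u t) (ut t) (ut t) = 0

theorem sq_zero_le_xsq (f : ℝ → ℝ) : f 0 ^ 2 ≤ xsq f := by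
  rw [xsq]; nlinarith [sq_nonneg (f 1), sqNorm_nonneg (deriv f)]

theorem sq_one_le_xsq (f : ℝ → ℝ) : f 1 ^ 2 ≤ xsq f := by
  rw [xsq]; nlinarith [sq_nonneg (f 0), sqNorm_nonneg (deriv f)]

theorem sqNorm_deriv_le_xsq (f : ℝ → ℝ) : sqNorm (deriv f) ≤ xsq f := by
  rw [xsq]; nlinarith [sq_nonneg (f 0), sq_nonneg (f 1)]

theorem InH1.sqNorm_le_xsq' {f : ℝ → ℝ} (hf : InH1 f) : sqNorm f ≤ xsq f :=
  hf.sqNorm_le_xsq.trans (by rw [xsq]; linarith [sqNorm_nonneg (deriv f)])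

theorem InH1.sq_le_xsq' {f : ℝ → ℝ} (hf : InH1 f) {x : ℝ} (hx : x ∈ Icc (0 : ℝ) 1) :
    f x ^ 2 ≤ xsq f :=
  (hf.sq_le_xsq hx).trans (by rw [xsq]; linarith [sqNorm_nonneg (deriv f)])

/-- A bound of the coefficients in both energies. -/
def coeffSum (ν wd : ℝ) (c : Fin 2 → ℝ) : ℝ :=
  1 + ν + (1 + 1 / ν) * (((c 0 + 1 + wd) + 1 / (3 * c 0)) + ((c 1 + 1 + wd) + 1 / (3 * c 1)))

theorem coeffSum_pos {ν wd : ℝ} {c : Fin 2 → ℝ} (hν : 0 < ν) (hwd : 0 ≤ wd) (hc : ∀ i, 0 < c i) :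
    0 < coeffSum ν wd c := by
  have := hc 0
  have := hc 1
  rw [coeffSum]; positivity

theorem quartic_le {K k s X : ℝ} (hK : 0 ≤ K) (hk : 0 ≤ k) (hs : s ^ 2 ≤ X) :
    K * s ^ 2 + k * s ^ 4 ≤ (K + k) * ((1 + X) * X) := by
  have hX : 0 ≤ X := (sq_nonneg s).trans hs
  have h1 : s ^ 2 ≤ (1 + X) * X := hs.trans (by nlinarith)
  have h2 : s ^ 4 ≤ (1 + X) * X := by
    have : s ^ 4 ≤ X ^ 2 := by
      have := pow_le_pow_left₀ (sq_nonneg s) hs 2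
      calc s ^ 4 = (s ^ 2) ^ 2 := by ring
        _ ≤ _ := this
    nlinarith
  nlinarith [mul_le_mul_of_nonneg_left h1 hK, mul_le_mul_of_nonneg_left h2 hk]

theorem energy₁_le {ν μ wd : ℝ} {c : Fin 2 → ℝ} (hν : 0 < ν) (hμ : 0 < μ) (hwd : 0 ≤ wd)
    (hc : ∀ i, 0 < c i) {u : ℝ → ℝ} (hu : InH1 u) :
    energy₁ ν μ wd c u ≤ coeffSum ν wd c * (1 + μ) * ((1 + xsq u) * xsq u) := by
  have hc0 := hc 0
  have hc1 := hc 1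
  have q0 := quartic_le (K := c 0 + 1 + wd) (k := 1 / (3 * c 0)) (by positivity) (by positivity)
    (sq_zero_le_xsq u)
  have q1 := quartic_le (K := c 1 + 1 + wd) (k := 1 / (3 * c 1)) (by positivity) (by positivity)
    (sq_one_le_xsq u)
  have n0 := hu.sqNorm_le_xsq'
  have n1 := mul_le_mul_of_nonneg_left (sqNorm_deriv_le_xsq u) hμ.le
  have X0 := xsq_nonneg u
  rw [energy₁, coeffSum]
  set S := ((c 0 + 1 + wd) + 1 / (3 * c 0)) + ((c 1 + 1 + wd) + 1 / (3 * c 1)) with hS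
  have S0 : 0 ≤ S := by positivity
  have h1 : xsq u ≤ (1 + xsq u) * xsq u := by nlinarith
  set Y := (1 + xsq u) * xsq u with hY
  have Y0 : 0 ≤ Y := X0.trans h1
  have h3 : μ / ν * (((c 0 + 1 + wd) * u 0 ^ 2 + 1 / (3 * c 0) * u 0 ^ 4)
      + ((c 1 + 1 + wd) * u 1 ^ 2 + 1 / (3 * c 1) * u 1 ^ 4)) ≤ μ / ν * (S * Y) := by
    gcongr
    rw [hS]; linarith
  have h4 : μ / ν * (S * Y) ≤ (1 + μ) * ((1 + 1 / ν) * (S * Y)) := by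
    have : μ / ν ≤ (1 + μ) * (1 + 1 / ν) := by
      have : (1 + μ) * (1 + 1 / ν) - μ / ν = 1 + μ + 1 / ν := by field_simp; ring
      have : 0 < 1 / ν := by positivity
      linarith
    rw [← mul_assoc (1 + μ)]
    gcongr
  have h5 := mul_le_mul_of_nonneg_left h1 hμ.le
  have h6 : 0 ≤ ν * ((1 + μ) * Y) := by positivity
  nlinarith

theorem energy₂_le {ν wd : ℝ} {c : Fin 2 → ℝ} (hν : 0 < ν) (hwd : 0 ≤ wd)
    (hc : ∀ i, 0 < c i) (u : ℝ → ℝ) :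
    energy₂ ν wd c u ≤ coeffSum ν wd c * ((1 + xsq u) * xsq u) := by
  have hc0 := hc 0
  have hc1 := hc 1
  have q0 := quartic_le (K := c 0 + 1 + wd) (k := 1 / (9 * c 0)) (by positivity) (by positivity)
    (sq_zero_le_xsq u)
  have q1 := quartic_le (K := c 1 + 1 + wd) (k := 1 / (9 * c 1)) (by positivity) (by positivity)
    (sq_one_le_xsq u)
  have X0 := xsq_nonneg u
  have n1 := mul_le_mul_of_nonneg_left (sqNorm_deriv_le_xsq u) hν.le
  have h1 : xsq u ≤ (1 + xsq u) * xsq u := by nlinarith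
  have hcs : ν + (((c 0 + 1 + wd) + 1 / (9 * c 0)) + ((c 1 + 1 + wd) + 1 / (9 * c 1)))
      ≤ coeffSum ν wd c := by
    rw [coeffSum]
    have k0 : 1 / (9 * c 0) ≤ 1 / (3 * c 0) := by gcongr; norm_num
    have k1 : 1 / (9 * c 1) ≤ 1 / (3 * c 1) := by gcongr; norm_num
    have : 0 ≤ 1 / ν * (((c 0 + 1 + wd) + 1 / (3 * c 0)) + ((c 1 + 1 + wd) + 1 / (3 * c 1))) := by
      positivity
    linarith
  have h2 := mul_le_mul_of_nonneg_right hcs (X0.trans h1)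
  have h3 := mul_le_mul_of_nonneg_left h1 hν.le
  rw [energy₂]
  linarith

theorem energy₂_ge {ν wd : ℝ} {c : Fin 2 → ℝ} (hwd : 0 ≤ wd)
    (hc : ∀ i, 0 < c i) (u : ℝ → ℝ) : dissip ν c * xsq u ≤ energy₂ ν wd c u := by
  have h := dissip_mul_xsq_le (ν := ν) (c := c) u
  have hc0 := hc 0
  have hc1 := hc 1
  have a0 : 0 ≤ (1 + wd) * u 0 ^ 2 + 1 / (9 * c 0) * u 0 ^ 4 := by positivity
  have a1 : 0 ≤ (1 + wd) * u 1 ^ 2 + 1 / (9 * c 1) * u 1 ^ 4 := by positivity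
  rw [energy₂]
  linarith

theorem energy₁_nonneg {ν μ wd : ℝ} {c : Fin 2 → ℝ} (hν : 0 < ν) (hμ : 0 < μ) (hwd : 0 ≤ wd)
    (hc : ∀ i, 0 < c i) (u : ℝ → ℝ) : 0 ≤ energy₁ ν μ wd c u := by
  have := hc 0
  have := hc 1
  have := sqNorm_nonneg u
  have := sqNorm_nonneg (deriv u)
  rw [energy₁]; positivity

theorem H1Curve.intervalIntegrable_xsq_self {u ut : ℝ → ℝ → ℝ} (h : H1Curve u ut) :
    ∀ T, 0 ≤ T → IntervalIntegrable (fun s => xsq (u s)) volume 0 T := fun T hT =>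
  ContinuousOn.intervalIntegrable (by simpa [uIcc_of_le hT] using h.continuousOn_xsq hT)

theorem H1Curve.intervalIntegrable_rate₂ {u ut : ℝ → ℝ → ℝ} (h : H1Curve u ut) (μ : ℝ) :
    ∀ T, 0 ≤ T → IntervalIntegrable (fun s => rate₂ μ (ut s)) volume 0 T := fun T hT =>
  (intervalIntegrable_sqNorm h.mem T hT).add ((h.intervalIntegrable_xsq T hT).const_mul μ)

theorem intervalIntegrable_exp_mul {f : ℝ → ℝ} (α : ℝ)
    (h : ∀ T, 0 ≤ T → IntervalIntegrable f volume 0 T) :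
    ∀ T, 0 ≤ T → IntervalIntegrable (fun s => Real.exp (2 * α * s) * f s) volume 0 T :=
  fun T hT => (h T hT).continuousOn_mul (Continuous.continuousOn (by fun_prop))

theorem integral_xsq_le {ν μ wd : ℝ} {c : Fin 2 → ℝ} (hν : 0 < ν) (hμ : 0 < μ)
    (hwd : 0 ≤ wd) (hc : ∀ i, 0 < c i) {u ut : ℝ → ℝ → ℝ} (h : IsTrajectory ν μ wd c u ut)
    {t : ℝ} (ht : 0 ≤ t) :
    dissip ν c * ∫ s in (0 : ℝ)..t, xsq (u s)
      ≤ coeffSum ν wd c * (1 + μ) * ((1 + xsq (u 0)) * xsq (u 0)) := by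
  have m0 := dissip_pos hν hc
  have g := gronwall (α := 0) (γ := fun _ => 0) (f := fun _ => 0)
    (d := fun s => dissip ν c * xsq (u s)) (h.curve.hasPrim_energy₁ ν μ wd c) (by simp)
    (fun T hT => (h.curve.intervalIntegrable_xsq_self T hT).const_mul _) (by simp) (by simp)
    (fun s => mul_nonneg m0.le (xsq_nonneg _)) (by simp) (by
      filter_upwards [h.self, ae_restrict_mem measurableSet_Ioi] with s hs hs0
      simpa using energy₁'_le hν hwd hc (h.curve.h1 s (le_of_lt hs0)) hs) ht
  simp only [mul_zero, zero_mul, Real.exp_zero, one_mul, intervalIntegral.integral_zero, mul_one,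
    add_zero, intervalIntegral.integral_const_mul] at g
  have e := energy₁_le hν hμ hwd hc (h.curve.h1 0 le_rfl)
  linarith [energy₁_nonneg hν hμ hwd hc (u t)]

/-- The first energy bounds the time integral of |||u|||² by a multiple of 1+μ. In the second energy
inequality this integral is the Gronwall exponent, with a coefficient proportional to 1/(1+μ), so
the resulting bound does not depend on μ. -/
theorem exists_trajectory_bound {ν wd : ℝ} {c : Fin 2 → ℝ} (hν : 0 < ν) (hwd : 0 ≤ wd)
    (hc : ∀ i, 0 < c i) (A₀ : ℝ) (hA₀ : 0 ≤ A₀) : ∃ A : ℝ, 0 < A ∧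
    ∀ (μ : ℝ) (u ut : ℝ → ℝ → ℝ), 0 < μ → IsTrajectory ν μ wd c u ut → xsq (u 0) ≤ A₀ →
      (∀ t, 0 ≤ t → xsq (u t) ≤ A) ∧
      (∀ t, 0 ≤ t → ∫ s in (0 : ℝ)..t, xsq (u s) ≤ A * (1 + μ)) ∧
      (∀ t, 0 ≤ t → μ * ∫ s in (0 : ℝ)..t, xsq (ut s) ≤ A) := by
  have m0 := dissip_pos hν hc
  have k0 := coer_pos hν
  have L0 := coeffSum_pos hν hwd hc
  set m := dissip ν c with hm
  set k := coer ν with hk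
  set L := coeffSum ν wd c with hL
  set G := 2 * (1 + wd) ^ 2 / k * (1 + 1 / m) with hG
  have G0 : 0 < G := by positivity
  set B := L * ((1 + A₀) * A₀) with hB
  have B0 : 0 ≤ B := by positivity
  set E := (1 + B) * Real.exp (G * (B / m)) with hE
  have E0 : 0 < E := by positivity
  refine ⟨E / m + B / m + E / k, by positivity, fun μ u ut hμ h hX => ?_⟩
  have hB' : L * ((1 + xsq (u 0)) * xsq (u 0)) ≤ B := by
    have := xsq_nonneg (u 0)
    rw [hB]; gcongr
  have hI : ∀ t, 0 ≤ t → ∫ s in (0 : ℝ)..t, xsq (u s) ≤ B / m * (1 + μ) := by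
    intro t ht
    have := integral_xsq_le hν hμ hwd hc h ht
    rw [← hm, ← hL] at this
    rw [div_mul_eq_mul_div, le_div_iff₀ m0]
    have := mul_le_mul_of_nonneg_left hB' (by positivity : 0 ≤ 1 + μ)
    linarith
  have hg : ∀ t, 0 ≤ t → energy₂ ν wd c (u t) + k * ∫ s in (0 : ℝ)..t, rate₂ μ (ut s) ≤ E := by
    intro t ht
    have g := gronwall (α := 0) (γ := fun s => G / (1 + μ) * xsq (u s)) (f := fun _ => 0)
      (d := fun s => k * rate₂ μ (ut s))
      -- The constant 1 is added so that (1 + |||u|||²)|||u|||² is at most a multiple of |||u|||²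
      -- times the unknown, which makes the quadratic inequality linear.
      ((HasPrim.const 1).add (h.curve.hasPrim_energy₂ ν wd c))
      (fun T hT => (h.curve.intervalIntegrable_xsq_self T hT).const_mul _)
      (fun T hT => (h.curve.intervalIntegrable_rate₂ μ T hT).const_mul _) (by simp)
      (fun s => mul_nonneg (by positivity) (xsq_nonneg _))
      (fun s => mul_nonneg k0.le (rate₂_nonneg hμ _)) (by simp) (by
        filter_upwards [h.rate, ae_restrict_mem measurableSet_Ioi, h.curve.h1t] with s hs hs0 hs1
        have h1 := energy₂'_le hν hμ hwd hc (h.curve.h1 s (le_of_lt hs0)) hs1 hs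
        have h2 := energy₂_ge (ν := ν) hwd hc (u s)
        rw [← hm] at h2
        have x0 := xsq_nonneg (u s)
        have h3 : 1 + xsq (u s) ≤ (1 + 1 / m) * (1 + energy₂ ν wd c (u s)) := by
          have e : xsq (u s) ≤ 1 / m * energy₂ ν wd c (u s) := by
            rw [one_div, inv_mul_eq_div, le_div_iff₀ m0]; linarith
          have : 0 ≤ energy₂ ν wd c (u s) := (mul_nonneg m0.le x0).trans h2
          have : 0 < 1 / m := by positivity
          linarith
        have h4 : 2 * (1 + wd) ^ 2 / k / (1 + μ) * ((1 + xsq (u s)) * xsq (u s))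
            ≤ 2 * (1 + wd) ^ 2 / k / (1 + μ) *
              ((1 + 1 / m) * (1 + energy₂ ν wd c (u s)) * xsq (u s)) := by gcongr
        have e : 2 * (1 + wd) ^ 2 / k / (1 + μ) *
              ((1 + 1 / m) * (1 + energy₂ ν wd c (u s)) * xsq (u s))
            = (G / (1 + μ) * xsq (u s) - 2 * 0) * (1 + energy₂ ν wd c (u s)) + 0 := by
          rw [hG]; ring
        rw [zero_add, ← e]
        exact h1.trans h4) ht
    simp only [mul_zero, zero_mul, Real.exp_zero, one_mul, intervalIntegral.integral_zero,
      add_zero, intervalIntegral.integral_const_mul] at g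
    have e0 := (energy₂_le hν hwd hc (u 0)).trans hB'
    have e1 : G / (1 + μ) * ∫ s in (0 : ℝ)..t, xsq (u s) ≤ G * (B / m) := by
      calc G / (1 + μ) * ∫ s in (0 : ℝ)..t, xsq (u s) ≤ G / (1 + μ) * (B / m * (1 + μ)) := by
            gcongr; exact hI t ht
        _ = _ := by field_simp
    have e2 : (1 + energy₂ ν wd c (u 0)) * Real.exp (G / (1 + μ) * ∫ s in (0 : ℝ)..t, xsq (u s))
        ≤ E := by
      rw [hE]
      have : 0 ≤ energy₂ ν wd c (u 0) :=
        (mul_nonneg m0.le (xsq_nonneg _)).trans (energy₂_ge hwd hc _)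
      gcongr
    linarith
  have hR : ∀ t, 0 ≤ t → 0 ≤ ∫ s in (0 : ℝ)..t, rate₂ μ (ut s) := fun t ht =>
    intervalIntegral.integral_nonneg ht fun s _ => rate₂_nonneg hμ _
  refine ⟨fun t ht => ?_, fun t ht => ?_, fun t ht => ?_⟩
  · have h2 := energy₂_ge (ν := ν) hwd hc (u t)
    rw [← hm] at h2
    have : xsq (u t) ≤ E / m := by
      rw [le_div_iff₀ m0]
      linarith [hg t ht, mul_nonneg k0.le (hR t ht)]
    have : 0 < E / k := by positivity
    have : 0 ≤ B / m := by positivity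
    linarith
  · refine (hI t ht).trans ?_
    gcongr
    have : 0 < E / k := by positivity
    have : 0 < E / m := by positivity
    linarith
  · have h2 : 0 ≤ energy₂ ν wd c (u t) :=
      (mul_nonneg m0.le (xsq_nonneg _)).trans (energy₂_ge hwd hc _)
    have h3 : μ * ∫ s in (0 : ℝ)..t, xsq (ut s) ≤ ∫ s in (0 : ℝ)..t, rate₂ μ (ut s) := by
      rw [← intervalIntegral.integral_const_mul]
      refine intervalIntegral.integral_mono_on ht ((h.curve.intervalIntegrable_xsq t ht).const_mul _)
        (h.curve.intervalIntegrable_rate₂ μ t ht) fun s _ => ?_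
      rw [rate₂]; linarith [sqNorm_nonneg (ut s)]
    have : ∫ s in (0 : ℝ)..t, rate₂ μ (ut s) ≤ E / k := by
      rw [le_div_iff₀ k0]; linarith [hg t ht]
    have : 0 < E / m := by positivity
    have : 0 ≤ B / m := by positivity
    linarith

/-- The unweighted bounds freeze the nonlinear coefficients, and the estimates become linear in
|||u(0)|||². The weighted integral of |||u|||² obtained from the first energy then serves as source
for the second one. -/
theorem exists_trajectory_weighted_bound {ν wd : ℝ} {c : Fin 2 → ℝ} (hν : 0 < ν) (hwd : 0 ≤ wd)
    (hc : ∀ i, 0 < c i) (A₀ : ℝ) (hA₀ : 0 ≤ A₀) : ∃ A : ℝ, 0 < A ∧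
    ∀ (μ α : ℝ) (u ut : ℝ → ℝ → ℝ), 0 < μ → AdmissibleRate ν μ wd c α →
      IsTrajectory ν μ wd c u ut → xsq (u 0) ≤ A₀ →
      (∀ t, 0 ≤ t → ∫ s in (0 : ℝ)..t, Real.exp (2 * α * s) * xsq (u s)
        ≤ A * (1 + μ) * xsq (u 0)) ∧
      (∀ t, 0 ≤ t → ∫ s in (0 : ℝ)..t, Real.exp (2 * α * s) * rate₂ μ (ut s)
        ≤ A * xsq (u 0)) := by
  obtain ⟨A, hA, HA⟩ := exists_trajectory_bound hν hwd hc A₀ hA₀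
  obtain ⟨C, hC, HC⟩ := exists_energy₁'_weighted hν hwd hc A hA.le
  have m0 := dissip_pos hν hc
  have k0 := coer_pos hν
  have L0 := coeffSum_pos hν hwd hc
  set m := dissip ν c with hm
  set k := coer ν with hk
  set L := coeffSum ν wd c with hL
  set P := 2 / m * (L * (1 + A₀) * Real.exp (C * A)) with hP
  have P0 : 0 < P := by positivity
  set F := ν * L * (1 + A) + 2 * (1 + wd) ^ 2 / k * (1 + A) with hF
  have F0 : 0 < F := by positivity
  refine ⟨P + (L * (1 + A₀) + F * P) / k, by positivity, fun μ α u ut hμ hα h hX => ?_⟩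
  obtain ⟨b1, b2, -⟩ := HA μ u ut hμ h hX
  have x0 := xsq_nonneg (u 0)
  have hI : ∀ t, 0 ≤ t → ∫ s in (0 : ℝ)..t, Real.exp (2 * α * s) * xsq (u s)
      ≤ P * (1 + μ) * xsq (u 0) := by
    intro t ht
    have g := gronwall (α := α) (γ := fun s => C / (1 + μ) * xsq (u s)) (f := fun _ => 0)
      (d := fun s => m / 2 * xsq (u s)) (h.curve.hasPrim_energy₁ ν μ wd c)
      (fun T hT => (h.curve.intervalIntegrable_xsq_self T hT).const_mul _)
      (fun T hT => (h.curve.intervalIntegrable_xsq_self T hT).const_mul _) (by simp)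
      (fun s => mul_nonneg (by positivity) (xsq_nonneg _))
      (fun s => mul_nonneg (by positivity) (xsq_nonneg _)) (by simp) (by
        filter_upwards [h.self, ae_restrict_mem measurableSet_Ioi] with s hs hs0
        rw [add_zero]
        exact HC μ α _ _ hμ hα (h.curve.h1 s (le_of_lt hs0)) hs (b1 s (le_of_lt hs0))) ht
    simp only [mul_zero, intervalIntegral.integral_zero, add_zero,
      intervalIntegral.integral_const_mul, mul_left_comm _ (m / 2)] at g
    have e0 := energy₁_le hν hμ hwd hc (h.curve.h1 0 le_rfl)
    rw [← hL] at e0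
    have e1 : C / (1 + μ) * ∫ s in (0 : ℝ)..t, xsq (u s) ≤ C * A := by
      calc C / (1 + μ) * ∫ s in (0 : ℝ)..t, xsq (u s) ≤ C / (1 + μ) * (A * (1 + μ)) := by
            gcongr; exact b2 t ht
        _ = _ := by field_simp
    have e2 : energy₁ ν μ wd c (u 0) * Real.exp (C / (1 + μ) * ∫ s in (0 : ℝ)..t, xsq (u s))
        ≤ L * (1 + μ) * ((1 + A₀) * xsq (u 0)) * Real.exp (C * A) := by
      have := energy₁_nonneg hν hμ hwd hc (u 0)
      have : energy₁ ν μ wd c (u 0) ≤ L * (1 + μ) * ((1 + A₀) * xsq (u 0)) := by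
        refine e0.trans ?_
        gcongr
      gcongr
    have e3 := mul_nonneg (Real.exp_pos (2 * α * t)).le (energy₁_nonneg hν hμ hwd hc (u t))
    have e4 : m / 2 * ∫ s in (0 : ℝ)..t, Real.exp (2 * α * s) * xsq (u s)
        ≤ L * (1 + μ) * ((1 + A₀) * xsq (u 0)) * Real.exp (C * A) := by linarith
    have e5 := mul_le_mul_of_nonneg_left e4 (by positivity : 0 ≤ 2 / m)
    have e6 : 2 / m * (m / 2 * ∫ s in (0 : ℝ)..t, Real.exp (2 * α * s) * xsq (u s))
        = ∫ s in (0 : ℝ)..t, Real.exp (2 * α * s) * xsq (u s) := by field_simp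
    rw [e6] at e5
    refine e5.trans (le_of_eq ?_)
    rw [hP]; ring
  refine ⟨fun t ht => (hI t ht).trans ?_, fun t ht => ?_⟩
  · have : 0 ≤ (L * (1 + A₀) + F * P) / k := by positivity
    gcongr
    linarith
  · have hαμ := (hα.mul_le hν hμ hwd hc).1
    have g := gronwall (α := α) (γ := fun _ => 0) (f := fun s => F / (1 + μ) * xsq (u s))
      (d := fun s => k * rate₂ μ (ut s)) (h.curve.hasPrim_energy₂ ν wd c) (by simp)
      (fun T hT => (h.curve.intervalIntegrable_rate₂ μ T hT).const_mul _)
      (fun T hT => (h.curve.intervalIntegrable_xsq_self T hT).const_mul _) (by simp)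
      (fun s => mul_nonneg k0.le (rate₂_nonneg hμ _))
      (fun s => mul_nonneg (by positivity) (xsq_nonneg _)) (by
        filter_upwards [h.rate, ae_restrict_mem measurableSet_Ioi, h.curve.h1t] with s hs hs0 hs1
        have h1 := energy₂'_le hν hμ hwd hc (h.curve.h1 s (le_of_lt hs0)) hs1 hs
        have h2 := energy₂_le hν hwd hc (u s)
        have xs := xsq_nonneg (u s)
        have hxA := b1 s (le_of_lt hs0)
        -- In the second energy inequality the weight is not paid by dissipation: 2α times the
        -- energy is treated as a source, and the factor 1/(1+μ) cancels the growth 1+μ of the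
        -- integral of |||u|||².
        have a1 : 2 * α ≤ ν / (1 + μ) := by
          rw [le_div_iff₀ (by positivity)]; linarith
        have hle : (1 + xsq (u s)) * xsq (u s) ≤ (1 + A) * xsq (u s) := by gcongr
        have h3 : 2 * α * energy₂ ν wd c (u s) ≤ ν / (1 + μ) * (L * ((1 + A) * xsq (u s))) := by
          have e0 : 0 ≤ energy₂ ν wd c (u s) := (mul_nonneg m0.le xs).trans (energy₂_ge hwd hc _)
          have : energy₂ ν wd c (u s) ≤ L * ((1 + A) * xsq (u s)) :=
            h2.trans (mul_le_mul_of_nonneg_left hle L0.le)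
          gcongr
        have h4 : 2 * (1 + wd) ^ 2 / k / (1 + μ) * ((1 + xsq (u s)) * xsq (u s))
            ≤ 2 * (1 + wd) ^ 2 / k / (1 + μ) * ((1 + A) * xsq (u s)) := by gcongr
        have e : F / (1 + μ) * xsq (u s) = ν / (1 + μ) * (L * ((1 + A) * xsq (u s)))
            + 2 * (1 + wd) ^ 2 / k / (1 + μ) * ((1 + A) * xsq (u s)) := by rw [hF]; ring
        rw [e]
        linarith) ht
    simp only [intervalIntegral.integral_zero, Real.exp_zero, mul_one,
      intervalIntegral.integral_const_mul, mul_left_comm _ k, mul_left_comm _ (F / (1 + μ))] at g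
    have e0 := energy₂_le hν hwd hc (u 0)
    rw [← hL] at e0
    have e1 : energy₂ ν wd c (u 0) ≤ L * (1 + A₀) * xsq (u 0) := by
      refine e0.trans ?_
      rw [mul_assoc]; gcongr
    have e2 : F / (1 + μ) * ∫ s in (0 : ℝ)..t, Real.exp (2 * α * s) * xsq (u s)
        ≤ F * P * xsq (u 0) := by
      calc F / (1 + μ) * ∫ s in (0 : ℝ)..t, Real.exp (2 * α * s) * xsq (u s)
          ≤ F / (1 + μ) * (P * (1 + μ) * xsq (u 0)) := by gcongr; exact hI t ht
        _ = _ := by field_simp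
    have e3 : 0 ≤ Real.exp (2 * α * t) * energy₂ ν wd c (u t) :=
      mul_nonneg (Real.exp_pos _).le ((mul_nonneg m0.le (xsq_nonneg _)).trans (energy₂_ge hwd hc _))
    have e4 : ∫ s in (0 : ℝ)..t, Real.exp (2 * α * s) * rate₂ μ (ut s)
        ≤ (L * (1 + A₀) + F * P) / k * xsq (u 0) := by
      rw [div_mul_eq_mul_div, le_div_iff₀ k0]; linarith
    refine e4.trans ?_
    gcongr
    linarith

/-! ### The error equation -/

/-- The quotient `(a³ - b³) / (a - b)`. -/
def cubeQuot (a b : ℝ) : ℝ := a ^ 2 + a * b + b ^ 2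

/-- The time derivative of `cubeQuot a b`, the time derivatives of `a`, `b` being `a'`, `b'`. -/
def cubeQuot' (a b a' b' : ℝ) : ℝ := a' * (2 * a + b) + b' * (a + 2 * b)

theorem cubeQuot_nonneg (a b : ℝ) : 0 ≤ cubeQuot a b := by
  rw [cubeQuot]; nlinarith [sq_nonneg (a + b), sq_nonneg a, sq_nonneg b]

theorem cubeQuot_le {a b s : ℝ} (h : a ^ 2 + b ^ 2 ≤ s) : cubeQuot a b ≤ 2 * s := by
  rw [cubeQuot]; nlinarith [sq_nonneg (a - b), sq_nonneg a, sq_nonneg b]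

theorem cubeQuot'_sq_le {a b a' b' s r : ℝ} (h : a ^ 2 + b ^ 2 ≤ s) (h' : a' ^ 2 + b' ^ 2 ≤ r) :
    cubeQuot' a b a' b' ^ 2 ≤ 10 * (s * r) := by
  have h1 : cubeQuot' a b a' b' ^ 2 ≤ (a' ^ 2 + b' ^ 2) * ((2 * a + b) ^ 2 + (a + 2 * b) ^ 2) := by
    rw [cubeQuot']; nlinarith [sq_nonneg (a' * (a + 2 * b) - b' * (2 * a + b))]
  have h2 : (2 * a + b) ^ 2 + (a + 2 * b) ^ 2 ≤ 10 * s := by nlinarith [sq_nonneg (a - b)]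
  have h3 : 0 ≤ r := (by positivity : 0 ≤ a' ^ 2 + b' ^ 2).trans h'
  calc _ ≤ _ := h1
    _ ≤ r * (10 * s) := by gcongr
    _ = _ := by ring

theorem InH1.ip_deriv_sub_left {f g k : ℝ → ℝ} (hf : InH1 f) (hg : InH1 g) (hk : InL2 k) :
    ip (deriv fun x => f x - g x) k = ip (deriv f) k - ip (deriv g) k := by
  rw [ip_congr (hf.deriv_sub hg) (Filter.EventuallyEq.refl _ k), ip_sub_left hf.2 hg.2 hk]

/-- The interior part of the residual. -/
def resF (ν μ lam : ℝ) (η ηt : ℝ → ℝ) (x : ℝ) : ℝ := (1 - μ * lam) * ηt x - ν * lam * η x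

/-- The part of the residual that is tested with the derivative. -/
def resK (wd : ℝ) (w wh η : ℝ → ℝ) (x : ℝ) : ℝ := (1 + wd + (wh x + w x) / 2) * η x

/-- The boundary part of the residual, without the convective contribution. -/
def resB (ν μ wd ci : ℝ) (w wt wh wht η ηt : ℝ) : ℝ :=
  μ / ν * ((ci + 1 + wd) * ηt
    + 2 / (9 * ci) * (cubeQuot wh w * ηt + cubeQuot' wh w wht wt * η))
  + ((ci + 1 + wd) * η + 2 / (9 * ci) * (cubeQuot wh w * η))

/-- The two weak forms are subtracted and w_h - w is split into θ - η. Orthogonality removes the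
gradients of η and η_t. The difference w_h w_hx - w w_x is half the derivative of (w_h + w)(θ - η),
and the η part of all convective terms is the derivative of `resK`, which is moved to χ. The
right-hand side therefore contains η and η_t only through their values. -/
theorem error_identity {ν μ wd lam : ℝ} {c : Fin 2 → ℝ} {w wt wh wht p pt χ : ℝ → ℝ}
    (hw : InH1 w) (hwt : InH1 wt) (hwh : InH1 wh) (hwht : InH1 wht) (hp : InH1 p) (hpt : InH1 pt)
    (hχ : InH1 χ) (e : weakForm ν μ wd c w wt χ = 0) (eh : weakForm ν μ wd c wh wht χ = 0)
    (o : ip (deriv fun x => w x - p x) (deriv χ) = -lam * ip (fun x => w x - p x) χ)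
    (ot : ip (deriv fun x => wt x - pt x) (deriv χ) = -lam * ip (fun x => wt x - pt x) χ) :
    ip (fun x => wht x - pt x) χ + μ * ip (deriv fun x => wht x - pt x) (deriv χ)
      + ν * ip (deriv fun x => wh x - p x) (deriv χ)
      + (1 + wd) * ip (deriv fun x => wh x - p x) χ
      + 1 / 2 * ip (fun x => deriv (fun x => wh x + w x) x * (wh x - p x)
          + (wh x + w x) * deriv (fun x => wh x - p x) x) χ
      + μ / ν * (((c 0 + 1 + wd) * (wht 0 - pt 0) + 2 / (9 * c 0) * (cubeQuot (wh 0) (w 0)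
            * (wht 0 - pt 0) + cubeQuot' (wh 0) (w 0) (wht 0) (wt 0) * (wh 0 - p 0))) * χ 0
        + ((c 1 + 1 + wd) * (wht 1 - pt 1) + 2 / (9 * c 1) * (cubeQuot (wh 1) (w 1)
            * (wht 1 - pt 1) + cubeQuot' (wh 1) (w 1) (wht 1) (wt 1) * (wh 1 - p 1))) * χ 1)
      + (((c 0 + 1 + wd) * (wh 0 - p 0) + 2 / (9 * c 0) * (cubeQuot (wh 0) (w 0)
            * (wh 0 - p 0))) * χ 0
        + ((c 1 + 1 + wd) * (wh 1 - p 1) + 2 / (9 * c 1) * (cubeQuot (wh 1) (w 1)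
            * (wh 1 - p 1))) * χ 1)
    = ip (resF ν μ lam (fun x => w x - p x) (fun x => wt x - pt x)) χ
      + (resB ν μ wd (c 0) (w 0) (wt 0) (wh 0) (wht 0) (w 0 - p 0) (wt 0 - pt 0)
          - resK wd w wh (fun x => w x - p x) 0) * χ 0
      + (resB ν μ wd (c 1) (w 1) (wt 1) (wh 1) (wht 1) (w 1 - p 1) (wt 1 - pt 1)
          + resK wd w wh (fun x => w x - p x) 1) * χ 1
      - ip (resK wd w wh (fun x => w x - p x)) (deriv χ) := by
  have hη := hw.sub hp
  have hηt := hwt.sub hpt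
  have hθ := hwh.sub hp
  have hg := hwh.add hw
  have hχ0 := hχ.inL2
  have hχ1 := hχ.deriv_inL2
  -- The integration by parts of the residual convection requires this product to be in H¹; its
  -- boundary values are the contributions of `resK` at the end points.
  have hk : InH1 (resK wd w wh (fun x => w x - p x)) := by
    have h1 : InH1 (fun x => 1 + wd + 1 / 2 * (wh x + w x)) :=
      (inH1_const (1 + wd)).add (hg.const_mul (1 / 2))
    refine (h1.mul hη).congr fun x _ => ?_
    simp only [resK]; ring
  have kd := hk.ip_deriv hχ
  -- the derivative of `resK`
  have kae : deriv (resK wd w wh (fun x => w x - p x)) =ᵐ[volume.restrict (Ioo (0 : ℝ) 1)]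
      fun x => (1 + wd) * (deriv w x - deriv p x)
        + 1 / 2 * ((deriv wh x + deriv w x) * (w x - p x)
          + (wh x + w x) * (deriv w x - deriv p x)) := by
    filter_upwards [hw.ae_differentiableAt, hwh.ae_differentiableAt, hp.ae_differentiableAt]
      with x h1 h2 h3
    have d := ((((h2.hasDerivAt.add h1.hasDerivAt).div_const 2).const_add (1 + wd))).mul
      (h1.hasDerivAt.sub h3.hasDerivAt)
    have : HasDerivAt (resK wd w wh (fun x => w x - p x)) _ x := d
    rw [this.deriv]
    simp only [Pi.add_apply, Pi.sub_apply]
    ring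
  have tae : (fun x => deriv (fun x => wh x + w x) x * (wh x - p x)
      + (wh x + w x) * deriv (fun x => wh x - p x) x) =ᵐ[volume.restrict (Ioo (0 : ℝ) 1)]
      fun x => (deriv wh x + deriv w x) * (wh x - p x)
        + (wh x + w x) * (deriv wh x - deriv p x) := by
    filter_upwards [hwh.deriv_add hw, hwh.deriv_sub hp] with x h1 h2
    rw [h1, h2]
  -- the convective terms
  have hwh2 : InL2 (fun x => wh x * deriv wh x) := InL2.bdd_mul hwh.continuousOn hwh.2
  have hw2 : InL2 (fun x => w x * deriv w x) := InL2.bdd_mul hw.continuousOn hw.2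
  have conv : ip (fun x => wh x * deriv wh x) χ - ip (fun x => w x * deriv w x) χ
      + (1 + wd) * (ip (deriv wh) χ - ip (deriv w) χ)
      = (1 + wd) * ip (deriv fun x => wh x - p x) χ
        + 1 / 2 * ip (fun x => deriv (fun x => wh x + w x) x * (wh x - p x)
          + (wh x + w x) * deriv (fun x => wh x - p x) x) χ
        - ip (deriv (resK wd w wh (fun x => w x - p x))) χ := by
    have t2 : InL2 (fun x => deriv (fun x => wh x + w x) x * (wh x - p x)
        + (wh x + w x) * deriv (fun x => wh x - p x) x) := by
      refine InL2.fun_add ?_ (InL2.bdd_mul hg.continuousOn hθ.2)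
      simpa only [mul_comm] using InL2.bdd_mul hθ.continuousOn hg.2
    rw [hwh.ip_deriv_sub_left hp hχ0, ← ip_sub_left hwh2 hw2 hχ0]
    have e1 : ip (fun x => wh x * deriv wh x - w x * deriv w x) χ
        = ip (fun x => (1 / 2 * (deriv (fun x => wh x + w x) x * (wh x - p x)
          + (wh x + w x) * deriv (fun x => wh x - p x) x)
          - deriv (resK wd w wh (fun x => w x - p x)) x)
          + (1 + wd) * (deriv w x - deriv p x)) χ := by
      refine ip_congr ?_ (Filter.EventuallyEq.refl _ _)
      filter_upwards [kae, tae] with x h1 h2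
      rw [h1, h2]; ring
    have i1 : InL2 (fun x => (1 + wd) * (deriv w x - deriv p x)) :=
      (hw.deriv_inL2.fun_sub hp.deriv_inL2).const_mul _
    have i2 : InL2 (fun x => 1 / 2 * (deriv (fun x => wh x + w x) x * (wh x - p x)
        + (wh x + w x) * deriv (fun x => wh x - p x) x)) := t2.const_mul _
    rw [e1, ip_add_left (i2.fun_sub hk.2) i1 hχ0, ip_sub_left i2 hk.2 hχ0, ip_const_mul_left, ip_const_mul_left,
      ip_sub_left hw.2 hp.2 hχ0]
    ring
  have f1 : ip (resF ν μ lam (fun x => w x - p x) (fun x => wt x - pt x)) χ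
      = (1 - μ * lam) * ip (fun x => wt x - pt x) χ - ν * lam * ip (fun x => w x - p x) χ := by
    rw [← ip_const_mul_left, ← ip_const_mul_left,
      ← ip_sub_left (hηt.inL2.const_mul _) (hη.inL2.const_mul _) hχ0]
    rfl
  rw [hw.ip_deriv_sub_left hp hχ1] at o
  rw [hwt.ip_deriv_sub_left hpt hχ1] at ot
  rw [f1]
  rw [ip_sub_left hw.inL2 hp.inL2 hχ0] at o ⊢
  rw [ip_sub_left hwt.inL2 hpt.inL2 hχ0] at ot ⊢
  rw [ip_sub_left hwht.inL2 hpt.inL2 hχ0, hwht.ip_deriv_sub_left hpt hχ1,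
    hwh.ip_deriv_sub_left hp hχ1]
  rw [weakForm_eq] at e eh
  have q : ∀ i : Fin 2, (2 : ℝ) / (3 * c i) = 3 * (2 / (9 * c i)) := fun i => by ring
  rw [q, q] at e eh
  simp only [resB, cubeQuot, cubeQuot']
  linear_combination eh - e - conv + kd + ν * o + μ * ot

/-- The quantity `‖f‖² + f(0)² + f(1)²`. -/
def hsq (f : ℝ → ℝ) : ℝ := sqNorm f + f 0 ^ 2 + f 1 ^ 2

theorem hsq_nonneg (f : ℝ → ℝ) : 0 ≤ hsq f := by
  have := sqNorm_nonneg f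
  rw [hsq]; positivity

theorem sqNorm_le_hsq (f : ℝ → ℝ) : sqNorm f ≤ hsq f := by
  rw [hsq]; nlinarith [sq_nonneg (f 0), sq_nonneg (f 1)]

theorem sq_zero_le_hsq (f : ℝ → ℝ) : f 0 ^ 2 ≤ hsq f := by
  rw [hsq]; nlinarith [sqNorm_nonneg f, sq_nonneg (f 1)]

theorem sq_one_le_hsq (f : ℝ → ℝ) : f 1 ^ 2 ≤ hsq f := by
  rw [hsq]; nlinarith [sqNorm_nonneg f, sq_nonneg (f 0)]

/-- The convective terms of the error equation. -/
def convT (w wh θ : ℝ → ℝ) (x : ℝ) : ℝ :=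
  deriv (fun x => wh x + w x) x * θ x + (wh x + w x) * deriv θ x

/-- The exact state `w`, the discrete state `wh` and the projection `p` of `w` at a fixed time, with
their time derivatives, and the differences `θ = wh - p`, `η = w - p`. -/
structure ErrorData (ν μ wd lam : ℝ) (c : Fin 2 → ℝ) (w wt wh wht p pt θ θt η ηt : ℝ → ℝ) :
    Prop where
  hw : InH1 w
  hwt : InH1 wt
  hwh : InH1 wh
  hwht : InH1 wht
  hp : InH1 p
  hpt : InH1 pt
  hθ : θ = fun x => wh x - p x
  hθt : θt = fun x => wht x - pt x
  hη : η = fun x => w x - p x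
  hηt : ηt = fun x => wt x - pt x
  weak : ∀ χ, χ = θ ∨ χ = θt → weakForm ν μ wd c w wt χ = 0 ∧ weakForm ν μ wd c wh wht χ = 0
  orth : ∀ χ, χ = θ ∨ χ = θt →
    ip (deriv η) (deriv χ) = -lam * ip η χ ∧ ip (deriv ηt) (deriv χ) = -lam * ip ηt χ

namespace ErrorData

variable {ν μ wd lam : ℝ} {c : Fin 2 → ℝ} {w wt wh wht p pt θ θt η ηt : ℝ → ℝ}

theorem inH1_θ (h : ErrorData ν μ wd lam c w wt wh wht p pt θ θt η ηt) : InH1 θ := by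
  rw [h.hθ]; exact h.hwh.sub h.hp

theorem inH1_θt (h : ErrorData ν μ wd lam c w wt wh wht p pt θ θt η ηt) : InH1 θt := by
  rw [h.hθt]; exact h.hwht.sub h.hpt

theorem inH1_η (h : ErrorData ν μ wd lam c w wt wh wht p pt θ θt η ηt) : InH1 η := by
  rw [h.hη]; exact h.hw.sub h.hp

theorem inH1_ηt (h : ErrorData ν μ wd lam c w wt wh wht p pt θ θt η ηt) : InH1 ηt := by
  rw [h.hηt]; exact h.hwt.sub h.hpt

theorem identity (h : ErrorData ν μ wd lam c w wt wh wht p pt θ θt η ηt) {χ : ℝ → ℝ}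
    (hχ : χ = θ ∨ χ = θt) :
    ip θt χ + μ * ip (deriv θt) (deriv χ) + ν * ip (deriv θ) (deriv χ)
      + (1 + wd) * ip (deriv θ) χ + 1 / 2 * ip (convT w wh θ) χ
      + μ / ν * (((c 0 + 1 + wd) * θt 0 + 2 / (9 * c 0) * (cubeQuot (wh 0) (w 0)
            * θt 0 + cubeQuot' (wh 0) (w 0) (wht 0) (wt 0) * θ 0)) * χ 0
        + ((c 1 + 1 + wd) * θt 1 + 2 / (9 * c 1) * (cubeQuot (wh 1) (w 1)
            * θt 1 + cubeQuot' (wh 1) (w 1) (wht 1) (wt 1) * θ 1)) * χ 1)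
      + (((c 0 + 1 + wd) * θ 0 + 2 / (9 * c 0) * (cubeQuot (wh 0) (w 0) * θ 0)) * χ 0
        + ((c 1 + 1 + wd) * θ 1 + 2 / (9 * c 1) * (cubeQuot (wh 1) (w 1) * θ 1)) * χ 1)
    = ip (resF ν μ lam η ηt) χ
      + (resB ν μ wd (c 0) (w 0) (wt 0) (wh 0) (wht 0) (η 0) (ηt 0) - resK wd w wh η 0) * χ 0
      + (resB ν μ wd (c 1) (w 1) (wt 1) (wh 1) (wht 1) (η 1) (ηt 1) + resK wd w wh η 1) * χ 1
      - ip (resK wd w wh η) (deriv χ) := by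
  have hχ1 : InH1 χ := by
    rcases hχ with rfl | rfl
    exacts [h.inH1_θ, h.inH1_θt]
  obtain ⟨e, eh⟩ := h.weak χ hχ
  obtain ⟨o, ot⟩ := h.orth χ hχ
  have hθ := h.hθ
  have hθt := h.hθt
  have hη := h.hη
  have hηt := h.hηt
  rw [hη] at o
  rw [hηt] at ot
  have key := error_identity h.hw h.hwt h.hwh h.hwht h.hp h.hpt hχ1 e eh o ot
  rw [← hη, ← hηt, ← hθ, ← hθt] at key
  have a : ∀ x, wh x - p x = θ x := fun x => by rw [hθ]
  have b : ∀ x, wht x - pt x = θt x := fun x => by rw [hθt]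
  have d : ∀ x, w x - p x = η x := fun x => by rw [hη]
  have f : ∀ x, wt x - pt x = ηt x := fun x => by rw [hηt]
  simp only [a, b, d, f] at key
  exact key

theorem sqNorm_resF_le (h : ErrorData ν μ wd lam c w wt wh wht p pt θ θt η ηt) (hμ : 0 < μ)
    (hlam : 0 < lam) :
    sqNorm (resF ν μ lam η ηt)
      ≤ 2 * ((1 + lam) ^ 2 + ν ^ 2 * lam ^ 2) * ((1 + μ) ^ 2 * hsq ηt + hsq η) := by
  have h1 := sqNorm_sub_le (h.inH1_ηt.inL2.const_mul (1 - μ * lam))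
    (h.inH1_η.inL2.const_mul (ν * lam))
  rw [sqNorm_const_mul, sqNorm_const_mul] at h1
  have h2 := sqNorm_le_hsq η
  have h3 := sqNorm_le_hsq ηt
  have n2 := sqNorm_nonneg η
  have n3 := sqNorm_nonneg ηt
  have h4 : (1 - μ * lam) ^ 2 ≤ (1 + lam) ^ 2 * (1 + μ) ^ 2 := by
    rw [← mul_pow]
    refine sq_le_sq' ?_ ?_ <;> nlinarith [mul_pos hμ hlam]
  have h5 : (1 - μ * lam) ^ 2 * sqNorm ηt ≤ (1 + lam) ^ 2 * (1 + μ) ^ 2 * hsq ηt := by gcongr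
  have h6 : (ν * lam) ^ 2 * sqNorm η ≤ ν ^ 2 * lam ^ 2 * hsq η := by
    rw [mul_pow]; gcongr
  have h7 : 0 ≤ ν ^ 2 * lam ^ 2 * ((1 + μ) ^ 2 * hsq ηt) := by
    have := hsq_nonneg ηt; positivity
  have h8 : 0 ≤ (1 + lam) ^ 2 * hsq η := by
    have := hsq_nonneg η; positivity
  have e : (fun x => (1 - μ * lam) * ηt x - ν * lam * η x) = resF ν μ lam η ηt := rfl
  rw [e] at h1
  linarith

theorem sum_sq_le (hw : InH1 w) (hwh : InH1 wh) {x : ℝ} (hx : x ∈ Icc (0 : ℝ) 1) :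
    wh x ^ 2 + w x ^ 2 ≤ xsq w + xsq wh := by
  linarith [hw.sq_le_xsq' hx, hwh.sq_le_xsq' hx]

theorem resK_coeff_sq_le (hw : InH1 w) (hwh : InH1 wh) {A : ℝ} (hA : xsq w + xsq wh ≤ A)
    {x : ℝ} (hx : x ∈ Icc (0 : ℝ) 1) :
    (1 + wd + (wh x + w x) / 2) ^ 2 ≤ 2 * (1 + wd) ^ 2 + A := by
  have := sum_sq_le hw hwh hx
  nlinarith [sq_nonneg (1 + wd - (wh x + w x) / 2), sq_nonneg (wh x - w x)]

theorem resK_sq_le (hw : InH1 w) (hwh : InH1 wh) {A : ℝ} (hA : xsq w + xsq wh ≤ A) (η : ℝ → ℝ)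
    {x : ℝ} (hx : x ∈ Icc (0 : ℝ) 1) :
    resK wd w wh η x ^ 2 ≤ (2 * (1 + wd) ^ 2 + A) * η x ^ 2 := by
  rw [resK, mul_pow]
  exact mul_le_mul_of_nonneg_right (resK_coeff_sq_le hw hwh hA hx) (sq_nonneg _)

theorem continuousOn_resK_coeff (hw : InH1 w) (hwh : InH1 wh) :
    ContinuousOn (fun x => 1 + wd + (wh x + w x) / 2) (Icc 0 1) :=
  continuousOn_const.add ((hwh.continuousOn.add hw.continuousOn).div_const 2)

theorem resK_inL2 (hw : InH1 w) (hwh : InH1 wh) {η : ℝ → ℝ} (hη : InH1 η) :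
    InL2 (resK wd w wh η) :=
  InL2.bdd_mul (continuousOn_resK_coeff hw hwh) hη.inL2

theorem sqNorm_resK_le (hw : InH1 w) (hwh : InH1 wh) {A : ℝ} (hA : xsq w + xsq wh ≤ A)
    {η : ℝ → ℝ} (hη : InH1 η) :
    sqNorm (resK wd w wh η) ≤ (2 * (1 + wd) ^ 2 + A) * hsq η := by
  refine (sqNorm_mul_le (continuousOn_resK_coeff hw hwh) hη.inL2
    fun x hx => resK_coeff_sq_le hw hwh hA hx).trans ?_
  refine mul_le_mul_of_nonneg_left (sqNorm_le_hsq η) ?_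
  nlinarith [xsq_nonneg w, xsq_nonneg wh]

theorem sqNorm_convT_le (hw : InH1 w) (hwh : InH1 wh) {θ : ℝ → ℝ} (hθ : InH1 θ) :
    InL2 (convT w wh θ) ∧ sqNorm (convT w wh θ) ≤ 8 * (xsq w + xsq wh) * xsq θ := by
  have hg := hwh.add hw
  have i1 : InL2 (fun x => deriv (fun x => wh x + w x) x * θ x) := by
    simpa only [mul_comm] using InL2.bdd_mul hθ.continuousOn hg.2
  have i2 : InL2 (fun x => (wh x + w x) * deriv θ x) := InL2.bdd_mul hg.continuousOn hθ.2
  refine ⟨i1.fun_add i2, ?_⟩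
  have h1 := sqNorm_add_le i1 i2
  have h2 : sqNorm (fun x => deriv (fun x => wh x + w x) x * θ x)
      ≤ xsq θ * sqNorm (deriv fun x => wh x + w x) := by
    have := sqNorm_mul_le hθ.continuousOn hg.deriv_inL2 (fun x hx => hθ.sq_le_xsq' hx)
    simpa only [mul_comm] using this
  have h3 : sqNorm (deriv fun x => wh x + w x) ≤ 2 * (xsq w + xsq wh) := by
    rw [sqNorm_congr (hwh.deriv_add hw)]
    have := sqNorm_add_le hwh.deriv_inL2 hw.deriv_inL2
    linarith [sqNorm_deriv_le_xsq w, sqNorm_deriv_le_xsq wh]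
  have h4 : sqNorm (fun x => (wh x + w x) * deriv θ x)
      ≤ 2 * (xsq w + xsq wh) * sqNorm (deriv θ) :=
    sqNorm_mul_le hg.continuousOn hθ.deriv_inL2 fun x hx => by
      nlinarith [sum_sq_le hw hwh hx, sq_nonneg (wh x - w x)]
  have x0 := xsq_nonneg θ
  have h5 := mul_le_mul_of_nonneg_left h3 x0
  have h6 := mul_le_mul_of_nonneg_left (sqNorm_deriv_le_xsq θ)
    (by have := xsq_nonneg w; have := xsq_nonneg wh; positivity : 0 ≤ 2 * (xsq w + xsq wh))
  have e : (fun x => deriv (fun x => wh x + w x) x * θ x + (wh x + w x) * deriv θ x)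
    = convT w wh θ := rfl
  rw [e] at h1
  linarith

end ErrorData

theorem sq_add_three_le (x y z : ℝ) : (x + y + z) ^ 2 ≤ 3 * (x ^ 2 + y ^ 2 + z ^ 2) := by
  nlinarith [sq_nonneg (x - y), sq_nonneg (y - z), sq_nonneg (x - z)]

theorem exists_resB_sq_le {ν wd ci : ℝ} (hν : 0 < ν) (hwd : 0 ≤ wd) (hc : 0 < ci) (A : ℝ)
    (hA : 0 ≤ A) : ∃ C : ℝ, 0 < C ∧ ∀ μ w wt wh wht η ηt a b H Ht : ℝ, 0 < μ →
      wh ^ 2 + w ^ 2 ≤ a → a ≤ A → wht ^ 2 + wt ^ 2 ≤ b → η ^ 2 ≤ H → ηt ^ 2 ≤ Ht →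
      resB ν μ wd ci w wt wh wht η ηt ^ 2 ≤ C * (μ ^ 2 * Ht + (1 + μ ^ 2 * b) * H) := by
  set K := ci + 1 + wd
  set κ := 2 / (9 * ci)
  -- M bounds the linearized feedback coefficient, because a² + ab + b² is at most 2(a² + b²).
  set M := K + κ * (2 * A)
  have K0 : 0 < K := by positivity
  have κ0 : 0 < κ := by positivity
  have M0 : 0 < M := by positivity
  refine ⟨3 * (M ^ 2 / ν ^ 2 + 10 * κ ^ 2 * A / ν ^ 2 + M ^ 2), by positivity,
    fun μ w wt wh wht η ηt a b H Ht hμ ha haA hb hη hηt => ?_⟩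
  have a0 : 0 ≤ a := (by positivity : 0 ≤ wh ^ 2 + w ^ 2).trans ha
  have b0 : 0 ≤ b := (by positivity : 0 ≤ wht ^ 2 + wt ^ 2).trans hb
  have H0 : 0 ≤ H := (sq_nonneg η).trans hη
  have Ht0 : 0 ≤ Ht := (sq_nonneg ηt).trans hηt
  have hQ := cubeQuot_le ha
  have hQ0 := cubeQuot_nonneg wh w
  have hQ' := cubeQuot'_sq_le ha hb
  have hM0 : 0 ≤ K + κ * cubeQuot wh w := by positivity
  have hM : K + κ * cubeQuot wh w ≤ M := by
    have : κ * cubeQuot wh w ≤ κ * (2 * A) := by gcongr; linarith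
    linarith
  have hM2 : (K + κ * cubeQuot wh w) ^ 2 ≤ M ^ 2 := by gcongr
  have e : resB ν μ wd ci w wt wh wht η ηt = μ / ν * ((K + κ * cubeQuot wh w) * ηt)
      + μ / ν * (κ * (cubeQuot' wh w wht wt * η)) + (K + κ * cubeQuot wh w) * η := by
    simp only [resB, K, κ]; ring
  rw [e]
  refine (sq_add_three_le _ _ _).trans ?_
  have t1 : (μ / ν * ((K + κ * cubeQuot wh w) * ηt)) ^ 2 ≤ M ^ 2 / ν ^ 2 * (μ ^ 2 * Ht) := by
    calc _ = (μ / ν) ^ 2 * ((K + κ * cubeQuot wh w) ^ 2 * ηt ^ 2) := by ring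
      _ ≤ (μ / ν) ^ 2 * (M ^ 2 * Ht) := by gcongr
      _ = _ := by ring
  have t2 : (μ / ν * (κ * (cubeQuot' wh w wht wt * η))) ^ 2
      ≤ 10 * κ ^ 2 * A / ν ^ 2 * (μ ^ 2 * b * H) := by
    calc _ = (μ / ν) ^ 2 * (κ ^ 2 * (cubeQuot' wh w wht wt ^ 2 * η ^ 2)) := by ring
      _ ≤ (μ / ν) ^ 2 * (κ ^ 2 * (10 * (A * b) * H)) := by
        gcongr
        exact hQ'.trans (by gcongr)
      _ = _ := by ring
  have t3 : ((K + κ * cubeQuot wh w) * η) ^ 2 ≤ M ^ 2 * H := by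
    rw [mul_pow]; gcongr
  have p1 : 0 ≤ M ^ 2 / ν ^ 2 * ((1 + μ ^ 2 * b) * H) := by positivity
  have p2 : 0 ≤ 10 * κ ^ 2 * A / ν ^ 2 * (μ ^ 2 * Ht + H) := by positivity
  have p3 : 0 ≤ M ^ 2 * (μ ^ 2 * Ht + μ ^ 2 * b * H) := by positivity
  linarith

theorem abs_le_of_sq_le_mul {z p q δ : ℝ} (hδ : 0 < δ) (hp : 0 ≤ p) (hq : 0 ≤ q)
    (h : z ^ 2 ≤ p * q) : |z| ≤ δ * p + q / (4 * δ) := by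
  have h1 : z ^ 2 ≤ (δ * p + q / (4 * δ)) ^ 2 := by
    have e : (δ * p + q / (4 * δ)) ^ 2 = (δ * p - q / (4 * δ)) ^ 2 + p * q := by field_simp; ring
    rw [e]; linarith [sq_nonneg (δ * p - q / (4 * δ))]
  exact abs_le_of_sq_le_sq h1 (by positivity)

theorem ErrorData.resF_inL2 {ν μ wd lam : ℝ} {c : Fin 2 → ℝ}
    {w wt wh wht p pt θ θt η ηt : ℝ → ℝ}
    (h : ErrorData ν μ wd lam c w wt wh wht p pt θ θt η ηt) : InL2 (resF ν μ lam η ηt) := by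
  have i1 : InL2 (fun x => (1 - μ * lam) * ηt x) := h.inH1_ηt.inL2.const_mul _
  have i2 : InL2 (fun x => ν * lam * η x) := h.inH1_η.inL2.const_mul _
  exact i1.fun_sub i2

theorem AdmissibleRate.mul_div_le {ν μ wd α : ℝ} {c : Fin 2 → ℝ} (hν : 0 < ν) (hμ : 0 < μ)
    (hwd : 0 ≤ wd) (hc : ∀ i, 0 < c i) (h : AdmissibleRate ν μ wd c α) : α * (μ / ν) ≤ 1 := by
  have h1 := (h.mul_le hν hμ hwd hc).1
  have h2 := h.1
  rw [mul_div_assoc', div_le_iff₀ hν]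
  linarith

/-! ### Differential inequalities for the two energies of the error. -/

/-- The first energy of the error. -/
def errEnergy₁ (ν μ wd : ℝ) (c : Fin 2 → ℝ) (w wh θ : ℝ → ℝ) : ℝ :=
  sqNorm θ + μ * sqNorm (deriv θ)
    + μ / ν * (((c 0 + 1 + wd) + 2 / (9 * c 0) * cubeQuot (wh 0) (w 0)) * θ 0 ^ 2
      + ((c 1 + 1 + wd) + 2 / (9 * c 1) * cubeQuot (wh 1) (w 1)) * θ 1 ^ 2)

/-- The time derivative of the first energy of the error. -/
def errEnergy₁' (ν μ wd : ℝ) (c : Fin 2 → ℝ) (w wt wh wht θ θt : ℝ → ℝ) : ℝ :=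
  2 * ip θ θt + μ * (2 * ip (deriv θ) (deriv θt))
    + μ / ν * ((2 / (9 * c 0) * cubeQuot' (wh 0) (w 0) (wht 0) (wt 0) * θ 0 ^ 2
        + ((c 0 + 1 + wd) + 2 / (9 * c 0) * cubeQuot (wh 0) (w 0)) * (2 * θ 0 * θt 0))
      + (2 / (9 * c 1) * cubeQuot' (wh 1) (w 1) (wht 1) (wt 1) * θ 1 ^ 2
        + ((c 1 + 1 + wd) + 2 / (9 * c 1) * cubeQuot (wh 1) (w 1)) * (2 * θ 1 * θt 1)))

/-- The boundary weights of the first error energy depend on time, and their derivative q is not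
bounded pointwise. The trace inequality trades θ(x)² for ‖θ‖² with a coefficient made of a and μ²b,
both of which will be integrable in time. -/
theorem InH1.abs_trace_rate_le {θ : ℝ → ℝ} (hθ : InH1 θ) {x : ℝ} (hx : x ∈ Icc (0 : ℝ) 1)
    {κ δ A a b μ q : ℝ} (hκ : 0 < κ) (hδ : 0 < δ) (hμ : 0 < μ) (ha : 0 ≤ a) (haA : a ≤ A)
    (hb : 0 ≤ b) (hq : q ^ 2 ≤ 10 * (a * b)) :
    |κ * μ * q * θ x ^ 2| ≤ δ * xsq θ + (3 * κ + 10 * κ ^ 2 * A / δ) * (a + μ ^ 2 * b) * sqNorm θ := by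
  have h1 : |μ * q| ≤ 1 * a + (10 * (μ ^ 2 * b)) / (4 * 1) := by
    refine abs_le_of_sq_le_mul one_pos ha (by positivity) ?_
    calc (μ * q) ^ 2 = μ ^ 2 * q ^ 2 := by ring
      _ ≤ μ ^ 2 * (10 * (a * b)) := by gcongr
      _ = _ := by ring
  have n0 := sqNorm_nonneg θ
  have h2 := hθ.trace_absorb (a := κ * |μ * q|) (by positivity) hδ hx
  have e : |κ * μ * q * θ x ^ 2| = κ * |μ * q| * θ x ^ 2 := by
    rw [abs_mul, mul_assoc κ, abs_mul, abs_of_pos hκ, abs_of_nonneg (sq_nonneg (θ x))]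
  rw [e]
  refine h2.trans ?_
  have h3 : κ * |μ * q| ≤ 3 * κ * (a + μ ^ 2 * b) := by
    have : 0 ≤ μ ^ 2 * b := by positivity
    calc κ * |μ * q| ≤ κ * (3 * (a + μ ^ 2 * b)) := by gcongr; linarith
      _ = _ := by ring
  have h4 : (κ * |μ * q|) ^ 2 / δ ≤ 10 * κ ^ 2 * A / δ * (a + μ ^ 2 * b) := by
    rw [mul_pow, sq_abs, div_mul_eq_mul_div]
    refine div_le_div_of_nonneg_right ?_ hδ.le
    calc κ ^ 2 * (μ * q) ^ 2 = κ ^ 2 * (μ ^ 2 * q ^ 2) := by ring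
      _ ≤ κ ^ 2 * (μ ^ 2 * (10 * (A * b))) := by
        gcongr
        exact hq.trans (by gcongr)
      _ = 10 * κ ^ 2 * A * (0 + μ ^ 2 * b) := by ring
      _ ≤ 10 * κ ^ 2 * A * (a + μ ^ 2 * b) := by
        have : 0 ≤ A := ha.trans haA
        gcongr
  have : (κ * |μ * q| + (κ * |μ * q|) ^ 2 / δ) * sqNorm θ
      ≤ (3 * κ + 10 * κ ^ 2 * A / δ) * (a + μ ^ 2 * b) * sqNorm θ := by
    gcongr
    linarith
  linarith

/-- Bounds of the residual terms, uniformly in `μ`. -/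
theorem exists_residual_bound {ν wd lam : ℝ} {c : Fin 2 → ℝ} (hν : 0 < ν) (hwd : 0 ≤ wd)
    (hlam : 0 < lam) (hc : ∀ i, 0 < c i) (A : ℝ) (hA : 0 ≤ A) : ∃ S : ℝ, 0 < S ∧
    ∀ (μ : ℝ) (w wt wh wht p pt θ θt η ηt : ℝ → ℝ), 0 < μ →
      ErrorData ν μ wd lam c w wt wh wht p pt θ θt η ηt → xsq w + xsq wh ≤ A →
      sqNorm (resF ν μ lam η ηt) ≤ S * ((1 + μ) ^ 2 * hsq ηt + hsq η) ∧
      (resB ν μ wd (c 0) (w 0) (wt 0) (wh 0) (wht 0) (η 0) (ηt 0) - resK wd w wh η 0) ^ 2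
        ≤ S * (μ ^ 2 * hsq ηt + (1 + μ ^ 2 * (xsq wt + xsq wht)) * hsq η) ∧
      (resB ν μ wd (c 1) (w 1) (wt 1) (wh 1) (wht 1) (η 1) (ηt 1) + resK wd w wh η 1) ^ 2
        ≤ S * (μ ^ 2 * hsq ηt + (1 + μ ^ 2 * (xsq wt + xsq wht)) * hsq η) ∧
      sqNorm (resK wd w wh η) ≤ S * hsq η := by
  obtain ⟨C₀, hC₀, H₀⟩ := exists_resB_sq_le hν hwd (hc 0) A hA
  obtain ⟨C₁, hC₁, H₁⟩ := exists_resB_sq_le hν hwd (hc 1) A hA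
  refine ⟨2 * ((1 + lam) ^ 2 + ν ^ 2 * lam ^ 2) + 2 * C₀ + 2 * C₁ + 2 * (2 * (1 + wd) ^ 2 + A),
    by positivity, fun μ w wt wh wht p pt θ θt η ηt hμ h hX => ?_⟩
  have hH := hsq_nonneg η
  have hHt := hsq_nonneg ηt
  have xt := xsq_nonneg wt
  have xht := xsq_nonneg wht
  set S₁ := 2 * ((1 + lam) ^ 2 + ν ^ 2 * lam ^ 2)
  set G := 2 * (1 + wd) ^ 2 + A
  have S₁0 : 0 ≤ S₁ := by positivity
  have G0 : 0 ≤ G := by positivity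
  set f := μ ^ 2 * hsq ηt + (1 + μ ^ 2 * (xsq wt + xsq wht)) * hsq η with hf
  have hfH : hsq η ≤ f := by
    have : 0 ≤ μ ^ 2 * hsq ηt + μ ^ 2 * (xsq wt + xsq wht) * hsq η := by positivity
    rw [hf]; linarith
  have f0 := hH.trans hfH
  have b0 := H₀ μ (w 0) (wt 0) (wh 0) (wht 0) (η 0) (ηt 0) _ (xsq wt + xsq wht) (hsq η) (hsq ηt) hμ
    (ErrorData.sum_sq_le h.hw h.hwh (by simp)) hX
    (by linarith [sq_zero_le_xsq wt, sq_zero_le_xsq wht]) (sq_zero_le_hsq η) (sq_zero_le_hsq ηt)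
  have b1 := H₁ μ (w 1) (wt 1) (wh 1) (wht 1) (η 1) (ηt 1) _ (xsq wt + xsq wht) (hsq η) (hsq ηt) hμ
    (ErrorData.sum_sq_le h.hw h.hwh (by simp)) hX
    (by linarith [sq_one_le_xsq wt, sq_one_le_xsq wht]) (sq_one_le_hsq η) (sq_one_le_hsq ηt)
  have k0 := ErrorData.resK_sq_le (wd := wd) h.hw h.hwh hX η (x := 0) (by simp)
  have k1 := ErrorData.resK_sq_le (wd := wd) h.hw h.hwh hX η (x := 1) (by simp)
  have k0' := mul_le_mul_of_nonneg_left ((sq_zero_le_hsq η).trans hfH) G0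
  have k1' := mul_le_mul_of_nonneg_left ((sq_one_le_hsq η).trans hfH) G0
  have p1 := mul_nonneg S₁0 f0
  have p2 := mul_nonneg hC₀.le f0
  have p3 := mul_nonneg hC₁.le f0
  have p4 := mul_nonneg G0 f0
  refine ⟨?_, ?_, ?_, ?_⟩
  · refine (h.sqNorm_resF_le hμ hlam).trans ?_
    have : 0 ≤ (1 + μ) ^ 2 * hsq ηt + hsq η := by positivity
    refine mul_le_mul_of_nonneg_right ?_ this
    linarith
  · nlinarith [sq_nonneg (resB ν μ wd (c 0) (w 0) (wt 0) (wh 0) (wht 0) (η 0) (ηt 0)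
      + resK wd w wh η 0)]
  · nlinarith [sq_nonneg (resB ν μ wd (c 1) (w 1) (wt 1) (wh 1) (wht 1) (η 1) (ηt 1)
      - resK wd w wh η 1)]
  · refine (ErrorData.sqNorm_resK_le h.hw h.hwh hX h.inH1_η).trans ?_
    refine mul_le_mul_of_nonneg_right ?_ hH
    linarith

/-- The error equation is tested with θ. The product w_h² + w_h w + w² is kept inside the energy as
a nonnegative boundary weight, so its leading contributions are exact derivatives or dissipative;
the convection and the derivative of that weight are absorbed or put into the Gronwall coefficient,
and the residuals become sources. -/
theorem exists_errEnergy₁'_le {ν wd lam : ℝ} {c : Fin 2 → ℝ} (hν : 0 < ν) (hwd : 0 ≤ wd)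
    (hlam : 0 < lam) (hc : ∀ i, 0 < c i) (A : ℝ) (hA : 0 ≤ A) : ∃ C : ℝ, 0 < C ∧
    ∀ (μ α : ℝ) (w wt wh wht p pt θ θt η ηt : ℝ → ℝ), 0 < μ → AdmissibleRate ν μ wd c α →
      ErrorData ν μ wd lam c w wt wh wht p pt θ θt η ηt → xsq w + xsq wh ≤ A →
      errEnergy₁' ν μ wd c w wt wh wht θ θt + dissip ν c / 2 * xsq θ
        ≤ (C / (1 + μ) * ((xsq w + xsq wh) + μ ^ 2 * (xsq wt + xsq wht)) - 2 * α)
            * errEnergy₁ ν μ wd c w wh θ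
          + C * ((1 + μ) ^ 2 * hsq ηt + (1 + μ ^ 2 * (xsq wt + xsq wht)) * hsq η) := by
  obtain ⟨S, hS, HS⟩ := exists_residual_bound hν hwd hlam hc A hA
  have m0 := dissip_pos hν hc
  have h2' := fun u => dissip_mul_xsq_le (ν := ν) (c := c) u
  generalize dissip ν c = m at *
  -- The absorbed terms add up to 13 δ|||θ|||²: one from the convection, two from each of the four
  -- residuals, two from each of the two boundary weights. Half of the dissipation is 14 δ|||θ|||².
  obtain ⟨δ, hδ⟩ : ∃ δ, δ = m / 28 := ⟨_, rfl⟩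
  have δ0 : 0 < δ := by rw [hδ]; positivity
  have hc0 := hc 0
  have hc1 := hc 1
  obtain ⟨κ₀, hκ₀⟩ : ∃ κ, κ = 2 / (9 * c 0) := ⟨_, rfl⟩
  obtain ⟨κ₁, hκ₁⟩ : ∃ κ, κ = 2 / (9 * c 1) := ⟨_, rfl⟩
  have κ₀0 : 0 < κ₀ := by rw [hκ₀]; positivity
  have κ₁0 : 0 < κ₁ := by rw [hκ₁]; positivity
  obtain ⟨B₀, hB₀⟩ : ∃ B, B = 3 * (κ₀ / (2 * ν)) + 10 * (κ₀ / (2 * ν)) ^ 2 * A / δ := ⟨_, rfl⟩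
  obtain ⟨B₁, hB₁⟩ : ∃ B, B = 3 * (κ₁ / (2 * ν)) + 10 * (κ₁ / (2 * ν)) ^ 2 * A / δ := ⟨_, rfl⟩
  have B₀0 : 0 < B₀ := by rw [hB₀]; positivity
  have B₁0 : 0 < B₁ := by rw [hB₁]; positivity
  refine ⟨2 * (2 / δ + B₀ + B₁) * (1 + ν) + 2 * (S / δ), by positivity,
    fun μ α w wt wh wht p pt θ θt η ηt hμ hα h hX => ?_⟩
  obtain ⟨r1, r2, r3, r4⟩ := HS μ w wt wh wht p pt θ θt η ηt hμ h hX
  have hθ := h.inH1_θ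
  have hid := h.identity (Or.inl rfl)
  have a0 : 0 ≤ xsq w + xsq wh := add_nonneg (xsq_nonneg w) (xsq_nonneg wh)
  have b0 : 0 ≤ xsq wt + xsq wht := add_nonneg (xsq_nonneg wt) (xsq_nonneg wht)
  have qt0 := cubeQuot'_sq_le (ErrorData.sum_sq_le h.hw h.hwh (x := 0) (by simp))
    (by linarith [sq_zero_le_xsq wt, sq_zero_le_xsq wht] :
      wht 0 ^ 2 + wt 0 ^ 2 ≤ xsq wt + xsq wht)
  have qt1 := cubeQuot'_sq_le (ErrorData.sum_sq_le h.hw h.hwh (x := 1) (by simp))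
    (by linarith [sq_one_le_xsq wt, sq_one_le_xsq wht] :
      wht 1 ^ 2 + wt 1 ^ 2 ≤ xsq wt + xsq wht)
  have hx0 := hθ.abs_trace_rate_le (x := 0) (by simp) (κ := κ₀ / (2 * ν)) (by positivity) δ0 hμ a0
    hX b0 qt0
  have hx1 := hθ.abs_trace_rate_le (x := 1) (by simp) (κ := κ₁ / (2 * ν)) (by positivity) δ0 hμ a0
    hX b0 qt1
  rw [← hB₀] at hx0
  rw [← hB₁] at hx1
  obtain ⟨iT, nT⟩ := ErrorData.sqNorm_convT_le h.hw h.hwh hθ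
  have iF : InL2 (resF ν μ lam η ηt) := h.resF_inL2
  have iK : InL2 (resK wd w wh η) := ErrorData.resK_inL2 h.hw h.hwh h.inH1_η
  have cT := ip_sq_le iT hθ.inL2
  have cF := ip_sq_le iF hθ.inL2
  have cK := ip_sq_le iK hθ.deriv_inL2
  have hQ0 := cubeQuot_nonneg (wh 0) (w 0)
  have hQ1 := cubeQuot_nonneg (wh 1) (w 1)
  have hge := energy_ge (μ := μ) hν hμ hwd hc hθ
  have hrate := rate_mul_energy_le hν hμ hwd hc hα hθ
  have hαμ := hα.mul_div_le hν hμ hwd hc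
  have hn0 := sqNorm_nonneg θ
  have hn1 := sqNorm_nonneg (deriv θ)
  have hnX := hθ.sqNorm_le_xsq'
  have hn1X := sqNorm_deriv_le_xsq θ
  have X0 := xsq_nonneg θ
  have hH := hsq_nonneg η
  have hHt := hsq_nonneg ηt
  have h2 := h2' θ
  have hs0 := sq_zero_le_xsq θ
  have hs1 := sq_one_le_xsq θ
  rw [hθ.ip_deriv_self, ← sqNorm_eq_ip, ip_comm θt, ip_comm (deriv θt)] at hid
  rw [errEnergy₁', errEnergy₁]
  rw [← hκ₀, ← hκ₁] at hid ⊢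
  generalize xsq w + xsq wh = a at *
  generalize xsq wt + xsq wht = b at *
  generalize resB ν μ wd (c 0) (w 0) (wt 0) (wh 0) (wht 0) (η 0) (ηt 0) - resK wd w wh η 0 = ρ₀ at *
  generalize resB ν μ wd (c 1) (w 1) (wt 1) (wh 1) (wht 1) (η 1) (ηt 1) + resK wd w wh η 1 = ρ₁ at *
  generalize ip (convT w wh θ) θ = zT at *
  generalize ip (resF ν μ lam η ηt) θ = zF at *
  generalize ip (resK wd w wh η) (deriv θ) = zK at *
  generalize cubeQuot' (wh 0) (w 0) (wht 0) (wt 0) = t0 at *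
  generalize cubeQuot' (wh 1) (w 1) (wht 1) (wt 1) = t1 at *
  generalize cubeQuot (wh 0) (w 0) = Q0 at *
  generalize cubeQuot (wh 1) (w 1) = Q1 at *
  generalize θ 0 = θ₀ at *
  generalize θ 1 = θ₁ at *
  generalize θt 0 = θt₀ at *
  generalize θt 1 = θt₁ at *
  generalize ip θ θt = I₀ at *
  generalize ip (deriv θ) (deriv θt) = I₁ at *
  generalize sqNorm (convT w wh θ) = nT' at *
  generalize sqNorm (resF ν μ lam η ηt) = nF at *
  generalize sqNorm (resK wd w wh η) = nK at *
  generalize hsq η = H at *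
  generalize hsq ηt = Ht at *
  generalize sqNorm θ = n₀ at *
  generalize sqNorm (deriv θ) = n₁ at *
  generalize xsq θ = X at *
  -- the bounds of the single terms
  obtain ⟨f, hf⟩ : ∃ f, f = (1 + μ) ^ 2 * Ht + (1 + μ ^ 2 * b) * H := ⟨_, rfl⟩
  have p1 : 0 ≤ μ ^ 2 * b * H := by positivity
  have p2 : 0 ≤ (1 + μ) ^ 2 * Ht := by positivity
  have p3 : 0 ≤ (1 + 2 * μ) * Ht := by positivity
  have f0 : 0 ≤ f := by rw [hf]; positivity
  have fF : (1 + μ) ^ 2 * Ht + H ≤ f := by rw [hf]; linarith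
  have fB : μ ^ 2 * Ht + (1 + μ ^ 2 * b) * H ≤ f := by rw [hf]; linarith
  have fK : H ≤ f := by linarith
  have Sf0 : 0 ≤ S * f := by positivity
  have zT_le : |zT| ≤ δ * X + 8 * a * n₀ / (4 * δ) :=
    abs_le_of_sq_le_mul δ0 X0 (by positivity) (cT.trans
      ((mul_le_mul_of_nonneg_right nT hn0).trans_eq (by ring)))
  have aux : ∀ {z p q : ℝ}, z ^ 2 ≤ p * q → p ≤ S * f → 0 ≤ q → q ≤ X →
      |z| ≤ δ * X + S * f / (4 * δ) := fun {z p q} hz hp hq0 hq =>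
    abs_le_of_sq_le_mul δ0 X0 Sf0 (hz.trans ((mul_le_mul hp hq hq0 Sf0).trans_eq (mul_comm _ _)))
  have zF_le := aux cF (r1.trans (mul_le_mul_of_nonneg_left fF hS.le)) hn0 hnX
  have zK_le := aux cK (r4.trans (mul_le_mul_of_nonneg_left fK hS.le)) hn1 hn1X
  have z0_le := aux (mul_pow ρ₀ θ₀ 2).le (r2.trans (mul_le_mul_of_nonneg_left fB hS.le))
    (sq_nonneg _) hs0
  have z1_le := aux (mul_pow ρ₁ θ₁ 2).le (r3.trans (mul_le_mul_of_nonneg_left fB hS.le))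
    (sq_nonneg _) hs1
  clear aux cT cF cK nT r1 r2 r3 r4 p1 p2 p3 fF fB fK iT iF iK qt0 qt1
  -- the part of the energy with `cubeQuot`
  have hg : n₀ ≤ (1 + ν) / (1 + μ) * (n₀ + μ * n₁ + μ / ν * ((c 0 + 1 + wd + κ₀ * Q0) * θ₀ ^ 2
      + (c 1 + 1 + wd + κ₁ * Q1) * θ₁ ^ 2)) := by
    rw [div_mul_eq_mul_div, le_div_iff₀ (by positivity)]
    have q : 0 ≤ (1 + ν) * (μ / ν * (κ₀ * Q0 * θ₀ ^ 2 + κ₁ * Q1 * θ₁ ^ 2)) := by positivity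
    linarith
  generalize hE : n₀ + μ * n₁ + μ / ν * ((c 0 + 1 + wd + κ₀ * Q0) * θ₀ ^ 2
      + (c 1 + 1 + wd + κ₁ * Q1) * θ₁ ^ 2) = E at *
  have hq : α * (μ / ν) * (κ₀ * Q0 * θ₀ ^ 2 + κ₁ * Q1 * θ₁ ^ 2)
      ≤ 1 * (κ₀ * Q0 * θ₀ ^ 2 + κ₁ * Q1 * θ₁ ^ 2) :=
    mul_le_mul_of_nonneg_right hαμ (by positivity)
  have hαE : α * E = α * (n₀ + μ * n₁ + μ / ν * ((c 0 + 1 + wd) * θ₀ ^ 2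
      + (c 1 + 1 + wd) * θ₁ ^ 2)) + α * (μ / ν) * (κ₀ * Q0 * θ₀ ^ 2 + κ₁ * Q1 * θ₁ ^ 2) := by
    rw [← hE]; ring
  have hγ0 : 0 ≤ a + μ ^ 2 * b := by positivity
  have hD0 : 0 < 2 / δ + B₀ + B₁ := by positivity
  have hgam : 2 * (2 / δ + B₀ + B₁) * ((a + μ ^ 2 * b) * n₀)
      ≤ 2 * (2 / δ + B₀ + B₁) * ((a + μ ^ 2 * b) * ((1 + ν) / (1 + μ) * E)) := by gcongr
  have hC : (2 * (2 / δ + B₀ + B₁) * (1 + ν) + 2 * (S / δ)) / (1 + μ) * (a + μ ^ 2 * b) * E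
      = 2 * (2 / δ + B₀ + B₁) * ((a + μ ^ 2 * b) * ((1 + ν) / (1 + μ) * E))
        + 2 * (S / δ) / (1 + μ) * (a + μ ^ 2 * b) * E := by ring
  have E0 : 0 ≤ E := by rw [← hE]; positivity
  have hC1 : 0 ≤ 2 * (S / δ) / (1 + μ) * (a + μ ^ 2 * b) * E := by positivity
  have hC2 : 0 ≤ 2 * (2 / δ + B₀ + B₁) * (1 + ν) * f := by positivity
  have ea : 8 * a * n₀ / (4 * δ) = 2 / δ * (a * n₀) := by field_simp; ring
  have ea' : 0 ≤ 2 / δ * (μ ^ 2 * b * n₀) := by positivity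
  have ea'' : 0 ≤ 2 / δ * (a * n₀) := by positivity
  have ef : S * f / (4 * δ) = S / δ * f / 4 := by field_simp
  have Sf1 : 0 ≤ S / δ * f := by positivity
  rw [ea] at zT_le
  rw [ef] at zF_le zK_le z0_le z1_le
  have eδ : 28 * (δ * X) = m * X := by rw [hδ]; ring
  have b0' : 0 ≤ B₀ * ((a + μ ^ 2 * b) * n₀) := by positivity
  have b1' : 0 ≤ B₁ * ((a + μ ^ 2 * b) * n₀) := by positivity
  have w1 := mul_nonneg hwd (sq_nonneg θ₁)
  have z1 := sq_nonneg θ₁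
  have t0e : μ / ν * (κ₀ * t0 * θ₀ ^ 2) = 2 * (κ₀ / (2 * ν) * μ * t0 * θ₀ ^ 2) := by field_simp
  have t1e : μ / ν * (κ₁ * t1 * θ₁ ^ 2) = 2 * (κ₁ / (2 * ν) * μ * t1 * θ₁ ^ 2) := by field_simp
  generalize κ₀ / (2 * ν) * μ * t0 * θ₀ ^ 2 = T0 at *
  generalize κ₁ / (2 * ν) * μ * t1 * θ₁ ^ 2 = T1 at *
  rw [← hf, sub_mul, hC, mul_assoc 2 α, hαE]
  rw [abs_le] at zT_le zF_le zK_le z0_le z1_le hx0 hx1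
  have dX0 : 0 ≤ δ * X := by positivity
  linarith [hx0.1, hx0.2, hx1.1, hx1.2, zT_le.1, zF_le.2, zK_le.1, z0_le.2, z1_le.2]

/-- The second energy of the error. -/
def errEnergy₂ (ν wd : ℝ) (c : Fin 2 → ℝ) (w θ : ℝ → ℝ) : ℝ :=
  ν * sqNorm (deriv θ)
    + ((c 0 + 1 + wd) * θ 0 ^ 2
      + 2 / (9 * c 0) * (3 * w 0 ^ 2 * θ 0 ^ 2 + 2 * w 0 * θ 0 ^ 3 + 1 / 2 * θ 0 ^ 4))
    + ((c 1 + 1 + wd) * θ 1 ^ 2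
      + 2 / (9 * c 1) * (3 * w 1 ^ 2 * θ 1 ^ 2 + 2 * w 1 * θ 1 ^ 3 + 1 / 2 * θ 1 ^ 4))

/-- The time derivative of the second energy of the error. -/
def errEnergy₂' (ν wd : ℝ) (c : Fin 2 → ℝ) (w wt θ θt : ℝ → ℝ) : ℝ :=
  2 * (ν * ip (deriv θ) (deriv θt)
    + ((c 0 + 1 + wd) * (θ 0 * θt 0)
      + 2 / (9 * c 0) * ((3 * w 0 ^ 2 + 3 * w 0 * θ 0 + θ 0 ^ 2) * (θ 0 * θt 0)
        + wt 0 * θ 0 ^ 2 * (3 * w 0 + θ 0)))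
    + ((c 1 + 1 + wd) * (θ 1 * θt 1)
      + 2 / (9 * c 1) * ((3 * w 1 ^ 2 + 3 * w 1 * θ 1 + θ 1 ^ 2) * (θ 1 * θt 1)
        + wt 1 * θ 1 ^ 2 * (3 * w 1 + θ 1))))

/-- The sides differ by the square (θ(θ + 3w))²/3, so the cubic term of indefinite sign is harmless.
The remaining θ⁴/6, multiplied by 2/(9c_i), is exactly a third of the quartic term of `E₂`. -/
theorem errQuartic_ge (w θ : ℝ) :
    1 / 6 * θ ^ 4 ≤ 3 * w ^ 2 * θ ^ 2 + 2 * w * θ ^ 3 + 1 / 2 * θ ^ 4 := by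
  have e : 3 * w ^ 2 * θ ^ 2 + 2 * w * θ ^ 3 + 1 / 2 * θ ^ 4 - 1 / 6 * θ ^ 4
      = 1 / 3 * (θ * (θ + 3 * w)) ^ 2 := by ring
  nlinarith [sq_nonneg (θ * (θ + 3 * w))]

theorem errQuartic_le {w θ M X : ℝ} (hw : w ^ 2 ≤ M) (hθ : θ ^ 2 ≤ M) (hX : θ ^ 2 ≤ X) :
    3 * w ^ 2 * θ ^ 2 + 2 * w * θ ^ 3 + 1 / 2 * θ ^ 4 ≤ 6 * M * X := by
  have e : 4 * w ^ 2 * θ ^ 2 + 2 * θ ^ 4 - (3 * w ^ 2 * θ ^ 2 + 2 * w * θ ^ 3 + 1 / 2 * θ ^ 4)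
      = (θ * (w - θ)) ^ 2 + 1 / 2 * (θ ^ 2) ^ 2 := by ring
  have h0 : 0 ≤ M := (sq_nonneg _).trans hw
  have h1 : w ^ 2 * θ ^ 2 ≤ M * X := mul_le_mul hw hX (sq_nonneg _) h0
  have h2 : θ ^ 2 * θ ^ 2 ≤ M * X := mul_le_mul hθ hX (sq_nonneg _) h0
  have h3 : θ ^ 4 = θ ^ 2 * θ ^ 2 := by ring
  nlinarith [sq_nonneg (θ * (w - θ)), sq_nonneg (θ ^ 2)]

theorem errEnergy₂_ge {ν wd : ℝ} {c : Fin 2 → ℝ} (hwd : 0 ≤ wd) (hc : ∀ i, 0 < c i)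
    (w θ : ℝ → ℝ) : dissip ν c * xsq θ ≤ errEnergy₂ ν wd c w θ := by
  have h := dissip_mul_xsq_le (ν := ν) (c := c) θ
  have hc0 := hc 0
  have hc1 := hc 1
  have q0 := mul_le_mul_of_nonneg_left (errQuartic_ge (w 0) (θ 0))
    (by positivity : 0 ≤ 2 / (9 * c 0))
  have q1 := mul_le_mul_of_nonneg_left (errQuartic_ge (w 1) (θ 1))
    (by positivity : 0 ≤ 2 / (9 * c 1))
  have a0 : 0 ≤ (1 + wd) * θ 0 ^ 2 := by positivity
  have a1 : 0 ≤ (1 + wd) * θ 1 ^ 2 := by positivity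
  have b0 : 0 ≤ 2 / (9 * c 0) * (1 / 6 * θ 0 ^ 4) := by positivity
  have b1 : 0 ≤ 2 / (9 * c 1) * (1 / 6 * θ 1 ^ 4) := by positivity
  rw [errEnergy₂]
  linarith

theorem le_errEnergy₂ {ν wd : ℝ} {c : Fin 2 → ℝ} (hwd : 0 ≤ wd) (hc : ∀ i, 0 < c i)
    (w θ : ℝ → ℝ) : ν * sqNorm (deriv θ) + 1 / 3 * E₂ wd c θ ≤ errEnergy₂ ν wd c w θ := by
  have hc0 := hc 0
  have hc1 := hc 1
  have q0 := mul_le_mul_of_nonneg_left (errQuartic_ge (w 0) (θ 0))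
    (by positivity : 0 ≤ 2 / (9 * c 0))
  have q1 := mul_le_mul_of_nonneg_left (errQuartic_ge (w 1) (θ 1))
    (by positivity : 0 ≤ 2 / (9 * c 1))
  have a0 : 0 ≤ (c 0 + 1 + wd) * θ 0 ^ 2 := by positivity
  have a1 : 0 ≤ (c 1 + 1 + wd) * θ 1 ^ 2 := by positivity
  have e : ∀ i (s : ℝ), 2 / (9 * c i) * (1 / 6 * s ^ 4) = 1 / 3 * (1 / (9 * c i) * s ^ 2 * s ^ 2) :=
    fun i s => by ring
  rw [e] at q0 q1
  simp only [errEnergy₂, E₂, Fin.sum_univ_two, endpt, Matrix.cons_val_zero, Matrix.cons_val_one]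
  linarith

theorem exists_errEnergy₂_le {ν wd : ℝ} {c : Fin 2 → ℝ} (hν : 0 < ν) (hwd : 0 ≤ wd)
    (hc : ∀ i, 0 < c i) (M : ℝ) (hM : 0 ≤ M) : ∃ C : ℝ, 0 < C ∧ ∀ w θ : ℝ → ℝ,
      w 0 ^ 2 ≤ M → w 1 ^ 2 ≤ M → θ 0 ^ 2 ≤ M → θ 1 ^ 2 ≤ M →
      errEnergy₂ ν wd c w θ ≤ C * xsq θ := by
  have hc0 := hc 0
  have hc1 := hc 1
  refine ⟨ν + ((c 0 + 1 + wd) + 2 / (9 * c 0) * (6 * M)) + ((c 1 + 1 + wd) + 2 / (9 * c 1) * (6 * M)),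
    by positivity, fun w θ h0 h1 h2 h3 => ?_⟩
  have q0 := mul_le_mul_of_nonneg_left (errQuartic_le h0 h2 (sq_zero_le_xsq θ))
    (by positivity : 0 ≤ 2 / (9 * c 0))
  have q1 := mul_le_mul_of_nonneg_left (errQuartic_le h1 h3 (sq_one_le_xsq θ))
    (by positivity : 0 ≤ 2 / (9 * c 1))
  have a0 := mul_le_mul_of_nonneg_left (sq_zero_le_xsq θ) (by positivity : 0 ≤ c 0 + 1 + wd)
  have a1 := mul_le_mul_of_nonneg_left (sq_one_le_xsq θ) (by positivity : 0 ≤ c 1 + 1 + wd)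
  have n1 := mul_le_mul_of_nonneg_left (sqNorm_deriv_le_xsq θ) hν.le
  rw [errEnergy₂]
  linarith

/-- The boundary terms in the estimate of the time derivative of the error. -/
theorem exists_boundary_rate_le {ν κ δ m : ℝ} (hν : 0 < ν) (hκ : 0 < κ) (hδ : 0 < δ) (hm : 0 < m)
    (M A : ℝ) (hM : 0 ≤ M) (hA : 0 ≤ A) : ∃ C : ℝ, 0 < C ∧
    ∀ μ w wt q θ θt η a b H X Y D : ℝ, 0 < μ → w ^ 2 ≤ M * a → η ^ 2 ≤ M * a → θ ^ 2 ≤ M * a →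
      0 ≤ a → a ≤ A → 0 ≤ b → η ^ 2 ≤ H → q ^ 2 ≤ 10 * (a * b) → θ ^ 2 ≤ X → m * X ≤ Y →
      μ * θt ^ 2 ≤ D →
      -(μ / ν * (κ * (q * θ) * θt)) - κ * (η * (η - 3 * w - 2 * θ) * (θ * θt))
          + κ * (wt * θ ^ 2 * (3 * w + θ))
        ≤ 2 * (δ * D)
          + C * (((1 + μ) * wt ^ 2 + a / (1 + μ) + μ * b) * Y + H / μ) := by
  refine ⟨κ ^ 2 / ν ^ 2 * 10 * A / m / (4 * δ) + 42 * κ ^ 2 * M ^ 2 * A ^ 2 / (4 * δ)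
    + κ / m * (10 * M + 1), by positivity,
    fun μ w wt q θ θt η a b H X Y D hμ hw hη hθ ha haA hb hH hq hX hY hD => ?_⟩
  have D0 : 0 ≤ D := (by positivity : 0 ≤ μ * θt ^ 2).trans hD
  have X0 : 0 ≤ X := (sq_nonneg _).trans hX
  have H0 : 0 ≤ H := (sq_nonneg _).trans hH
  have Y0 : 0 ≤ Y := (by positivity : 0 ≤ m * X).trans hY
  have hXY : θ ^ 2 ≤ Y / m := by
    rw [le_div_iff₀ hm]; linarith [mul_le_mul_of_nonneg_left hX hm.le]
  have MaA : M * a ≤ M * A := mul_le_mul_of_nonneg_left haA hM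
  have t3 : |μ / ν * (κ * (q * θ) * θt)|
      ≤ δ * D + κ ^ 2 / ν ^ 2 * 10 * A / m / (4 * δ) * (μ * b * Y) := by
    refine (abs_le_of_sq_le_mul hδ D0 (q := κ ^ 2 / ν ^ 2 * 10 * A / m * (μ * b * Y))
      (by positivity) ?_).trans_eq (by ring)
    calc _ = (μ * θt ^ 2) * (κ ^ 2 / ν ^ 2 * (μ * (q ^ 2 * θ ^ 2))) := by field_simp
      _ ≤ D * (κ ^ 2 / ν ^ 2 * (μ * (10 * (A * b) * (Y / m)))) := by
        gcongr
        exact hq.trans (by gcongr)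
      _ = _ := by ring
  -- This is the price for replacing the coefficient w_h² + w_h w + w² by its value at η = 0, the
  -- one that fits the quartic energy. It is proportional to η and hence a source.
  have t4 : |κ * (η * (η - 3 * w - 2 * θ) * (θ * θt))|
      ≤ δ * D + 42 * κ ^ 2 * M ^ 2 * A ^ 2 / (4 * δ) * (H / μ) := by
    refine (abs_le_of_sq_le_mul hδ D0 (q := 42 * κ ^ 2 * M ^ 2 * A ^ 2 * (H / μ))
      (by positivity) ?_).trans_eq (by ring)
    have s : (η - 3 * w - 2 * θ) ^ 2 ≤ 42 * (M * A) := by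
      nlinarith [sq_add_three_le η (-(3 * w)) (-(2 * θ))]
    calc _ = (μ * θt ^ 2) * (κ ^ 2 / μ * (η ^ 2 * ((η - 3 * w - 2 * θ) ^ 2 * θ ^ 2))) := by
          field_simp
      _ ≤ D * (κ ^ 2 / μ * (H * (42 * (M * A) * (M * A)))) := by
        gcongr
        exact hθ.trans MaA
      _ = _ := by ring
  have t5 : κ * (wt * θ ^ 2 * (3 * w + θ))
      ≤ κ / m * (10 * M + 1) * (((1 + μ) * wt ^ 2 + a / (1 + μ)) * Y) := by
    have s : wt * (3 * w + θ) ≤ (10 * M + 1) * ((1 + μ) * wt ^ 2 + a / (1 + μ)) := by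
      -- The weight 1+μ splits the product into (1+μ)w_t² and a/(1+μ); these are the two
      -- combinations whose time integrals are controlled independently of the weight α.
      have h1 := abs_mul_le_young (a := wt) (b := 3 * w + θ) (k := 1 + μ) (by positivity)
      have h2 : (3 * w + θ) ^ 2 ≤ 20 * (M * a) := by nlinarith [sq_nonneg (3 * w - θ)]
      have h3 : 1 / (2 * (1 + μ)) * (3 * w + θ) ^ 2 ≤ 1 / (2 * (1 + μ)) * (20 * (M * a)) := by gcongr
      have h4 : 1 / (2 * (1 + μ)) * (20 * (M * a)) = 10 * M * (a / (1 + μ)) := by field_simp; ring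
      have h5 : 0 ≤ a / (1 + μ) := by positivity
      have h6 : 0 ≤ (1 + μ) * wt ^ 2 := by positivity
      have h7 : 0 ≤ 10 * M * ((1 + μ) * wt ^ 2) := by positivity
      linarith [le_abs_self (wt * (3 * w + θ))]
    calc _ = κ * θ ^ 2 * (wt * (3 * w + θ)) := by ring
      _ ≤ κ * θ ^ 2 * ((10 * M + 1) * ((1 + μ) * wt ^ 2 + a / (1 + μ))) := by gcongr
      _ ≤ κ * (Y / m) * ((10 * M + 1) * ((1 + μ) * wt ^ 2 + a / (1 + μ))) := by gcongr
      _ = _ := by ring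
  rw [abs_le] at t3 t4
  have G1 : 0 ≤ (1 + μ) * wt ^ 2 + a / (1 + μ) := by positivity
  generalize (1 + μ) * wt ^ 2 + a / (1 + μ) = G at *
  have hHμ : 0 ≤ H / μ := by positivity
  have c3 : 0 ≤ κ ^ 2 / ν ^ 2 * 10 * A / m / (4 * δ) := by positivity
  have c4 : 0 ≤ 42 * κ ^ 2 * M ^ 2 * A ^ 2 / (4 * δ) := by positivity
  have c5 : 0 ≤ κ / m * (10 * M + 1) := by positivity
  generalize κ ^ 2 / ν ^ 2 * 10 * A / m / (4 * δ) = C3 at *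
  generalize 42 * κ ^ 2 * M ^ 2 * A ^ 2 / (4 * δ) = C4 at *
  generalize κ / m * (10 * M + 1) = C5 at *
  have e1 : 0 ≤ C3 * (G * Y + H / μ) := by positivity
  have e2 : 0 ≤ C4 * ((G + μ * b) * Y) := by positivity
  have e3 : 0 ≤ C5 * (μ * b * Y + H / μ) := by positivity
  linarith [t3.1, t4.1]

theorem sq_le_of_sum_sq_le {v w η a M : ℝ} (hM : 0 ≤ M) (h : v ^ 2 + w ^ 2 ≤ a)
    (hη : η ^ 2 ≤ M * a) :
    w ^ 2 ≤ (2 * M + 5) * a ∧ (v - w + η) ^ 2 ≤ (2 * M + 5) * a := by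
  have a0 : 0 ≤ a := (by positivity : 0 ≤ v ^ 2 + w ^ 2).trans h
  have h1 : 0 ≤ M * a := mul_nonneg hM a0
  have h2 := sq_nonneg v
  constructor
  · linarith
  · have h3 := sq_nonneg (v - w - η)
    have h4 := sq_nonneg (v + w)
    linarith

set_option maxHeartbeats 1000000 in
-- The error equation is tested with θ_t. Up to a remainder proportional to η, the feedback
-- difference is 3w²θ + 3wθ² + θ³, whose primitive in θ is the quartic part of the energy. The
-- dependence of that primitive on w costs a term with the trace of w_t, which is the critical one
-- for uniformity in μ.
theorem exists_errEnergy₂'_le {ν wd lam : ℝ} {c : Fin 2 → ℝ} (hν : 0 < ν) (hwd : 0 ≤ wd)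
    (hlam : 0 < lam) (hc : ∀ i, 0 < c i) (A M : ℝ) (hA : 0 ≤ A) (hM : 0 ≤ M) : ∃ C : ℝ, 0 < C ∧
    ∀ (μ α : ℝ) (w wt wh wht p pt θ θt η ηt : ℝ → ℝ), 0 < μ → AdmissibleRate ν μ wd c α →
      ErrorData ν μ wd lam c w wt wh wht p pt θ θt η ηt → xsq w + xsq wh ≤ A →
      η 0 ^ 2 ≤ M * (xsq w + xsq wh) → η 1 ^ 2 ≤ M * (xsq w + xsq wh) →
      errEnergy₂' ν wd c w wt θ θt + coer ν * rate₂ μ θt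
        ≤ (C * ((1 + μ) * (wt 0 ^ 2 + wt 1 ^ 2) + (xsq w + xsq wh) / (1 + μ)
              + μ * (xsq wt + xsq wht)) - 2 * α) * errEnergy₂ ν wd c w θ
          + C * (xsq θ / (1 + μ) + (1 + μ) * hsq ηt
            + (1 / μ + μ * (xsq wt + xsq wht)) * hsq η) := by
  have hc0 := hc 0
  have hc1 := hc 1
  obtain ⟨S, hS, HS⟩ := exists_residual_bound hν hwd hlam hc A hA
  have m0 := dissip_pos hν hc
  have k0 := coer_pos hν
  have hYge := fun w θ => errEnergy₂_ge (ν := ν) hwd hc w θ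
  generalize dissip ν c = m at *
  -- After reserving the dissipation on the left, the coercive part leaves 20 copies of δ · `rate₂`.
  -- The absorbed terms need 19 of them: 11 from convection and residuals, 8 from the two boundary
  -- estimates.
  obtain ⟨δ, hδ⟩ : ∃ δ, δ = coer ν / 20 := ⟨_, rfl⟩
  have δ0 : 0 < δ := by rw [hδ]; positivity
  obtain ⟨L, hL, HL⟩ := exists_errEnergy₂_le hν hwd hc ((2 * M + 5) * A) (by positivity)
  obtain ⟨κ₀, hκ₀⟩ : ∃ κ, κ = 2 / (9 * c 0) := ⟨_, rfl⟩
  obtain ⟨κ₁, hκ₁⟩ : ∃ κ, κ = 2 / (9 * c 1) := ⟨_, rfl⟩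
  have κ₀0 : 0 < κ₀ := by rw [hκ₀]; positivity
  have κ₁0 : 0 < κ₁ := by rw [hκ₁]; positivity
  obtain ⟨C₀, hC₀, H₀⟩ := exists_boundary_rate_le hν κ₀0 δ0 m0 (2 * M + 5) A (by positivity) hA
  obtain ⟨C₁, hC₁, H₁⟩ := exists_boundary_rate_le hν κ₁0 δ0 m0 (2 * M + 5) A (by positivity) hA
  refine ⟨2 * C₀ + 2 * C₁ + 2 * S / δ + ((1 + wd) ^ 2 + 8 * A) / δ + ν * L, by positivity,
    fun μ α w wt wh wht p pt θ θt η ηt hμ hα h hX e0 e1 => ?_⟩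
  obtain ⟨r1, r2, r3, r4⟩ := HS μ w wt wh wht p pt θ θt η ηt hμ h hX
  have hθ := h.inH1_θ
  have hθt := h.inH1_θt
  have hid := h.identity (Or.inr rfl)
  have a0 : 0 ≤ xsq w + xsq wh := add_nonneg (xsq_nonneg w) (xsq_nonneg wh)
  have b0 : 0 ≤ xsq wt + xsq wht := add_nonneg (xsq_nonneg wt) (xsq_nonneg wht)
  have s0 := ErrorData.sum_sq_le h.hw h.hwh (x := 0) (by simp)
  have s1 := ErrorData.sum_sq_le h.hw h.hwh (x := 1) (by simp)
  have qt0 := cubeQuot'_sq_le s0 (by linarith [sq_zero_le_xsq wt, sq_zero_le_xsq wht] :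
      wht 0 ^ 2 + wt 0 ^ 2 ≤ xsq wt + xsq wht)
  have qt1 := cubeQuot'_sq_le s1 (by linarith [sq_one_le_xsq wt, sq_one_le_xsq wht] :
      wht 1 ^ 2 + wt 1 ^ 2 ≤ xsq wt + xsq wht)
  have hθx : ∀ x, θ x = wh x - w x + η x := fun x => by rw [h.hθ, h.hη]; ring
  have ma : M * (xsq w + xsq wh) ≤ (2 * M + 5) * (xsq w + xsq wh) :=
    mul_le_mul_of_nonneg_right (by linarith) a0
  obtain ⟨wM0, θM0⟩ := sq_le_of_sum_sq_le hM s0 e0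
  obtain ⟨wM1, θM1⟩ := sq_le_of_sum_sq_le hM s1 e1
  rw [← hθx] at θM0 θM1
  have maA := mul_le_mul_of_nonneg_left hX (by positivity : 0 ≤ 2 * M + 5)
  have hYle := HL w θ (wM0.trans maA) (wM1.trans maA) (θM0.trans maA) (θM1.trans maA)
  have hYge := hYge w θ
  have hx0 := H₀ μ (w 0) (wt 0) _ (θ 0) (θt 0) (η 0) _ _ _ _ _ (rate₂ μ θt) hμ wM0 (e0.trans ma)
    θM0 a0 hX b0 (sq_zero_le_hsq η) qt0 (sq_zero_le_xsq θ) hYge (by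
      rw [rate₂]
      linarith [sqNorm_nonneg θt, mul_le_mul_of_nonneg_left (sq_zero_le_xsq θt) hμ.le])
  have hx1 := H₁ μ (w 1) (wt 1) _ (θ 1) (θt 1) (η 1) _ _ _ _ _ (rate₂ μ θt) hμ wM1 (e1.trans ma)
    θM1 a0 hX b0 (sq_one_le_hsq η) qt1 (sq_one_le_xsq θ) hYge (by
      rw [rate₂]
      linarith [sqNorm_nonneg θt, mul_le_mul_of_nonneg_left (sq_one_le_xsq θt) hμ.le])
  clear H₀ H₁ HL HS wM0 wM1 θM0 θM1 maA e0 e1 s0 s1 ma qt0 qt1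
  -- Obtained by inserting w_h = w + θ - η: the part at η = 0 matches the derivative of the quartic
  -- energy.
  have hQe0 : cubeQuot (wh 0) (w 0) = 3 * w 0 ^ 2 + 3 * w 0 * θ 0 + θ 0 ^ 2
      + η 0 * (η 0 - 3 * w 0 - 2 * θ 0) := by rw [hθx, cubeQuot]; ring
  have hQe1 : cubeQuot (wh 1) (w 1) = 3 * w 1 ^ 2 + 3 * w 1 * θ 1 + θ 1 ^ 2
      + η 1 * (η 1 - 3 * w 1 - 2 * θ 1) := by rw [hθx, cubeQuot]; ring
  obtain ⟨iT, nT⟩ := ErrorData.sqNorm_convT_le h.hw h.hwh hθ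
  have iF : InL2 (resF ν μ lam η ηt) := h.resF_inL2
  have iK : InL2 (resK wd w wh η) := ErrorData.resK_inL2 h.hw h.hwh h.inH1_η
  have cD := ip_sq_le hθ.deriv_inL2 hθt.inL2
  have cT := ip_sq_le iT hθt.inL2
  have cF := ip_sq_le iF hθt.inL2
  have cK := ip_sq_le iK hθt.deriv_inL2
  have hQ0 := cubeQuot_nonneg (wh 0) (w 0)
  have hQ1 := cubeQuot_nonneg (wh 1) (w 1)
  have hk := coer_mul_rate₂_le hν hμ hwd hc θt
  have hr := rate₂_ge hμ hθt
  have hrX : μ * xsq θt ≤ rate₂ μ θt := by rw [rate₂]; linarith [sqNorm_nonneg θt]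
  have hα1 := (hα.mul_le hν hμ hwd hc).1
  have hα0 := hα.1
  have X0 := xsq_nonneg θ
  have hn1X := sqNorm_deriv_le_xsq θ
  have hn0t := sqNorm_nonneg θt
  have hn1t := sqNorm_nonneg (deriv θt)
  have hn1tX := sqNorm_deriv_le_xsq θt
  have hs0 := sq_zero_le_xsq θt
  have hs1 := sq_one_le_xsq θt
  have Xt0 := xsq_nonneg θt
  have hH := hsq_nonneg η
  have hHt := hsq_nonneg ηt
  rw [← sqNorm_eq_ip, ← sqNorm_eq_ip] at hid
  rw [errEnergy₂']
  rw [← hκ₀, ← hκ₁] at hid ⊢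
  have D0 := rate₂_nonneg hμ θt
  have Y0 : 0 ≤ errEnergy₂ ν wd c w θ := (by positivity : 0 ≤ m * xsq θ).trans hYge
  have wt0 := sq_nonneg (wt 0)
  have wt1 := sq_nonneg (wt 1)
  have hQt0 : 0 ≤ μ / ν * (κ₀ * cubeQuot (wh 0) (w 0) * θt 0 ^ 2) := by positivity
  have hQt1 : 0 ≤ μ / ν * (κ₁ * cubeQuot (wh 1) (w 1) * θt 1 ^ 2) := by positivity
  generalize errEnergy₂ ν wd c w θ = Y at *
  generalize rate₂ μ θt = D at *
  generalize xsq w + xsq wh = a at *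
  generalize xsq wt + xsq wht = b at *
  generalize resB ν μ wd (c 0) (w 0) (wt 0) (wh 0) (wht 0) (η 0) (ηt 0) - resK wd w wh η 0 = ρ₀ at *
  generalize resB ν μ wd (c 1) (w 1) (wt 1) (wh 1) (wht 1) (η 1) (ηt 1) + resK wd w wh η 1 = ρ₁ at *
  generalize ip (deriv θ) θt = zD at *
  generalize ip (convT w wh θ) θt = zT at *
  generalize ip (resF ν μ lam η ηt) θt = zF at *
  generalize ip (resK wd w wh η) (deriv θt) = zK at *
  generalize cubeQuot' (wh 0) (w 0) (wht 0) (wt 0) = t0 at *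
  generalize cubeQuot' (wh 1) (w 1) (wht 1) (wt 1) = t1 at *
  generalize cubeQuot (wh 0) (w 0) = Q0 at *
  generalize cubeQuot (wh 1) (w 1) = Q1 at *
  generalize w 0 = w₀ at *
  generalize w 1 = w₁ at *
  generalize wt 0 = wt₀ at *
  generalize wt 1 = wt₁ at *
  generalize θ 0 = θ₀ at *
  generalize θ 1 = θ₁ at *
  generalize η 0 = η₀ at *
  generalize η 1 = η₁ at *
  generalize θt 0 = θt₀ at *
  generalize θt 1 = θt₁ at *
  generalize ip (deriv θ) (deriv θt) = I₁ at *
  generalize sqNorm (convT w wh θ) = nT' at *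
  generalize sqNorm (resF ν μ lam η ηt) = nF at *
  generalize sqNorm (resK wd w wh η) = nK at *
  generalize hsq η = H at *
  generalize hsq ηt = Ht at *
  generalize sqNorm (deriv θ) = n₁ at *
  generalize sqNorm θt = n₀t at *
  generalize sqNorm (deriv θt) = n₁t at *
  generalize xsq θ = X at *
  generalize xsq θt = Xt at *
  clear h hθ hθt iT iF iK hα hθx
  generalize coer ν = k at *
  have hD1 : n₀t ≤ D / (1 + μ) := by rw [le_div_iff₀ (by positivity)]; linarith
  have hDμ : Xt ≤ D / μ := by rw [le_div_iff₀ hμ]; linarith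
  obtain ⟨f, hf⟩ : ∃ f, f = (1 + μ) * Ht + (1 / μ + μ * b) * H := ⟨_, rfl⟩
  have f0 : 0 ≤ f := by rw [hf]; positivity
  have Sf0 : 0 ≤ S * f := by positivity
  have aux : ∀ {z p q r : ℝ}, z ^ 2 ≤ p * q → 0 ≤ r → p * q ≤ D * r →
      |z| ≤ δ * D + r / (4 * δ) := fun hz hr hp => abs_le_of_sq_le_mul δ0 D0 hr (hz.trans hp)
  have zD_le : |(1 + wd) * zD| ≤ δ * D + (1 + wd) ^ 2 * (X / (1 + μ)) / (4 * δ) := by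
    refine abs_le_of_sq_le_mul δ0 D0 (by positivity) ?_
    rw [mul_pow]
    calc (1 + wd) ^ 2 * zD ^ 2 ≤ (1 + wd) ^ 2 * (X * (D / (1 + μ))) :=
          mul_le_mul_of_nonneg_left (cD.trans (mul_le_mul hn1X hD1 hn0t X0)) (by positivity)
      _ = _ := by ring
  have zT_le : |zT| ≤ δ * D + 8 * A * (X / (1 + μ)) / (4 * δ) := by
    refine abs_le_of_sq_le_mul δ0 D0 (by positivity) ?_
    calc zT ^ 2 ≤ nT' * n₀t := cT
      _ ≤ 8 * A * X * (D / (1 + μ)) := mul_le_mul (nT.trans (by gcongr)) hD1 hn0t (by positivity)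
      _ = _ := by ring
  have zF_le : |zF| ≤ δ * D + S * f / (4 * δ) := by
    refine abs_le_of_sq_le_mul δ0 D0 Sf0 ?_
    have : ((1 + μ) ^ 2 * Ht + H) / (1 + μ) ≤ f := by
      have e : ((1 + μ) ^ 2 * Ht + H) / (1 + μ) = (1 + μ) * Ht + 1 / (1 + μ) * H := by field_simp
      have : 1 / (1 + μ) ≤ 1 / μ := by gcongr; linarith
      have := mul_le_mul_of_nonneg_right this hH
      have : 0 ≤ μ * b * H := by positivity
      rw [e, hf]; linarith
    calc zF ^ 2 ≤ nF * n₀t := cF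
      _ ≤ S * ((1 + μ) ^ 2 * Ht + H) * (D / (1 + μ)) := mul_le_mul r1 hD1 hn0t (by positivity)
      _ = D * (S * (((1 + μ) ^ 2 * Ht + H) / (1 + μ))) := by ring
      _ ≤ _ := by gcongr
  have fB : (μ ^ 2 * Ht + (1 + μ ^ 2 * b) * H) / μ ≤ f := by
    have e : (μ ^ 2 * Ht + (1 + μ ^ 2 * b) * H) / μ = μ * Ht + (1 / μ + μ * b) * H := by
      field_simp
    rw [e, hf]; linarith
  have bd : ∀ {z s : ℝ}, z ^ 2 ≤ S * (μ ^ 2 * Ht + (1 + μ ^ 2 * b) * H) * s → 0 ≤ s → s ≤ Xt →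
      |z| ≤ δ * D + S * f / (4 * δ) := fun {z s} hz hs0 hs => by
    refine abs_le_of_sq_le_mul δ0 D0 Sf0 ?_
    calc z ^ 2 ≤ _ := hz
      _ ≤ S * (μ ^ 2 * Ht + (1 + μ ^ 2 * b) * H) * (D / μ) := by
        gcongr
        exact hs.trans hDμ
      _ = D * (S * ((μ ^ 2 * Ht + (1 + μ ^ 2 * b) * H) / μ)) := by ring
      _ ≤ _ := by gcongr
  have z0_le := bd (z := ρ₀ * θt₀) ((mul_pow _ _ 2).trans_le
    (mul_le_mul_of_nonneg_right r2 (sq_nonneg _))) (sq_nonneg _) hs0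
  have z1_le := bd (z := ρ₁ * θt₁) ((mul_pow _ _ 2).trans_le
    (mul_le_mul_of_nonneg_right r3 (sq_nonneg _))) (sq_nonneg _) hs1
  have zK_le : |zK| ≤ δ * D + S * f / (4 * δ) := by
    refine bd (cK.trans ?_) hn1t hn1tX
    refine mul_le_mul_of_nonneg_right (r4.trans (mul_le_mul_of_nonneg_left ?_ hS.le)) hn1t
    have : 0 ≤ μ ^ 2 * Ht + μ ^ 2 * b * H := by positivity
    linarith
  clear bd aux cD cT cF cK r1 r2 r3 r4 nT fB
  have hαY : 2 * α * Y ≤ ν * L * (X / (1 + μ)) := by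
    have h1 : α ≤ ν / 2 / (1 + μ) := by rw [le_div_iff₀ (by positivity)]; exact hα1
    calc 2 * α * Y ≤ 2 * (ν / 2 / (1 + μ)) * (L * X) := by gcongr
      _ = _ := by ring
  have hfH : H / μ ≤ f := by
    have e : H / μ = 1 / μ * H := by ring
    have : 0 ≤ (1 + μ) * Ht + μ * b * H := by positivity
    rw [hf, e]; linarith
  obtain ⟨G, hG⟩ : ∃ G, G = (1 + μ) * (wt₀ ^ 2 + wt₁ ^ 2) + a / (1 + μ) + μ * b := ⟨_, rfl⟩
  obtain ⟨ξ, hξ⟩ : ∃ ξ, ξ = X / (1 + μ) := ⟨_, rfl⟩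
  have ξ0 : 0 ≤ ξ := by rw [hξ]; positivity
  have G0 : 0 ≤ G := by rw [hG]; positivity
  have hG0 : ((1 + μ) * wt₀ ^ 2 + a / (1 + μ) + μ * b) * Y ≤ G * Y := by
    refine mul_le_mul_of_nonneg_right ?_ Y0
    have : 0 ≤ (1 + μ) * wt₁ ^ 2 := by positivity
    rw [hG]; linarith
  have hG1 : ((1 + μ) * wt₁ ^ 2 + a / (1 + μ) + μ * b) * Y ≤ G * Y := by
    refine mul_le_mul_of_nonneg_right ?_ Y0
    have : 0 ≤ (1 + μ) * wt₀ ^ 2 := by positivity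
    rw [hG]; linarith
  have hx0' := hx0.trans (by gcongr : _ ≤ 2 * (δ * D) + C₀ * (G * Y + f))
  have hx1' := hx1.trans (by gcongr : _ ≤ 2 * (δ * D) + C₁ * (G * Y + f))
  clear hx0 hx1
  have ef : S * f / (4 * δ) = S / δ * f / 4 := by field_simp
  have ed : (1 + wd) ^ 2 * ξ / (4 * δ) = (1 + wd) ^ 2 / δ * ξ / 4 := by field_simp
  have et : 8 * A * ξ / (4 * δ) = 8 * A / δ * ξ / 4 := by field_simp
  have eX : X / (1 + μ) + (1 + μ) * Ht + (1 / μ + μ * b) * H = ξ + f := by rw [hξ, hf]; ring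
  rw [eX, ← hG]
  rw [← hξ] at zD_le zT_le hαY
  rw [ef] at zF_le z0_le z1_le zK_le
  rw [ed] at zD_le
  rw [et] at zT_le
  rw [hQe0, hQe1] at hid
  rw [hQe0] at hQt0
  rw [hQe1] at hQt1
  have eC : (2 * C₀ + 2 * C₁ + 2 * S / δ + ((1 + wd) ^ 2 + 8 * A) / δ + ν * L)
      = 2 * C₀ + 2 * C₁ + 2 * (S / δ) + (1 + wd) ^ 2 / δ + 8 * A / δ + ν * L := by ring
  rw [eC]
  have c1 : 0 ≤ S / δ := by positivity
  have c2 : 0 ≤ (1 + wd) ^ 2 / δ := by positivity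
  have c3 : 0 ≤ 8 * A / δ := by positivity
  have c4 : 0 ≤ ν * L := by positivity
  generalize S / δ = C3 at *
  generalize (1 + wd) ^ 2 / δ = C4 at *
  generalize 8 * A / δ = C5 at *
  generalize ν * L = C6 at *
  have GY0 : 0 ≤ G * Y := by positivity
  have m1 : 0 ≤ (2 * C3 + C4 + C5 + C6) * (G * Y) := by positivity
  have m2 : 0 ≤ (C4 + C5 + C6) * f := by positivity
  have m3 : 0 ≤ (2 * C₀ + 2 * C₁ + 2 * C3) * ξ := by positivity
  have m4 : 0 ≤ C3 * f := by positivity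
  have m5 : 0 ≤ C4 * ξ := by positivity
  have m6 : 0 ≤ C5 * ξ := by positivity
  rw [abs_le] at zD_le zT_le zF_le zK_le z0_le z1_le
  have eδ : 20 * (δ * D) = k * D := by rw [hδ]; ring
  have δD0 : 0 ≤ δ * D := by positivity
  generalize δ * D = δD at *
  have d1 := zD_le.1
  have d2 := zT_le.1
  have d3 := zF_le.2
  have d4 := zK_le.1
  have d5 := z0_le.2
  have d6 := z1_le.2
  clear zD_le zT_le zF_le zK_le z0_le z1_le hf hG hξ hδ hκ₀ hκ₁ ef ed et eX eC hG0 hG1 hfH hDμ hD1 hX hn1X hs0 hs1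
  linarith

/-! ### Spatial regularity -/

/-- A function whose weak derivative is `-r` in the sense of natural boundary conditions is the
primitive of `r`. -/
theorem ae_eq_primitive_of_weak {F r : ℝ → ℝ} (hF : InL2 F) (hr : InL2 r) {b₀ b₁ : ℝ}
    (h : ∀ χ, InH1 χ → ip F (deriv χ) + ip r χ + b₀ * χ 0 + b₁ * χ 1 = 0) :
    (F =ᵐ[volume.restrict (Ioo (0 : ℝ) 1)] fun x => b₀ + ∫ y in (0 : ℝ)..x, r y) ∧
      b₀ + ∫ y in (0 : ℝ)..1, r y = -b₁ := by
  obtain ⟨hR, hRd⟩ := inH1_of_primitive hr (f := fun x => b₀ + ∫ y in (0 : ℝ)..x, r y)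
    (fun x _ => by simp)
  set ρ : ℝ → ℝ := fun x => b₀ + ∫ y in (0 : ℝ)..x, r y with hρ
  -- The constant test function fixes the value of the primitive at the right end point. The test
  -- function χ below, a primitive of F - ρ, then gives ‖F - ρ‖² = 0.
  have e1 : ρ 1 = -b₁ := by
    have := h (fun _ => 1) (inH1_const 1)
    simp only [deriv_const', ip, mul_zero, mul_one, intervalIntegral.integral_zero] at this
    simp only [hρ]; linarith
  refine ⟨?_, e1⟩
  have hψ : InL2 (fun x => F x - ρ x) := hF.fun_sub hR.inL2
  obtain ⟨hχ, hχd⟩ := inH1_of_primitive hψ (f := fun x => ∫ y in (0 : ℝ)..x, (F y - ρ y))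
    (fun x _ => by simp)
  set χ : ℝ → ℝ := fun x => ∫ y in (0 : ℝ)..x, (F y - ρ y) with hχdef
  have e2 := h χ hχ
  have e3 := hR.ip_deriv hχ
  have e4 : ip r χ = ip (deriv ρ) χ := ip_congr hRd.symm (Filter.EventuallyEq.refl _ _)
  have χ0 : χ 0 = 0 := by simp [hχdef]
  have e5 : ip (fun x => F x - ρ x) (deriv χ) = 0 := by
    rw [ip_sub_left hF hR.inL2 hχ.2]
    rw [e4] at e2
    rw [χ0] at e2 e3
    rw [e1] at e3
    linarith
  rw [ip_congr (Filter.EventuallyEq.refl _ _) hχd, ← sqNorm_eq_ip, sqNorm, unitIntegral_eq] at e5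
  have e6 := (integral_eq_zero_iff_of_nonneg (fun x => sq_nonneg _) hψ.integrable_sq).1 e5
  filter_upwards [e6] with x hx
  have : F x - ρ x = 0 := by simpa using hx
  linarith

/-- The outgoing boundary flux of the feedback law. -/
def flux (ν wd ci s : ℝ) : ℝ := 1 / ν * ((ci + 1 + wd) * s + 2 / (9 * ci) * s ^ 3)

/-- The derivative of `flux`. -/
def flux' (ν wd ci s : ℝ) : ℝ := 1 / ν * ((ci + 1 + wd) + 3 * (2 / (9 * ci)) * s ^ 2)

/-- The part of the equation that does not contain second space derivatives. -/
def lowerPart (wd : ℝ) (w wt : ℝ → ℝ) (x : ℝ) : ℝ := wt x + (1 + wd + w x) * deriv w x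

theorem InH1.convective_inL2 {w : ℝ → ℝ} (hw : InH1 w) (wd : ℝ) :
    InL2 (fun x => (1 + wd + w x) * deriv w x) :=
  InL2.bdd_mul (continuousOn_const.add hw.continuousOn) hw.2

theorem lowerPart_inL2 {w wt : ℝ → ℝ} (hw : InH1 w) (hwt : InL2 wt) (wd : ℝ) :
    InL2 (lowerPart wd w wt) := hwt.fun_add (hw.convective_inL2 wd)

/-- Since 2/(3c_i) is three times 2/(9c_i), the boundary rate terms are μ times the time derivative
of ν^{-1} times the feedback, that is, of `flux`. Interior and boundary thus have the common
structure μ∂_t + ν. -/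
theorem weakForm_eq_lowerPart {ν μ wd : ℝ} {c : Fin 2 → ℝ} {w wt χ : ℝ → ℝ} (hν : 0 < ν)
    (hw : InH1 w) (hwt : InH1 wt) (hχ : InH1 χ) :
    weakForm ν μ wd c w wt χ = μ * ip (deriv wt) (deriv χ) + ν * ip (deriv w) (deriv χ)
      + ip (lowerPart wd w wt) χ
      + (μ * (flux' ν wd (c 0) (w 0) * wt 0) + ν * flux ν wd (c 0) (w 0)) * χ 0
      + (μ * (flux' ν wd (c 1) (w 1) * wt 1) + ν * flux ν wd (c 1) (w 1)) * χ 1 := by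
  have h1 : ip (lowerPart wd w wt) χ = ip wt χ + ((1 + wd) * ip (deriv w) χ
      + ip (fun x => w x * deriv w x) χ) := by
    have i1 : InL2 (fun x => (1 + wd) * deriv w x) := hw.deriv_inL2.const_mul _
    have i2 : InL2 (fun x => w x * deriv w x) := InL2.bdd_mul hw.continuousOn hw.2
    rw [← ip_const_mul_left, ← ip_add_left i1 i2 hχ.inL2,
      ← ip_add_left hwt.inL2 (i1.fun_add i2) hχ.inL2]
    congr 1
    funext x
    rw [lowerPart]; ring
  rw [weakForm_eq, h1, flux, flux', flux, flux']
  have q : ∀ i : Fin 2, (2 : ℝ) / (3 * c i) = 3 * (2 / (9 * c i)) := fun i => by ring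
  rw [q, q]
  field_simp
  ring

/-- The second space derivative `Z` of the weak solution `w`, as a curve in `L²(0,1)`. -/
structure SecondDeriv (ν μ wd : ℝ) (c : Fin 2 → ℝ) (w wt Z : ℝ → ℝ → ℝ) (k₀ k₁ : ℝ) : Prop where
  mem : ∀ t, 0 ≤ t → InL2 (Z t)
  -- The numbers k₀ and k₁ measure the failure of the initial value to satisfy the feedback laws;
  -- this defect decays like exp(-νt/μ).
  deriv_eq : ∀ t, 0 ≤ t → deriv (w t) =ᵐ[volume.restrict (Ioo (0 : ℝ) 1)]
    fun x => flux ν wd (c 0) (w t 0) + Real.exp (-(ν / μ * t)) * k₀ + ∫ y in (0 : ℝ)..x, Z t y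
  right_eq : ∀ t, 0 ≤ t →
    flux ν wd (c 0) (w t 0) + Real.exp (-(ν / μ * t)) * k₀ + ∫ y in (0 : ℝ)..1, Z t y
      = -(flux ν wd (c 1) (w t 1) + Real.exp (-(ν / μ * t)) * k₁)
  rate : HasPrim (fun t => sqNorm (Z t))
    (fun t => 2 / μ * (ip (Z t) (lowerPart wd (w t) (wt t)) - ν * sqNorm (Z t)))
  integrable : ∀ T, 0 ≤ T →
    IntervalIntegrable (fun t => sqNorm (lowerPart wd (w t) (wt t))) volume 0 T

theorem HasPrim.exp_mul {y φ : ℝ → ℝ} (h : HasPrim y φ) (a : ℝ) :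
    HasPrim (fun t => Real.exp (a * t) * y t) (fun t => Real.exp (a * t) * (a * y t + φ t)) := by
  have hlin : HasPrim (fun t => a * t) (fun _ => a) := ⟨fun _ _ => by simp, fun t _ => by simp; ring⟩
  refine ((hlin.comp Real.contDiff_exp Real.hasDerivAt_exp).mul h).congr_right ?_
  exact Filter.Eventually.of_forall fun t => by ring

theorem H1Curve.hasPrim_flux {w wt : ℝ → ℝ → ℝ} (h : H1Curve w wt) (ν wd ci : ℝ) {x : ℝ}
    (hx : x ∈ Icc (0 : ℝ) 1) :
    HasPrim (fun t => flux ν wd ci (w t x)) (fun t => flux' ν wd ci (w t x) * wt t x) := by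
  have h1 := h.hasPrim hx
  refine ((((h1.const_mul (ci + 1 + wd)).add ((h1.pow 3).const_mul (2 / (9 * ci)))).const_mul
    (1 / ν))).congr_right ?_
  refine Filter.Eventually.of_forall fun t => ?_
  simp only [flux', Nat.cast_ofNat, Nat.add_one_sub_one]
  ring

/-- On a bounded time interval the continuous function |||w(t)|||² is bounded, so the convective
term is a bounded jointly measurable factor times a jointly square integrable one. -/
theorem H1Curve.exists_lowerPart {w wt : ℝ → ℝ → ℝ} (h : H1Curve w wt) (wd : ℝ) :
    ∃ r : ℝ → ℝ → ℝ, (∀ T, 0 < T → InL2T T r) ∧ ∀ t, 0 ≤ t →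
      r t =ᵐ[volume.restrict (Ioo (0 : ℝ) 1)] lowerPart wd (w t) (wt t) := by
  obtain ⟨p, hp, hpe⟩ := h.memx
  have hx := h.l2x_of hp hpe
  refine ⟨fun t x => wt t x + (1 + wd + (w 0 x + ∫ s in (0 : ℝ)..t, wt s x))
    * (deriv (w 0) x + ∫ s in (0 : ℝ)..t, p s x), fun T hT => ?_, fun t ht => ?_⟩
  · refine (h.mem T hT).add ?_
    have m1 := h.l2.inL2T hT
    have m2 := hx.inL2T hT
    obtain ⟨B, hB⟩ : ∃ B, ∀ t ∈ Icc 0 T, xsq (w t) ≤ B := by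
      obtain ⟨B, hB⟩ := (isCompact_Icc.image_of_continuousOn (h.continuousOn_xsq hT.le)).bddAbove
      exact ⟨B, fun t ht => hB (mem_image_of_mem _ ht)⟩
    have B0 : 0 ≤ B := (xsq_nonneg _).trans (hB 0 ⟨le_rfl, hT.le⟩)
    have mb : MemLp (fun q : ℝ × ℝ => 1 + wd + (w 0 q.2 + ∫ s in (0 : ℝ)..q.1, wt s q.2)) ⊤
        ((volume.restrict (Ioo 0 T)).prod (volume.restrict (Ioo 0 1))) := by
      refine MemLp.of_bound (aestronglyMeasurable_const.add m1.1) (|1 + wd| + √B) ?_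
      rw [Measure.prod_restrict]
      filter_upwards [ae_restrict_mem (measurableSet_Ioo.prod measurableSet_Ioo)] with q hq
      have hq1 := Ioo_subset_Icc_self hq.1
      have hq2 := Ioo_subset_Icc_self hq.2
      rw [← h.eq q.1 hq1.1 q.2 hq2]
      refine (norm_add_le _ _).trans (add_le_add le_rfl ?_)
      exact Real.abs_le_sqrt (((h.h1 _ hq1.1).sq_le_xsq' hq2).trans (hB _ hq1))
    have := m2.mul (p := ⊤) (q := 2) (r := 2) mb
    exact this
  · filter_upwards [hx.eq t ht, ae_restrict_mem measurableSet_Ioo] with x h1 h2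
    rw [lowerPart, h1, h.eq t ht x (Ioo_subset_Icc_self h2)]

/-- With a = ν/μ, the factor exp(at) turns μ∂_t + ν into a total time derivative. Integrating the
weak form in time gives, at every t, a weak identity for exp(at) w_x with natural boundary terms and
a square integrable source, so `ae_eq_primitive_of_weak` identifies w_x as a primitive. -/
theorem exists_secondDeriv {ν μ wd : ℝ} {c : Fin 2 → ℝ} (hν : 0 < ν) (hμ : 0 < μ)
    {w wt : ℝ → ℝ → ℝ} (h : H1Curve w wt)
    (hweak : ∀ᵐ t ∂volume.restrict (Ioi (0 : ℝ)), ∀ χ, InH1 χ → weakForm ν μ wd c (w t) (wt t) χ = 0)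
    {g : ℝ → ℝ} (hg : InH1 g) (hg0 : deriv (w 0) =ᵐ[volume.restrict (Ioo (0 : ℝ) 1)] g) :
    ∃ Z k₀ k₁, SecondDeriv ν μ wd c w wt Z k₀ k₁ ∧ Z 0 =ᵐ[volume.restrict (Ioo (0 : ℝ) 1)] deriv g := by
  obtain ⟨r, hr, hre⟩ := h.exists_lowerPart wd
  set a := ν / μ with ha
  set V : ℝ → ℝ → ℝ := fun s x => 1 / μ * Real.exp (a * s) * r s x with hV
  have hVm : ∀ T, 0 < T → InL2T T V := by
    intro T hT
    have mb : MemLp (fun q : ℝ × ℝ => 1 / μ * Real.exp (a * q.1)) ⊤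
        ((volume.restrict (Ioo 0 T)).prod (volume.restrict (Ioo 0 1))) := by
      refine MemLp.of_bound (Continuous.aestronglyMeasurable (by fun_prop))
        (1 / μ * Real.exp (a * T)) ?_
      rw [Measure.prod_restrict]
      filter_upwards [ae_restrict_mem (measurableSet_Ioo.prod measurableSet_Ioo)] with q hq
      rw [Real.norm_eq_abs, abs_of_pos (by positivity)]
      have : 0 < a := by positivity
      have := hq.1.2.le
      gcongr
    have := (hr T hT).mul (p := ⊤) (q := 2) (r := 2) mb
    exact this
  -- Y is exp(at) times the second space derivative. Its initial value is that of the datum, so it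
  -- is obtained from the equation as an ordinary differential equation in time for almost every x.
  set Y : ℝ → ℝ → ℝ := fun t x => deriv g x + ∫ s in (0 : ℝ)..t, V s x with hY
  have Y0 : Y 0 = deriv g := by funext x; simp [hY]
  have hL : L2Curve Y V := by
    refine ⟨by rw [Y0]; exact hg.2, hVm, fun t ht => ?_⟩
    rw [Y0]
    exact Filter.Eventually.of_forall fun x => rfl
  have f0 := h.hasPrim_flux ν wd (c 0) (x := 0) (by simp)
  have f1 := h.hasPrim_flux ν wd (c 1) (x := 1) (by simp)
  -- These are the integration constants that make the time-integrated identity hold at t = 0.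
  set k₀ := g 0 - flux ν wd (c 0) (w 0 0) with hk₀
  set k₁ := -g 1 - flux ν wd (c 1) (w 0 1) with hk₁
  have key : ∀ t, 0 ≤ t → ∀ χ, InH1 χ →
      ip (fun x => Real.exp (a * t) * deriv (w t) x) (deriv χ) + ip (Y t) χ
        + (Real.exp (a * t) * flux ν wd (c 0) (w t 0) + k₀) * χ 0
        + (Real.exp (a * t) * flux ν wd (c 1) (w t 1) + k₁) * χ 1 = 0 := by
    intro t ht χ hχ
    have p1 := (h.hasPrim_ip_deriv hχ.2).exp_mul a
    have p2 := hL.hasPrim_ip hχ.inL2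
    have p3 := (((f0.exp_mul a).add (HasPrim.const k₀))).const_mul (χ 0)
    have p4 := (((f1.exp_mul a).add (HasPrim.const k₁))).const_mul (χ 1)
    have p := ((p1.add p2).add p3).add p4
    have pz := p.congr_right (ψ := fun _ => 0) (by
      filter_upwards [hweak, h.h1t, ae_restrict_mem measurableSet_Ioi] with s hs hs1 hs0
      have e := hs χ hχ
      have hs0' : 0 ≤ s := le_of_lt hs0
      rw [weakForm_eq_lowerPart hν (h.h1 s hs0') hs1 hχ,
        ← ip_congr (hre s hs0') (Filter.EventuallyEq.refl _ χ)] at e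
      have e2 : ip (V s) χ = 1 / μ * Real.exp (a * s) * ip (r s) χ := by
        rw [← ip_const_mul_left]
      rw [e2, ha]
      have : ∀ A B R F0 F1 G0 G1 x0 x1 E : ℝ,
          μ * A + ν * B + R + (μ * G0 + ν * F0) * x0 + (μ * G1 + ν * F1) * x1 = 0 →
          E * (ν / μ * B + A) + 1 / μ * E * R + x0 * (E * (ν / μ * F0 + G0) + 0)
            + x1 * (E * (ν / μ * F1 + G1) + 0) = 0 := by
        intro A B R F0 F1 G0 G1 x0 x1 E hh
        have : E * (ν / μ * B + A) + 1 / μ * E * R + x0 * (E * (ν / μ * F0 + G0) + 0)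
            + x1 * (E * (ν / μ * F1 + G1) + 0) = E / μ * (μ * A + ν * B + R
              + (μ * G0 + ν * F0) * x0 + (μ * G1 + ν * F1) * x1) := by field_simp; ring
        rw [this, hh, mul_zero]
      exact this _ _ _ _ _ _ _ _ _ _ e)
    have e := pz.eq t ht
    have i0 := hg.ip_deriv hχ
    have j0 := ip_congr hg0 (Filter.EventuallyEq.refl _ (deriv χ))
    simp only [intervalIntegral.integral_zero, mul_zero, Real.exp_zero, one_mul, Y0, j0] at e
    rw [ip_const_mul_left]
    simp only [hk₀, hk₁] at e ⊢
    linarith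
  have E : ∀ t, Real.exp (-(a * t)) * Real.exp (a * t) = 1 := fun t => by
    rw [← Real.exp_add]; simp
  set Z : ℝ → ℝ → ℝ := fun t x => Real.exp (-(a * t)) * Y t x with hZ
  have dbr := fun t ht => ae_eq_primitive_of_weak ((h.h1 t ht).2.const_mul (Real.exp (a * t)))
    (hL.inL2 ht) (key t ht)
  refine ⟨Z, k₀, k₁, ⟨fun t ht => (hL.inL2 ht).const_mul _, fun t ht => ?_, fun t ht => ?_, ?_,
    fun T hT => ?_⟩, ?_⟩
  · filter_upwards [(dbr t ht).1] with x hx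
    have := congrArg (fun z => Real.exp (-(a * t)) * z) hx
    simp only [← mul_assoc, E, one_mul, mul_add] at this
    rw [this]
    simp only [hZ, ha, intervalIntegral.integral_const_mul]
  · have := congrArg (fun z => Real.exp (-(a * t)) * z) (dbr t ht).2
    simp only [← mul_assoc, E, one_mul, mul_add, mul_neg] at this
    simp only [hZ, intervalIntegral.integral_const_mul]
    linarith
  · have p := (hL.hasPrim_sqNorm.exp_mul (-(2 * a))).congr_left (z := fun t => sqNorm (Z t))
      (fun t _ => by
        simp only [hZ]
        rw [sqNorm_const_mul, sq, ← Real.exp_add]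
        ring_nf)
    refine p.congr_right ?_
    filter_upwards [ae_restrict_mem measurableSet_Ioi] with s hs
    have e1 : ip (Y s) (V s) = 1 / μ * Real.exp (a * s) * ip (Y s) (lowerPart wd (w s) (wt s)) := by
      rw [ip_comm (Y s) (lowerPart wd (w s) (wt s)),
        ← ip_congr (hre s (le_of_lt hs)) (Filter.EventuallyEq.refl _ (Y s)), ← ip_const_mul_left,
        ip_comm (Y s)]
    simp only [hZ]
    rw [e1, sqNorm_const_mul, ip_const_mul_left]
    have e2 : Real.exp (-(2 * a) * s) = Real.exp (-(a * s)) ^ 2 := by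
      rw [sq, ← Real.exp_add]; ring_nf
    have e3 := E s
    rw [e2]
    have : Real.exp (-(a * s)) ^ 2 * (2 * (1 / μ * Real.exp (a * s)
        * ip (Y s) (lowerPart wd (w s) (wt s)))) = 2 / μ * (Real.exp (-(a * s))
          * ip (Y s) (lowerPart wd (w s) (wt s))) := by
      linear_combination 2 / μ * Real.exp (-(a * s)) * ip (Y s) (lowerPart wd (w s) (wt s)) * e3
    rw [mul_add, this, ha]
    field_simp
    ring
  · refine intervalIntegrable_congr_ae_Ioi ?_ hT (intervalIntegrable_sqNorm hr T hT)
    filter_upwards [ae_restrict_mem measurableSet_Ioi] with s hs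
    exact sqNorm_congr (hre s (le_of_lt hs))
  · simp only [hZ, Y0, mul_zero, neg_zero, Real.exp_zero, one_mul]
    exact Filter.EventuallyEq.refl _ _

/-! ### Estimates for the second space derivative and its time derivative. -/

/-- The time derivative of the second space derivative `Z`, from the equation. -/
def secondDerivT (ν μ wd : ℝ) (w wt Z : ℝ → ℝ) (x : ℝ) : ℝ :=
  1 / μ * (lowerPart wd w wt x - ν * Z x)

theorem secondDerivT_inL2 {ν μ wd : ℝ} {w wt Z : ℝ → ℝ} (hw : InH1 w) (hwt : InL2 wt)
    (hZ : InL2 Z) : InL2 (secondDerivT ν μ wd w wt Z) := by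
  have h1 : InL2 (fun x => ν * Z x) := hZ.const_mul _
  exact ((lowerPart_inL2 hw hwt wd).fun_sub h1).const_mul _

theorem sqNorm_secondDerivT {ν μ wd : ℝ} {w wt Z : ℝ → ℝ} (hμ : 0 < μ) (hw : InH1 w)
    (hwt : InL2 wt) (hZ : InL2 Z) :
    μ ^ 2 * sqNorm (secondDerivT ν μ wd w wt Z) = sqNorm (lowerPart wd w wt)
      - 2 * ν * ip Z (lowerPart wd w wt) + ν ^ 2 * sqNorm Z := by
  have h1 : InL2 (fun x => ν * Z x) := hZ.const_mul _
  have h2 := lowerPart_inL2 hw hwt wd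
  have e : sqNorm (secondDerivT ν μ wd w wt Z)
      = (1 / μ) ^ 2 * sqNorm (fun x => lowerPart wd w wt x - ν * Z x) := by
    rw [← sqNorm_const_mul]; rfl
  rw [e, sqNorm_eq_ip (fun x => lowerPart wd w wt x - ν * Z x), ip_sub_left h2 h1 (h2.fun_sub h1),
    ip_sub_right h2 h1 h2, ip_sub_right h2 h1 h1, ip_const_mul_left, ip_const_mul_left,
    ip_const_mul_right, ip_const_mul_right, ip_comm (lowerPart wd w wt) Z, ← sqNorm_eq_ip,
    ← sqNorm_eq_ip]
  field_simp
  ring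

theorem sqNorm_lowerPart_le {wd A : ℝ} {w wt : ℝ → ℝ} (hw : InH1 w) (hwt : InL2 wt)
    (hA : xsq w ≤ A) : sqNorm (lowerPart wd w wt)
      ≤ 2 * sqNorm wt + 4 * ((1 + wd) ^ 2 + A) * xsq w := by
  refine (sqNorm_add_le hwt (hw.convective_inL2 wd)).trans ?_
  have h1 : sqNorm (fun x => (1 + wd + w x) * deriv w x)
      ≤ 2 * ((1 + wd) ^ 2 + A) * sqNorm (deriv w) := by
    refine sqNorm_mul_le (continuousOn_const.add hw.continuousOn) hw.2 fun x hx => ?_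
    have := (hw.sq_le_xsq' hx).trans hA
    nlinarith [sq_nonneg (1 + wd - w x)]
  have h2 : 2 * ((1 + wd) ^ 2 + A) * sqNorm (deriv w) ≤ 2 * ((1 + wd) ^ 2 + A) * xsq w := by
    have := (xsq_nonneg w).trans hA
    exact mul_le_mul_of_nonneg_left (sqNorm_deriv_le_xsq w) (by positivity)
  linarith

namespace SecondDeriv

variable {ν μ wd k₀ k₁ : ℝ} {c : Fin 2 → ℝ} {w wt Z : ℝ → ℝ → ℝ}

theorem intervalIntegrable_sqNorm (h : SecondDeriv ν μ wd c w wt Z k₀ k₁) (T : ℝ) (hT : 0 ≤ T) :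
    IntervalIntegrable (fun t => sqNorm (Z t)) volume 0 T :=
  ContinuousOn.intervalIntegrable (by simpa [uIcc_of_le hT] using h.rate.continuousOn hT)

theorem intervalIntegrable_ip (hμ : 0 < μ) (h : SecondDeriv ν μ wd c w wt Z k₀ k₁) (T : ℝ)
    (hT : 0 ≤ T) :
    IntervalIntegrable (fun t => ip (Z t) (lowerPart wd (w t) (wt t))) volume 0 T := by
  have h1 := ((h.rate.int T hT).const_mul (μ / 2)).add
    ((h.intervalIntegrable_sqNorm T hT).const_mul ν)
  refine h1.congr fun t _ => ?_
  field_simp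
  ring

theorem intervalIntegrable_sqNorm_secondDerivT (hμ : 0 < μ)
    (h : SecondDeriv ν μ wd c w wt Z k₀ k₁) (hw : H1Curve w wt) (T : ℝ) (hT : 0 ≤ T) :
    IntervalIntegrable (fun t => sqNorm (secondDerivT ν μ wd (w t) (wt t) (Z t))) volume 0 T := by
  have h1 := (((h.integrable T hT).sub ((h.intervalIntegrable_ip hμ T hT).const_mul (2 * ν))).add
    ((h.intervalIntegrable_sqNorm T hT).const_mul (ν ^ 2))).const_mul (1 / μ ^ 2)
  refine intervalIntegrable_congr_ae_Ioi ?_ hT h1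
  filter_upwards [hw.h1t, ae_restrict_mem measurableSet_Ioi] with t h2 h3
  rw [← sqNorm_secondDerivT hμ (hw.h1 t (le_of_lt h3)) h2.inL2 (h.mem t (le_of_lt h3))]
  field_simp

theorem inH1 (h : SecondDeriv ν μ wd c w wt Z k₀ k₁) {t : ℝ} (ht : 0 ≤ t) (b : ℝ) :
    InH1 (fun x => b + ∫ y in (0 : ℝ)..x, Z t y) ∧
      deriv (fun x => b + ∫ y in (0 : ℝ)..x, Z t y) =ᵐ[volume.restrict (Ioo (0 : ℝ) 1)] Z t :=
  inH1_of_primitive (h.mem t ht) fun x _ => by simp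

/-- The second space derivative of `wt`. -/
theorem deriv_rate_eq (hν : 0 < ν) (hμ : 0 < μ) (h : SecondDeriv ν μ wd c w wt Z k₀ k₁) {t : ℝ}
    (ht : 0 ≤ t) (hw : InH1 (w t)) (hwt : InH1 (wt t))
    (hweak : ∀ χ, InH1 χ → weakForm ν μ wd c (w t) (wt t) χ = 0) :
    (deriv (wt t) =ᵐ[volume.restrict (Ioo (0 : ℝ) 1)] fun x =>
      (flux' ν wd (c 0) (w t 0) * wt t 0 - ν / μ * (Real.exp (-(ν / μ * t)) * k₀))
        + ∫ y in (0 : ℝ)..x, secondDerivT ν μ wd (w t) (wt t) (Z t) y) ∧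
    (flux' ν wd (c 0) (w t 0) * wt t 0 - ν / μ * (Real.exp (-(ν / μ * t)) * k₀))
        + ∫ y in (0 : ℝ)..1, secondDerivT ν μ wd (w t) (wt t) (Z t) y
      = -(flux' ν wd (c 1) (w t 1) * wt t 1 - ν / μ * (Real.exp (-(ν / μ * t)) * k₁)) := by
  have hl := lowerPart_inL2 hw hwt.inL2 wd
  have i1 : InL2 (fun x => μ * deriv (wt t) x) := hwt.deriv_inL2.const_mul _
  have i2 : InL2 (fun x => ν * deriv (w t) x) := hw.deriv_inL2.const_mul _
  -- At a fixed time the weak form says that μ w_xt + ν w_x is a primitive of the lower order part;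
  -- subtracting the known representation of w_x isolates w_xt.
  obtain ⟨d1, d2⟩ := ae_eq_primitive_of_weak (i1.fun_add i2) hl
    (b₀ := μ * (flux' ν wd (c 0) (w t 0) * wt t 0) + ν * flux ν wd (c 0) (w t 0))
    (b₁ := μ * (flux' ν wd (c 1) (w t 1) * wt t 1) + ν * flux ν wd (c 1) (w t 1))
    (fun χ hχ => by
      have e := hweak χ hχ
      rw [weakForm_eq_lowerPart hν hw hwt hχ] at e
      rw [ip_add_left i1 i2 hχ.2, ip_const_mul_left, ip_const_mul_left]
      exact e)
  have il := hl.intervalIntegrable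
  have iZ := (h.mem t ht).intervalIntegrable
  have e : ∀ x ∈ Icc (0 : ℝ) 1, ∫ y in (0 : ℝ)..x, secondDerivT ν μ wd (w t) (wt t) (Z t) y
      = 1 / μ * ((∫ y in (0 : ℝ)..x, lowerPart wd (w t) (wt t) y) - ν * ∫ y in (0 : ℝ)..x, Z t y) := by
    intro x hx
    simp only [secondDerivT]
    rw [intervalIntegral.integral_const_mul, intervalIntegral.integral_sub
      (intervalIntegrable_sub il le_rfl hx.1 hx.2)
      ((intervalIntegrable_sub iZ le_rfl hx.1 hx.2).const_mul ν),
      intervalIntegral.integral_const_mul]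
  constructor
  · filter_upwards [d1, h.deriv_eq t ht, ae_restrict_mem measurableSet_Ioo] with x h1 h2 hx
    rw [h2] at h1
    rw [e x (Ioo_subset_Icc_self hx)]
    have : deriv (wt t) x = 1 / μ * (μ * deriv (wt t) x) := by field_simp
    rw [this, eq_sub_of_add_eq h1]
    field_simp
    ring
  · have h2 := h.right_eq t ht
    rw [e 1 (by simp)]
    have h3 : (∫ y in (0 : ℝ)..1, lowerPart wd (w t) (wt t) y)
        = -(μ * (flux' ν wd (c 1) (w t 1) * wt t 1) + ν * flux ν wd (c 1) (w t 1))
          - (μ * (flux' ν wd (c 0) (w t 0) * wt t 0) + ν * flux ν wd (c 0) (w t 0)) := by linarith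
    have h4 : (∫ y in (0 : ℝ)..1, Z t y) = -(flux ν wd (c 1) (w t 1) + Real.exp (-(ν / μ * t)) * k₁)
      - (flux ν wd (c 0) (w t 0) + Real.exp (-(ν / μ * t)) * k₀) := by linarith
    rw [h3, h4]
    field_simp
    ring

end SecondDeriv

/-- The equation μ Z_t + ν Z = `lowerPart` is multiplied by Z; its right-hand side is controlled by
the weighted bounds for the trajectory. The bound for Z_t is then read off the equation, which costs
the factor μ². -/
theorem exists_secondDeriv_bound {ν wd : ℝ} {c : Fin 2 → ℝ} (hν : 0 < ν) (hwd : 0 ≤ wd)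
    (hc : ∀ i, 0 < c i) (A₀ : ℝ) (hA₀ : 0 ≤ A₀) : ∃ A : ℝ, 0 < A ∧
    ∀ (μ α k₀ k₁ : ℝ) (w wt Z : ℝ → ℝ → ℝ), 0 < μ → AdmissibleRate ν μ wd c α →
      IsTrajectory ν μ wd c w wt → SecondDeriv ν μ wd c w wt Z k₀ k₁ → xsq (w 0) ≤ A₀ →
      ∀ t, 0 ≤ t →
        μ * (Real.exp (2 * α * t) * sqNorm (Z t)) ≤ A * (1 + μ) * (sqNorm (Z 0) + xsq (w 0)) ∧
        ∫ s in (0 : ℝ)..t, Real.exp (2 * α * s) * sqNorm (Z s)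
          ≤ A * (1 + μ) * (sqNorm (Z 0) + xsq (w 0)) ∧
        μ ^ 2 * ∫ s in (0 : ℝ)..t, Real.exp (2 * α * s)
            * sqNorm (secondDerivT ν μ wd (w s) (wt s) (Z s))
          ≤ A * (1 + μ) * (sqNorm (Z 0) + xsq (w 0)) := by
  obtain ⟨A, hA, HA⟩ := exists_trajectory_bound hν hwd hc A₀ hA₀
  obtain ⟨B, hB, HB⟩ := exists_trajectory_weighted_bound hν hwd hc A₀ hA₀
  set D := 4 * ((1 + wd) ^ 2 + A) with hD
  have D0 : 0 < D := by positivity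
  set L := 2 * B + D * B with hL
  have L0 : 0 < L := by positivity
  set J := 1 + 2 / ν * L with hJ
  have J0 : 0 < J := by positivity
  refine ⟨J + 2 / ν * J + 2 * (L + ν ^ 2 * (2 / ν * J)), by positivity,
    fun μ α k₀ k₁ w wt Z hμ hα hw hZ hw0 t ht => ?_⟩
  have hbd := (HA μ w wt hμ hw hw0).1
  obtain ⟨b1, b2⟩ := HB μ α w wt hμ hα hw hw0
  have b1 := b1 t ht
  have b2 := b2 t ht
  set N := sqNorm (Z 0) + xsq (w 0) with hN
  have x0 := xsq_nonneg (w 0)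
  have z0 := sqNorm_nonneg (Z 0)
  have N0 : 0 ≤ N := by positivity
  have xN : xsq (w 0) ≤ N := by linarith
  have zN : sqNorm (Z 0) ≤ N := by linarith
  -- the integral of the lower order part
  have iX := hw.curve.intervalIntegrable_xsq_self t ht
  have hlow : ∫ s in (0 : ℝ)..t, Real.exp (2 * α * s) * sqNorm (lowerPart wd (w s) (wt s))
      ≤ L * (1 + μ) * N := by
    have i1 := intervalIntegrable_exp_mul α hw.curve.intervalIntegrable_xsq_self t ht
    have i2 := intervalIntegrable_exp_mul α (hw.curve.intervalIntegrable_rate₂ μ) t ht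
    have h1 := intervalIntegral_mono_ae_Ioi
      (f := fun s => Real.exp (2 * α * s) * sqNorm (lowerPart wd (w s) (wt s)))
      (g := fun s => 2 * (Real.exp (2 * α * s) * rate₂ μ (wt s))
        + D * (Real.exp (2 * α * s) * xsq (w s))) (by
        filter_upwards [hw.curve.h1t, ae_restrict_mem measurableSet_Ioi] with s hs hs0
        have hs0' : 0 ≤ s := le_of_lt hs0
        have e1 := sqNorm_lowerPart_le (wd := wd) (hw.curve.h1 s hs0') hs.inL2 (hbd s hs0')
        have e2 : sqNorm (wt s) ≤ rate₂ μ (wt s) := by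
          rw [rate₂]; linarith [mul_nonneg hμ.le (xsq_nonneg (wt s))]
        have e3 : sqNorm (lowerPart wd (w s) (wt s)) ≤ 2 * rate₂ μ (wt s) + D * xsq (w s) := by
          linarith
        calc _ ≤ Real.exp (2 * α * s) * (2 * rate₂ μ (wt s) + D * xsq (w s)) := by gcongr
          _ = _ := by ring) ht
      (intervalIntegrable_exp_mul α hZ.integrable t ht) ((i2.const_mul 2).add (i1.const_mul D))
    rw [intervalIntegral.integral_add (i2.const_mul 2) (i1.const_mul D),
      intervalIntegral.integral_const_mul, intervalIntegral.integral_const_mul] at h1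
    have h2 : B * xsq (w 0) ≤ B * ((1 + μ) * N) := by
      gcongr
      nlinarith
    have h3 : B * (1 + μ) * xsq (w 0) ≤ B * (1 + μ) * N := by gcongr
    have h4 := mul_le_mul_of_nonneg_left (b1.trans h3) D0.le
    rw [hL]; linarith
  -- the energy estimate
  have g := gronwall (α := α) (γ := fun _ => 0)
    (f := fun s => 2 / (ν * μ) * sqNorm (lowerPart wd (w s) (wt s)))
    (d := fun s => ν / (2 * μ) * sqNorm (Z s)) hZ.rate (by simp)
    (fun T hT => (hZ.intervalIntegrable_sqNorm T hT).const_mul _)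
    (fun T hT => (hZ.integrable T hT).const_mul _) (by simp)
    (fun s => mul_nonneg (by positivity) (sqNorm_nonneg _))
    (fun s => mul_nonneg (by positivity) (sqNorm_nonneg _)) (by
      filter_upwards [hw.curve.h1t, ae_restrict_mem measurableSet_Ioi] with s hs hs0
      have hs0' : 0 ≤ s := le_of_lt hs0
      have e1 := abs_ip_le_young (hZ.mem s hs0')
        (lowerPart_inL2 (hw.curve.h1 s hs0') hs.inL2 wd) (k := ν / 2) (by positivity)
      have e2 := (abs_le.1 e1).2
      have e3 : 2 * α * μ ≤ ν := by
        have := (hα.mul_le hν hμ hwd hc).1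
        have := hα.1
        linarith
      -- The damping of Z has rate ν/μ, so an admissible weight is paid for, with half of the
      -- damping term left after Young's inequality.
      have e4 : 2 * α ≤ ν / μ := by rw [le_div_iff₀ hμ]; exact e3
      have zn := sqNorm_nonneg (Z s)
      have e5 := mul_le_mul_of_nonneg_right e4 zn
      have e6 := mul_le_mul_of_nonneg_left e2 (by positivity : 0 ≤ 2 / μ)
      have e7 : 2 / μ * (ν / 2 / 2 * sqNorm (Z s)
          + 1 / (2 * (ν / 2)) * sqNorm (lowerPart wd (w s) (wt s)))
          = ν / μ * sqNorm (Z s) / 2 + 2 / (ν * μ) * sqNorm (lowerPart wd (w s) (wt s)) := by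
        field_simp
      have e8 : 2 / μ * (ip (Z s) (lowerPart wd (w s) (wt s)) - ν * sqNorm (Z s))
          = 2 / μ * ip (Z s) (lowerPart wd (w s) (wt s)) - 2 * (ν / μ * sqNorm (Z s)) := by ring
      have e9 : ν / (2 * μ) * sqNorm (Z s) = ν / μ * sqNorm (Z s) / 2 := by field_simp
      rw [e8, e9]
      linarith) ht
  have s1 : ∀ s, Real.exp (2 * α * s) * (ν / (2 * μ) * sqNorm (Z s))
      = ν / (2 * μ) * (Real.exp (2 * α * s) * sqNorm (Z s)) := fun s => by ring
  have s2 : ∀ s, Real.exp (2 * α * s) * (2 / (ν * μ) * sqNorm (lowerPart wd (w s) (wt s)))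
      = 2 / (ν * μ) * (Real.exp (2 * α * s) * sqNorm (lowerPart wd (w s) (wt s))) :=
    fun s => by ring
  simp only [s1, s2, intervalIntegral.integral_const_mul, intervalIntegral.integral_zero,
    Real.exp_zero, mul_one] at g
  have iZ0 : 0 ≤ ∫ s in (0 : ℝ)..t, Real.exp (2 * α * s) * sqNorm (Z s) :=
    intervalIntegral.integral_nonneg ht fun s _ =>
      mul_nonneg (Real.exp_pos _).le (sqNorm_nonneg _)
  have zt0 : 0 ≤ Real.exp (2 * α * t) * sqNorm (Z t) :=
    mul_nonneg (Real.exp_pos _).le (sqNorm_nonneg _)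
  have g' : μ * (Real.exp (2 * α * t) * sqNorm (Z t))
      + ν / 2 * ∫ s in (0 : ℝ)..t, Real.exp (2 * α * s) * sqNorm (Z s) ≤ J * (1 + μ) * N := by
    have h1 := mul_le_mul_of_nonneg_left g hμ.le
    have e1 : μ * (ν / (2 * μ) * ∫ s in (0 : ℝ)..t, Real.exp (2 * α * s) * sqNorm (Z s))
        = ν / 2 * ∫ s in (0 : ℝ)..t, Real.exp (2 * α * s) * sqNorm (Z s) := by field_simp
    have e2 : μ * (2 / (ν * μ) * ∫ s in (0 : ℝ)..t,
        Real.exp (2 * α * s) * sqNorm (lowerPart wd (w s) (wt s))) = 2 / ν * ∫ s in (0 : ℝ)..t,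
        Real.exp (2 * α * s) * sqNorm (lowerPart wd (w s) (wt s)) := by field_simp
    rw [mul_add, mul_add, e1, e2] at h1
    have h2 := mul_le_mul_of_nonneg_left hlow (by positivity : 0 ≤ 2 / ν)
    have h3 := mul_le_mul_of_nonneg_left zN hμ.le
    rw [hJ]; linarith
  have P0 : 0 ≤ (1 + μ) * N := by positivity
  have c1 : μ * (Real.exp (2 * α * t) * sqNorm (Z t)) ≤ J * ((1 + μ) * N) := by
    have := mul_nonneg (by positivity : 0 ≤ ν / 2) iZ0
    linarith
  have c2 : ∫ s in (0 : ℝ)..t, Real.exp (2 * α * s) * sqNorm (Z s) ≤ 2 / ν * J * ((1 + μ) * N) := by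
    have h1 : ν / 2 * ∫ s in (0 : ℝ)..t, Real.exp (2 * α * s) * sqNorm (Z s)
        ≤ J * ((1 + μ) * N) := by
      have := mul_nonneg hμ.le zt0
      linarith
    have h2 := mul_le_mul_of_nonneg_left h1 (by positivity : 0 ≤ 2 / ν)
    have h3 : 2 / ν * (ν / 2 * ∫ s in (0 : ℝ)..t, Real.exp (2 * α * s) * sqNorm (Z s))
        = ∫ s in (0 : ℝ)..t, Real.exp (2 * α * s) * sqNorm (Z s) := by field_simp
    linarith
  have c3 : μ ^ 2 * ∫ s in (0 : ℝ)..t, Real.exp (2 * α * s)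
      * sqNorm (secondDerivT ν μ wd (w s) (wt s) (Z s))
      ≤ 2 * (L + ν ^ 2 * (2 / ν * J)) * ((1 + μ) * N) := by
    have i1 := intervalIntegrable_exp_mul α hZ.integrable t ht
    have i2 := intervalIntegrable_exp_mul α hZ.intervalIntegrable_sqNorm t ht
    rw [← intervalIntegral.integral_const_mul]
    have h1 := intervalIntegral_mono_ae_Ioi
      (f := fun s => μ ^ 2 * (Real.exp (2 * α * s)
        * sqNorm (secondDerivT ν μ wd (w s) (wt s) (Z s))))
      (g := fun s => 2 * (Real.exp (2 * α * s) * sqNorm (lowerPart wd (w s) (wt s)))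
        + 2 * ν ^ 2 * (Real.exp (2 * α * s) * sqNorm (Z s))) (by
        filter_upwards [hw.curve.h1t, ae_restrict_mem measurableSet_Ioi] with s hs hs0
        have hs0' : 0 ≤ s := le_of_lt hs0
        have l2 := lowerPart_inL2 (hw.curve.h1 s hs0') hs.inL2 wd
        have e1 := sqNorm_secondDerivT (ν := ν) (wd := wd) hμ (hw.curve.h1 s hs0') hs.inL2
          (hZ.mem s hs0')
        have e2 := (abs_le.1 (abs_ip_le_young (hZ.mem s hs0') l2 hν)).1
        have e3 := mul_le_mul_of_nonneg_left e2 (by positivity : 0 ≤ 2 * ν)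
        have e4 : 2 * ν * -(ν / 2 * sqNorm (Z s) + 1 / (2 * ν) * sqNorm (lowerPart wd (w s) (wt s)))
          = -(ν ^ 2 * sqNorm (Z s)) - sqNorm (lowerPart wd (w s) (wt s)) := by field_simp; ring
        have e5 : μ ^ 2 * sqNorm (secondDerivT ν μ wd (w s) (wt s) (Z s))
          ≤ 2 * sqNorm (lowerPart wd (w s) (wt s)) + 2 * ν ^ 2 * sqNorm (Z s) := by linarith
        calc _ = Real.exp (2 * α * s) * (μ ^ 2 * sqNorm (secondDerivT ν μ wd (w s) (wt s) (Z s))) := by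
              ring
          _ ≤ Real.exp (2 * α * s)
              * (2 * sqNorm (lowerPart wd (w s) (wt s)) + 2 * ν ^ 2 * sqNorm (Z s)) := by gcongr
          _ = _ := by ring) ht
      ((intervalIntegrable_exp_mul α
        (hZ.intervalIntegrable_sqNorm_secondDerivT hμ hw.curve) t ht).const_mul _)
      ((i1.const_mul 2).add (i2.const_mul _))
    rw [intervalIntegral.integral_add (i1.const_mul 2) (i2.const_mul _),
      intervalIntegral.integral_const_mul (2 : ℝ), intervalIntegral.integral_const_mul (2 * ν ^ 2)]
      at h1
    have h2 := mul_le_mul_of_nonneg_left c2 (by positivity : 0 ≤ 2 * ν ^ 2)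
    linarith
  have q1 : 0 ≤ J * ((1 + μ) * N) := by positivity
  have q2 : 0 ≤ 2 / ν * J * ((1 + μ) * N) := by positivity
  have q3 : 0 ≤ 2 * (L + ν ^ 2 * (2 / ν * J)) * ((1 + μ) * N) := by positivity
  refine ⟨?_, ?_, ?_⟩ <;> linarith

/-! ### The weak solution under the feedback laws -/

/-- When the weak derivative has a continuous representative up to the boundary, the fundamental
theorem applied to a continuous extension gives the one-sided derivatives at 0 and 1, where the
almost everywhere information says nothing. -/
theorem InH1.hasDerivWithinAt {f g : ℝ → ℝ} (hf : InH1 f) (hg : ContinuousOn g (Icc 0 1))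
    (h : deriv f =ᵐ[volume.restrict (Ioo (0 : ℝ) 1)] g) {x : ℝ} (hx : x ∈ Icc (0 : ℝ) 1) :
    HasDerivWithinAt f (g x) (Icc 0 1) x := by
  set G : ℝ → ℝ := IccExtend zero_le_one ((Icc (0 : ℝ) 1).domRestrict g) with hG
  have hGc : Continuous G := (continuousOn_iff_continuous_domRestrict.1 hg).Icc_extend'
  have hGe : ∀ y ∈ Icc (0 : ℝ) 1, G y = g y := fun y hy => by
    simp only [hG, IccExtend_of_mem zero_le_one _ hy, domRestrict_apply]
  have h1 := (hGc.integral_hasStrictDerivAt 0 x).hasDerivAt.hasDerivWithinAt (s := Icc 0 1)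
  rw [hGe x hx] at h1
  refine (h1.const_add (f 0)).congr_of_mem (fun y hy => ?_) hx
  rw [hf.eq_add_integral hy]
  simp only [intervalIntegral.integral_of_le hy.1, integral_Ioc_eq_integral_Ioo]
  congr 1
  refine integral_congr_ae ?_
  filter_upwards [ae_restrict_of_ae_restrict_of_subset (Ioo_subset_Ioo_right hy.2) h,
    ae_restrict_mem measurableSet_Ioo] with z hz hz'
  rw [hz, hGe z ⟨hz'.1.le, hz'.2.le.trans hy.2⟩]

/-- A single positive time suffices: there the one-sided derivatives differ from the feedback law by
a nonzero multiple of k₀ and k₁, and derivatives within [0,1] are unique. -/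
theorem SecondDeriv.eq_zero_of_feedback {ν μ wd k₀ k₁ : ℝ} {c : Fin 2 → ℝ} {w wt Z : ℝ → ℝ → ℝ}
    (h : SecondDeriv ν μ wd c w wt Z k₀ k₁) (hw : H1Curve w wt)
    (hf : SatisfiesFeedback ν wd c w) : k₀ = 0 ∧ k₁ = 0 := by
  obtain ⟨f0, f1⟩ := hf 1 one_pos
  have hH := (h.inH1 zero_le_one
    (flux ν wd (c 0) (w 1 0) + Real.exp (-(ν / μ * 1)) * k₀)).1.continuousOn
  have d0 := (hw.h1 1 zero_le_one).hasDerivWithinAt hH (h.deriv_eq 1 zero_le_one) (x := 0) (by simp)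
  have d1 := (hw.h1 1 zero_le_one).hasDerivWithinAt hH (h.deriv_eq 1 zero_le_one) (x := 1) (by simp)
  have u := uniqueDiffOn_Icc (zero_lt_one (α := ℝ))
  have e0 := (u 0 (by simp)).eq_deriv _ d0 f0
  have e1 := (u 1 (by simp)).eq_deriv _ d1 f1
  rw [h.right_eq 1 zero_le_one] at e1
  have hE := (Real.exp_pos (-(ν / μ * 1))).ne'
  simp only [intervalIntegral.integral_same, add_zero] at e0
  constructor
  · refine (mul_eq_zero.1 ?_).resolve_left hE
    rw [flux] at e0; linarith
  · refine (mul_eq_zero.1 ?_).resolve_left hE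
    rw [flux] at e1; linarith

theorem flux'_ge {ν wd ci s : ℝ} (hν : 0 < ν) (hwd : 0 ≤ wd) (hc : 0 < ci) :
    1 / ν ≤ flux' ν wd ci s := by
  rw [flux']
  have : 0 ≤ 3 * (2 / (9 * ci)) * s ^ 2 := by positivity
  exact le_mul_of_one_le_right (by positivity) (by linarith)

theorem flux'_le {ν wd ci s A : ℝ} (hν : 0 < ν) (hc : 0 < ci) (hs : s ^ 2 ≤ A) :
    flux' ν wd ci s ≤ 1 / ν * ((ci + 1 + wd) + 3 * (2 / (9 * ci)) * A) := by
  rw [flux']; gcongr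

theorem flux_sq_le {ν wd ci s A : ℝ} (hν : 0 < ν) (hwd : 0 ≤ wd) (hc : 0 < ci) (hs : s ^ 2 ≤ A) :
    flux ν wd ci s ^ 2 ≤ (1 / ν * ((ci + 1 + wd) + 3 * (2 / (9 * ci)) * A)) ^ 2 * s ^ 2 := by
  have e : flux ν wd ci s = 1 / ν * ((ci + 1 + wd) + 2 / (9 * ci) * s ^ 2) * s := by
    rw [flux]; ring
  have hA : 0 ≤ A := (sq_nonneg s).trans hs
  have h1 : 2 / (9 * ci) * s ^ 2 ≤ 3 * (2 / (9 * ci)) * A := by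
    calc 2 / (9 * ci) * s ^ 2 ≤ 2 / (9 * ci) * A := by gcongr
      _ = 1 * (2 / (9 * ci)) * A := by ring
      _ ≤ _ := by gcongr; norm_num
  rw [e, mul_pow]
  gcongr

/-- The estimate of the trace term in the test with the second space derivative. -/
theorem exists_trace_term_le {ν wd ci : ℝ} (hν : 0 < ν) (hwd : 0 ≤ wd) (hc : 0 < ci) (A : ℝ)
    (hA : 0 ≤ A) : ∃ C : ℝ, 0 < C ∧ ∀ s st : ℝ, s ^ 2 ≤ A →
      |(1 + wd + s) * flux ν wd ci s * (flux' ν wd ci s * st)| ≤ 1 / (2 * ν) * st ^ 2 + C * s ^ 2 := by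
  set F := 1 / ν * ((ci + 1 + wd) + 3 * (2 / (9 * ci)) * A) with hF
  have F0 : 0 < F := by positivity
  set G := 2 * ((1 + wd) ^ 2 + A) * F ^ 2 * F ^ 2 with hG
  have G0 : 0 < G := by positivity
  refine ⟨ν / 2 * G, by positivity, fun s st hs => ?_⟩
  have h1 := flux_sq_le hν hwd hc hs
  have h2 := flux'_le (wd := wd) hν hc hs
  have h3 : 0 ≤ flux' ν wd ci s := (by positivity : 0 ≤ 1 / ν).trans (flux'_ge hν hwd hc)
  have h4 : (1 + wd + s) ^ 2 ≤ 2 * ((1 + wd) ^ 2 + A) := by nlinarith [sq_nonneg (1 + wd - s)]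
  have e : (1 + wd + s) * flux ν wd ci s * (flux' ν wd ci s * st)
      = ((1 + wd + s) * flux ν wd ci s * flux' ν wd ci s) * st := by ring
  have y := abs_mul_le_young (a := (1 + wd + s) * flux ν wd ci s * flux' ν wd ci s) (b := st) hν
  have h5 : ((1 + wd + s) * flux ν wd ci s * flux' ν wd ci s) ^ 2 ≤ G * s ^ 2 := by
    calc _ = (1 + wd + s) ^ 2 * flux ν wd ci s ^ 2 * flux' ν wd ci s ^ 2 := by ring
      _ ≤ (2 * ((1 + wd) ^ 2 + A)) * (F ^ 2 * s ^ 2) * F ^ 2 := by gcongr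
      _ = _ := by rw [hG]; ring
  rw [e]
  have h6 := mul_le_mul_of_nonneg_left h5 (by positivity : 0 ≤ ν / 2)
  linarith

/-- The equation is tested with w_xxt. Integrating (w_t, w_xxt) by parts yields -‖w_xt‖² and, since
w_xt at the end points is the differentiated feedback law, boundary terms in -w_t² with the
coefficient `flux'`, which is at least 1/ν. This dissipation carries no factor μ. -/
theorem exists_feedback_identity_le {ν wd : ℝ} {c : Fin 2 → ℝ} (hν : 0 < ν) (hwd : 0 ≤ wd)
    (hc : ∀ i, 0 < c i) (A : ℝ) (hA : 0 ≤ A) : ∃ C : ℝ, 0 < C ∧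
    ∀ (μ : ℝ) (w wt g gt Z : ℝ → ℝ), 0 < μ → InH1 w → InH1 wt → InH1 g → InH1 gt → InL2 Z →
      deriv w =ᵐ[volume.restrict (Ioo (0 : ℝ) 1)] g →
      deriv wt =ᵐ[volume.restrict (Ioo (0 : ℝ) 1)] gt →
      deriv g =ᵐ[volume.restrict (Ioo (0 : ℝ) 1)] Z →
      deriv gt =ᵐ[volume.restrict (Ioo (0 : ℝ) 1)] secondDerivT ν μ wd w wt Z →
      g 0 = flux ν wd (c 0) (w 0) → g 1 = -flux ν wd (c 1) (w 1) →
      gt 0 = flux' ν wd (c 0) (w 0) * wt 0 → gt 1 = -(flux' ν wd (c 1) (w 1) * wt 1) →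
      xsq w ≤ A →
      μ * sqNorm (secondDerivT ν μ wd w wt Z) + 1 / (2 * ν) * (wt 0 ^ 2 + wt 1 ^ 2)
        + ν * ip Z (secondDerivT ν μ wd w wt Z) ≤ C * (sqNorm Z + xsq w) := by
  obtain ⟨C₀, hC₀, H₀⟩ := exists_trace_term_le hν hwd (hc 0) A hA
  obtain ⟨C₁, hC₁, H₁⟩ := exists_trace_term_le hν hwd (hc 1) A hA
  set F₀ := (1 / ν * ((c 0 + 1 + wd) + 3 * (2 / (9 * c 0)) * A)) ^ 2 with hF₀
  set F₁ := (1 / ν * ((c 1 + 1 + wd) + 3 * (2 / (9 * c 1)) * A)) ^ 2 with hF₁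
  have F₀0 : 0 ≤ F₀ := sq_nonneg _
  have F₁0 : 0 ≤ F₁ := sq_nonneg _
  set G := 2 * ((1 + wd) ^ 2 + A) with hG
  have G0 : 0 < G := by positivity
  refine ⟨C₀ + C₁ + A * (F₀ + F₁ + 1) + G, by positivity,
    fun μ w wt g gt Z hμ hw hwt hg hgt hZ dw dwt dg dgt g0 g1 gt0 gt1 hX => ?_⟩
  set Zt := secondDerivT ν μ wd w wt Z with hZt
  have iZt : InL2 Zt := secondDerivT_inL2 hw hwt.inL2 hZ
  have X0 := xsq_nonneg w
  have nZ := sqNorm_nonneg Z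
  have s0 := sq_zero_le_xsq w
  have s1 := sq_one_le_xsq w
  -- the equation tested with `Zt`
  have hco : ContinuousOn (fun x => 1 + wd + w x) (Icc 0 1) :=
    continuousOn_const.add hw.continuousOn
  have hv : InH1 (fun x => (1 + wd + w x) * g x) := ((inH1_const (1 + wd)).add hw).mul hg
  have e1 : μ * sqNorm Zt + ν * ip Z Zt = ip wt Zt + ip (fun x => (1 + wd + w x) * g x) Zt := by
    have j1 : InL2 (fun x => μ * Zt x) := iZt.const_mul _
    have j2 : InL2 (fun x => ν * Z x) := hZ.const_mul _
    rw [sqNorm_eq_ip, ← ip_const_mul_left, ← ip_const_mul_left, ← ip_add_left j1 j2 iZt,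
      ← ip_add_left hwt.inL2 hv.inL2 iZt]
    refine ip_congr ?_ (Filter.EventuallyEq.refl _ _)
    filter_upwards [dw] with x hx
    rw [hZt, secondDerivT, lowerPart, hx]
    field_simp
    ring
  have e2 : ip wt Zt = -(flux' ν wd (c 1) (w 1) * wt 1 ^ 2) - flux' ν wd (c 0) (w 0) * wt 0 ^ 2
      - sqNorm gt := by
    have := hwt.ip_deriv hgt
    rw [ip_congr dwt (Filter.EventuallyEq.refl _ gt), ← sqNorm_eq_ip,
      ip_congr (Filter.EventuallyEq.refl _ wt) dgt, gt0, gt1] at this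
    linarith
  have dv : deriv (fun x => (1 + wd + w x) * g x) =ᵐ[volume.restrict (Ioo (0 : ℝ) 1)]
      fun x => g x * g x + (1 + wd + w x) * Z x := by
    filter_upwards [dw, dg, hw.ae_differentiableAt, hg.ae_differentiableAt] with x h1 h2 h3 h4
    have := ((h3.hasDerivAt.const_add (1 + wd)).mul h4.hasDerivAt).deriv
    rw [h1, h2] at this
    exact this
  -- The convection is integrated by parts as well, so that it is paired with w_xt instead of w_xxt
  -- and can be absorbed by -‖w_xt‖².
  have e3 : ip (fun x => (1 + wd + w x) * g x) Zt
      = -((1 + wd + w 1) * flux ν wd (c 1) (w 1) * -(flux' ν wd (c 1) (w 1) * wt 1))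
        - (1 + wd + w 0) * flux ν wd (c 0) (w 0) * (flux' ν wd (c 0) (w 0) * wt 0)
        - ip (fun x => g x * g x + (1 + wd + w x) * Z x) gt := by
    have := hv.ip_deriv hgt
    rw [ip_congr dv (Filter.EventuallyEq.refl _ gt),
      ip_congr (Filter.EventuallyEq.refl _ _) dgt, g0, g1, gt0, gt1] at this
    linarith
  have i1 : InL2 (fun x => g x * g x) := InL2.bdd_mul hg.continuousOn hg.inL2
  have i2 : InL2 (fun x => (1 + wd + w x) * Z x) := InL2.bdd_mul hco hZ
  -- The quadratic term g² is made linear in the bounded quantities: one factor is estimated in the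
  -- supremum norm by ‖Z‖² and |||w|||², the other in L² by A.
  have hgs : ∀ x ∈ Icc (0 : ℝ) 1, g x ^ 2 ≤ (F₀ + F₁ + 1) * (sqNorm Z + xsq w) := by
    intro x hx
    have h1 := hg.sq_le_xsq hx
    rw [sqNorm_congr dg, g0, g1, neg_sq] at h1
    have f0 := flux_sq_le hν hwd (hc 0) (s0.trans hX)
    have f1 := flux_sq_le hν hwd (hc 1) (s1.trans hX)
    have f0' := mul_le_mul_of_nonneg_left s0 F₀0
    have f1' := mul_le_mul_of_nonneg_left s1 F₁0
    have p1 := mul_nonneg F₀0 nZ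
    have p2 := mul_nonneg F₁0 nZ
    linarith
  have n1 : sqNorm (fun x => g x * g x) ≤ (F₀ + F₁ + 1) * (sqNorm Z + xsq w) * A := by
    refine (sqNorm_mul_le hg.continuousOn hg.inL2 hgs).trans ?_
    have : sqNorm g ≤ A := by
      rw [← sqNorm_congr dw]; exact (sqNorm_deriv_le_xsq w).trans hX
    gcongr
  have n2 : sqNorm (fun x => (1 + wd + w x) * Z x) ≤ G * sqNorm Z := by
    refine sqNorm_mul_le hco hZ fun x hx => ?_
    have := (hw.sq_le_xsq' hx).trans hX
    rw [hG]
    nlinarith [sq_nonneg (1 + wd - w x)]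
  have n3 := sqNorm_add_le i1 i2
  have y := (abs_le.1 (abs_ip_le_young (i1.fun_add i2) hgt.inL2 one_pos)).1
  have ngt := sqNorm_nonneg gt
  have t0 := (abs_le.1 (H₀ (w 0) (wt 0) (s0.trans hX))).1
  have t1 := (abs_le.1 (H₁ (w 1) (wt 1) (s1.trans hX))).2
  have q0 := mul_le_mul_of_nonneg_right (flux'_ge (s := w 0) hν hwd (hc 0)) (sq_nonneg (wt 0))
  have q1 := mul_le_mul_of_nonneg_right (flux'_ge (s := w 1) hν hwd (hc 1)) (sq_nonneg (wt 1))
  have qe : 1 / (2 * ν) = 1 / ν / 2 := by field_simp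
  rw [qe] at t0 t1 ⊢
  have c0 := mul_le_mul_of_nonneg_left s0 hC₀.le
  have c1 := mul_le_mul_of_nonneg_left s1 hC₁.le
  have d0 := mul_nonneg hC₀.le nZ
  have d1 := mul_nonneg hC₁.le nZ
  have d2 := mul_nonneg G0.le X0
  linarith

/-- The integrated form of the test with w_xxt, for μ ≤ 1. Compared with `exists_secondDeriv_bound`
it needs one power of μ less in front of ‖w_xxt‖², and it bounds the traces of w_t without any power
of μ. -/
theorem exists_feedback_bound {ν wd : ℝ} {c : Fin 2 → ℝ} (hν : 0 < ν) (hwd : 0 ≤ wd)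
    (hc : ∀ i, 0 < c i) (A₀ : ℝ) (hA₀ : 0 ≤ A₀) : ∃ A : ℝ, 0 < A ∧
    ∀ (μ α : ℝ) (w wt Z : ℝ → ℝ → ℝ), 0 < μ → μ ≤ 1 → AdmissibleRate ν μ wd c α →
      IsTrajectory ν μ wd c w wt → SecondDeriv ν μ wd c w wt Z 0 0 →
      (∀ᵐ t ∂volume.restrict (Ioi (0 : ℝ)),
        ∀ χ, InH1 χ → weakForm ν μ wd c (w t) (wt t) χ = 0) → xsq (w 0) ≤ A₀ →
      ∀ t, 0 ≤ t →
        μ * (∫ s in (0 : ℝ)..t, Real.exp (2 * α * s)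
            * sqNorm (secondDerivT ν μ wd (w s) (wt s) (Z s)))
          ≤ A * (sqNorm (Z 0) + xsq (w 0)) ∧
        ∫ s in (0 : ℝ)..t, (wt s 0 ^ 2 + wt s 1 ^ 2) ≤ A * (sqNorm (Z 0) + xsq (w 0)) := by
  obtain ⟨A, hA, HA⟩ := exists_trajectory_bound hν hwd hc A₀ hA₀
  obtain ⟨B, hB, HB⟩ := exists_trajectory_weighted_bound hν hwd hc A₀ hA₀
  obtain ⟨D, hD, HD⟩ := exists_secondDeriv_bound hν hwd hc A₀ hA₀
  obtain ⟨C, hC, HC⟩ := exists_feedback_identity_le hν hwd hc A hA.le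
  set J := ν / 2 + (C + ν * ν / 2) * (2 * B + 2 * D) with hJ
  have J0 : 0 < J := by positivity
  refine ⟨J + 2 * ν * J, by positivity, fun μ α w wt Z hμ hμ1 hα hw hZ hweak hw0 t ht => ?_⟩
  have hbd := (HA μ w wt hμ hw hw0).1
  have b1 := (HB μ α w wt hμ hα hw hw0).1 t ht
  have b2 := (HD μ α 0 0 w wt Z hμ hα hw hZ hw0 t ht).2.1
  set N := sqNorm (Z 0) + xsq (w 0) with hN
  have x0 := xsq_nonneg (w 0)
  have z0 := sqNorm_nonneg (Z 0)
  have N0 : 0 ≤ N := by positivity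
  have xN : xsq (w 0) ≤ N := by linarith
  have zN : sqNorm (Z 0) ≤ N := by linarith
  have hα1 : α ≤ ν / 2 := by
    have h1 := (hα.mul_le hν hμ hwd hc).1
    have := mul_nonneg hα.1 hμ.le
    linarith
  set Zt : ℝ → ℝ → ℝ := fun s => secondDerivT ν μ wd (w s) (wt s) (Z s) with hZt
  have i0 : ∀ T, 0 ≤ T → IntervalIntegrable (fun s => wt s 0 ^ 2 + wt s 1 ^ 2) volume 0 T :=
    fun T hT => (hw.curve.intervalIntegrable_trace_sq (by simp) T hT).add
      (hw.curve.intervalIntegrable_trace_sq (by simp) T hT)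
  have iZt := hZ.intervalIntegrable_sqNorm_secondDerivT hμ hw.curve
  have iX := hw.curve.intervalIntegrable_xsq_self
  have iZ := hZ.intervalIntegrable_sqNorm
  -- the weighted energy estimate, with all remaining terms on the right
  have g := gronwall (α := α) (γ := fun _ => 0)
    (f := fun s => (2 * C + ν * ν) / ν * (sqNorm (Z s) + xsq (w s)))
    (d := fun s => 2 * μ / ν * sqNorm (Zt s) + 1 / ν ^ 2 * (wt s 0 ^ 2 + wt s 1 ^ 2)) hZ.rate
    (by simp) (fun T hT => ((iZt T hT).const_mul _).add ((i0 T hT).const_mul _))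
    (fun T hT => ((iZ T hT).add (iX T hT)).const_mul _) (by simp)
    (fun s => by have := sqNorm_nonneg (Zt s); positivity)
    (fun s => by
      have := sqNorm_nonneg (Z s)
      have := xsq_nonneg (w s)
      positivity) (by
      filter_upwards [hweak, hw.curve.h1t, ae_restrict_mem measurableSet_Ioi] with s hs hs1 hs0
      have hs0' : 0 ≤ s := le_of_lt hs0
      have hws := hw.curve.h1 s hs0'
      have hZs := hZ.mem s hs0'
      obtain ⟨r1, r2⟩ := hZ.deriv_rate_eq hν hμ hs0' hws hs1 hs
      have r3 := hZ.deriv_eq s hs0'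
      have r4 := hZ.right_eq s hs0'
      simp only [mul_zero, sub_zero, add_zero] at r1 r2 r3 r4
      obtain ⟨q1, q2⟩ := hZ.inH1 hs0' (flux ν wd (c 0) (w s 0))
      obtain ⟨q3, q4⟩ := inH1_of_primitive (secondDerivT_inL2 (ν := ν) (μ := μ) (wd := wd) hws hs1.inL2 hZs)
        (f := fun x => flux' ν wd (c 0) (w s 0) * wt s 0
          + ∫ y in (0 : ℝ)..x, secondDerivT ν μ wd (w s) (wt s) (Z s) y) (fun x _ => by simp)
      have key := HC μ (w s) (wt s) _ _ (Z s) hμ hws hs1 q1 q3 hZs r3 r1 q2 q4 (by simp) r4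
        (by simp) r2 (hbd s hs0')
      have e1 : ip (Z s) (Zt s) = 1 / μ * (ip (Z s) (lowerPart wd (w s) (wt s)) - ν * sqNorm (Z s)) := by
        have l1 := lowerPart_inL2 hws hs1.inL2 wd
        have l2 : InL2 (fun x => ν * Z s x) := hZs.const_mul _
        have : ip (Z s) (Zt s) = 1 / μ * ip (Z s) (fun x => lowerPart wd (w s) (wt s) x - ν * Z s x) := by
          rw [← ip_const_mul_right]; rfl
        rw [this, ip_sub_right l1 l2 hZs, ip_const_mul_right, ← sqNorm_eq_ip]
      have e2 : 2 / μ * (ip (Z s) (lowerPart wd (w s) (wt s)) - ν * sqNorm (Z s))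
          = 2 * ip (Z s) (Zt s) := by rw [e1]; ring
      have X0 := xsq_nonneg (w s)
      have nZ := sqNorm_nonneg (Z s)
      have h1 : 2 * α * sqNorm (Z s) ≤ ν * (sqNorm (Z s) + xsq (w s)) := by
        calc 2 * α * sqNorm (Z s) ≤ 2 * (ν / 2) * (sqNorm (Z s) + xsq (w s)) := by
              gcongr; linarith
          _ = _ := by ring
      -- The factor 2/ν turns ν(Z, Z_t) into the derivative of ‖Z‖².
      have h2 := mul_le_mul_of_nonneg_left key (by positivity : 0 ≤ 2 / ν)
      have h3 : 2 / ν * (μ * sqNorm (Zt s) + 1 / (2 * ν) * (wt s 0 ^ 2 + wt s 1 ^ 2)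
          + ν * ip (Z s) (Zt s)) = 2 * μ / ν * sqNorm (Zt s)
            + 1 / ν ^ 2 * (wt s 0 ^ 2 + wt s 1 ^ 2) + 2 * ip (Z s) (Zt s) := by field_simp
      have h4 : (2 * C + ν * ν) / ν * (sqNorm (Z s) + xsq (w s))
          = 2 / ν * (C * (sqNorm (Z s) + xsq (w s))) + ν * (sqNorm (Z s) + xsq (w s)) := by
        field_simp
      rw [e2, h4]
      linarith) ht
  have j1 := intervalIntegrable_exp_mul α iZt t ht
  have j2 := intervalIntegrable_exp_mul α i0 t ht
  have j3 := intervalIntegrable_exp_mul α iZ t ht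
  have j4 := intervalIntegrable_exp_mul α iX t ht
  have s1 : ∀ s, Real.exp (2 * α * s) * (2 * μ / ν * sqNorm (Zt s)
      + 1 / ν ^ 2 * (wt s 0 ^ 2 + wt s 1 ^ 2)) = 2 * μ / ν * (Real.exp (2 * α * s) * sqNorm (Zt s))
      + 1 / ν ^ 2 * (Real.exp (2 * α * s) * (wt s 0 ^ 2 + wt s 1 ^ 2)) := fun s => by ring
  have s2 : ∀ s, Real.exp (2 * α * s) * ((2 * C + ν * ν) / ν * (sqNorm (Z s) + xsq (w s)))
      = (2 * C + ν * ν) / ν * (Real.exp (2 * α * s) * sqNorm (Z s)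
        + Real.exp (2 * α * s) * xsq (w s)) := fun s => by ring
  simp only [s1, s2] at g
  rw [intervalIntegral.integral_add (j1.const_mul _) (j2.const_mul _),
    intervalIntegral.integral_const_mul, intervalIntegral.integral_const_mul,
    intervalIntegral.integral_const_mul, intervalIntegral.integral_add j3 j4] at g
  simp only [intervalIntegral.integral_zero, Real.exp_zero, mul_one] at g
  have I1 : 0 ≤ ∫ s in (0 : ℝ)..t, Real.exp (2 * α * s) * sqNorm (Zt s) :=
    intervalIntegral.integral_nonneg ht fun s _ =>
      mul_nonneg (Real.exp_pos _).le (sqNorm_nonneg _)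
  have I2 : ∫ s in (0 : ℝ)..t, (wt s 0 ^ 2 + wt s 1 ^ 2)
      ≤ ∫ s in (0 : ℝ)..t, Real.exp (2 * α * s) * (wt s 0 ^ 2 + wt s 1 ^ 2) := by
    refine intervalIntegral.integral_mono_on ht (i0 t ht) j2 fun s hs => ?_
    have : 1 ≤ Real.exp (2 * α * s) := Real.one_le_exp (by
      have := hα.1
      have := hs.1
      positivity)
    exact le_mul_of_one_le_left (by positivity) this
  have I3 : 0 ≤ ∫ s in (0 : ℝ)..t, (wt s 0 ^ 2 + wt s 1 ^ 2) :=
    intervalIntegral.integral_nonneg ht fun s _ => by positivity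
  have I4 : 0 ≤ Real.exp (2 * α * t) * sqNorm (Z t) :=
    mul_nonneg (Real.exp_pos _).le (sqNorm_nonneg _)
  set J1 := ∫ s in (0 : ℝ)..t, Real.exp (2 * α * s) * sqNorm (Zt s)
  set J2 := ∫ s in (0 : ℝ)..t, Real.exp (2 * α * s) * (wt s 0 ^ 2 + wt s 1 ^ 2)
  have I5 := I3.trans I2
  have b1' : ∫ s in (0 : ℝ)..t, Real.exp (2 * α * s) * xsq (w s) ≤ B * 2 * N := by
    refine b1.trans ?_
    gcongr
    linarith
  have b2' : ∫ s in (0 : ℝ)..t, Real.exp (2 * α * s) * sqNorm (Z s) ≤ D * 2 * N := by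
    refine b2.trans ?_
    gcongr
    linarith
  have g2 : 2 * μ / ν * J1 + 1 / ν ^ 2 * J2 ≤ 2 / ν * (J * N) := by
    have h1 := mul_le_mul_of_nonneg_left (add_le_add b2' b1')
      (by positivity : 0 ≤ (2 * C + ν * ν) / ν)
    have h2 : 2 / ν * (J * N) = N + (2 * C + ν * ν) / ν * (D * 2 * N + B * 2 * N) := by
      rw [hJ]; field_simp; ring
    linarith
  have g3 := mul_le_mul_of_nonneg_left g2 (by positivity : 0 ≤ ν / 2)
  have e3 : ν / 2 * (2 * μ / ν * J1 + 1 / ν ^ 2 * J2) = μ * J1 + 1 / (2 * ν) * J2 := by field_simp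
  have e4 : ν / 2 * (2 / ν * (J * N)) = J * N := by field_simp
  rw [e3, e4] at g3
  have JN : 0 ≤ J * N := by positivity
  constructor
  · have : 0 ≤ 1 / (2 * ν) * J2 := by positivity
    have : 0 ≤ 2 * ν * (J * N) := by positivity
    linarith
  · have h1 : 1 / (2 * ν) * J2 ≤ J * N := by
      have := mul_nonneg hμ.le I1
      linarith
    have h2 := mul_le_mul_of_nonneg_left h1 (by positivity : 0 ≤ 2 * ν)
    have h3 : 2 * ν * (1 / (2 * ν) * J2) = J2 := by field_simp
    linarith

/-! ### Continuous piecewise affine functions -/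

theorem _root_.LipschitzWith.inH1 {f : ℝ → ℝ} {K : NNReal} (hf : LipschitzWith K f) : InH1 f := by
  refine ⟨hf.lipschitzOnWith.absolutelyContinuousOnInterval, ?_⟩
  refine MemLp.of_bound (measurable_deriv f).aestronglyMeasurable K ?_
  exact Filter.Eventually.of_forall fun x => norm_deriv_le_of_lipschitz hf

namespace Mesh

variable (P : Mesh)

/-- The length of a subinterval. -/
def len (j : Fin P.N) : ℝ := P.node j.succ - P.node j.castSucc

theorem len_pos (j : Fin P.N) : 0 < P.len j := sub_pos.2 (P.strictMono Fin.castSucc_lt_succ)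

theorem len_le_h (j : Fin P.N) : P.len j ≤ P.h := le_ciSup (Set.finite_range P.len).bddAbove j

theorem node_mem (k : Fin (P.N + 1)) : P.node k ∈ Icc (0 : ℝ) 1 := by
  rw [← P.first, ← P.last]
  exact ⟨P.strictMono.monotone (Fin.zero_le k), P.strictMono.monotone (Fin.le_last k)⟩

theorem h_nonneg : 0 ≤ P.h := Real.iSup_nonneg fun j => (P.len_pos j).le

theorem h_le_one : P.h ≤ 1 := by
  refine Real.iSup_le (fun j => ?_) zero_le_one
  linarith [(P.node_mem j.succ).2, (P.node_mem j.castSucc).1]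

/-- The ramp of height `1` on a subinterval. -/
def ramp (j : Fin P.N) (x : ℝ) : ℝ := max 0 (min 1 ((x - P.node j.castSucc) / P.len j))

theorem ramp_of_le {j : Fin P.N} {x : ℝ} (hx : x ≤ P.node j.castSucc) : P.ramp j x = 0 := by
  have : (x - P.node j.castSucc) / P.len j ≤ 0 :=
    div_nonpos_of_nonpos_of_nonneg (by linarith) (P.len_pos j).le
  rw [ramp, min_eq_right (by linarith), max_eq_left this]

theorem ramp_of_ge {j : Fin P.N} {x : ℝ} (hx : P.node j.succ ≤ x) : P.ramp j x = 1 := by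
  have : 1 ≤ (x - P.node j.castSucc) / P.len j := by
    rw [le_div_iff₀ (P.len_pos j), len]; linarith
  rw [ramp, min_eq_left this, max_eq_right zero_le_one]

theorem ramp_of_mem {j : Fin P.N} {x : ℝ} (hx : x ∈ Icc (P.node j.castSucc) (P.node j.succ)) :
    P.ramp j x = (x - P.node j.castSucc) / P.len j := by
  have h0 : 0 ≤ (x - P.node j.castSucc) / P.len j :=
    div_nonneg (by linarith [hx.1]) (P.len_pos j).le
  have h1 : (x - P.node j.castSucc) / P.len j ≤ 1 := by
    rw [div_le_one (P.len_pos j), len]; linarith [hx.2]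
  rw [ramp, min_eq_right h1, max_eq_right h0]

theorem lipschitzWith_ramp (j : Fin P.N) : LipschitzWith (1 / P.len j).toNNReal (P.ramp j) := by
  have h1 : LipschitzWith (1 / P.len j).toNNReal fun x => (x - P.node j.castSucc) / P.len j := by
    refine LipschitzWith.of_dist_le_mul fun x y => ?_
    have := P.len_pos j
    rw [Real.dist_eq, Real.dist_eq, Real.coe_toNNReal _ (by positivity), ← sub_div, abs_div,
      abs_of_pos this]
    apply le_of_eq
    rw [show x - P.node j.castSucc - (y - P.node j.castSucc) = x - y by ring]
    ring
  exact (h1.const_min 1).const_max 0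

theorem ramp_mem (j : Fin P.N) : P.ramp j ∈ P.space := by
  refine ⟨(P.lipschitzWith_ramp j).continuous.continuousOn, fun i => ?_⟩
  rcases lt_trichotomy i j with h | h | h
  · refine ⟨0, 0, fun x hx => ?_⟩
    rw [P.ramp_of_le (hx.2.le.trans (P.strictMono.monotone (Fin.succ_le_castSucc_iff.2 h)))]
    simp
  · subst h
    refine ⟨-P.node i.castSucc / P.len i, 1 / P.len i, fun x hx => ?_⟩
    rw [P.ramp_of_mem (Ioo_subset_Icc_self hx)]
    ring
  · refine ⟨1, 0, fun x hx => ?_⟩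
    rw [P.ramp_of_ge ((P.strictMono.monotone (Fin.succ_le_castSucc_iff.2 h)).trans hx.1.le)]
    simp

theorem ramp_succ_sub (i j : Fin P.N) :
    P.ramp i (P.node j.succ) - P.ramp i (P.node j.castSucc) = if i = j then 1 else 0 := by
  rcases lt_trichotomy i j with h | h | h
  · have h1 := P.strictMono.monotone (Fin.succ_le_castSucc_iff.2 h)
    rw [P.ramp_of_ge h1, P.ramp_of_ge (h1.trans (P.strictMono Fin.castSucc_lt_succ).le),
      if_neg h.ne, sub_self]
  · subst h
    rw [P.ramp_of_ge le_rfl, P.ramp_of_le le_rfl, if_pos rfl, sub_zero]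
  · have h1 := P.strictMono.monotone (Fin.succ_le_castSucc_iff.2 h)
    rw [P.ramp_of_le h1, P.ramp_of_le ((P.strictMono Fin.castSucc_lt_succ).le.trans h1),
      if_neg h.ne', sub_self]

/-- The basis of `V_h` that consists of `1` and the ramps. -/
def basis : Option (Fin P.N) → ℝ → ℝ
  | none => fun _ => 1
  | some j => P.ramp j

/-- The coordinates with respect to `Mesh.basis`. -/
def coord : Option (Fin P.N) → (ℝ → ℝ) → ℝ
  | none => fun v => v 0
  | some j => fun v => v (P.node j.succ) - v (P.node j.castSucc)

theorem basis_mem (k : Option (Fin P.N)) : P.basis k ∈ P.space := by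
  cases k with
  | none => exact ⟨continuousOn_const, fun _ => ⟨1, 0, fun x _ => by simp [basis]⟩⟩
  | some j => exact P.ramp_mem j

theorem basis_inH1 (k : Option (Fin P.N)) : InH1 (P.basis k) := by
  cases k with
  | none => exact inH1_const 1
  | some j => exact (P.lipschitzWith_ramp j).inH1

theorem coord_basis (k l : Option (Fin P.N)) : P.coord k (P.basis l) = if l = k then 1 else 0 := by
  cases k with
  | none =>
    cases l with
    | none => simp [coord, basis]
    | some j =>
      simp only [coord, basis, reduceCtorEq, if_false]
      exact P.ramp_of_le (P.node_mem _).1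
  | some i =>
    cases l with
    | none => simp [coord, basis]
    | some j =>
      simp only [coord, basis, Option.some.injEq]
      exact P.ramp_succ_sub j i

theorem coord_sum (y : Option (Fin P.N) → ℝ) (k : Option (Fin P.N)) :
    P.coord k (fun x => ∑ l, y l * P.basis l x) = y k := by
  have h : P.coord k (fun x => ∑ l, y l * P.basis l x) = ∑ l, y l * P.coord k (P.basis l) := by
    cases k with
    | none => rfl
    | some j => simp only [coord, ← Finset.sum_sub_distrib, mul_sub]
  rw [h]
  simp only [coord_basis, mul_ite, mul_one, mul_zero, Finset.sum_ite_eq', Finset.mem_univ, if_true]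

theorem coord_congr {f g : ℝ → ℝ} (h : EqOn f g (Icc 0 1)) (k : Option (Fin P.N)) :
    P.coord k f = P.coord k g := by
  cases k with
  | none => exact h (by simp)
  | some j => simp only [coord, h (P.node_mem _)]

theorem sum_mem_space {ι : Type*} (s : Finset ι) {f : ι → ℝ → ℝ} (y : ι → ℝ)
    (h : ∀ k, f k ∈ P.space) : (fun x => ∑ k ∈ s, y k * f k x) ∈ P.space := by
  refine ⟨continuousOn_finsetSum _ fun k _ => continuousOn_const.mul (h k).1, fun j => ?_⟩
  choose a b hab using fun k => (h k).2 j
  refine ⟨∑ k ∈ s, y k * a k, ∑ k ∈ s, y k * b k, fun x hx => ?_⟩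
  rw [Finset.sum_mul, ← Finset.sum_add_distrib]
  refine Finset.sum_congr rfl fun k _ => ?_
  rw [hab k x hx]; ring

theorem sub_mem_space {f g : ℝ → ℝ} (hf : f ∈ P.space) (hg : g ∈ P.space) :
    (fun x => f x - g x) ∈ P.space := by
  refine ⟨hf.1.sub hg.1, fun j => ?_⟩
  obtain ⟨a, b, h1⟩ := hf.2 j
  obtain ⟨a', b', h2⟩ := hg.2 j
  exact ⟨a - a', b - b', fun x hx => by simp only [h1 x hx, h2 x hx]; ring⟩

variable {P}

theorem affineOn_Icc {v : ℝ → ℝ} (hv : v ∈ P.space) (j : Fin P.N) :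
    ∃ a b : ℝ, ∀ x ∈ Icc (P.node j.castSucc) (P.node j.succ), v x = a + b * x := by
  obtain ⟨a, b, h⟩ := hv.2 j
  have hlt := P.strictMono (Fin.castSucc_lt_succ (i := j))
  have hsub : Icc (P.node j.castSucc) (P.node j.succ) ⊆ Icc 0 1 :=
    Icc_subset_Icc (P.node_mem _).1 (P.node_mem _).2
  refine ⟨a, b, ?_⟩
  have := EqOn.of_subset_closure (f := v) (g := fun x => a + b * x) h (hv.1.mono hsub)
    (by fun_prop) Ioo_subset_Icc_self (by rw [closure_Ioo hlt.ne])
  exact this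

theorem exists_mem_cell (x : ℝ) (hx : x ∈ Icc (0 : ℝ) 1) :
    ∃ j : Fin P.N, x ∈ Icc (P.node j.castSucc) (P.node j.succ) := by
  by_contra! hcon
  -- If x lies in no cell, induction pushes every node below x, so x = 1; but then x is in the last
  -- cell.
  have h : ∀ k : Fin (P.N + 1), P.node k ≤ x := by
    intro k
    induction k using Fin.induction with
    | zero => rw [P.first]; exact hx.1
    | succ j ih => exact (not_le.1 fun h => hcon j ⟨ih, h⟩).le
  have h1 : x = 1 := le_antisymm hx.2 (P.last ▸ h (Fin.last P.N))
  have hN : P.N ≠ 0 := by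
    intro h0
    have : Fin.last P.N = 0 := by ext; simp [h0]
    have := P.last ▸ this ▸ P.first
    simp at this
  obtain ⟨n, hn⟩ := Nat.exists_eq_succ_of_ne_zero hN
  refine hcon ⟨n, by omega⟩ ⟨h _, ?_⟩
  have e : (⟨n, by omega⟩ : Fin P.N).succ = Fin.last P.N := by ext; simp [hn]
  rw [e, P.last, h1]

theorem eq_zero_of_node {v : ℝ → ℝ} (hv : v ∈ P.space) (h : ∀ k, v (P.node k) = 0) :
    ∀ x ∈ Icc (0 : ℝ) 1, v x = 0 := by
  intro x hx
  obtain ⟨j, hj⟩ := exists_mem_cell (P := P) x hx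
  obtain ⟨a, b, hab⟩ := affineOn_Icc hv j
  have hlt := P.strictMono (Fin.castSucc_lt_succ (i := j))
  have h0 := hab _ (left_mem_Icc.2 hlt.le)
  have h1 := hab _ (right_mem_Icc.2 hlt.le)
  rw [h] at h0 h1
  have hb : b = 0 := by
    have : b * (P.node j.succ - P.node j.castSucc) = 0 := by linarith
    exact (mul_eq_zero.1 this).resolve_right (sub_pos.2 hlt).ne'
  rw [hab x hj, hb]
  rw [hb] at h0
  linarith

theorem eq_sum_basis {v : ℝ → ℝ} (hv : v ∈ P.space) {x : ℝ} (hx : x ∈ Icc (0 : ℝ) 1) :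
    v x = ∑ k, P.coord k v * P.basis k x := by
  have hs := P.sum_mem_space Finset.univ (fun k => P.coord k v) P.basis_mem
  have hd := P.sub_mem_space hv hs
  have hc : ∀ k, P.coord k (fun x => ∑ k, P.coord k v * P.basis k x) = P.coord k v :=
    P.coord_sum _
  refine sub_eq_zero.1 (eq_zero_of_node hd (fun k => ?_) x hx)
  induction k using Fin.induction with
  | zero =>
    rw [P.first]
    exact sub_eq_zero.2 (hc none).symm
  | succ j ih =>
    have h1 := hc (some j)
    simp only [coord] at h1 ih ⊢
    linarith

theorem inH1_of_mem {v : ℝ → ℝ} (hv : v ∈ P.space) : InH1 v := by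
  have h : InH1 (fun x => ∑ k, P.coord k v * P.basis k x) := by
    have : ∀ s : Finset (Option (Fin P.N)), InH1 (fun x => ∑ k ∈ s, P.coord k v * P.basis k x) := by
      intro s
      induction s using Finset.cons_induction with
      | empty => simpa using inH1_const 0
      | cons a s ha ih =>
        simp only [Finset.sum_cons]
        exact ((P.basis_inH1 a).const_mul _).add ih
    exact this _
  exact h.congr fun x hx => (eq_sum_basis hv hx).symm

end Mesh

/-! ### Cell averages and the error of the elliptic projection. -/

theorem InH1.sub_eq_integral {G : ℝ → ℝ} (hG : InH1 G) {a x : ℝ} (ha : 0 ≤ a) (hax : a ≤ x)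
    (hx : x ≤ 1) : G x - G a = ∫ y in a..x, deriv G y := by
  have h : AbsolutelyContinuousOnInterval G a x := hG.1.mono (by
    rw [uIcc_of_le hax, uIcc_of_le zero_le_one]; exact Icc_subset_Icc ha hx)
  rw [h.integral_deriv_eq_sub]

theorem InL2.intervalIntegrable_sq {F : ℝ → ℝ} (hF : InL2 F) :
    IntervalIntegrable (fun x => F x ^ 2) volume 0 1 :=
  (intervalIntegrable_iff_Ioo zero_le_one).2 hF.integrable_sq

/-- The Poincaré inequality on a subinterval. -/
theorem InH1.integral_sub_sq_le {G : ℝ → ℝ} (hG : InH1 G) {a b : ℝ} (ha : 0 ≤ a) (hab : a ≤ b)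
    (hb : b ≤ 1) :
    ∫ x in a..b, (G x - G a) ^ 2 ≤ (b - a) ^ 2 * ∫ x in a..b, deriv G x ^ 2 := by
  have hsub : Icc a b ⊆ Icc 0 1 := Icc_subset_Icc ha hb
  have i2 := intervalIntegrable_sub hG.deriv_inL2.intervalIntegrable_sq ha hab hb
  have hpt : ∀ x ∈ Icc a b, (G x - G a) ^ 2 ≤ (b - a) * ∫ x in a..b, deriv G x ^ 2 := by
    intro x hx
    rw [hG.sub_eq_integral ha hx.1 (hx.2.trans hb)]
    refine (integral_sq_le hG.deriv_inL2 hx.1 ha (hx.2.trans hb)).trans ?_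
    have h1 : ∫ y in a..x, deriv G y ^ 2 ≤ ∫ x in a..b, deriv G x ^ 2 :=
      intervalIntegral.integral_mono_interval le_rfl hx.1 hx.2
        (Filter.Eventually.of_forall fun _ => sq_nonneg _) i2
    have h0 : 0 ≤ ∫ y in a..x, deriv G y ^ 2 :=
      intervalIntegral.integral_nonneg hx.1 fun _ _ => sq_nonneg _
    have := hx.2
    have := hx.1
    gcongr
  have hc : ContinuousOn (fun x => (G x - G a) ^ 2) (uIcc a b) := by
    rw [uIcc_of_le hab]
    exact ((hG.continuousOn.mono hsub).sub continuousOn_const).pow 2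
  have := intervalIntegral.integral_mono_on (μ := volume) hab hc.intervalIntegrable
    intervalIntegrable_const hpt
  rw [intervalIntegral.integral_const, smul_eq_mul] at this
  linarith

/-- The left-hand side is the squared distance of F from its mean, and the mean is the best constant
approximation in L². -/
theorem integral_sq_sub_le {F : ℝ → ℝ} {a b : ℝ} (hab : a < b) (i1 : IntervalIntegrable F volume a b)
    (i2 : IntervalIntegrable (fun x => F x ^ 2) volume a b) (k : ℝ) :
    (∫ x in a..b, F x ^ 2) - 1 / (b - a) * (∫ x in a..b, F x) * (∫ x in a..b, F x)
      ≤ ∫ x in a..b, (F x - k) ^ 2 := by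
  have e : ∀ x, (F x - k) ^ 2 = (F x ^ 2 - (2 * k) * F x) + k ^ 2 := fun x => by ring
  simp only [e]
  rw [intervalIntegral.integral_add (i2.sub (i1.const_mul _)) (by simp),
    intervalIntegral.integral_sub i2 (i1.const_mul _), intervalIntegral.integral_const_mul,
    intervalIntegral.integral_const, smul_eq_mul]
  have hl : 0 < b - a := sub_pos.2 hab
  have key : 0 ≤ 1 / (b - a) * ((∫ x in a..b, F x) - k * (b - a)) ^ 2 := by positivity
  have e2 : 1 / (b - a) * ((∫ x in a..b, F x) - k * (b - a)) ^ 2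
      = 1 / (b - a) * (∫ x in a..b, F x) * (∫ x in a..b, F x) - 2 * k * (∫ x in a..b, F x)
        + (b - a) * k ^ 2 := by field_simp; ring
  linarith

theorem sq_le_mul_of_quadratic {A B C : ℝ} (h : ∀ t : ℝ, 0 ≤ A + 2 * t * B + t ^ 2 * C) :
    B ^ 2 ≤ A * C := by
  have key : ∀ t : ℝ, 0 ≤ C * (t * t) + (2 * B) * t + A := fun t => by linarith [h t]
  have := discrim_le_zero key
  rw [discrim] at this
  linarith

namespace Mesh

variable (P : Mesh)

theorem node_nonneg (k : Fin (P.N + 1)) : 0 ≤ P.node k := (P.node_mem k).1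

theorem node_le_one (k : Fin (P.N + 1)) : P.node k ≤ 1 := (P.node_mem k).2

theorem node_lt (j : Fin P.N) : P.node j.castSucc < P.node j.succ :=
  P.strictMono Fin.castSucc_lt_succ

/-- The integral over a subinterval. -/
def cellInt (j : Fin P.N) (F : ℝ → ℝ) : ℝ := ∫ x in (P.node j.castSucc)..(P.node j.succ), F x

variable {P}

theorem cell_integrable {F : ℝ → ℝ} (hF : IntervalIntegrable F volume 0 1) (j : Fin P.N) :
    IntervalIntegrable F volume (P.node j.castSucc) (P.node j.succ) :=
  intervalIntegrable_sub hF (P.node_nonneg _) (P.node_lt j).le (P.node_le_one _)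

theorem integral_eq_sum_cellInt {F : ℝ → ℝ} (hF : IntervalIntegrable F volume 0 1) :
    ∫ x in (0 : ℝ)..1, F x = ∑ j, P.cellInt j F := by
  set a : ℕ → ℝ := fun k => if h : k < P.N + 1 then P.node ⟨k, h⟩ else 1 with ha
  have e0 : ∀ j : Fin P.N, a j = P.node j.castSucc := fun j => by
    have : (j : ℕ) < P.N + 1 := by omega
    simp only [ha, this, dif_pos]; rfl
  have e1 : ∀ j : Fin P.N, a (j + 1) = P.node j.succ := fun j => by
    have : (j : ℕ) + 1 < P.N + 1 := by omega
    simp only [ha, this, dif_pos]; rfl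
  have a0 : a 0 = 0 := by
    simp only [ha, Nat.zero_lt_succ, dif_pos]
    exact P.first
  have aN : a P.N = 1 := by
    have : P.N < P.N + 1 := by omega
    simp only [ha, this, dif_pos]
    exact P.last
  have h := intervalIntegral.sum_integral_adjacent_intervals (f := F) (a := a) (n := P.N)
    (μ := volume) (fun k hk => by
      rw [e0 ⟨k, hk⟩, e1 ⟨k, hk⟩]
      exact cell_integrable hF ⟨k, hk⟩)
  rw [a0, aN] at h
  rw [← h, Finset.sum_range]
  exact Finset.sum_congr rfl fun j _ => by rw [e0, e1, cellInt]

/-- The inner product of the cell averages. -/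
def meanIp (P : Mesh) (F K : ℝ → ℝ) : ℝ :=
  ∑ j, 1 / P.len j * P.cellInt j F * P.cellInt j K

theorem meanIp_self_nonneg (F : ℝ → ℝ) : 0 ≤ P.meanIp F F :=
  Finset.sum_nonneg fun j _ => by
    have := P.len_pos j
    rw [mul_assoc]
    exact mul_nonneg (by positivity) (mul_self_nonneg _)

theorem cellInt_add_mul {F K : ℝ → ℝ} (hF : InL2 F) (hK : InL2 K) (t : ℝ) (j : Fin P.N) :
    P.cellInt j (fun x => F x + t * K x) = P.cellInt j F + t * P.cellInt j K := by
  rw [cellInt, intervalIntegral.integral_add (cell_integrable hF.intervalIntegrable j)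
    ((cell_integrable hK.intervalIntegrable j).const_mul t), intervalIntegral.integral_const_mul]
  rfl

theorem meanIp_add_mul {F K : ℝ → ℝ} (hF : InL2 F) (hK : InL2 K) (t : ℝ) :
    P.meanIp (fun x => F x + t * K x) (fun x => F x + t * K x)
      = P.meanIp F F + 2 * t * P.meanIp F K + t ^ 2 * P.meanIp K K := by
  simp only [meanIp, cellInt_add_mul hF hK, Finset.mul_sum, ← Finset.sum_add_distrib]
  exact Finset.sum_congr rfl fun j _ => by ring

theorem meanIp_sq_le {F K : ℝ → ℝ} (hF : InL2 F) (hK : InL2 K) :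
    P.meanIp F K ^ 2 ≤ P.meanIp F F * P.meanIp K K :=
  sq_le_mul_of_quadratic fun t => by
    rw [← meanIp_add_mul hF hK]; exact meanIp_self_nonneg _

/-- The quantity ‖F‖² - `meanIp` F F is the squared L² distance from F to the piecewise constant
functions, so on each cell a comparison constant may be chosen freely. -/
theorem var_le {F q : ℝ → ℝ} (hF : InL2 F) (hq : IntervalIntegrable q volume 0 1)
    (h : ∀ j, ∃ k, P.cellInt j (fun x => (F x - k) ^ 2) ≤ P.cellInt j q) :
    sqNorm F - P.meanIp F F ≤ ∫ x in (0 : ℝ)..1, q x := by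
  have e : sqNorm F = ∑ j, P.cellInt j (fun x => F x ^ 2) :=
    integral_eq_sum_cellInt hF.intervalIntegrable_sq
  rw [e, meanIp, ← Finset.sum_sub_distrib, integral_eq_sum_cellInt (P := P) hq]
  refine Finset.sum_le_sum fun j _ => ?_
  obtain ⟨k, hk⟩ := h j
  exact (integral_sq_sub_le (P.node_lt j) (cell_integrable hF.intervalIntegrable j)
    (cell_integrable hF.intervalIntegrable_sq j) k).trans hk

theorem meanIp_self_le {F : ℝ → ℝ} (hF : InL2 F) : P.meanIp F F ≤ sqNorm F := by
  have h := var_le (P := P) hF (q := fun _ => 0) (by simp)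
  have e : sqNorm F = ∑ j, P.cellInt j (fun x => F x ^ 2) :=
    integral_eq_sum_cellInt hF.intervalIntegrable_sq
  rw [e, meanIp]
  refine Finset.sum_le_sum fun j _ => ?_
  have h1 := integral_sq_le hF (P.node_lt j).le (P.node_nonneg _) (P.node_le_one _)
  have := P.len_pos j
  rw [mul_assoc, div_mul_eq_mul_div, one_mul, div_le_iff₀ this, ← sq]
  rw [mul_comm]
  exact h1

/-- Subtracting `meanIp` from the inner product leaves the inner product of the deviations from the
cell means. It is positive semidefinite, hence satisfies the Cauchy–Schwarz inequality. -/
theorem cov_sq_le {F K : ℝ → ℝ} (hF : InL2 F) (hK : InL2 K) :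
    (ip F K - P.meanIp F K) ^ 2
      ≤ (sqNorm F - P.meanIp F F) * (sqNorm K - P.meanIp K K) :=
  sq_le_mul_of_quadratic fun t => by
    have hs : InL2 (fun x => t * K x) := hK.const_mul t
    have h := meanIp_self_le (P := P) (hF.fun_add hs)
    rw [meanIp_add_mul hF hK, sqNorm_eq_ip, ip_add_left hF hs (hF.fun_add hs), ip_const_mul_left,
      ip_add_right hF hs hF, ip_add_right hF hs hK, ip_const_mul_right, ip_const_mul_right,
      ip_comm K F, ← sqNorm_eq_ip, ← sqNorm_eq_ip] at h
    linarith

theorem InH1.var_le {G : ℝ → ℝ} (hG : InH1 G) :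
    sqNorm G - P.meanIp G G ≤ P.h ^ 2 * sqNorm (deriv G) := by
  have h := Mesh.var_le (P := P) hG.inL2 (hG.deriv_inL2.intervalIntegrable_sq.const_mul (P.h ^ 2))
    fun j => ⟨G (P.node j.castSucc), by
      refine (hG.integral_sub_sq_le (P.node_nonneg _) (P.node_lt j).le (P.node_le_one _)).trans ?_
      rw [cellInt, intervalIntegral.integral_const_mul]
      have h0 : 0 ≤ ∫ x in (P.node j.castSucc)..(P.node j.succ), deriv G x ^ 2 :=
        intervalIntegral.integral_nonneg (P.node_lt j).le fun _ _ => sq_nonneg _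
      have h1 := P.len_le_h j
      have h2 := (P.len_pos j).le
      rw [len] at h1 h2
      gcongr⟩
  rwa [intervalIntegral.integral_const_mul] at h

theorem deriv_on_cell {v : ℝ → ℝ} (hv : v ∈ P.space) (j : Fin P.N) :
    ∃ b : ℝ, ∀ x ∈ Ioo (P.node j.castSucc) (P.node j.succ), deriv v x = b := by
  obtain ⟨a, b, h⟩ := hv.2 j
  refine ⟨b, fun x hx => ?_⟩
  have : v =ᶠ[nhds x] fun x => a + b * x :=
    Filter.eventuallyEq_of_mem (isOpen_Ioo.mem_nhds hx) h
  rw [this.deriv_eq]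
  simp

theorem cellInt_congr {F K : ℝ → ℝ} {j : Fin P.N}
    (h : ∀ᵐ x ∂volume.restrict (Ioo (0 : ℝ) 1), x ∈ Ioo (P.node j.castSucc) (P.node j.succ) → F x = K x) :
    P.cellInt j F = P.cellInt j K := by
  simp only [cellInt, intervalIntegral.integral_of_le (P.node_lt j).le, integral_Ioc_eq_integral_Ioo]
  refine integral_congr_ae ?_
  filter_upwards [ae_restrict_of_ae_restrict_of_subset
    (Ioo_subset_Ioo (P.node_nonneg _) (P.node_le_one _)) h, ae_restrict_mem measurableSet_Ioo]
    with x h1 h2 using h1 h2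

/-- A ramp has constant slope on its cell and is constant elsewhere, so testing with ramps reads off
the cell averages. -/
theorem ip_deriv_ramp {F : ℝ → ℝ} (hF : InL2 F) (j : Fin P.N) :
    ip F (deriv (P.ramp j)) = 1 / P.len j * P.cellInt j F := by
  have hr : InH1 (P.ramp j) := (P.lipschitzWith_ramp j).inH1
  rw [ip, integral_eq_sum_cellInt (P := P) (hF.intervalIntegrable_mul hr.2), Finset.sum_eq_single j]
  · rw [cellInt_congr (K := fun x => 1 / P.len j * F x), cellInt, intervalIntegral.integral_const_mul]
    · rfl
    · refine Filter.Eventually.of_forall fun x hx => ?_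
      have : P.ramp j =ᶠ[nhds x] fun x => (x - P.node j.castSucc) / P.len j :=
        Filter.eventuallyEq_of_mem (isOpen_Ioo.mem_nhds hx)
          fun y hy => P.ramp_of_mem (Ioo_subset_Icc_self hy)
      rw [this.deriv_eq]
      simp [mul_comm]
  · intro i _ hij
    rw [cellInt_congr (K := fun _ => 0), cellInt, intervalIntegral.integral_zero]
    refine Filter.Eventually.of_forall fun x hx => ?_
    have : ∃ k : ℝ, P.ramp j =ᶠ[nhds x] fun _ => k := by
      rcases lt_or_gt_of_ne hij with h | h
      · refine ⟨0, Filter.eventuallyEq_of_mem (isOpen_Ioo.mem_nhds hx) fun y hy => ?_⟩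
        exact P.ramp_of_le (hy.2.le.trans (P.strictMono.monotone (Fin.succ_le_castSucc_iff.2 h)))
      · refine ⟨1, Filter.eventuallyEq_of_mem (isOpen_Ioo.mem_nhds hx) fun y hy => ?_⟩
        exact P.ramp_of_ge ((P.strictMono.monotone (Fin.succ_le_castSucc_iff.2 h)).trans hy.1.le)
    obtain ⟨k, hk⟩ := this
    rw [hk.deriv_eq, deriv_const, mul_zero]
  · simp

end Mesh

/-- The error of the elliptic projection, in terms of the oscillation of its derivative. -/
theorem projection_error {lam Q : ℝ} {P : Mesh} {η : ℝ → ℝ} (hlam : 0 < lam) (hη : InH1 η)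
    (orth : ∀ χ ∈ P.space, ip (deriv η) (deriv χ) = -lam * ip η χ)
    (hQ : sqNorm (deriv η) - P.meanIp (deriv η) (deriv η) ≤ Q) :
    hsq η ≤ (5 + 4 * lam ^ 2) * (P.h ^ 2 * Q) := by
  obtain ⟨hΨ, hΨd⟩ := inH1_of_primitive hη.inL2 (f := fun x => ∫ y in (0 : ℝ)..x, η y)
    (fun x _ => by simp)
  set Ψ : ℝ → ℝ := fun x => ∫ y in (0 : ℝ)..x, η y with hΨdef
  -- The constant function is in V_h and λ > 0, so η has mean zero and its primitive Ψ vanishes at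
  -- both end points.
  have hmean : ip η (fun _ => 1) = 0 := by
    have := orth _ (P.basis_mem none)
    simp only [Mesh.basis, deriv_const', ip, mul_zero, intervalIntegral.integral_zero] at this
    simp only [ip]
    exact (mul_eq_zero.1 this.symm).resolve_left (by linarith)
  have Ψ0 : Ψ 0 = 0 := by simp [hΨdef]
  have Ψ1 : Ψ 1 = 0 := by simpa [ip, hΨdef] using hmean
  -- Testing with the ramps shows that η_x and λΨ have the same cell averages. Everything that η_x
  -- contributes beyond them is a deviation from cell means, measured by Q.
  have hcell : ∀ j, P.cellInt j (deriv η) = lam * P.cellInt j Ψ := by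
    intro j
    have hr : InH1 (P.ramp j) := (P.lipschitzWith_ramp j).inH1
    have h1 := orth _ (P.ramp_mem j)
    have h2 := hΨ.ip_deriv hr
    rw [ip_congr hΨd (Filter.EventuallyEq.refl _ _), Ψ0, Ψ1, Mesh.ip_deriv_ramp hΨ.inL2] at h2
    rw [Mesh.ip_deriv_ramp hη.deriv_inL2, h2] at h1
    have hl := P.len_pos j
    field_simp at h1
    linarith
  have hM : ∀ K, P.meanIp (deriv η) K = lam * P.meanIp Ψ K := fun K => by
    simp only [Mesh.meanIp, hcell, Finset.mul_sum]
    exact Finset.sum_congr rfl fun j _ => by ring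
  have hcovΨ : sqNorm Ψ - P.meanIp Ψ Ψ ≤ P.h ^ 2 * sqNorm η := by
    have := Mesh.InH1.var_le (P := P) hΨ
    rwa [sqNorm_congr hΨd] at this
  have n0 := sqNorm_nonneg η
  have Q0 : 0 ≤ Q := (sub_nonneg.2 (Mesh.meanIp_self_le hη.deriv_inL2)).trans hQ
  have h0 := P.h_nonneg
  -- the estimate of the norm
  have hn : sqNorm η ≤ P.h ^ 2 * Q := by
    have e1 : sqNorm η = -ip (deriv η) Ψ := by
      have := hΨ.ip_deriv hη
      rw [ip_congr hΨd (Filter.EventuallyEq.refl _ _), Ψ0, Ψ1, ← sqNorm_eq_ip, ip_comm Ψ] at this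
      linarith
    have c := Mesh.cov_sq_le (P := P) hη.deriv_inL2 hΨ.inL2
    have m0 := mul_nonneg hlam.le (Mesh.meanIp_self_nonneg (P := P) Ψ)
    rw [hM Ψ] at c
    set D := ip (deriv η) Ψ - lam * P.meanIp Ψ Ψ with hD
    have e2 : sqNorm η ≤ -D := by rw [e1, hD]; linarith
    have c2 : D ^ 2 ≤ Q * (P.h ^ 2 * sqNorm η) :=
      c.trans (mul_le_mul hQ hcovΨ (sub_nonneg.2 (Mesh.meanIp_self_le hΨ.inL2)) Q0)
    have c3 : sqNorm η ^ 2 ≤ sqNorm η * (P.h ^ 2 * Q) := by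
      have : sqNorm η ^ 2 ≤ (-D) ^ 2 := by gcongr
      linarith [neg_sq D]
    rcases eq_or_lt_of_le n0 with h | h
    · rw [← h]; positivity
    · rw [sq] at c3
      exact le_of_mul_le_mul_left c3 h
  -- the estimate at the end points
  have hΨn : sqNorm Ψ ≤ sqNorm η := by
    have := hΨ.sqNorm_le_xsq
    rw [sqNorm_congr hΨd, Ψ0, Ψ1] at this
    linarith
  -- The end point values of η are (η_x, G) with G = x - 1 and G = x, because η has mean zero.
  -- Splitting into means and deviations gains a factor h in both parts: the deviation of G is O(h),
  -- and the mean part is λ times that of Ψ, already estimated.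
  have trace : ∀ (G : ℝ → ℝ), InH1 G → sqNorm (deriv G) ≤ 1 → sqNorm G ≤ 1 →
      ip (deriv η) G ^ 2 ≤ 2 * (1 + lam ^ 2) * (P.h ^ 2 * Q) := by
    intro G hG d1 d2
    have c := Mesh.cov_sq_le (P := P) hη.deriv_inL2 hG.inL2
    have v := Mesh.InH1.var_le (P := P) hG
    have v' : sqNorm G - P.meanIp G G ≤ P.h ^ 2 := v.trans (by nlinarith [sq_nonneg P.h])
    have c1 : (ip (deriv η) G - P.meanIp (deriv η) G) ^ 2 ≤ Q * P.h ^ 2 :=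
      c.trans (mul_le_mul hQ v' (sub_nonneg.2 (Mesh.meanIp_self_le hG.inL2)) Q0)
    have m1 := Mesh.meanIp_sq_le (P := P) hΨ.inL2 hG.inL2
    have m2 : P.meanIp Ψ G ^ 2 ≤ P.h ^ 2 * Q * 1 := m1.trans
      (mul_le_mul (((Mesh.meanIp_self_le hΨ.inL2).trans hΨn).trans hn)
        ((Mesh.meanIp_self_le hG.inL2).trans d2) (Mesh.meanIp_self_nonneg _) (by positivity))
    rw [hM G] at c1
    have m3 := mul_le_mul_of_nonneg_left m2 (sq_nonneg lam)
    nlinarith [sq_nonneg (ip (deriv η) G - 2 * (lam * P.meanIp Ψ G))]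
  have hid : InH1 (fun x => x) := (LipschitzWith.id).inH1
  have i1 : InH1 (fun x => x - 1) := hid.sub (inH1_const 1)
  have s1 : sqNorm (deriv fun x : ℝ => x) ≤ 1 := by simp [sqNorm]
  have s2 : sqNorm (fun x : ℝ => x) ≤ 1 := by simp [sqNorm]; norm_num
  have s3 : sqNorm (deriv fun x : ℝ => x - 1) ≤ 1 := by simp [sqNorm]
  have s4 : sqNorm (fun x : ℝ => x - 1) ≤ 1 := by
    have : sqNorm (fun x : ℝ => x - 1) = 1 / 3 := by
      simp only [sqNorm]
      rw [intervalIntegral.integral_comp_sub_right (fun x => x ^ 2)]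
      norm_num
    rw [this]; norm_num
  have t1 := trace _ hid s1 s2
  have t0 := trace _ i1 s3 s4
  have e1 : ip (deriv η) (fun x => x) = η 1 := by
    have := hη.ip_deriv hid
    rw [deriv_id'', hmean] at this
    linarith
  have e0 : ip (deriv η) (fun x => x - 1) = η 0 := by
    have := hη.ip_deriv i1
    have d : deriv (fun x : ℝ => x - 1) = fun _ => 1 := by funext x; simp
    rw [d, hmean] at this
    linarith
  rw [e1] at t1
  rw [e0] at t0
  rw [hsq]
  linarith

theorem IsEllipticProjection.orth {lam : ℝ} {P : Mesh} {f v : ℝ → ℝ}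
    (h : IsEllipticProjection lam P f v) (hf : InH1 f) {χ : ℝ → ℝ} (hχ : χ ∈ P.space) :
    ip (deriv fun x => f x - v x) (deriv χ) = -lam * ip (fun x => f x - v x) χ := by
  have h1 := h.2 χ hχ
  rw [ip_congr (hf.deriv_sub (Mesh.inH1_of_mem h.1)) (Filter.EventuallyEq.refl _ _)]
  simp only [ip]
  linarith

/-- On each cell the projection has constant slope, so η_x deviates from its cell mean only as much
as f_x does. Poincaré turns this into h times the second derivative. -/
theorem hsq_projection_error_le {lam : ℝ} {P : Mesh} {f v g z : ℝ → ℝ} (hlam : 0 < lam)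
    (hf : InH1 f) (hg : InH1 g) (hfg : deriv f =ᵐ[volume.restrict (Ioo (0 : ℝ) 1)] g)
    (hgz : deriv g =ᵐ[volume.restrict (Ioo (0 : ℝ) 1)] z)
    (h : IsEllipticProjection lam P f v) :
    hsq (fun x => f x - v x) ≤ (5 + 4 * lam ^ 2) * (P.h ^ 4 * sqNorm z) := by
  have hv := Mesh.inH1_of_mem h.1
  refine (projection_error hlam (hf.sub hv) (fun χ hχ => h.orth hf hχ)
    (Q := P.h ^ 2 * sqNorm z) ?_).trans_eq (by ring)
  have e := Mesh.var_le (P := P) (hf.sub hv).deriv_inL2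
    (hg.deriv_inL2.intervalIntegrable_sq.const_mul (P.h ^ 2)) fun j => by
      obtain ⟨b, hb⟩ := Mesh.deriv_on_cell h.1 j
      refine ⟨g (P.node j.castSucc) - b, ?_⟩
      rw [Mesh.cellInt_congr (K := fun x => (g x - g (P.node j.castSucc)) ^ 2)]
      · refine (hg.integral_sub_sq_le (P.node_nonneg _) (P.node_lt j).le (P.node_le_one _)).trans ?_
        rw [Mesh.cellInt, intervalIntegral.integral_const_mul]
        have h0 : 0 ≤ ∫ x in (P.node j.castSucc)..(P.node j.succ), deriv g x ^ 2 :=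
          intervalIntegral.integral_nonneg (P.node_lt j).le fun _ _ => sq_nonneg _
        have h1 := P.len_le_h j
        have h2 := (P.len_pos j).le
        rw [Mesh.len] at h1 h2
        gcongr
      · filter_upwards [hf.deriv_sub hv, hfg] with x h1 h2 h3
        rw [h1, h2, hb x h3]
        ring
  rw [intervalIntegral.integral_const_mul] at e
  rwa [← sqNorm_congr hgz]

/-- The crude version without second derivatives. It bounds the size of θ at the end points, which
enters the coefficients of the second error energy. -/
theorem hsq_projection_error_le_xsq {lam : ℝ} {P : Mesh} {f v : ℝ → ℝ} (hlam : 0 < lam)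
    (hf : InH1 f) (h : IsEllipticProjection lam P f v) :
    hsq (fun x => f x - v x) ≤ (5 + 4 * lam ^ 2) * xsq f := by
  have hv := Mesh.inH1_of_mem h.1
  have e := Mesh.var_le (P := P) (hf.sub hv).deriv_inL2
    hf.deriv_inL2.intervalIntegrable_sq fun j => by
      obtain ⟨b, hb⟩ := Mesh.deriv_on_cell h.1 j
      refine ⟨-b, ?_⟩
      rw [Mesh.cellInt_congr (K := fun x => deriv f x ^ 2)]
      filter_upwards [hf.deriv_sub hv] with x h1 h3
      rw [h1, hb x h3]
      ring
  refine (projection_error hlam (hf.sub hv) (fun χ hχ => h.orth hf hχ)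
    (Q := sqNorm (deriv f)) e).trans ?_
  have h1 : P.h ^ 2 ≤ 1 := pow_le_one₀ P.h_nonneg P.h_le_one
  have h2 := sqNorm_nonneg (deriv f)
  calc (5 + 4 * lam ^ 2) * (P.h ^ 2 * sqNorm (deriv f))
      ≤ (5 + 4 * lam ^ 2) * (1 * xsq f) := by
        gcongr
        exact sqNorm_deriv_le_xsq f
    _ = _ := by ring

/-- Stability of the projection in |||·|||, uniform over all partitions: the gradient by testing
with v itself, the end point values through the projection error. It bounds the initial value of the
discrete solution. -/
theorem xsq_projection_le {lam : ℝ} {P : Mesh} {f v : ℝ → ℝ} (hlam : 0 < lam)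
    (hf : InH1 f) (h : IsEllipticProjection lam P f v) :
    xsq v ≤ (15 + lam + 8 * lam ^ 2) * xsq f := by
  have hv := Mesh.inH1_of_mem h.1
  have h1 := hsq_projection_error_le_xsq hlam hf h
  have o := h.orth hf h.1
  rw [hf.ip_deriv_sub_left hv hv.2, ip_sub_left hf.inL2 hv.inL2 hv.inL2, ← sqNorm_eq_ip,
    ← sqNorm_eq_ip] at o
  have y1 := (abs_le.1 (abs_ip_le_young hf.deriv_inL2 hv.deriv_inL2 one_pos)).2
  have y2 := (abs_le.1 (abs_ip_le_young hf.inL2 hv.inL2 one_pos)).2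
  have y3 := mul_le_mul_of_nonneg_left y2 hlam.le
  have n0 := mul_nonneg hlam.le (sqNorm_nonneg v)
  have n1 := mul_le_mul_of_nonneg_left hf.sqNorm_le_xsq' hlam.le
  have n2 := sqNorm_deriv_le_xsq f
  have d : sqNorm (deriv v) ≤ (1 + lam) * xsq f := by linarith
  have e0 : v 0 ^ 2 ≤ 2 * f 0 ^ 2 + 2 * (f 0 - v 0) ^ 2 := by nlinarith [sq_nonneg (f 0 + (f 0 - v 0))]
  have e1 : v 1 ^ 2 ≤ 2 * f 1 ^ 2 + 2 * (f 1 - v 1) ^ 2 := by nlinarith [sq_nonneg (f 1 + (f 1 - v 1))]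
  have q : (f 0 - v 0) ^ 2 + (f 1 - v 1) ^ 2 ≤ hsq (fun x => f x - v x) := by
    rw [hsq]; linarith [sqNorm_nonneg fun x => f x - v x]
  have q2 : f 0 ^ 2 + f 1 ^ 2 ≤ xsq f := by
    rw [xsq]; linarith [sqNorm_nonneg (deriv f)]
  have X0 := xsq_nonneg f
  rw [xsq]
  nlinarith

/-! ### Curves with values in a finite-dimensional space -/

theorem inH1_sum {ι : Type*} (s : Finset ι) {e : ι → ℝ → ℝ} (he : ∀ k, InH1 (e k)) (a : ι → ℝ) :
    InH1 (fun x => ∑ k ∈ s, a k * e k x) ∧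
      deriv (fun x => ∑ k ∈ s, a k * e k x) =ᵐ[volume.restrict (Ioo (0 : ℝ) 1)]
        fun x => ∑ k ∈ s, a k * deriv (e k) x := by
  classical
  induction s using Finset.induction_on with
  | empty => simpa using inH1_const 0
  | insert k s hk ih =>
    simp only [Finset.sum_insert hk]
    have hm := (he k).const_mul (a k)
    refine ⟨hm.add ih.1, ?_⟩
    filter_upwards [hm.deriv_add ih.1, ih.2] with x h1 h2
    rw [h1, h2, deriv_const_mul_field]

theorem InL2.sum {ι : Type*} (s : Finset ι) {f : ι → ℝ → ℝ} (hf : ∀ k, InL2 (f k)) (a : ι → ℝ) :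
    InL2 (fun x => ∑ k ∈ s, a k * f k x) :=
  memLp_finsetSum s fun k _ => (hf k).const_mul (a k)

theorem ip_sum_left {ι : Type*} (s : Finset ι) {f : ι → ℝ → ℝ} (hf : ∀ k, InL2 (f k)) (a : ι → ℝ)
    {g : ℝ → ℝ} (hg : InL2 g) : ip (fun x => ∑ k ∈ s, a k * f k x) g = ∑ k ∈ s, a k * ip (f k) g := by
  classical
  induction s using Finset.induction_on with
  | empty => simp [ip]
  | insert k s hk ih =>
    simp only [Finset.sum_insert hk]
    rw [ip_add_left ((hf k).const_mul (a k)) (InL2.sum s hf a) hg, ip_const_mul_left, ih]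

theorem inL2T_mul {T : ℝ} {a b : ℝ → ℝ} (ha : MemLp a 2 (volume.restrict (Ioo 0 T))) (hb : InL2 b) :
    InL2T T (fun t x => a t * b x) := by
  have hm : AEStronglyMeasurable (fun p : ℝ × ℝ => a p.1 * b p.2)
      ((volume.restrict (Ioo 0 T)).prod (volume.restrict (Ioo 0 1))) :=
    ha.1.comp_fst.mul hb.1.comp_snd
  refine (memLp_two_iff_integrable_sq hm).2 ?_
  simp only [mul_pow]
  exact ha.integrable_sq.mul_prod hb.integrable_sq

theorem H1Curve.of_finite {ι : Type*} [Fintype ι] {e : ι → ℝ → ℝ} (he : ∀ k, InH1 (e k))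
    {Y y : ι → ℝ → ℝ} (hY : ∀ k, HasPrim (Y k) (y k))
    (hy : ∀ k, ∀ T, 0 < T → MemLp (y k) 2 (volume.restrict (Ioo 0 T))) {u : ℝ → ℝ → ℝ}
    (hu : ∀ t, 0 ≤ t → ∀ x ∈ Icc (0 : ℝ) 1, u t x = ∑ k, Y k t * e k x) :
    H1Curve u (fun t x => ∑ k, y k t * e k x) := by
  refine ⟨fun t ht => ((inH1_sum Finset.univ he fun k => Y k t).1).congr fun x hx =>
    (hu t ht x hx).symm, Filter.Eventually.of_forall fun t => (inH1_sum Finset.univ he _).1,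
    fun T hT => memLp_finsetSum _ fun k _ => inL2T_mul (hy k T hT) (he k).inL2,
    ⟨fun t x => ∑ k, y k t * deriv (e k) x, fun T hT => memLp_finsetSum _ fun k _ =>
      inL2T_mul (hy k T hT) (he k).2, Filter.Eventually.of_forall fun t =>
      (inH1_sum Finset.univ he _).2⟩, fun t ht x hx => ?_⟩
  rw [hu t ht x hx, hu 0 le_rfl x hx, intervalIntegral.integral_finsetSum
    fun k _ => ((hY k).int t ht).mul_const _, ← Finset.sum_add_distrib]
  refine Finset.sum_congr rfl fun k _ => ?_
  rw [intervalIntegral.integral_mul_const, (hY k).eq t ht]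
  ring

theorem ae_hasDerivAt_of_finite {ι : Type*} [Fintype ι] {e : ι → ℝ → ℝ}
    {Y y : ι → ℝ → ℝ} (hY : ∀ k, HasPrim (Y k) (y k)) {u : ℝ → ℝ → ℝ}
    (hu : ∀ t, 0 ≤ t → ∀ x ∈ Icc (0 : ℝ) 1, u t x = ∑ k, Y k t * e k x) :
    ∀ᵐ s ∂volume.restrict (Ioi (0 : ℝ)), ∀ x ∈ Icc (0 : ℝ) 1,
      HasDerivAt (fun t => u t x) (∑ k, y k s * e k x) s := by
  filter_upwards [ae_all_iff.2 fun k => (hY k).ae_hasDerivAt, ae_restrict_mem measurableSet_Ioi]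
    with s hs hs0 x hx
  have := HasDerivAt.fun_sum fun k (_ : k ∈ Finset.univ) => (hs k).mul_const (e k x)
  exact this.congr_of_eventuallyEq (Filter.eventuallyEq_of_mem (Ioi_mem_nhds hs0)
    fun t ht => hu t (le_of_lt ht) x hx)

theorem memLp_ip {V : ℝ → ℝ → ℝ} (h : ∀ T, 0 < T → InL2T T V) {G : ℝ → ℝ} (hG : InL2 G) {T : ℝ}
    (hT : 0 < T) : MemLp (fun s => ip (V s) G) 2 (volume.restrict (Ioo 0 T)) := by
  have h1 := (intervalIntegrable_iff_Ioo hT.le).1 (intervalIntegrable_ip h hG T hT.le)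
  have h2 := (intervalIntegrable_iff_Ioo hT.le).1 ((intervalIntegrable_sqNorm h T hT.le).mul_const
    (sqNorm G))
  refine (memLp_two_iff_integrable_sq h1.1).2 (h2.mono' (h1.1.pow 2) ?_)
  filter_upwards [InL2T.ae_inL2 (h T hT)] with s hs
  rw [Real.norm_eq_abs, abs_of_nonneg (sq_nonneg _)]
  exact ip_sq_le hs hG

theorem H1Curve.memLp_ip_deriv {u ut : ℝ → ℝ → ℝ} (h : H1Curve u ut) {G : ℝ → ℝ} (hG : InL2 G)
    {T : ℝ} (hT : 0 < T) :
    MemLp (fun s => ip (deriv (ut s)) G) 2 (volume.restrict (Ioo 0 T)) := by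
  obtain ⟨p, hp, hpe⟩ := h.memx
  refine (memLp_congr_ae ?_).1 (memLp_ip hp hG hT)
  filter_upwards [ae_Ioo_of_ae_Ioi hpe T] with s hs
  exact ip_congr hs.symm (Filter.EventuallyEq.refl _ _)

/-! ### The elliptic projection as a linear map -/

/-- The bilinear form that defines the elliptic projection. -/
def ellForm (lam : ℝ) (f g : ℝ → ℝ) : ℝ := ip (deriv f) (deriv g) + lam * ip f g

theorem ellForm_comm (lam : ℝ) (f g : ℝ → ℝ) : ellForm lam f g = ellForm lam g f := by
  rw [ellForm, ellForm, ip_comm, ip_comm f]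

theorem ellForm_congr_left {lam : ℝ} {f f' : ℝ → ℝ} (h : EqOn f f' (Icc 0 1)) (g : ℝ → ℝ) :
    ellForm lam f g = ellForm lam f' g := by
  rw [ellForm, ellForm, ip_congr (deriv_ae_congr h) (Filter.EventuallyEq.refl _ _),
    ip_congr (EqOn.ae_eq_Ioo (h.mono Ioo_subset_Icc_self)) (Filter.EventuallyEq.refl _ _)]

theorem ellForm_sum_left {ι : Type*} (s : Finset ι) (lam : ℝ) {e : ι → ℝ → ℝ}
    (he : ∀ k, InH1 (e k)) (a : ι → ℝ) {g : ℝ → ℝ} (hg : InH1 g) :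
    ellForm lam (fun x => ∑ k ∈ s, a k * e k x) g = ∑ k ∈ s, a k * ellForm lam (e k) g := by
  rw [ellForm, ip_congr (inH1_sum s he a).2 (Filter.EventuallyEq.refl _ _),
    ip_sum_left s (fun k => (he k).2) a hg.2, ip_sum_left s (fun k => (he k).inL2) a hg.inL2,
    Finset.mul_sum, ← Finset.sum_add_distrib]
  refine Finset.sum_congr rfl fun k _ => ?_
  rw [ellForm]; ring

theorem isEllipticProjection_iff {lam : ℝ} {P : Mesh} {f v : ℝ → ℝ} (hf : InH1 f) :
    IsEllipticProjection lam P f v ↔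
      v ∈ P.space ∧ ∀ χ ∈ P.space, ellForm lam f χ = ellForm lam v χ := by
  refine and_congr_right fun hv => forall₂_congr fun χ hχ => ?_
  have hv' := P.inH1_of_mem hv
  have hχ' := P.inH1_of_mem hχ
  have e1 := ip_sub_left hf.2 hv'.2 hχ'.2
  have e2 := ip_sub_left hf.inL2 hv'.inL2 hχ'.inL2
  simp only [ellForm]
  rw [ip] at e1 e2
  rw [e1, e2]
  constructor <;> intro h <;> linarith

namespace Mesh

variable (P : Mesh) {lam : ℝ}

/-- The Gram matrix of the basis of `V_h`. -/
def gram (lam : ℝ) : Matrix (Option (Fin P.N)) (Option (Fin P.N)) ℝ :=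
  Matrix.of fun k l => ellForm lam (P.basis k) (P.basis l)

theorem gram_mulVec (y : Option (Fin P.N) → ℝ) (l : Option (Fin P.N)) :
    (P.gram lam).mulVec y l = ellForm lam (fun x => ∑ k, y k * P.basis k x) (P.basis l) := by
  rw [ellForm_sum_left _ _ P.basis_inH1 _ (P.basis_inH1 l)]
  simp only [Matrix.mulVec, dotProduct, gram, Matrix.of_apply]
  exact Finset.sum_congr rfl fun k _ => by rw [ellForm_comm, mul_comm]

/-- A vector in the kernel gives v in V_h with ‖v_x‖² + λ‖v‖² = 0. The trace inequality then forces
v to vanish pointwise, and with it its coordinates. -/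
theorem isUnit_gram (hlam : 0 < lam) : IsUnit (P.gram lam) := by
  rw [← Matrix.mulVec_injective_iff_isUnit]
  refine (injective_iff_map_eq_zero (P.gram lam).mulVecLin).2 fun y hy => ?_
  have hy' : ∀ l, ellForm lam (fun x => ∑ k, y k * P.basis k x) (P.basis l) = 0 := fun l => by
    rw [← P.gram_mulVec]; exact congrFun hy l
  have hv := (inH1_sum Finset.univ P.basis_inH1 y).1
  have h0 : ellForm lam (fun x => ∑ k, y k * P.basis k x) (fun x => ∑ k, y k * P.basis k x) = 0 := by
    rw [ellForm_sum_left _ _ P.basis_inH1 _ hv]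
    refine Finset.sum_eq_zero fun k _ => ?_
    rw [ellForm_comm, hy', mul_zero]
  set v : ℝ → ℝ := fun x => ∑ k, y k * P.basis k x with hvdef
  rw [ellForm, ← sqNorm_eq_ip, ← sqNorm_eq_ip] at h0
  have n1 := sqNorm_nonneg (deriv v)
  have n2 := sqNorm_nonneg v
  have z : sqNorm v = 0 := by nlinarith
  have hz : EqOn v (fun _ => 0) (Icc 0 1) := fun x hx => by
    have := hv.sq_le_trace hx
    rw [z] at this
    simp only [Real.sqrt_zero, zero_mul, mul_zero, add_zero] at this
    exact pow_eq_zero_iff two_ne_zero |>.1 (le_antisymm this (sq_nonneg _))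
  funext k
  rw [← P.coord_sum y k, P.coord_congr hz k]
  cases k <;> simp [coord]

/-- The coordinates of the elliptic projection. -/
def projCoord (lam : ℝ) (f : ℝ → ℝ) (k : Option (Fin P.N)) : ℝ :=
  ∑ l, (P.gram lam)⁻¹ k l * ellForm lam f (P.basis l)

/-- The projection is unique on [0,1] and its coordinates are fixed linear combinations of the
functionals `ellForm` against the basis. This transfers the regularity in time from w to its
projection. -/
theorem coord_eq_projCoord (hlam : 0 < lam) {f v : ℝ → ℝ} (hf : InH1 f)
    (h : IsEllipticProjection lam P f v) (k : Option (Fin P.N)) :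
    P.coord k v = P.projCoord lam f k := by
  rw [isEllipticProjection_iff hf] at h
  have hA := (Matrix.isUnit_iff_isUnit_det _).1 (P.isUnit_gram hlam)
  have e : (P.gram lam).mulVec (fun k => P.coord k v) = fun l => ellForm lam f (P.basis l) := by
    funext l
    rw [P.gram_mulVec, h.2 _ (P.basis_mem l)]
    exact ellForm_congr_left (fun x hx => (P.eq_sum_basis h.1 hx).symm) _
  have := congrFun (congrArg (P.gram lam)⁻¹.mulVec e) k
  rw [Matrix.mulVec_mulVec, Matrix.nonsing_inv_mul _ hA, Matrix.one_mulVec] at this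
  exact this

theorem isEllipticProjection_projCoord (hlam : 0 < lam) {f : ℝ → ℝ} (hf : InH1 f) :
    IsEllipticProjection lam P f (fun x => ∑ k, P.projCoord lam f k * P.basis k x) := by
  rw [isEllipticProjection_iff hf]
  have hv := P.sum_mem_space Finset.univ (P.projCoord lam f) P.basis_mem
  refine ⟨hv, fun χ hχ => ?_⟩
  have hA := (Matrix.isUnit_iff_isUnit_det _).1 (P.isUnit_gram hlam)
  have e : ∀ l, ellForm lam (fun x => ∑ k, P.projCoord lam f k * P.basis k x) (P.basis l)
      = ellForm lam f (P.basis l) := by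
    intro l
    rw [← P.gram_mulVec]
    have : P.projCoord lam f = (P.gram lam)⁻¹.mulVec fun l => ellForm lam f (P.basis l) := rfl
    rw [this, Matrix.mulVec_mulVec, Matrix.mul_nonsing_inv _ hA, Matrix.one_mulVec]
  have hc : EqOn χ (fun x => ∑ k, P.coord k χ * P.basis k x) (Icc 0 1) := fun x hx =>
    P.eq_sum_basis hχ hx
  rw [ellForm_comm, ellForm_congr_left hc, ellForm_sum_left _ _ P.basis_inH1 _ hf, ellForm_comm,
    ellForm_congr_left hc, ellForm_sum_left _ _ P.basis_inH1 _ (P.inH1_of_mem hv)]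
  refine Finset.sum_congr rfl fun k _ => ?_
  rw [ellForm_comm lam _ f, ← e, ellForm_comm]

theorem hasPrim_projCoord {w wt : ℝ → ℝ → ℝ} (h : H1Curve w wt) (k : Option (Fin P.N)) :
    HasPrim (fun t => P.projCoord lam (w t) k) (fun t => P.projCoord lam (wt t) k) :=
  HasPrim.finsetSum _ fun l => HasPrim.const_mul
    ((h.hasPrim_ip_deriv (P.basis_inH1 l).2).add
      ((h.l2.hasPrim_ip (P.basis_inH1 l).inL2).const_mul lam)) _

theorem memLp_projCoord {w wt : ℝ → ℝ → ℝ} (h : H1Curve w wt) (k : Option (Fin P.N)) {T : ℝ}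
    (hT : 0 < T) : MemLp (fun t => P.projCoord lam (wt t) k) 2 (volume.restrict (Ioo 0 T)) :=
  memLp_finsetSum _ fun l _ => MemLp.const_mul
    ((h.memLp_ip_deriv (P.basis_inH1 l).2 hT).add
      ((memLp_ip h.mem (P.basis_inH1 l).inL2 hT).const_mul lam)) _

end Mesh

/-- The elliptic projection of a curve, with its time derivative. -/
theorem H1Curve.exists_projection {lam : ℝ} (hlam : 0 < lam) {P : Mesh} {w wt wp : ℝ → ℝ → ℝ}
    (h : H1Curve w wt) (hp : ∀ t, 0 ≤ t → IsEllipticProjection lam P (w t) (wp t)) :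
    ∃ wpt : ℝ → ℝ → ℝ, H1Curve wp wpt ∧
      (∀ᵐ s ∂volume.restrict (Ioi (0 : ℝ)), IsEllipticProjection lam P (wt s) (wpt s)) ∧
      ∀ᵐ s ∂volume.restrict (Ioi (0 : ℝ)), ∀ x ∈ Icc (0 : ℝ) 1,
        HasDerivAt (fun t => wp t x) (wpt s x) s := by
  have hu : ∀ t, 0 ≤ t → ∀ x ∈ Icc (0 : ℝ) 1,
      wp t x = ∑ k, P.projCoord lam (w t) k * P.basis k x := fun t ht x hx => by
    rw [P.eq_sum_basis (hp t ht).1 hx]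
    exact Finset.sum_congr rfl fun k _ => by rw [P.coord_eq_projCoord hlam (h.h1 t ht) (hp t ht)]
  refine ⟨_, H1Curve.of_finite P.basis_inH1 (fun k => P.hasPrim_projCoord (lam := lam) h k)
    (fun k T hT => P.memLp_projCoord h k hT) hu, ?_,
    ae_hasDerivAt_of_finite (fun k => P.hasPrim_projCoord (lam := lam) h k) hu⟩
  filter_upwards [h.h1t] with s hs using P.isEllipticProjection_projCoord hlam hs

/-! ### The semidiscrete solution as a curve -/

theorem weakForm_congr_rate {ν μ wd : ℝ} {c : Fin 2 → ℝ} {u ut ut' χ : ℝ → ℝ}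
    (h : EqOn ut ut' (Icc 0 1)) : weakForm ν μ wd c u ut χ = weakForm ν μ wd c u ut' χ := by
  rw [weakForm_eq, weakForm_eq, h (x := 0) (by simp), h (x := 1) (by simp),
    ip_congr (EqOn.ae_eq_Ioo (h.mono Ioo_subset_Icc_self)) (Filter.EventuallyEq.refl _ χ),
    ip_congr (deriv_ae_congr h) (Filter.EventuallyEq.refl _ (deriv χ))]

theorem neg_boundary_rate_le {k κ s r δ A : ℝ} (hk : 0 ≤ k) (hκ : 0 ≤ κ) (hδ : 0 < δ)
    (hs : s ^ 2 ≤ A) :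
    -(k * (2 * s * r) + κ * (4 * s ^ 3 * r)) ≤ δ / 2 * r ^ 2 + 1 / (2 * δ) * (2 * k + 4 * κ * A) ^ 2 * A := by
  have hA : 0 ≤ A := (sq_nonneg s).trans hs
  have h1 := neg_le_of_abs_le (abs_mul_le_young hδ (a := r) (b := (2 * k + 4 * κ * s ^ 2) * s))
  have h2 : ((2 * k + 4 * κ * s ^ 2) * s) ^ 2 ≤ (2 * k + 4 * κ * A) ^ 2 * A := by
    rw [mul_pow]
    have : 2 * k + 4 * κ * s ^ 2 ≤ 2 * k + 4 * κ * A := by nlinarith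
    gcongr
  have h3 : 1 / (2 * δ) * ((2 * k + 4 * κ * s ^ 2) * s) ^ 2
      ≤ 1 / (2 * δ) * ((2 * k + 4 * κ * A) ^ 2 * A) := by gcongr
  have e : -(k * (2 * s * r) + κ * (4 * s ^ 3 * r)) = -(r * ((2 * k + 4 * κ * s ^ 2) * s)) := by ring
  rw [e]
  linarith

/-- For fixed μ > 0 the terms with μ are coercive in the rate, so the equation bounds the rate by
the state at the same time. No bound on the size of the constant as μ tends to 0 is needed here. -/
theorem exists_rate_bound {ν μ wd : ℝ} {c : Fin 2 → ℝ} (hν : 0 < ν) (hμ : 0 < μ) (hwd : 0 ≤ wd)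
    (hc : ∀ i, 0 < c i) (A : ℝ) : ∃ K : ℝ, ∀ u ut : ℝ → ℝ, InH1 u → InH1 ut →
      weakForm ν μ wd c u ut ut = 0 → xsq u ≤ A → xsq ut ≤ K := by
  have hL : 0 < coer ν := coer_pos hν
  set δ := coer ν * μ with hδdef
  have hδ : 0 < δ := mul_pos hL hμ
  set B := 2 * (1 + wd) ^ 2 / coer ν / (1 + μ) * ((1 + A) * A) + 2 * ν ^ 2 / δ * A
    + 1 / (2 * δ) * (2 * (c 0 + 1 + wd) + 4 * (1 / (9 * c 0)) * A) ^ 2 * A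
    + 1 / (2 * δ) * (2 * (c 1 + 1 + wd) + 4 * (1 / (9 * c 1)) * A) ^ 2 * A with hB
  refine ⟨B / (δ / 2), fun u ut hu hut hw hA => ?_⟩
  have hX := xsq_nonneg u
  have k0 := hc 0
  have k1 := hc 1
  have e1 := energy₂'_le hν hμ hwd hc hu hut hw
  have b0 := neg_boundary_rate_le (k := c 0 + 1 + wd) (κ := 1 / (9 * c 0)) (r := ut 0)
    (by linarith) (by positivity) hδ ((sq_zero_le_xsq u).trans hA)
  have b1 := neg_boundary_rate_le (k := c 1 + 1 + wd) (κ := 1 / (9 * c 1)) (r := ut 1)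
    (by linarith) (by positivity) hδ ((sq_one_le_xsq u).trans hA)
  have y := neg_le_of_abs_le (abs_ip_le_young hut.2 hu.2 (k := δ / (2 * ν)) (by positivity))
  rw [ip_comm] at y
  have y' : -(2 * ν * ip (deriv u) (deriv ut))
      ≤ δ / 2 * sqNorm (deriv ut) + 2 * ν ^ 2 / δ * sqNorm (deriv u) := by
    have := mul_le_mul_of_nonneg_left y (show (0 : ℝ) ≤ 2 * ν by positivity)
    have e : 2 * ν * (-(δ / (2 * ν) / 2 * sqNorm (deriv ut)
        + 1 / (2 * (δ / (2 * ν))) * sqNorm (deriv u)))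
        = -(δ / 2 * sqNorm (deriv ut) + 2 * ν ^ 2 / δ * sqNorm (deriv u)) := by
      field_simp
    rw [e] at this
    linarith
  have z1 : 2 * ν ^ 2 / δ * sqNorm (deriv u) ≤ 2 * ν ^ 2 / δ * A := by
    have := (sqNorm_deriv_le_xsq u).trans hA
    gcongr
  have z2 : 2 * (1 + wd) ^ 2 / coer ν / (1 + μ) * ((1 + xsq u) * xsq u)
      ≤ 2 * (1 + wd) ^ 2 / coer ν / (1 + μ) * ((1 + A) * A) := by
    have := hX.trans hA
    gcongr
  have hr : δ * xsq ut ≤ coer ν * rate₂ μ ut := by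
    have := mul_nonneg hL.le (sqNorm_nonneg ut)
    rw [rate₂, hδdef]; linarith
  have hxe : xsq ut = ut 0 ^ 2 + ut 1 ^ 2 + sqNorm (deriv ut) := rfl
  rw [le_div_iff₀ (by positivity)]
  have e2 : energy₂' ν wd c u ut = 2 * ν * ip (deriv u) (deriv ut)
    + ((c 0 + 1 + wd) * (2 * u 0 * ut 0) + 1 / (9 * c 0) * (4 * u 0 ^ 3 * ut 0))
      + ((c 1 + 1 + wd) * (2 * u 1 * ut 1) + 1 / (9 * c 1) * (4 * u 1 ^ 3 * ut 1)) := by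
    rw [energy₂']; ring
  have hsum : δ / 2 * xsq ut = δ / 2 * ut 0 ^ 2 + δ / 2 * ut 1 ^ 2 + δ / 2 * sqNorm (deriv ut) := by
    rw [hxe]; ring
  linarith

theorem xsq_congr {f g : ℝ → ℝ} (h : EqOn f g (Icc 0 1)) : xsq f = xsq g := by
  rw [xsq, xsq, h (x := 0) (by simp), h (x := 1) (by simp), sqNorm_congr (deriv_ae_congr h)]

theorem continuousOn_xsq_of_finite {ι : Type*} [Fintype ι] {e : ι → ℝ → ℝ} (he : ∀ k, InH1 (e k))
    {Y : ι → ℝ → ℝ} {s : Set ℝ} (hY : ∀ k, ContinuousOn (Y k) s) :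
    ContinuousOn (fun t => xsq fun x => ∑ k, Y k t * e k x) s := by
  have hd : ∀ t, sqNorm (deriv fun x => ∑ k, Y k t * e k x)
      = ∑ k, Y k t * ∑ l, Y l t * ip (deriv (e l)) (deriv (e k)) := fun t => by
    have h := (inH1_sum Finset.univ he fun k => Y k t).2
    rw [sqNorm_eq_ip, ip_congr h h, ip_sum_left _ (fun k => (he k).2) _
      (InL2.sum Finset.univ (fun k => (he k).2) _)]
    refine Finset.sum_congr rfl fun k _ => ?_
    rw [ip_comm, ip_sum_left _ (fun k => (he k).2) _ (he k).2]
  simp only [xsq, hd]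
  have hv : ∀ x, ContinuousOn (fun t => ∑ k, Y k t * e k x) s := fun x =>
    continuousOn_finsetSum _ fun k _ => (hY k).mul continuousOn_const
  exact (((hv 0).pow 2).add ((hv 1).pow 2)).add (continuousOn_finsetSum _ fun k _ =>
    (hY k).mul (continuousOn_finsetSum _ fun l _ => (hY l).mul continuousOn_const))

theorem HasPrim.of_hasDerivAt {y φ : ℝ → ℝ} (hc : ContinuousOn y (Ici 0))
    (hd : ∀ t, 0 < t → HasDerivAt y (φ t) t)
    (hm : ∀ T, 0 < T → MemLp φ 2 (volume.restrict (Ioo 0 T))) : HasPrim y φ := by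
  have hi := intervalIntegrable_of_pos fun T hT => (hm T hT).integrable (by norm_num)
  refine ⟨hi, fun t ht => ?_⟩
  rw [intervalIntegral.integral_eq_sub_of_hasDerivAt_of_le ht (hc.mono Icc_subset_Ici_self)
    (fun x hx => hd x hx.1) (hi t ht)]
  ring

theorem Mesh.coord_sq_le {P : Mesh} {f : ℝ → ℝ} (hf : InH1 f) (k : Option (Fin P.N)) :
    P.coord k f ^ 2 ≤ 4 * xsq f := by
  cases k with
  | none => have := sq_zero_le_xsq f; have := xsq_nonneg f; simp only [coord]; linarith
  | some j =>
    have h1 := hf.sq_le_xsq' (P.node_mem j.succ)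
    have h2 := hf.sq_le_xsq' (P.node_mem j.castSucc)
    simp only [coord]
    nlinarith [sq_nonneg (f (P.node j.succ) + f (P.node j.castSucc))]

theorem Mesh.continuousOn_coord {P : Mesh} {u : ℝ → ℝ → ℝ} {s : Set ℝ}
    (h : ∀ x ∈ Icc (0 : ℝ) 1, ContinuousOn (fun t => u t x) s) (k : Option (Fin P.N)) :
    ContinuousOn (fun t => P.coord k (u t)) s := by
  cases k with
  | none => exact h 0 (by simp)
  | some j => exact (h _ (P.node_mem _)).sub (h _ (P.node_mem _))

theorem Mesh.hasDerivAt_coord {P : Mesh} {u : ℝ → ℝ → ℝ} {t : ℝ} {ut : ℝ → ℝ}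
    (h : ∀ x ∈ Icc (0 : ℝ) 1, HasDerivAt (fun t => u t x) (ut x) t) (k : Option (Fin P.N)) :
    HasDerivAt (fun t => P.coord k (u t)) (P.coord k ut) t := by
  cases k with
  | none => exact h 0 (by simp)
  | some j => exact (h _ (P.node_mem _)).sub (h _ (P.node_mem _))

theorem IsSemidiscreteSolution.exists_trajectory {ν μ wd : ℝ} {c : Fin 2 → ℝ} (hν : 0 < ν)
    (hμ : 0 < μ) (hwd : 0 ≤ wd) (hc : ∀ i, 0 < c i) {P : Mesh} {wh : ℝ → ℝ → ℝ}
    (h : IsSemidiscreteSolution ν μ wd c P wh) :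
    ∃ wht : ℝ → ℝ → ℝ, IsTrajectory ν μ wd c wh wht ∧ (∀ t, wht t ∈ P.space) ∧
      (∀ t, 0 < t → ∀ χ ∈ P.space, weakForm ν μ wd c (wh t) (wht t) χ = 0) ∧
      ∀ t, 0 < t → ∀ x ∈ Icc (0 : ℝ) 1, HasDerivAt (fun s => wh s x) (wht t x) t := by
  obtain ⟨hspace, hcont, hdiff, hweak⟩ := h
  set Y : Option (Fin P.N) → ℝ → ℝ := fun k t => P.coord k (wh t) with hY
  have hu : ∀ t, 0 ≤ t → ∀ x ∈ Icc (0 : ℝ) 1, wh t x = ∑ k, Y k t * P.basis k x :=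
    fun t ht x hx => P.eq_sum_basis (hspace t ht) hx
  have hYc : ∀ k, ContinuousOn (Y k) (Ici 0) := P.continuousOn_coord hcont
  have hYd : ∀ t, 0 < t → ∀ k, HasDerivAt (Y k) (deriv (Y k) t) t := fun t ht k =>
    (P.hasDerivAt_coord (fun x hx => (hdiff t ht x hx).hasDerivAt) k).differentiableAt.hasDerivAt
  set wht : ℝ → ℝ → ℝ := fun t x => ∑ k, deriv (Y k) t * P.basis k x with hwht
  have hd : ∀ t, 0 < t → ∀ x ∈ Icc (0 : ℝ) 1, HasDerivAt (fun s => wh s x) (wht t x) t := by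
    intro t ht x hx
    have := HasDerivAt.fun_sum fun k (_ : k ∈ Finset.univ) => (hYd t ht k).mul_const (P.basis k x)
    exact this.congr_of_eventuallyEq (Filter.eventuallyEq_of_mem (Ioi_mem_nhds ht)
      fun s hs => hu s (le_of_lt hs) x hx)
  have hs : ∀ t, wht t ∈ P.space := fun t => P.sum_mem_space _ _ P.basis_mem
  have hw : ∀ t, 0 < t → ∀ χ ∈ P.space, weakForm ν μ wd c (wh t) (wht t) χ = 0 := by
    intro t ht χ hχ
    rw [← hweak t ht χ hχ]
    exact weakForm_congr_rate fun x hx => (hd t ht x hx).deriv.symm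
  -- The discrete solution is assumed merely continuous at t = 0. Continuity of the state up to 0
  -- together with `exists_rate_bound` makes the rate bounded on (0,T), so the solution is a curve
  -- starting at time 0.
  have hbound : ∀ T, 0 < T → ∃ K, ∀ t ∈ Ioo 0 T, xsq (wht t) ≤ K := by
    intro T hT
    have hc1 : ContinuousOn (fun t => xsq (wh t)) (Icc 0 T) := by
      refine (continuousOn_xsq_of_finite P.basis_inH1 fun k =>
        (hYc k).mono Icc_subset_Ici_self).congr fun t ht => xsq_congr fun x hx => hu t ht.1 x hx
    obtain ⟨A, hA⟩ := isCompact_Icc.exists_bound_of_continuousOn hc1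
    obtain ⟨K, hK⟩ := exists_rate_bound hν hμ hwd hc A
    exact ⟨K, fun t ht => hK _ _ (P.inH1_of_mem (hspace t ht.1.le)) (P.inH1_of_mem (hs t))
      (hw t ht.1 _ (hs t)) ((Real.le_norm_self _).trans (hA t (Ioo_subset_Icc_self ht)))⟩
  have hm : ∀ k T, 0 < T → MemLp (deriv (Y k)) 2 (volume.restrict (Ioo 0 T)) := by
    intro k T hT
    obtain ⟨K, hK⟩ := hbound T hT
    refine MemLp.of_bound (measurable_deriv _).aestronglyMeasurable (√(4 * K)) ?_
    filter_upwards [ae_restrict_mem measurableSet_Ioo] with t ht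
    refine Real.abs_le_sqrt ?_
    have h1 := P.coord_sum (fun k => deriv (Y k) t) k
    rw [← h1]
    exact (Mesh.coord_sq_le (P.inH1_of_mem (hs t)) k).trans (by linarith [hK t ht])
  have hcurve : H1Curve wh wht := H1Curve.of_finite P.basis_inH1
    (fun k => HasPrim.of_hasDerivAt (hYc k) (fun t ht => hYd t ht k) (hm k)) hm hu
  refine ⟨wht, ⟨hcurve, ?_, ?_⟩, hs, hw, hd⟩
  · filter_upwards [ae_restrict_mem measurableSet_Ioi] with t ht
      using hw t ht _ (hspace t (le_of_lt ht))
  · filter_upwards [ae_restrict_mem measurableSet_Ioi] with t ht using hw t ht _ (hs t)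

theorem IsWeakSolution.exists_trajectory {ν μ wd : ℝ} {c : Fin 2 → ℝ} {w₀ : ℝ → ℝ}
    {w : ℝ → ℝ → ℝ} (h : IsWeakSolution ν μ wd c w₀ w) :
    ∃ wt : ℝ → ℝ → ℝ, IsTrajectory ν μ wd c w wt ∧
      (∀ᵐ t ∂volume.restrict (Ioi (0 : ℝ)), ∀ χ, InH1 χ → weakForm ν μ wd c (w t) (wt t) χ = 0) ∧
      EqOn (w 0) w₀ (Icc 0 1) := by
  obtain ⟨wt, h1, h2, h3, h4, h5⟩ := h
  have h0 : EqOn (w 0) w₀ (Icc 0 1) := fun x hx => by simpa using h4 0 le_rfl x hx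
  refine ⟨wt, ⟨⟨h1, h2, fun T hT => (h3 T hT).1, ⟨fun t => deriv (wt t), fun T hT => (h3 T hT).2,
    Filter.Eventually.of_forall fun t => Filter.EventuallyEq.refl _ _⟩, fun t ht x hx => by
      rw [h4 t ht x hx, h0 hx]⟩, ?_, ?_⟩, h5, h0⟩
  · filter_upwards [h5, ae_restrict_mem measurableSet_Ioi] with t ht ht0
      using ht _ (h1 t (le_of_lt ht0))
  · filter_upwards [h5, h2] with t ht ht2 using ht _ ht2

/-! ### Integration of the error estimates in time -/

/-- The exponentially weighted time integral. -/
def expInt (α t : ℝ) (f : ℝ → ℝ) : ℝ := ∫ s in (0 : ℝ)..t, Real.exp (2 * α * s) * f s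

theorem expInt_add {α t : ℝ} {f g : ℝ → ℝ} (hf : ∀ T, 0 ≤ T → IntervalIntegrable f volume 0 T)
    (hg : ∀ T, 0 ≤ T → IntervalIntegrable g volume 0 T) (ht : 0 ≤ t) :
    expInt α t (fun s => f s + g s) = expInt α t f + expInt α t g := by
  rw [expInt, expInt, expInt, ← intervalIntegral.integral_add
    (intervalIntegrable_exp_mul α hf t ht) (intervalIntegrable_exp_mul α hg t ht)]
  simp only [mul_add]

theorem expInt_const_mul (α t a : ℝ) (f : ℝ → ℝ) :
    expInt α t (fun s => a * f s) = a * expInt α t f := by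
  rw [expInt, expInt, ← intervalIntegral.integral_const_mul]
  simp only [mul_left_comm]

theorem expInt_nonneg {α t : ℝ} {f : ℝ → ℝ} (ht : 0 ≤ t) (hf : ∀ s, 0 ≤ f s) :
    0 ≤ expInt α t f :=
  intervalIntegral.integral_nonneg ht fun s _ => mul_nonneg (Real.exp_pos _).le (hf s)

/-- Bound for the weighted integral of a product, one factor of which is bounded in the weighted
supremum norm. -/
theorem expInt_mul_le {α t K L : ℝ} {b H : ℝ → ℝ} (ht : 0 ≤ t) (hK : 0 ≤ K)
    (hb : ∀ T, 0 ≤ T → IntervalIntegrable b volume 0 T)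
    (hbH : ∀ T, 0 ≤ T → IntervalIntegrable (fun s => b s * H s) volume 0 T) (b0 : ∀ s, 0 ≤ b s)
    (hH : ∀ s, 0 ≤ s → Real.exp (2 * α * s) * H s ≤ K) (hL : ∫ s in (0 : ℝ)..t, b s ≤ L) :
    expInt α t (fun s => b s * H s) ≤ K * L := by
  have h1 : expInt α t (fun s => b s * H s) ≤ ∫ s in (0 : ℝ)..t, K * b s := by
    refine intervalIntegral.integral_mono_on ht (intervalIntegrable_exp_mul α hbH t ht)
      ((hb t ht).const_mul K) fun s hs => ?_
    have := mul_le_mul_of_nonneg_right (hH s hs.1) (b0 s)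
    linarith
  rw [intervalIntegral.integral_const_mul] at h1
  exact h1.trans (mul_le_mul_of_nonneg_left hL hK)

theorem H1Curve.hasPrim_errEnergy₁ {w wt wh wht θ θt : ℝ → ℝ → ℝ} (hw : H1Curve w wt)
    (hwh : H1Curve wh wht) (hθ : H1Curve θ θt) (ν μ wd : ℝ) (c : Fin 2 → ℝ) :
    HasPrim (fun t => errEnergy₁ ν μ wd c (w t) (wh t) (θ t))
      (fun t => errEnergy₁' ν μ wd c (w t) (wt t) (wh t) (wht t) (θ t) (θt t)) := by
  have key : ∀ ci x : ℝ, x ∈ Icc (0 : ℝ) 1 → HasPrim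
      (fun t => ((ci + 1 + wd) + 2 / (9 * ci) * cubeQuot (wh t x) (w t x)) * θ t x ^ 2)
      (fun t => 2 / (9 * ci) * cubeQuot' (wh t x) (w t x) (wht t x) (wt t x) * θ t x ^ 2
        + ((ci + 1 + wd) + 2 / (9 * ci) * cubeQuot (wh t x) (w t x)) * (2 * θ t x * θt t x)) := by
    intro ci x hx
    have a := hw.hasPrim hx
    have b := hwh.hasPrim hx
    have q := ((b.pow 2).add (b.mul a)).add (a.pow 2)
    have := ((HasPrim.const (ci + 1 + wd)).add (q.const_mul (2 / (9 * ci)))).mul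
      ((hθ.hasPrim hx).pow 2)
    refine (this.congr_right (Filter.Eventually.of_forall fun t => ?_)).congr_left fun t _ => ?_
    · simp only [cubeQuot, cubeQuot']; push_cast; ring
    · simp only [cubeQuot]
  exact (hθ.l2.hasPrim_sqNorm.add (hθ.hasPrim_sqNorm_deriv.const_mul μ)).add
    (((key (c 0) 0 (by simp)).add (key (c 1) 1 (by simp))).const_mul (μ / ν))

theorem H1Curve.hasPrim_errEnergy₂ {w wt θ θt : ℝ → ℝ → ℝ} (hw : H1Curve w wt)
    (hθ : H1Curve θ θt) (ν wd : ℝ) (c : Fin 2 → ℝ) :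
    HasPrim (fun t => errEnergy₂ ν wd c (w t) (θ t))
      (fun t => errEnergy₂' ν wd c (w t) (wt t) (θ t) (θt t)) := by
  have key : ∀ ci x : ℝ, x ∈ Icc (0 : ℝ) 1 → HasPrim
      (fun t => (ci + 1 + wd) * θ t x ^ 2 + 2 / (9 * ci) * (3 * w t x ^ 2 * θ t x ^ 2
        + 2 * w t x * θ t x ^ 3 + 1 / 2 * θ t x ^ 4))
      (fun t => 2 * ((ci + 1 + wd) * (θ t x * θt t x)
        + 2 / (9 * ci) * ((3 * w t x ^ 2 + 3 * w t x * θ t x + θ t x ^ 2) * (θ t x * θt t x)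
          + wt t x * θ t x ^ 2 * (3 * w t x + θ t x)))) := by
    intro ci x hx
    have a := hw.hasPrim hx
    have b := hθ.hasPrim hx
    have := ((b.pow 2).const_mul (ci + 1 + wd)).add
      ((((((a.pow 2).const_mul 3).mul (b.pow 2)).add ((a.const_mul 2).mul (b.pow 3))).add
        ((b.pow 4).const_mul (1 / 2))).const_mul (2 / (9 * ci)))
    refine this.congr_right (Filter.Eventually.of_forall fun t => ?_)
    push_cast; ring
  refine (((hθ.hasPrim_sqNorm_deriv.const_mul ν).add (key (c 0) 0 (by simp))).add
    (key (c 1) 1 (by simp))).congr_right (Filter.Eventually.of_forall fun t => ?_)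
  simp only [errEnergy₂']; ring

theorem H1Curve.continuousOn_hsq {u ut : ℝ → ℝ → ℝ} (h : H1Curve u ut) {T : ℝ} (hT : 0 ≤ T) :
    ContinuousOn (fun t => hsq (u t)) (Icc 0 T) :=
  ((h.l2.hasPrim_sqNorm.continuousOn hT).add
    (((h.hasPrim (by simp)).continuousOn hT).pow 2)).add
    (((h.hasPrim (by simp)).continuousOn hT).pow 2)

theorem H1Curve.intervalIntegrable_hsq {u ut : ℝ → ℝ → ℝ} (h : H1Curve u ut) :
    ∀ T, 0 ≤ T → IntervalIntegrable (fun s => hsq (ut s)) volume 0 T := fun T hT =>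
  ((intervalIntegrable_sqNorm h.mem T hT).add (h.intervalIntegrable_trace_sq (by simp) T hT)).add
    (h.intervalIntegrable_trace_sq (by simp) T hT)

/-- The exact solution `w`, the semidiscrete solution `wh` and the projection `p` of the exact
solution, with their time derivatives. -/
structure ErrorCurves (ν μ wd lam : ℝ) (c : Fin 2 → ℝ) (w wt wh wht p pt : ℝ → ℝ → ℝ) : Prop where
  hw : H1Curve w wt
  hwh : H1Curve wh wht
  hp : H1Curve p pt
  data : ∀ᵐ t ∂volume.restrict (Ioi (0 : ℝ)), ErrorData ν μ wd lam c (w t) (wt t) (wh t) (wht t)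
    (p t) (pt t) (fun x => wh t x - p t x) (fun x => wht t x - pt t x) (fun x => w t x - p t x)
    (fun x => wt t x - pt t x)
  init : EqOn (wh 0) (p 0) (Icc 0 1)

/-- The a priori bounds that enter the error estimate, in terms of the size `A` of the solutions, the
weighted size `G` of the projection error, and a number `B` that controls the parameter dependence. -/
structure ErrorBounds (μ α A B G : ℝ) (w wt wh wht p pt : ℝ → ℝ → ℝ) : Prop where
  sup : ∀ t, 0 ≤ t → xsq (w t) + xsq (wh t) ≤ A
  int : ∀ t, 0 ≤ t → ∫ s in (0 : ℝ)..t, (xsq (w s) + xsq (wh s)) ≤ A * (1 + μ)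
  rate : ∀ t, 0 ≤ t → μ * ∫ s in (0 : ℝ)..t, (xsq (wt s) + xsq (wht s)) ≤ A
  proj : ∀ t, 0 ≤ t → hsq (fun x => w t x - p t x) ≤ A * (xsq (w t) + xsq (wh t))
  proj_sup : ∀ t, 0 ≤ t → μ * (Real.exp (2 * α * t) * hsq (fun x => w t x - p t x)) ≤ (1 + μ) * G
  proj_int : ∀ t, 0 ≤ t → expInt α t (fun s => hsq fun x => w s x - p s x) ≤ (1 + μ) * G
  proj_rate : ∀ t, 0 ≤ t → μ * expInt α t (fun s => hsq fun x => wt s x - pt s x) ≤ B * G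
  trace : ∀ t, 0 ≤ t → (1 + μ) * ∫ s in (0 : ℝ)..t, (wt s 0 ^ 2 + wt s 1 ^ 2) ≤ B

theorem ErrorCurves.xsq_init {ν μ wd lam : ℝ} {c : Fin 2 → ℝ} {w wt wh wht p pt : ℝ → ℝ → ℝ}
    (h : ErrorCurves ν μ wd lam c w wt wh wht p pt) :
    EqOn (fun x => wh 0 x - p 0 x) (fun _ => 0) (Icc 0 1) := fun x hx => by
  simp [h.init hx]

theorem errEnergy₁_of_eqOn_zero {ν μ wd : ℝ} {c : Fin 2 → ℝ} {w wh θ : ℝ → ℝ}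
    (h : EqOn θ (fun _ => 0) (Icc 0 1)) : errEnergy₁ ν μ wd c w wh θ = 0 := by
  rw [errEnergy₁, sqNorm_congr (deriv_ae_congr h),
    sqNorm_congr (EqOn.ae_eq_Ioo (h.mono Ioo_subset_Icc_self)), h (x := 0) (by simp),
    h (x := 1) (by simp)]
  simp [sqNorm]

theorem errEnergy₂_of_eqOn_zero {ν wd : ℝ} {c : Fin 2 → ℝ} {w θ : ℝ → ℝ}
    (h : EqOn θ (fun _ => 0) (Icc 0 1)) : errEnergy₂ ν wd c w θ = 0 := by
  rw [errEnergy₂, sqNorm_congr (deriv_ae_congr h), h (x := 0) (by simp), h (x := 1) (by simp)]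
  simp [sqNorm]

theorem errEnergy₁_nonneg {ν μ wd : ℝ} {c : Fin 2 → ℝ} (hν : 0 < ν) (hμ : 0 < μ) (hwd : 0 ≤ wd)
    (hc : ∀ i, 0 < c i) (w wh θ : ℝ → ℝ) : 0 ≤ errEnergy₁ ν μ wd c w wh θ := by
  have := hc 0
  have := hc 1
  have := cubeQuot_nonneg (wh 0) (w 0)
  have := cubeQuot_nonneg (wh 1) (w 1)
  have := sqNorm_nonneg θ
  have := sqNorm_nonneg (deriv θ)
  rw [errEnergy₁]
  positivity

/-- The Gronwall coefficient 1/(1+μ) · (a + μ²r) has a bounded integral, since the integral of a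
grows like 1+μ and that of r like 1/μ. The error starts from zero, so only the projection error
remains. -/
theorem exists_integrated_error₁ {ν wd lam : ℝ} {c : Fin 2 → ℝ} (hν : 0 < ν) (hwd : 0 ≤ wd)
    (hlam : 0 < lam) (hc : ∀ i, 0 < c i) (A : ℝ) (hA : 0 ≤ A) : ∃ C : ℝ, 0 < C ∧
    ∀ (μ α B G : ℝ) (w wt wh wht p pt : ℝ → ℝ → ℝ), 0 < μ → AdmissibleRate ν μ wd c α → 1 ≤ B →
      0 ≤ G → ErrorCurves ν μ wd lam c w wt wh wht p pt →
      ErrorBounds μ α A B G w wt wh wht p pt → ∀ t, 0 ≤ t →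
      μ * expInt α t (fun s => xsq fun x => wh s x - p s x) ≤ C * B * (1 + μ) ^ 2 * G := by
  obtain ⟨C, hC, HC⟩ := exists_errEnergy₁'_le hν hwd hlam hc A hA
  have m0 := dissip_pos hν hc
  set m := dissip ν c with hm
  refine ⟨2 / m * (C * (2 + A) * Real.exp (2 * C * A)), by positivity,
    fun μ α B G w wt wh wht p pt hμ hα hB hG h b t ht => ?_⟩
  have hη := h.hw.sub h.hp
  have hθ := h.hwh.sub h.hp
  set a : ℝ → ℝ := fun s => xsq (w s) + xsq (wh s) with ha
  set r : ℝ → ℝ := fun s => xsq (wt s) + xsq (wht s) with hr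
  set H : ℝ → ℝ := fun s => hsq fun x => w s x - p s x with hH
  set Ht : ℝ → ℝ := fun s => hsq fun x => wt s x - pt s x with hHt
  set X : ℝ → ℝ := fun s => xsq fun x => wh s x - p s x with hX
  have ia : ∀ T, 0 ≤ T → IntervalIntegrable a volume 0 T := fun T hT =>
    (h.hw.intervalIntegrable_xsq_self T hT).add (h.hwh.intervalIntegrable_xsq_self T hT)
  have ir : ∀ T, 0 ≤ T → IntervalIntegrable r volume 0 T := fun T hT =>
    (h.hw.intervalIntegrable_xsq T hT).add (h.hwh.intervalIntegrable_xsq T hT)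
  have cH : ∀ T, 0 ≤ T → ContinuousOn H (uIcc 0 T) := fun T hT => by
    rw [uIcc_of_le hT]; exact hη.continuousOn_hsq hT
  have iH : ∀ T, 0 ≤ T → IntervalIntegrable H volume 0 T := fun T hT => (cH T hT).intervalIntegrable
  have iHt : ∀ T, 0 ≤ T → IntervalIntegrable Ht volume 0 T := hη.intervalIntegrable_hsq
  have irH : ∀ T, 0 ≤ T → IntervalIntegrable (fun s => r s * H s) volume 0 T := fun T hT =>
    (ir T hT).mul_continuousOn (cH T hT)
  have iX : ∀ T, 0 ≤ T → IntervalIntegrable X volume 0 T := hθ.intervalIntegrable_xsq_self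
  have a0 : ∀ s, 0 ≤ a s := fun s => add_nonneg (xsq_nonneg _) (xsq_nonneg _)
  have r0 : ∀ s, 0 ≤ r s := fun s => add_nonneg (xsq_nonneg _) (xsq_nonneg _)
  have H0 : ∀ s, 0 ≤ H s := fun s => hsq_nonneg _
  have Ht0 : ∀ s, 0 ≤ Ht s := fun s => hsq_nonneg _
  have X0 : ∀ s, 0 ≤ X s := fun s => xsq_nonneg _
  have g := gronwall (α := α) (γ := fun s => C / (1 + μ) * (a s + μ ^ 2 * r s))
    (d := fun s => m / 2 * X s)
    (f := fun s => C * (((1 + μ) ^ 2 * Ht s + H s) + μ ^ 2 * (r s * H s)))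
    (h.hw.hasPrim_errEnergy₁ h.hwh hθ ν μ wd c)
    (fun T hT => ((ia T hT).add ((ir T hT).const_mul _)).const_mul _)
    (fun T hT => (iX T hT).const_mul _)
    (fun T hT => ((((iHt T hT).const_mul _).add (iH T hT)).add ((irH T hT).const_mul _)).const_mul _)
    (fun s => by have := a0 s; have := r0 s; positivity)
    (fun s => by have := X0 s; positivity)
    (fun s => by have := H0 s; have := Ht0 s; have := r0 s; positivity) (by
      filter_upwards [h.data, ae_restrict_mem measurableSet_Ioi] with s hs hs0
      refine (HC μ α _ _ _ _ _ _ _ _ _ _ hμ hα hs (b.sup s (le_of_lt hs0))).trans (le_of_eq ?_)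
      simp only [ha, hr, hH, hHt]
      ring) ht
  rw [errEnergy₁_of_eqOn_zero h.xsq_init, zero_add] at g
  have e1 : ∫ s in (0 : ℝ)..t, C / (1 + μ) * (a s + μ ^ 2 * r s) ≤ 2 * C * A := by
    rw [intervalIntegral.integral_const_mul, intervalIntegral.integral_add (ia t ht)
      ((ir t ht).const_mul _), intervalIntegral.integral_const_mul]
    have i1 := b.int t ht
    have i2 := mul_le_mul_of_nonneg_left (b.rate t ht) hμ.le
    rw [div_mul_eq_mul_div, div_le_iff₀ (by positivity)]
    have : (∫ s in (0 : ℝ)..t, a s) + μ ^ 2 * ∫ s in (0 : ℝ)..t, r s ≤ 2 * A * (1 + μ) := by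
      have : 0 ≤ A * 1 := by positivity
      simp only [ha, hr]
      linarith
    have := mul_le_mul_of_nonneg_left this hC.le
    linarith
  have e2 : expInt α t (fun s => C * (((1 + μ) ^ 2 * Ht s + H s) + μ ^ 2 * (r s * H s)))
      = C * (((1 + μ) ^ 2 * expInt α t Ht + expInt α t H)
        + μ ^ 2 * expInt α t fun s => r s * H s) := by
    rw [expInt_const_mul, expInt_add (fun T hT => ((iHt T hT).const_mul _).add (iH T hT))
      (fun T hT => (irH T hT).const_mul _) ht, expInt_add (fun T hT => (iHt T hT).const_mul _) iH ht,
      expInt_const_mul, expInt_const_mul]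
  have e3 : μ * expInt α t (fun s => C * (((1 + μ) ^ 2 * Ht s + H s) + μ ^ 2 * (r s * H s)))
      ≤ C * (2 + A) * B * (1 + μ) ^ 2 * G := by
    rw [e2]
    have j1 := mul_le_mul_of_nonneg_left (b.proj_rate t ht) (sq_nonneg (1 + μ))
    have j2 := mul_le_mul_of_nonneg_left (b.proj_int t ht) hμ.le
    -- The exponential weight is given entirely to the projection error, bounded in the weighted
    -- supremum norm; the rates r are integrated without weight.
    have j3 : expInt α t (fun s => r s * H s) ≤ ((1 + μ) * G / μ) * (A / μ) := by
      refine expInt_mul_le ht (by positivity) ir irH r0 (fun s hs => ?_) ?_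
      · rw [le_div_iff₀ hμ, mul_comm]; exact b.proj_sup s hs
      · rw [le_div_iff₀ hμ, mul_comm]; exact b.rate t ht
    have j4 : μ * (μ ^ 2 * expInt α t (fun s => r s * H s)) ≤ μ * ((1 + μ) * G * A) := by
      have := mul_le_mul_of_nonneg_left j3 (show 0 ≤ μ * μ ^ 2 by positivity)
      refine (le_of_eq (by ring)).trans (this.trans (le_of_eq ?_))
      field_simp
    have k1 : μ * ((1 + μ) * G) ≤ B * (1 + μ) ^ 2 * G := by
      have : μ * (1 + μ) ≤ B * (1 + μ) ^ 2 := by nlinarith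
      nlinarith
    have k2 : μ * ((1 + μ) * G * A) ≤ A * (B * (1 + μ) ^ 2 * G) := by
      have := mul_le_mul_of_nonneg_left k1 hA
      linarith
    have : μ * (((1 + μ) ^ 2 * expInt α t Ht + expInt α t H)
        + μ ^ 2 * expInt α t fun s => r s * H s) ≤ (2 + A) * (B * (1 + μ) ^ 2 * G) := by
      simp only [hHt, hH] at *
      linarith
    have := mul_le_mul_of_nonneg_left this hC.le
    linarith
  have e4 : m / 2 * expInt α t X ≤ expInt α t (fun s => C * (((1 + μ) ^ 2 * Ht s + H s)
      + μ ^ 2 * (r s * H s))) * Real.exp (2 * C * A) := by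
    have := mul_nonneg (Real.exp_pos (2 * α * t)).le (errEnergy₁_nonneg hν hμ hwd hc (w t) (wh t)
      (fun x => wh t x - p t x))
    rw [← expInt_const_mul]
    refine (le_add_of_nonneg_left this).trans (g.trans ?_)
    refine mul_le_mul_of_nonneg_left (Real.exp_le_exp.2 e1) (expInt_nonneg ht fun s => ?_)
    have := H0 s; have := Ht0 s; have := r0 s; positivity
  have e5 := mul_le_mul_of_nonneg_right e3 (Real.exp_pos (2 * C * A)).le
  have e6 := mul_le_mul_of_nonneg_left e4 hμ.le
  have e7 : m / 2 * (μ * expInt α t X) ≤ C * (2 + A) * B * (1 + μ) ^ 2 * G * Real.exp (2 * C * A) := by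
    linarith
  have e8 := mul_le_mul_of_nonneg_left e7 (show 0 ≤ 2 / m by positivity)
  refine (le_of_eq ?_).trans (e8.trans (le_of_eq (by ring)))
  field_simp

/-- The integrated |||θ|||² from the first step enters as a source with the factor 1/(1+μ), and the
trace of w_t enters the Gronwall exponent; this is why B appears in an exponential. All sources are
multiples of (1+μ)/μ · G, the origin of the factor μ^{-1}(1+μ) in the final bound. -/
theorem exists_integrated_error₂ {ν wd lam : ℝ} {c : Fin 2 → ℝ} (hν : 0 < ν) (hwd : 0 ≤ wd)
    (hlam : 0 < lam) (hc : ∀ i, 0 < c i) (A : ℝ) (hA : 0 ≤ A) : ∃ C : ℝ, 0 < C ∧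
    ∀ (μ α B G : ℝ) (w wt wh wht p pt : ℝ → ℝ → ℝ), 0 < μ → AdmissibleRate ν μ wd c α → 1 ≤ B →
      0 ≤ G → ErrorCurves ν μ wd lam c w wt wh wht p pt →
      ErrorBounds μ α A B G w wt wh wht p pt → ∀ t, 0 ≤ t →
      Real.exp (2 * α * t) * errEnergy₂ ν wd c (w t) (fun x => wh t x - p t x)
        + coer ν * expInt α t (fun s => rate₂ μ fun x => wht s x - pt s x)
        ≤ C * Real.exp (C * B) * B * ((1 + μ) / μ * G) := by
  obtain ⟨C₁, hC₁, HC₁⟩ := exists_integrated_error₁ hν hwd hlam hc A hA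
  obtain ⟨C, hC, HC⟩ := exists_errEnergy₂'_le hν hwd hlam hc A A hA hA
  have k0 := coer_pos hν
  refine ⟨C * (2 + A + C₁) + C * (1 + 2 * A), by positivity,
    fun μ α B G w wt wh wht p pt hμ hα hB hG h b t ht => ?_⟩
  have hstep := HC₁ μ α B G w wt wh wht p pt hμ hα hB hG h b t ht
  have hη := h.hw.sub h.hp
  have hθ := h.hwh.sub h.hp
  set a : ℝ → ℝ := fun s => xsq (w s) + xsq (wh s) with ha
  set r : ℝ → ℝ := fun s => xsq (wt s) + xsq (wht s) with hr
  set q : ℝ → ℝ := fun s => wt s 0 ^ 2 + wt s 1 ^ 2 with hq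
  set H : ℝ → ℝ := fun s => hsq fun x => w s x - p s x with hH
  set Ht : ℝ → ℝ := fun s => hsq fun x => wt s x - pt s x with hHt
  set X : ℝ → ℝ := fun s => xsq fun x => wh s x - p s x with hX
  set D : ℝ → ℝ := fun s => rate₂ μ fun x => wht s x - pt s x with hD
  have ia : ∀ T, 0 ≤ T → IntervalIntegrable a volume 0 T := fun T hT =>
    (h.hw.intervalIntegrable_xsq_self T hT).add (h.hwh.intervalIntegrable_xsq_self T hT)
  have ir : ∀ T, 0 ≤ T → IntervalIntegrable r volume 0 T := fun T hT =>
    (h.hw.intervalIntegrable_xsq T hT).add (h.hwh.intervalIntegrable_xsq T hT)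
  have iq : ∀ T, 0 ≤ T → IntervalIntegrable q volume 0 T := fun T hT =>
    (h.hw.intervalIntegrable_trace_sq (by simp) T hT).add
      (h.hw.intervalIntegrable_trace_sq (by simp) T hT)
  have cH : ∀ T, 0 ≤ T → ContinuousOn H (uIcc 0 T) := fun T hT => by
    rw [uIcc_of_le hT]; exact hη.continuousOn_hsq hT
  have iH : ∀ T, 0 ≤ T → IntervalIntegrable H volume 0 T := fun T hT => (cH T hT).intervalIntegrable
  have iHt : ∀ T, 0 ≤ T → IntervalIntegrable Ht volume 0 T := hη.intervalIntegrable_hsq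
  have irH : ∀ T, 0 ≤ T → IntervalIntegrable (fun s => r s * H s) volume 0 T := fun T hT =>
    (ir T hT).mul_continuousOn (cH T hT)
  have iX : ∀ T, 0 ≤ T → IntervalIntegrable X volume 0 T := hθ.intervalIntegrable_xsq_self
  have iD : ∀ T, 0 ≤ T → IntervalIntegrable D volume 0 T := hθ.intervalIntegrable_rate₂ μ
  have a0 : ∀ s, 0 ≤ a s := fun s => add_nonneg (xsq_nonneg _) (xsq_nonneg _)
  have r0 : ∀ s, 0 ≤ r s := fun s => add_nonneg (xsq_nonneg _) (xsq_nonneg _)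
  have q0 : ∀ s, 0 ≤ q s := fun s => add_nonneg (sq_nonneg _) (sq_nonneg _)
  have H0 : ∀ s, 0 ≤ H s := fun s => hsq_nonneg _
  have Ht0 : ∀ s, 0 ≤ Ht s := fun s => hsq_nonneg _
  have X0 : ∀ s, 0 ≤ X s := fun s => xsq_nonneg _
  have D0 : ∀ s, 0 ≤ D s := fun s => rate₂_nonneg hμ _
  have f0 : ∀ s, 0 ≤ C * ((1 / (1 + μ) * X s + (1 + μ) * Ht s)
      + (1 / μ * H s + μ * (r s * H s))) := fun s => by
    have := H0 s; have := Ht0 s; have := r0 s; have := X0 s; positivity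
  have g := gronwall (α := α)
    (γ := fun s => C * (((1 + μ) * q s + 1 / (1 + μ) * a s) + μ * r s))
    (d := fun s => coer ν * D s)
    (f := fun s => C * ((1 / (1 + μ) * X s + (1 + μ) * Ht s) + (1 / μ * H s + μ * (r s * H s))))
    (h.hw.hasPrim_errEnergy₂ hθ ν wd c)
    (fun T hT => ((((iq T hT).const_mul _).add ((ia T hT).const_mul _)).add
      ((ir T hT).const_mul _)).const_mul _)
    (fun T hT => (iD T hT).const_mul _)
    (fun T hT => ((((iX T hT).const_mul _).add ((iHt T hT).const_mul _)).add
      (((iH T hT).const_mul _).add ((irH T hT).const_mul _))).const_mul _)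
    (fun s => by have := a0 s; have := r0 s; have := q0 s; positivity)
    (fun s => by have := D0 s; positivity) f0 (by
      filter_upwards [h.data, ae_restrict_mem measurableSet_Ioi] with s hs hs0
      have hp := b.proj s (le_of_lt hs0)
      refine (HC μ α _ _ _ _ _ _ _ _ _ _ hμ hα hs (b.sup s (le_of_lt hs0))
        ((sq_zero_le_hsq _).trans hp) ((sq_one_le_hsq _).trans hp)).trans (le_of_eq ?_)
      simp only [ha, hr, hH, hHt, hq, hX]
      ring) ht
  rw [errEnergy₂_of_eqOn_zero h.xsq_init, zero_add] at g
  have e1 : ∫ s in (0 : ℝ)..t, C * (((1 + μ) * q s + 1 / (1 + μ) * a s) + μ * r s)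
      ≤ C * (1 + 2 * A) * B := by
    rw [intervalIntegral.integral_const_mul, intervalIntegral.integral_add
      (((iq t ht).const_mul _).add ((ia t ht).const_mul _)) ((ir t ht).const_mul _),
      intervalIntegral.integral_add ((iq t ht).const_mul _) ((ia t ht).const_mul _),
      intervalIntegral.integral_const_mul, intervalIntegral.integral_const_mul,
      intervalIntegral.integral_const_mul, mul_assoc C]
    refine mul_le_mul_of_nonneg_left ?_ hC.le
    have i1 := b.trace t ht
    have i2 : 1 / (1 + μ) * ∫ s in (0 : ℝ)..t, a s ≤ A := by
      rw [one_div_mul_eq_div, div_le_iff₀ (by positivity)]; exact b.int t ht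
    have i3 := b.rate t ht
    have i4 : A ≤ A * B := le_mul_of_one_le_right hA hB
    simp only [hq, hr] at *
    linarith
  have hK : ∀ s, 0 ≤ s → Real.exp (2 * α * s) * H s ≤ (1 + μ) / μ * G := fun s hs => by
    rw [div_mul_eq_mul_div, le_div_iff₀ hμ, mul_comm]; exact b.proj_sup s hs
  set Q := (1 + μ) / μ * G with hQ
  have Q0 : 0 ≤ Q := by positivity
  have e2 : expInt α t (fun s => C * ((1 / (1 + μ) * X s + (1 + μ) * Ht s)
        + (1 / μ * H s + μ * (r s * H s))))
      = C * ((1 / (1 + μ) * expInt α t X + (1 + μ) * expInt α t Ht)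
        + (1 / μ * expInt α t H + μ * expInt α t fun s => r s * H s)) := by
    rw [expInt_const_mul, expInt_add
      (fun T hT => ((iX T hT).const_mul _).add ((iHt T hT).const_mul _))
      (fun T hT => ((iH T hT).const_mul _).add ((irH T hT).const_mul _)) ht,
      expInt_add (fun T hT => (iX T hT).const_mul _) (fun T hT => (iHt T hT).const_mul _) ht,
      expInt_add (fun T hT => (iH T hT).const_mul _) (fun T hT => (irH T hT).const_mul _) ht,
      expInt_const_mul, expInt_const_mul, expInt_const_mul, expInt_const_mul]
  have e3 : expInt α t (fun s => C * ((1 / (1 + μ) * X s + (1 + μ) * Ht s)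
        + (1 / μ * H s + μ * (r s * H s)))) ≤ C * (2 + A + C₁) * B * Q := by
    rw [e2, mul_assoc C, mul_assoc C]
    refine mul_le_mul_of_nonneg_left ?_ hC.le
    have j1 : 1 / (1 + μ) * expInt α t X ≤ C₁ * (B * Q) := by
      have : expInt α t X ≤ C₁ * B * (1 + μ) ^ 2 * G / μ := by
        rw [le_div_iff₀ hμ, mul_comm]; exact hstep
      refine (mul_le_mul_of_nonneg_left this (by positivity)).trans (le_of_eq ?_)
      rw [hQ]; field_simp
    have j2 : (1 + μ) * expInt α t Ht ≤ B * Q := by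
      have : expInt α t Ht ≤ B * G / μ := by
        rw [le_div_iff₀ hμ, mul_comm]; exact b.proj_rate t ht
      refine (mul_le_mul_of_nonneg_left this (by positivity)).trans (le_of_eq ?_)
      rw [hQ]; field_simp
    have j3 : 1 / μ * expInt α t H ≤ Q := by
      refine (mul_le_mul_of_nonneg_left (b.proj_int t ht) (by positivity)).trans (le_of_eq ?_)
      rw [hQ]; field_simp
    have j4 : μ * expInt α t (fun s => r s * H s) ≤ A * Q := by
      have : expInt α t (fun s => r s * H s) ≤ Q * (A / μ) := by
        refine expInt_mul_le ht Q0 ir irH r0 hK ?_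
        rw [le_div_iff₀ hμ, mul_comm]; exact b.rate t ht
      refine (mul_le_mul_of_nonneg_left this hμ.le).trans (le_of_eq ?_)
      field_simp
    have j5 : Q ≤ B * Q := le_mul_of_one_le_left Q0 hB
    have j6 := mul_le_mul_of_nonneg_left j5 hA
    linarith
  have e4 := expInt_const_mul α t (coer ν) D
  rw [expInt] at e4
  rw [e4] at g
  refine g.trans ((mul_le_mul e3 (Real.exp_le_exp.2 e1) (Real.exp_pos _).le
    ((expInt_nonneg ht f0).trans e3)).trans ?_)
  have x1 : C * (2 + A + C₁) ≤ C * (2 + A + C₁) + C * (1 + 2 * A) := by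
    have : 0 ≤ C * (1 + 2 * A) := by positivity
    linarith
  have x2 : C * (1 + 2 * A) ≤ C * (2 + A + C₁) + C * (1 + 2 * A) := by
    have : 0 ≤ C * (2 + A + C₁) := by positivity
    linarith
  calc C * (2 + A + C₁) * B * Q * Real.exp (C * (1 + 2 * A) * B)
      = C * (2 + A + C₁) * Real.exp (C * (1 + 2 * A) * B) * B * Q := by ring
    _ ≤ _ := by gcongr

/-! ### The error estimate -/

theorem sqNorm_add_xsq_le_h2Norm {w₀ : ℝ → ℝ} (h : InH1 w₀) :
    sqNorm (deriv (deriv w₀)) + xsq w₀ ≤ 4 * h2Norm w₀ ^ 2 := by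
  have n0 := sqNorm_nonneg w₀
  have n1 := sqNorm_nonneg (deriv w₀)
  have n2 := sqNorm_nonneg (deriv (deriv w₀))
  rw [h2Norm, Real.sq_sqrt (by positivity), xsq]
  have t0 := h.sq_le_trace (x := 0) (by simp)
  have t1 := h.sq_le_trace (x := 1) (by simp)
  have := Real.sq_sqrt n0
  have := Real.sq_sqrt n1
  nlinarith [sq_nonneg (√(sqNorm w₀) - √(sqNorm (deriv w₀)))]

theorem h2Norm_nonneg (w₀ : ℝ → ℝ) : 0 ≤ h2Norm w₀ := Real.sqrt_nonneg _

/-- The time derivatives and the second space derivative that belong to a `Setting`. -/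
structure SettingData (ν μ wd lam : ℝ) (c : Fin 2 → ℝ) (w₀ : ℝ → ℝ) (P : Mesh)
    (w wt wh wht p pt Z : ℝ → ℝ → ℝ) (k₀ k₁ : ℝ) : Prop where
  traj : IsTrajectory ν μ wd c w wt
  trajh : IsTrajectory ν μ wd c wh wht
  weak : ∀ᵐ t ∂volume.restrict (Ioi (0 : ℝ)), ∀ χ, InH1 χ → weakForm ν μ wd c (w t) (wt t) χ = 0
  second : SecondDeriv ν μ wd c w wt Z k₀ k₁
  curves : ErrorCurves ν μ wd lam c w wt wh wht p pt
  proj : ∀ t, 0 ≤ t → IsEllipticProjection lam P (w t) (p t)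
  projt : ∀ᵐ t ∂volume.restrict (Ioi (0 : ℝ)), IsEllipticProjection lam P (wt t) (pt t)
  hasDerivAt : ∀ᵐ s ∂volume.restrict (Ioi (0 : ℝ)), ∀ x ∈ Icc (0 : ℝ) 1,
    HasDerivAt (fun t => wh t x - p t x) (wht s x - pt s x) s
  initial : sqNorm (Z 0) + xsq (w 0) ≤ 4 * h2Norm w₀ ^ 2

theorem Setting.exists_data {ν μ wd lam : ℝ} {c : Fin 2 → ℝ} (hν : 0 < ν) (hμ : 0 < μ)
    (hwd : 0 ≤ wd) (hc : ∀ i, 0 < c i) (hlam : 0 < lam) {w₀ : ℝ → ℝ} {w : ℝ → ℝ → ℝ} {P : Mesh}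
    {wp wh : ℝ → ℝ → ℝ} (h : Setting ν μ wd lam c w₀ w P wp wh) :
    ∃ wt wht pt Z k₀ k₁, SettingData ν μ wd lam c w₀ P w wt wh wht wp pt Z k₀ k₁ := by
  obtain ⟨⟨hw0, g, hg, hg0⟩, hweak, hproj, hsemi, hinit⟩ := h
  obtain ⟨wt, htraj, hwk, h0⟩ := hweak.exists_trajectory
  obtain ⟨wht, htrajh, hspace, hwkh, hdh⟩ := hsemi.exists_trajectory hν hμ hwd hc
  obtain ⟨pt, hp, hpt, hdp⟩ := htraj.curve.exists_projection hlam hproj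
  have hgw : deriv (w 0) =ᵐ[volume.restrict (Ioo (0 : ℝ) 1)] g :=
    (deriv_ae_congr h0).trans (EqOn.ae_eq_Ioo hg0)
  obtain ⟨Z, k₀, k₁, hZ, hZ0⟩ := exists_secondDeriv hν hμ htraj.curve hwk hg hgw
  refine ⟨wt, wht, pt, Z, k₀, k₁, htraj, htrajh, hwk, hZ, ⟨htraj.curve, htrajh.curve, hp, ?_, hinit⟩,
    hproj, hpt, ?_, ?_⟩
  · filter_upwards [htraj.curve.h1t, htrajh.curve.h1t, hp.h1t, hwk, hpt,
      ae_restrict_mem measurableSet_Ioi] with t a1 a2 a3 a4 a5 a6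
    have a6 : 0 < t := a6
    have hm : ∀ χ, ((χ = fun x => wh t x - wp t x) ∨ χ = fun x => wht t x - pt t x) →
        χ ∈ P.space := by
      rintro χ (rfl | rfl)
      · exact P.sub_mem_space (hsemi.1 t a6.le) (hproj t a6.le).1
      · exact P.sub_mem_space (hspace t) a5.1
    exact ⟨htraj.curve.h1 t a6.le, a1, htrajh.curve.h1 t a6.le, a2, hp.h1 t a6.le, a3, rfl, rfl, rfl,
      rfl, fun χ hχ => ⟨a4 χ (P.inH1_of_mem (hm χ hχ)), hwkh t a6 χ (hm χ hχ)⟩,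
      fun χ hχ => ⟨(hproj t a6.le).orth (htraj.curve.h1 t a6.le) (hm χ hχ),
        a5.orth a1 (hm χ hχ)⟩⟩
  · filter_upwards [hdp, ae_restrict_mem measurableSet_Ioi] with s a1 a2 x hx
      using (hdh s a2 x hx).sub (a1 x hx)
  · rw [sqNorm_congr (hZ0.trans (EqOn.ae_eq_Ioo (deriv_eqOn_of_eqOn hg0)).symm), xsq_congr h0]
    exact sqNorm_add_xsq_le_h2Norm hw0

/-- Collects the a priori bounds. Only the bounds for w_xxt and for the traces of w_t are left as
hypotheses, because they are the ones in which the general case and the feedback case differ in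
their dependence on μ. -/
theorem exists_errorBounds {ν wd lam : ℝ} {c : Fin 2 → ℝ} (hν : 0 < ν) (hwd : 0 ≤ wd)
    (hlam : 0 < lam) (hc : ∀ i, 0 < c i) (A₀ : ℝ) (hA₀ : 0 ≤ A₀) : ∃ A L : ℝ, 0 < A ∧ 1 ≤ L ∧
    ∀ (μ α B k₀ k₁ : ℝ) (w₀ : ℝ → ℝ) (P : Mesh) (w wt wh wht p pt Z : ℝ → ℝ → ℝ), 0 < μ →
      AdmissibleRate ν μ wd c α → 1 ≤ B →
      SettingData ν μ wd lam c w₀ P w wt wh wht p pt Z k₀ k₁ → xsq (w 0) ≤ A₀ →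
      (∀ t, 0 ≤ t → μ * (∫ s in (0 : ℝ)..t, Real.exp (2 * α * s)
        * sqNorm (secondDerivT ν μ wd (w s) (wt s) (Z s))) ≤ B * (sqNorm (Z 0) + xsq (w 0))) →
      (∀ t, 0 ≤ t → (1 + μ) * ∫ s in (0 : ℝ)..t, (wt s 0 ^ 2 + wt s 1 ^ 2) ≤ B) →
      ErrorBounds μ α A B (L * (P.h ^ 4 * (sqNorm (Z 0) + xsq (w 0)))) w wt wh wht p pt := by
  -- The stability constant of the projection, so that the same a priori bound applies to the exact
  -- and to the discrete initial value.
  set K := 15 + lam + 8 * lam ^ 2 with hK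
  have K1 : 1 ≤ K := by rw [hK]; nlinarith
  obtain ⟨A₁, hA₁, HA₁⟩ := exists_trajectory_bound hν hwd hc (K * A₀) (by positivity)
  obtain ⟨A₂, hA₂, HA₂⟩ := exists_secondDeriv_bound hν hwd hc A₀ hA₀
  set Λ := 5 + 4 * lam ^ 2 with hΛ
  have Λ0 : 0 < Λ := by positivity
  have Λ1 : 1 ≤ Λ := by rw [hΛ]; nlinarith
  refine ⟨2 * A₁ + Λ, Λ * (A₂ + 1), by positivity, by nlinarith,
    fun μ α B k₀ k₁ w₀ P w wt wh wht p pt Z hμ hα hB h hX hrate htrace => ?_⟩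
  have hX' : xsq (w 0) ≤ K * A₀ := hX.trans (le_mul_of_one_le_left hA₀ K1)
  have hXh : xsq (wh 0) ≤ K * A₀ := by
    rw [xsq_congr h.curves.init]
    exact (xsq_projection_le hlam (h.traj.curve.h1 0 le_rfl) (h.proj 0 le_rfl)).trans
      (mul_le_mul_of_nonneg_left hX (by positivity))
  obtain ⟨a1, a2, a3⟩ := HA₁ μ w wt hμ h.traj hX'
  obtain ⟨b1, b2, b3⟩ := HA₁ μ wh wht hμ h.trajh hXh
  set N := sqNorm (Z 0) + xsq (w 0) with hN
  have N0 : 0 ≤ N := add_nonneg (sqNorm_nonneg _) (xsq_nonneg _)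
  have hZ := HA₂ μ α k₀ k₁ w wt Z hμ hα h.traj h.second hX
  have h4 : 0 ≤ P.h ^ 4 := by have := P.h_nonneg; positivity
  have hη := h.curves.hw.sub h.curves.hp
  have G0 : 0 ≤ Λ * P.h ^ 4 := by positivity
  have GN : Λ * P.h ^ 4 * (A₂ * N) ≤ Λ * (A₂ + 1) * (P.h ^ 4 * N) := by
    have : 0 ≤ Λ * P.h ^ 4 * N := by positivity
    linarith
  have pe : ∀ t, 0 ≤ t → hsq (fun x => w t x - p t x) ≤ Λ * P.h ^ 4 * sqNorm (Z t) := by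
    intro t ht
    obtain ⟨i1, i2⟩ := h.second.inH1 ht (flux ν wd (c 0) (w t 0) + Real.exp (-(ν / μ * t)) * k₀)
    have := hsq_projection_error_le hlam (h.traj.curve.h1 t ht) i1 (h.second.deriv_eq t ht) i2
      (h.proj t ht)
    rwa [← mul_assoc] at this
  have pet : ∀ᵐ t ∂volume.restrict (Ioi (0 : ℝ)), hsq (fun x => wt t x - pt t x)
      ≤ Λ * P.h ^ 4 * sqNorm (secondDerivT ν μ wd (w t) (wt t) (Z t)) := by
    filter_upwards [h.projt, h.traj.curve.h1t, h.weak, ae_restrict_mem measurableSet_Ioi]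
      with t c1 c2 c3 c4
    have c4 : 0 ≤ t := le_of_lt c4
    have hw := h.traj.curve.h1 t c4
    have d := (h.second.deriv_rate_eq hν hμ c4 hw c2 c3).1
    have i := inH1_of_primitive (secondDerivT_inL2 (ν := ν) (μ := μ) (wd := wd) hw c2.inL2
      (h.second.mem t c4)) (f := fun x => (flux' ν wd (c 0) (w t 0) * wt t 0
        - ν / μ * (Real.exp (-(ν / μ * t)) * k₀))
        + ∫ y in (0 : ℝ)..x, secondDerivT ν μ wd (w t) (wt t) (Z t) y) (fun x _ => by simp)
    have := hsq_projection_error_le hlam c2 i.1 d i.2 c1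
    rwa [← mul_assoc] at this
  refine ⟨fun t ht => ?_, fun t ht => ?_, fun t ht => ?_, fun t ht => ?_, fun t ht => ?_,
    fun t ht => ?_, fun t ht => ?_, htrace⟩
  · have := a1 t ht
    have := b1 t ht
    linarith
  · rw [intervalIntegral.integral_add (h.traj.curve.intervalIntegrable_xsq_self t ht)
      (h.trajh.curve.intervalIntegrable_xsq_self t ht)]
    have := a2 t ht
    have := b2 t ht
    have : 0 ≤ Λ * (1 + μ) := by positivity
    linarith
  · rw [intervalIntegral.integral_add (h.traj.curve.intervalIntegrable_xsq t ht)
      (h.trajh.curve.intervalIntegrable_xsq t ht)]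
    have := a3 t ht
    have := b3 t ht
    linarith
  · have e := hsq_projection_error_le_xsq hlam (h.traj.curve.h1 t ht) (h.proj t ht)
    rw [← hΛ] at e
    have := xsq_nonneg (w t)
    have := xsq_nonneg (wh t)
    have : 0 ≤ Λ * xsq (wh t) := by positivity
    have : 0 ≤ 2 * A₁ * (xsq (w t) + xsq (wh t)) := by positivity
    linarith
  · have e1 := mul_le_mul_of_nonneg_left (hZ t ht).1 G0
    have e2 := mul_le_mul_of_nonneg_left (pe t ht)
      (show 0 ≤ μ * Real.exp (2 * α * t) by positivity)
    have e3 := mul_le_mul_of_nonneg_right GN (show 0 ≤ 1 + μ by positivity)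
    linarith
  · have e1 := mul_le_mul_of_nonneg_left (hZ t ht).2.1 G0
    have e3 := mul_le_mul_of_nonneg_right GN (show 0 ≤ 1 + μ by positivity)
    have e2 : expInt α t (fun s => hsq fun x => w s x - p s x)
        ≤ ∫ s in (0 : ℝ)..t, Λ * P.h ^ 4 * (Real.exp (2 * α * s) * sqNorm (Z s)) := by
      refine intervalIntegral.integral_mono_on ht (intervalIntegrable_exp_mul α
        (fun T hT => ContinuousOn.intervalIntegrable (by
          rw [uIcc_of_le hT]; exact hη.continuousOn_hsq hT)) t ht)
        ((intervalIntegrable_exp_mul α h.second.intervalIntegrable_sqNorm t ht).const_mul _)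
        fun s hs => ?_
      have := mul_le_mul_of_nonneg_left (pe s hs.1) (Real.exp_pos (2 * α * s)).le
      linarith
    rw [intervalIntegral.integral_const_mul] at e2
    linarith
  · have e1 := mul_le_mul_of_nonneg_left (hrate t ht) G0
    have e2 : expInt α t (fun s => hsq fun x => wt s x - pt s x)
        ≤ ∫ s in (0 : ℝ)..t, Λ * P.h ^ 4 * (Real.exp (2 * α * s)
          * sqNorm (secondDerivT ν μ wd (w s) (wt s) (Z s))) := by
      refine intervalIntegral_mono_ae_Ioi ?_ ht
        (intervalIntegrable_exp_mul α hη.intervalIntegrable_hsq t ht)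
        ((intervalIntegrable_exp_mul α
          (h.second.intervalIntegrable_sqNorm_secondDerivT hμ h.traj.curve) t ht).const_mul _)
      filter_upwards [pet] with s hs
      have := mul_le_mul_of_nonneg_left hs (Real.exp_pos (2 * α * s)).le
      linarith
    rw [intervalIntegral.integral_const_mul] at e2
    have e3 := mul_le_mul_of_nonneg_left e2 hμ.le
    have e4 : B * (Λ * P.h ^ 4 * N) ≤ B * (Λ * (A₂ + 1) * (P.h ^ 4 * N)) := by
      refine mul_le_mul_of_nonneg_left ?_ (by linarith)
      have : 0 ≤ Λ * P.h ^ 4 * N * A₂ := by positivity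
      linarith
    linarith

theorem endpt_zero : endpt 0 = 0 := rfl

theorem endpt_one : endpt 1 = 1 := rfl

theorem interiorRate_eq {μ α s : ℝ} {θ : ℝ → ℝ → ℝ} {θt : ℝ → ℝ} (h : EqOn (dt θ s) θt (Icc 0 1)) :
    interiorRate μ α θ s = Real.exp (2 * α * s) * (sqNorm θt + μ * sqNorm (deriv θt)) := by
  rw [interiorRate, sqNorm_congr (EqOn.ae_eq_Ioo (h.mono Ioo_subset_Icc_self)),
    sqNorm_congr (deriv_ae_congr h)]

theorem boundaryRate_eq {wd α s : ℝ} {c : Fin 2 → ℝ} {θ : ℝ → ℝ → ℝ} {θt : ℝ → ℝ}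
    (h : EqOn (dt θ s) θt (Icc 0 1)) :
    boundaryRate wd α c θ s = Real.exp (2 * α * s)
      * ((1 + c 0 + wd) * θt 0 ^ 2 + (1 + c 1 + wd) * θt 1 ^ 2) := by
  rw [boundaryRate, Fin.sum_univ_two, endpt_zero, endpt_one, h (x := 0) (by simp),
    h (x := 1) (by simp)]

/-- The superconvergence estimate follows from the estimate of the energy of the error. -/
theorem superconvergence_of_energy {ν μ wd α Y C : ℝ} {c : Fin 2 → ℝ} {w₀ : ℝ → ℝ} {η : ℝ}
    {w θ θt : ℝ → ℝ → ℝ} (hν : 0 < ν) (hμ : 0 < μ) (hwd : 0 ≤ wd) (hc : ∀ i, 0 < c i)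
    (hY : 0 ≤ Y) (hθ : H1Curve θ θt)
    (hd : ∀ᵐ s ∂volume.restrict (Ioi (0 : ℝ)), ∀ x ∈ Icc (0 : ℝ) 1,
      HasDerivAt (fun t => θ t x) (θt s x) s)
    (he : ∀ t, 0 ≤ t → Real.exp (2 * α * t) * errEnergy₂ ν wd c (w t) (θ t)
      + coer ν * expInt α t (fun s => rate₂ μ (θt s)) ≤ Y)
    (hC : (1 + (2 + 1 / ν * ((1 + c 0 + wd) + (1 + c 1 + wd))) / coer ν + 1 / dissip ν c) * Y
      ≤ C * (1 / μ) * h2Norm w₀ * (1 + μ) * η ^ 4 * Real.exp (C * h2Norm w₀)) :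
    Superconvergence ν μ wd α C c w₀ η θ := by
  have k0 := coer_pos hν
  have m0 := dissip_pos hν hc
  have c0 := hc 0
  have c1 := hc 1
  have hdt : ∀ᵐ s ∂volume.restrict (Ioi (0 : ℝ)), EqOn (dt θ s) (θt s) (Icc 0 1) := by
    filter_upwards [hd] with s hs x hx using (hs x hx).deriv
  refine ⟨fun x hx => ?_, fun t ht => ?_⟩
  · filter_upwards [hd] with s hs using (hs x hx).differentiableAt
  have i1 : ∀ T, 0 ≤ T → IntervalIntegrable (fun s => sqNorm (θt s) + μ * sqNorm (deriv (θt s)))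
      volume 0 T := fun T hT =>
    (intervalIntegrable_sqNorm hθ.mem T hT).add ((hθ.intervalIntegrable_sqNorm_deriv T hT).const_mul μ)
  have i2 : ∀ T, 0 ≤ T → IntervalIntegrable
      (fun s => (1 + c 0 + wd) * θt s 0 ^ 2 + (1 + c 1 + wd) * θt s 1 ^ 2) volume 0 T := fun T hT =>
    ((hθ.intervalIntegrable_trace_sq (by simp) T hT).const_mul _).add
      ((hθ.intervalIntegrable_trace_sq (by simp) T hT).const_mul _)
  have i3 := hθ.intervalIntegrable_rate₂ μ
  have e1 : ∀ᵐ s ∂volume.restrict (Ioi (0 : ℝ)),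
      Real.exp (2 * α * s) * (sqNorm (θt s) + μ * sqNorm (deriv (θt s))) = interiorRate μ α θ s := by
    filter_upwards [hdt] with s hs using (interiorRate_eq hs).symm
  have e2 : ∀ᵐ s ∂volume.restrict (Ioi (0 : ℝ)),
      Real.exp (2 * α * s) * ((1 + c 0 + wd) * θt s 0 ^ 2 + (1 + c 1 + wd) * θt s 1 ^ 2)
        = boundaryRate wd α c θ s := by
    filter_upwards [hdt] with s hs using (boundaryRate_eq hs).symm
  have x1 : ∫ s in (0 : ℝ)..t, interiorRate μ α θ s ≤ expInt α t (fun s => rate₂ μ (θt s)) := by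
    rw [← intervalIntegral_congr_ae_Ioi e1 ht]
    refine intervalIntegral.integral_mono_on ht (intervalIntegrable_exp_mul α i1 t ht)
      (intervalIntegrable_exp_mul α i3 t ht) fun s _ => ?_
    refine mul_le_mul_of_nonneg_left ?_ (Real.exp_pos _).le
    simp only [rate₂]
    have := mul_le_mul_of_nonneg_left (sqNorm_deriv_le_xsq (θt s)) hμ.le
    linarith
  have x2 : μ * ∫ s in (0 : ℝ)..t, boundaryRate wd α c θ s
      ≤ ((1 + c 0 + wd) + (1 + c 1 + wd)) * expInt α t (fun s => rate₂ μ (θt s)) := by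
    rw [← intervalIntegral_congr_ae_Ioi e2 ht, expInt, ← intervalIntegral.integral_const_mul,
      ← intervalIntegral.integral_const_mul]
    refine intervalIntegral.integral_mono_on ht ((intervalIntegrable_exp_mul α i2 t ht).const_mul _)
      ((intervalIntegrable_exp_mul α i3 t ht).const_mul _) fun s _ => ?_
    have y0 := mul_le_mul_of_nonneg_left (sq_zero_le_xsq (θt s)) hμ.le
    have y1 := mul_le_mul_of_nonneg_left (sq_one_le_xsq (θt s)) hμ.le
    have n0 := sqNorm_nonneg (θt s)
    have z0 : μ * θt s 0 ^ 2 ≤ rate₂ μ (θt s) := by rw [rate₂]; linarith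
    have z1 : μ * θt s 1 ^ 2 ≤ rate₂ μ (θt s) := by rw [rate₂]; linarith
    have z0' := mul_le_mul_of_nonneg_left z0 (show 0 ≤ 1 + c 0 + wd by positivity)
    have z1' := mul_le_mul_of_nonneg_left z1 (show 0 ≤ 1 + c 1 + wd by positivity)
    have : μ * ((1 + c 0 + wd) * θt s 0 ^ 2 + (1 + c 1 + wd) * θt s 1 ^ 2)
        ≤ ((1 + c 0 + wd) + (1 + c 1 + wd)) * rate₂ μ (θt s) := by linarith
    have := mul_le_mul_of_nonneg_left this (Real.exp_pos (2 * α * s)).le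
    linarith
  have I0 : 0 ≤ expInt α t (fun s => rate₂ μ (θt s)) := expInt_nonneg ht fun s => rate₂_nonneg hμ _
  have het := he t ht
  have hge := errEnergy₂_ge (ν := ν) hwd hc (w t) (θ t)
  have hle := le_errEnergy₂ (ν := ν) hwd hc (w t) (θ t)
  have E0 : 0 ≤ errEnergy₂ ν wd c (w t) (θ t) := le_trans (mul_nonneg m0.le (xsq_nonneg _)) hge
  set E := errEnergy₂ ν wd c (w t) (θ t)
  set I := expInt α t (fun s => rate₂ μ (θt s))
  set J := ∫ s in (0 : ℝ)..t, interiorRate μ α θ s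
  set J' := ∫ s in (0 : ℝ)..t, boundaryRate wd α c θ s
  set κ := (1 + c 0 + wd) + (1 + c 1 + wd) with hκ
  have κ0 : 0 ≤ κ := by rw [hκ]; linarith
  set ε := Real.exp (-(2 * α * t)) with hε
  have ε0 : 0 < ε := Real.exp_pos _
  have hE : Real.exp (2 * α * t) * E ≤ Y := by
    have := mul_nonneg k0.le I0
    linarith
  have hE' : E ≤ ε * Y := by
    have := mul_le_mul_of_nonneg_left hE ε0.le
    rwa [← mul_assoc, hε, ← Real.exp_add, neg_add_cancel, Real.exp_zero, one_mul] at this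
  have hI : I ≤ Y / coer ν := by
    rw [le_div_iff₀ k0, mul_comm]
    have := mul_nonneg (Real.exp_pos (2 * α * t)).le E0
    linarith
  have hJ' : μ / ν * J' ≤ 1 / ν * κ * (Y / coer ν) := by
    have := mul_le_mul_of_nonneg_left (x2.trans (mul_le_mul_of_nonneg_left hI κ0))
      (show 0 ≤ 1 / ν by positivity)
    calc μ / ν * J' = 1 / ν * (μ * J') := by ring
      _ ≤ _ := this
      _ = _ := by ring
  have s1 : 0 ≤ 1 / dissip ν c * Y := by positivity
  have s2 : 0 ≤ (2 + 1 / ν * κ) / coer ν * Y := by positivity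
  have hb : ε * ((1 + (2 + 1 / ν * κ) / coer ν + 1 / dissip ν c) * Y) ≤ bound μ α C w₀ η t := by
    refine (mul_le_mul_of_nonneg_left hC ε0.le).trans (le_of_eq ?_)
    rw [bound, hε]; ring
  refine ⟨intervalIntegrable_congr_ae_Ioi e1 ht (intervalIntegrable_exp_mul α i1 t ht),
    intervalIntegrable_congr_ae_Ioi e2 ht (intervalIntegrable_exp_mul α i2 t ht),
    le_trans ?_ hb, le_trans ?_ hb⟩
  · have t1 := mul_le_mul_of_nonneg_left (x1.trans hI) (show 0 ≤ 2 * ε by positivity)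
    have t2 := mul_le_mul_of_nonneg_left hJ' ε0.le
    have t3 := mul_nonneg ε0.le s1
    have t4 : ε * ((2 + 1 / ν * κ) / coer ν * Y) = 2 * ε * (Y / coer ν)
      + ε * (1 / ν * κ * (Y / coer ν)) := by ring
    linarith
  · rw [tnorm_sq]
    have t1 : xsq (θ t) ≤ ε * Y / dissip ν c := by
      rw [le_div_iff₀ m0, mul_comm]; exact hge.trans hE'
    have t2 := mul_nonneg ε0.le s2
    have t3 := mul_nonneg ε0.le hY
    have t4 : ε * Y / dissip ν c = ε * (1 / dissip ν c * Y) := by ring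
    linarith

/-- All dependence on μ beyond the displayed factor is carried by B: the constant depends on μ only
if B does. -/
theorem exists_superconvergence {ν wd lam : ℝ} {c : Fin 2 → ℝ} (hν : 0 < ν) (hwd : 0 ≤ wd)
    (hlam : 0 < lam) (hc : ∀ i, 0 < c i) (R B : ℝ) (hB : 1 ≤ B) : ∃ C : ℝ, 0 < C ∧
    ∀ (μ α : ℝ) (w₀ : ℝ → ℝ) (w : ℝ → ℝ → ℝ) (P : Mesh) (wp wh : ℝ → ℝ → ℝ), 0 < μ →
      AdmissibleRate ν μ wd c α → h2Norm w₀ ≤ R → Setting ν μ wd lam c w₀ w P wp wh →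
      (∀ (wt Z : ℝ → ℝ → ℝ) (k₀ k₁ : ℝ), IsTrajectory ν μ wd c w wt →
        (∀ᵐ t ∂volume.restrict (Ioi (0 : ℝ)),
          ∀ χ, InH1 χ → weakForm ν μ wd c (w t) (wt t) χ = 0) →
        SecondDeriv ν μ wd c w wt Z k₀ k₁ → sqNorm (Z 0) + xsq (w 0) ≤ 4 * R ^ 2 →
        (∀ t, 0 ≤ t → μ * (∫ s in (0 : ℝ)..t, Real.exp (2 * α * s)
          * sqNorm (secondDerivT ν μ wd (w s) (wt s) (Z s))) ≤ B * (sqNorm (Z 0) + xsq (w 0))) ∧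
        (∀ t, 0 ≤ t → (1 + μ) * ∫ s in (0 : ℝ)..t, (wt s 0 ^ 2 + wt s 1 ^ 2) ≤ B)) →
      Superconvergence ν μ wd α C c w₀ P.h (fun t x => wh t x - wp t x) := by
  obtain ⟨A, L, hA, hL, HA⟩ := exists_errorBounds hν hwd hlam hc (4 * R ^ 2) (by positivity)
  obtain ⟨C, hC, HC⟩ := exists_integrated_error₂ hν hwd hlam hc A hA.le
  have k0 := coer_pos hν
  have m0 := dissip_pos hν hc
  have c0 := hc 0
  have c1 := hc 1
  set S := 1 + (2 + 1 / ν * ((1 + c 0 + wd) + (1 + c 1 + wd))) / coer ν + 1 / dissip ν c with hS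
  have S0 : 0 < S := by positivity
  set Q := C * Real.exp (C * B) * B * L with hQ
  have Q0 : 0 < Q := by positivity
  refine ⟨S * Q * 4 * (|R| + 1), by positivity,
    fun μ α w₀ w P wp wh hμ hα hR hset hyp => ?_⟩
  obtain ⟨wt, wht, pt, Z, k₀, k₁, hd⟩ := hset.exists_data hν hμ hwd hc hlam
  have n0 := h2Norm_nonneg w₀
  have hN : sqNorm (Z 0) + xsq (w 0) ≤ 4 * R ^ 2 := hd.initial.trans (by gcongr)
  have hX : xsq (w 0) ≤ 4 * R ^ 2 := by
    have := sqNorm_nonneg (Z 0)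
    linarith
  obtain ⟨r1, r2⟩ := hyp wt Z k₀ k₁ hd.traj hd.weak hd.second hN
  have hb := HA μ α B k₀ k₁ w₀ P w wt wh wht wp pt Z hμ hα hB hd hX r1 r2
  set N := sqNorm (Z 0) + xsq (w 0) with hNdef
  have N0 : 0 ≤ N := add_nonneg (sqNorm_nonneg _) (xsq_nonneg _)
  have h4 : 0 ≤ P.h ^ 4 := by have := P.h_nonneg; positivity
  have G0 : 0 ≤ L * (P.h ^ 4 * N) := by positivity
  have he := HC μ α B _ w wt wh wht wp pt hμ hα hB G0 hd.curves hb
  refine superconvergence_of_energy hν hμ hwd hc (by positivity) (hd.curves.hwh.sub hd.curves.hp)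
    hd.hasDerivAt he ?_
  rw [← hS]
  -- The energies give a bound quadratic in ‖w₀‖₂; one factor is estimated through R to reach the
  -- linear form.
  have hN' : N ≤ 4 * ((|R| + 1) * h2Norm w₀) := by
    refine hd.initial.trans ?_
    have : h2Norm w₀ ≤ |R| + 1 := hR.trans ((le_abs_self R).trans (by linarith))
    have := mul_le_mul_of_nonneg_right this n0
    nlinarith
  set K := S * Q * 4 * (|R| + 1) with hK
  have K0 : 0 ≤ K := by positivity
  -- The Gronwall exponential is already contained in the constant through R and B, so the factor
  -- exp(C‖w₀‖₂) only weakens the estimate.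
  have hexp : 1 ≤ Real.exp (K * h2Norm w₀) := Real.one_le_exp (by positivity)
  have hmain : S * (C * Real.exp (C * B) * B * ((1 + μ) / μ * (L * (P.h ^ 4 * N))))
      ≤ K * (1 / μ) * h2Norm w₀ * (1 + μ) * P.h ^ 4 := by
    have := mul_le_mul_of_nonneg_left hN' (show 0 ≤ S * Q * ((1 + μ) / μ) * P.h ^ 4 by positivity)
    calc S * (C * Real.exp (C * B) * B * ((1 + μ) / μ * (L * (P.h ^ 4 * N))))
        = S * Q * ((1 + μ) / μ) * P.h ^ 4 * N := by rw [hQ]; ring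
      _ ≤ _ := this
      _ = _ := by rw [hK]; ring
  exact hmain.trans (le_mul_of_one_le_right (by positivity) hexp)

end BBMB

end

/-! ### The estimate for fixed μ and the estimate uniform in μ. -/

theorem mainTheorem10 (ν wd lam R : ℝ) (c : Fin 2 → ℝ)
    (hν : 0 < ν) (hwd : 0 ≤ wd) (hlam : 0 < lam) (hc : ∀ i, 0 < c i) :
    (∀ μ : ℝ, 0 < μ → ∃ C : ℝ, 0 < C ∧
      ∀ α : ℝ, BBMB.AdmissibleRate ν μ wd c α →
      ∀ (w₀ : ℝ → ℝ) (w : ℝ → ℝ → ℝ) (P : BBMB.Mesh) (wp wh : ℝ → ℝ → ℝ),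
        BBMB.h2Norm w₀ ≤ R → BBMB.Setting ν μ wd lam c w₀ w P wp wh →
        BBMB.Superconvergence ν μ wd α C c w₀ P.h (fun t x => wh t x - wp t x)) ∧
    (∃ C : ℝ, 0 < C ∧ ∀ μ : ℝ, 0 < μ →
      ∀ α : ℝ, BBMB.AdmissibleRate ν μ wd c α →
      ∀ (w₀ : ℝ → ℝ) (w : ℝ → ℝ → ℝ) (P : BBMB.Mesh) (wp wh : ℝ → ℝ → ℝ),
        BBMB.h2Norm w₀ ≤ R → BBMB.Setting ν μ wd lam c w₀ w P wp wh →
        BBMB.SatisfiesFeedback ν wd c w →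
        BBMB.Superconvergence ν μ wd α C c w₀ P.h (fun t x => wh t x - wp t x)) := by
  open BBMB in
  obtain ⟨A₁, hA₁, H₁⟩ := exists_trajectory_bound hν hwd hc (4 * R ^ 2) (by positivity)
  obtain ⟨A₂, hA₂, H₂⟩ := exists_secondDeriv_bound hν hwd hc (4 * R ^ 2) (by positivity)
  obtain ⟨A₃, hA₃, H₃⟩ := exists_feedback_bound hν hwd hc (4 * R ^ 2) (by positivity)
  -- The bounds available without the pointwise feedback laws: relative to what is needed, the
  -- energy estimates lose the factor (1+μ)/μ in both integrals.
  have general : ∀ (μ α k₀ k₁ m : ℝ) (w wt Z : ℝ → ℝ → ℝ), 0 < μ → AdmissibleRate ν μ wd c α →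
      IsTrajectory ν μ wd c w wt → SecondDeriv ν μ wd c w wt Z k₀ k₁ →
      sqNorm (Z 0) + xsq (w 0) ≤ 4 * R ^ 2 → (1 + μ) / μ ≤ m → ∀ t, 0 ≤ t →
      μ * (∫ s in (0 : ℝ)..t, Real.exp (2 * α * s)
        * sqNorm (secondDerivT ν μ wd (w s) (wt s) (Z s))) ≤ m * A₂ * (sqNorm (Z 0) + xsq (w 0)) ∧
      (1 + μ) * ∫ s in (0 : ℝ)..t, (wt s 0 ^ 2 + wt s 1 ^ 2) ≤ m * A₁ := by
    intro μ α k₀ k₁ m w wt Z hμ hα htr hsd hN hm t ht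
    have hX : xsq (w 0) ≤ 4 * R ^ 2 := by
      have := sqNorm_nonneg (Z 0)
      linarith
    have N0 : 0 ≤ sqNorm (Z 0) + xsq (w 0) := add_nonneg (sqNorm_nonneg _) (xsq_nonneg _)
    constructor
    · have e := (H₂ μ α k₀ k₁ w wt Z hμ hα htr hsd hX t ht).2.2
      set I := ∫ s in (0 : ℝ)..t, Real.exp (2 * α * s)
        * sqNorm (secondDerivT ν μ wd (w s) (wt s) (Z s))
      have e1 := mul_le_mul_of_nonneg_left e (show 0 ≤ 1 / μ by positivity)
      calc μ * I = 1 / μ * (μ ^ 2 * I) := by field_simp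
        _ ≤ _ := e1
        _ = (1 + μ) / μ * A₂ * (sqNorm (Z 0) + xsq (w 0)) := by ring
        _ ≤ _ := by gcongr
    · have e := (H₁ μ w wt hμ htr hX).2.2 t ht
      have i1 := htr.curve.intervalIntegrable_trace_sq (x := 0) (by simp) t ht
      have i2 := htr.curve.intervalIntegrable_trace_sq (x := 1) (by simp) t ht
      have e2 : ∫ s in (0 : ℝ)..t, (wt s 0 ^ 2 + wt s 1 ^ 2) ≤ ∫ s in (0 : ℝ)..t, xsq (wt s) :=
        intervalIntegral.integral_mono_on ht (i1.add i2)
          (htr.curve.intervalIntegrable_xsq t ht) fun s _ =>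
            le_add_of_nonneg_right (sqNorm_nonneg _)
      set I := ∫ s in (0 : ℝ)..t, (wt s 0 ^ 2 + wt s 1 ^ 2)
      have e3 := mul_le_mul_of_nonneg_left ((mul_le_mul_of_nonneg_left e2 hμ.le).trans e)
        (show 0 ≤ (1 + μ) / μ by positivity)
      calc (1 + μ) * I = (1 + μ) / μ * (μ * I) := by field_simp
        _ ≤ _ := e3
        _ ≤ _ := by gcongr
  constructor
  · intro μ hμ
    have m0 : 0 < (1 + μ) / μ := by positivity
    obtain ⟨C, hC, HC⟩ := exists_superconvergence hν hwd hlam hc R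
      (1 + (1 + μ) / μ * A₂ + (1 + μ) / μ * A₁) (by
        have : 0 ≤ (1 + μ) / μ * A₂ + (1 + μ) / μ * A₁ := by positivity
        linarith)
    refine ⟨C, hC, fun α hα w₀ w P wp wh hR hset => HC μ α w₀ w P wp wh hμ hα hR hset
      fun wt Z k₀ k₁ htr _ hsd hN => ?_⟩
    have N0 : 0 ≤ sqNorm (Z 0) + xsq (w 0) := add_nonneg (sqNorm_nonneg _) (xsq_nonneg _)
    have y1 : 0 ≤ (1 + μ) / μ * A₁ := by positivity
    have y2 : 0 ≤ (1 + μ) / μ * A₂ := by positivity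
    refine ⟨fun t ht => ((general μ α k₀ k₁ _ w wt Z hμ hα htr hsd hN le_rfl t ht).1).trans
      (mul_le_mul_of_nonneg_right (by linarith) N0), fun t ht =>
      ((general μ α k₀ k₁ _ w wt Z hμ hα htr hsd hN le_rfl t ht).2).trans (by linarith)⟩
  · have y3 : 0 ≤ 2 * A₃ * (4 * R ^ 2) := by positivity
    obtain ⟨C, hC, HC⟩ := exists_superconvergence hν hwd hlam hc R
      (1 + 2 * A₂ + 2 * A₁ + A₃ + 2 * A₃ * (4 * R ^ 2)) (by linarith)
    refine ⟨C, hC, fun μ hμ α hα w₀ w P wp wh hR hset hf => HC μ α w₀ w P wp wh hμ hα hR hset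
      fun wt Z k₀ k₁ htr hwk hsd hN => ?_⟩
    have N0 : 0 ≤ sqNorm (Z 0) + xsq (w 0) := add_nonneg (sqNorm_nonneg _) (xsq_nonneg _)
    -- Only small μ require the feedback laws; for μ ≥ 1 the factor (1+μ)/μ is at most 2 and the
    -- general bounds are already uniform.
    rcases le_total μ 1 with hμ1 | hμ1
    · obtain ⟨rfl, rfl⟩ := hsd.eq_zero_of_feedback htr.curve hf
      have hX : xsq (w 0) ≤ 4 * R ^ 2 := by
        have := sqNorm_nonneg (Z 0)
        linarith
      have e := H₃ μ α w wt Z hμ hμ1 hα htr hsd hwk hX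
      refine ⟨fun t ht => (e t ht).1.trans (mul_le_mul_of_nonneg_right (by linarith) N0),
        fun t ht => ?_⟩
      have e1 := (e t ht).2.trans (mul_le_mul_of_nonneg_left hN hA₃.le)
      have y4 : 0 ≤ A₃ * (4 * R ^ 2) := by positivity
      have e2 := mul_le_mul_of_nonneg_left e1 (show 0 ≤ 1 + μ by positivity)
      have e3 := mul_le_mul_of_nonneg_right (show 1 + μ ≤ 2 by linarith) y4
      linarith
    · have hm : (1 + μ) / μ ≤ 2 := by rw [div_le_iff₀ hμ]; linarith
      have e := general μ α k₀ k₁ 2 w wt Z hμ hα htr hsd hN hm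
      exact ⟨fun t ht => (e t ht).1.trans (mul_le_mul_of_nonneg_right (by linarith) N0),
        fun t ht => (e t ht).2.trans (by linarith)⟩
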